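/- **Setting.** Let $R>0$, let $\Omega\subset\mathbb R^2$ be the open disk of radius $R$ centred at $0$, and let $n=n(r)$ be a radial function which is $\mathcal C^\infty$ on $[0,R]$ with $n>1$ there, and $n(r)=1$ for $r>R$. Put $n_0=n(R)$, $n_i=\lim_{r\nearrow R}n^{(i)}(r)$, $\breve\kappa=R\big(\tfrac1R+\tfrac{n_1}{n_0}\big)$, $\breve\mu=R^2\big(\tfrac2{R^2}-\tfrac{n_2}{n_0}\big)$. Let $\mathsf A(z)=\mathrm{Ai}(-z)$ be the flipped Airy function and $0<\mathsf a_0<\mathsf a_1<\cdots$ its successive roots. Let $p\in\{1,-1\}$, and let $\mathrm H^2_p$ be the space of $u\in L^2(\mathbb R^2)$ with $u|_\Omega\in H^2(\Omega)$, $u|_{\mathbb R^2\setminus\overline\Omega}\in H^2(\mathbb R^2\setminus\overline\Omega)$, $[u]=0$ and $[n^{p-1}\partial_\nu u]=0$ across $\partial\Omega$. A *family of resonance quasi-pairs* consists of real numbers $\underline k(m)$ and functions $\underline u(m):\mathbb R^2\to\mathbb C$, $m\ge1$, such that: (1) $\underline u(m)\in\mathrm H^2_p$ and $\|\underline u(m)\|_{L^2}=1$;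 (2) $\|-\mathrm{div}(n^{p-1}\nabla\underline u(m))-\underline k(m)^2n^{p+1}\underline u(m)\|_{L^2}=\mathcal O(m^{-\infty})$ (operators taken in $\Omega$ and in $\mathbb R^2\setminus\overline\Omega$); (3) there is $\mathfrak X\in\mathcal C_0^\infty(\mathbb R^2)$, $0\le\mathfrak X\le1$, such that, for all $m\ge1$, $\mathfrak X\underline u(m)\in \mathrm H^2_p$ and $\|\mathfrak X\underline u(m)\|_{L^2}\ge\frac12$, and (2) holds with $\mathfrak X\underline u(m)$ in place of $\underline u(m)$; (4) there are $\beta>0$ and $\mathrm K\in\mathcal C^\infty([0,1])$ with $\underline k(m)/m=\mathrm K(m^{-\beta})$ for all $m\ge1$. It is *of whispering gallery type* if every $\mathfrak X\in\mathcal C_0^\infty(\mathbb R^2)$ with $0\le\mathfrak X\le1$ and $\mathfrak X\equiv1$ near $\partial\Omega$ has the properties in (3) for all $m$ large enough. For closed half-lines $S=\mathbb R_\pm$, $\mathcal C^\infty([0,1],\mathcal S(S))$ is the set of smooth functions on $[0,1]\times S$ all of whose derivatives are rapidly decreasing in the second variable, uniformly in the first. **Theorem 4.1.** If $\breve\kappa>0$,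 then for each $j\in\mathbb N=\{0,1,2,\dots\}$ there is a family of resonance quasi-pairs $(\underline k_{p;j}(m),\underline u_{p;j}(m))_{m\ge1}$ of whispering gallery type with the following properties. (i) Property (4) holds with $\beta=\frac13$, and there are coefficients $\mathrm K^\ell_{p;j}\in\mathbb R$, $\ell\in\mathbb N$, and constants $C_N$ (depending on $n,R,p,j,N$) with $$\Big|\frac{\underline k_{p;j}(m)}m-\sum_{\ell=0}^{N-1}\mathrm K^\ell_{p;j}m^{-\ell/3}\Big|\le C_Nm^{-N/3}\qquad\forall N\ge1,\ \forall m\ge1 .$$ Moreover $\mathrm K^0_{p;j}=\frac1{Rn_0}$, $\mathrm K^1_{p;j}=0$, and the coefficients $\mathrm K^2_{p;j}$ are pairwise distinct for distinct $j$. (ii) There are constants $c_{p;j}(m)>0$ (the $L^2$ normalization) such that, in polar coordinates, $\underline u_{p;j}(m;x,y)=c_{p;j}(m)\,\underline w_{p;j}(m;r)\,e^{im\theta}$, where, with $\sigma=m^{2/3}(\frac rR-1)$ for $r<R$ and $\rho=m(\frac rR-1)$ for $r>R$, $$\underline w_{p;j}(m;r)=\mathfrak X(r)\big(\mathbf 1_{r<R}\,\Phi_{p;j}(m^{-1/3},\sigma)+\mathbf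 1_{r>R}\,\Psi_{p;j}(m^{-1/3},\rho)\big)\qquad(r\ne R)$$ for some real-valued $\Phi_{p;j}\in\mathcal C^\infty([0,1],\mathcal S(\mathbb R_-))$ and $\Psi_{p;j}\in\mathcal C^\infty([0,1],\mathcal S(\mathbb R_+))$ and a cut-off function $\mathfrak X\in\mathcal C_0^\infty((0,\infty))$ with $\mathfrak X\equiv1$ near $R$; the two one-sided limits of $\underline w_{p;j}(m;\cdot)$ at $R$ coincide, and $\underline w_{p;j}(m;R)$ is their common value. (iii) Uniformly in $r>0$, $$\underline w_{p;j}(m;r)=\mathfrak X(r)\big(\mathrm w^0_{p;j}(m;r)+m^{-1/3}\mathrm w^1_{p;j}(m;r)\big)+\mathcal O(m^{-2/3}),$$ where $\mathrm w^0_{p;j}=\mathsf A(\mathsf a_j+(2\breve\kappa)^{1/3}\sigma)$ for $r<R$, $\mathrm w^0_{p;j}=0$ for $r\ge R$, and $$\mathrm w^1_{p;j}=\frac{-n_0^p(2\breve\kappa)^{1/3}}{\sqrt{n_0^2-1}}\times\begin{cases}\mathsf A'(\mathsf a_j+(2\breve\kappa)^{1/3}\sigma)& r<R,\\ \mathsf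 A'(\mathsf a_j)\exp\big(-\tfrac{\sqrt{n_0^2-1}}{n_0}\rho\big)& r\ge R.\end{cases}$$ (iv) As $m\to\infty$, with $s=2\breve\kappa/m$, $$\underline k_{p;j}(m)=\frac m{Rn_0}\Big[1+\frac{\mathsf a_j}2s^{2/3}-\frac{n_0^p}{2\sqrt{n_0^2-1}}s+\mathrm k^4_{p;j}s^{4/3}+\mathrm k^5_{p;j}s^{5/3}+\mathcal O(m^{-2})\Big],$$ $$\mathrm k^4_{p;j}=\frac{\mathsf a_j^2}{15}\Big(\frac{17}8-\frac3{\breve\kappa}+\frac{\breve\mu}{\breve\kappa^2}\Big),\qquad \mathrm k^5_{p;j}=-\frac{\mathsf a_jn_0^p}{12\sqrt{n_0^2-1}}\Big(\frac{3n_0^2-2n_0^{2p}}{n_0^2-1}+2-\frac6{\breve\kappa}+\frac{2\breve\mu}{\breve\kappa^2}\Big).$$ (v) If $n\equiv n_0$ is constant on $[0,R]$, then, as $m\to\infty$, with $s=2/m$: for $p=1$, $$\begin{aligned}\underline k_{1;j}(m)=\frac m{Rn_0}\Big[&1+\frac{\mathsf a_j}2s^{\frac23}-\frac{n_0}{2(n_0^2-1)^{1/2}}s+\frac{3\mathsf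 a_j^2}{40}s^{\frac43}-\frac{\mathsf a_jn_0^3}{12(n_0^2-1)^{3/2}}s^{\frac53}+\frac{10-\mathsf a_j^3}{2800}s^2\\&+\frac{\mathsf a_j^2n_0^3(n_0^2-4)}{80(n_0^2-1)^{5/2}}s^{\frac73}-\frac{\mathsf a_j}{144}\Big(\frac1{175}+\frac{479\mathsf a_j^3}{7000}+\frac{2n_0^6}{(n_0^2-1)^3}\Big)s^{\frac83}+\mathcal O(m^{-3})\Big],\end{aligned}$$ and for $p=-1$, $$\begin{aligned}\underline k_{-1;j}(m)=\frac m{Rn_0}\Big[&1+\frac{\mathsf a_j}2s^{\frac23}-\frac1{2n_0(n_0^2-1)^{1/2}}s+\frac{3\mathsf a_j^2}{40}s^{\frac43}-\frac{\mathsf a_j(3n_0^4-2)}{12n_0^3(n_0^2-1)^{3/2}}s^{\frac53}\\&+\frac18\Big(\frac1{35}-\frac{\mathsf a_j^3}{350}+\frac1{n_0^4(n_0^2-1)}\Big)s^2-\frac{\mathsf a_j^2(3n_0^8+12n_0^6-12n_0^4-8n_0^2+8)}{80n_0^5(n_0^2-1)^{5/2}}s^{\frac73}\\&-\frac{\mathsf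 a_j}{144}\Big(\frac1{175}+\frac{479\mathsf a_j^3}{7000}+\frac{18n_0^8-45n_0^6+12n_0^4+45n_0^2-28}{n_0^6(n_0^2-1)^3}\Big)s^{\frac83}+\mathcal O(m^{-3})\Big].\end{aligned}$$ -/

import Mathlib

open Real Set Filter Topology MeasureTheory
open scoped ContDiff ENNReal

/-! ## The plane, weak derivatives, Sobolev spaces and traces -/

/-- The Euclidean plane `ℝ²`. -/
abbrev Plane : Type := EuclideanSpace ℝ (Fin 2)

/-- The point with polar coordinates `(r, θ)`. -/
noncomputable def polarPoint (r θ : ℝ) : Plane := !₂[r * Real.cos θ, r * Real.sin θ]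

/-- Classical partial derivative in the direction of the `i`-th coordinate. -/
noncomputable def partialDeriv {F : Type*} [NormedAddCommGroup F] [NormedSpace ℝ F]
    (i : Fin 2) (f : Plane → F) (x : Plane) : F :=
  fderiv ℝ f x (EuclideanSpace.single i 1)

/-- `φ` is a test function on the open set `U`, that is `φ ∈ C_c^∞(U)`. -/
structure IsTestFunction (U : Set Plane) (φ : Plane → ℝ) : Prop where
  smooth : ContDiff ℝ ∞ φ
  compactSupport : HasCompactSupport φ
  support_subset : tsupport φ ⊆ U

/-- `g` is the weak (distributional) partial derivative `∂ᵢ f` in the open set `U`. -/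
structure HasWeakPartial (U : Set Plane) (i : Fin 2) (f g : Plane → ℂ) : Prop where
  locInt : LocallyIntegrableOn f U volume
  locInt_deriv : LocallyIntegrableOn g U volume
  integral_eq : ∀ φ : Plane → ℝ, IsTestFunction U φ →
    ∫ x in U, partialDeriv i φ x • f x = -∫ x in U, φ x • g x

/-- `d` is the weak (distributional) divergence of the vector field `V` in the open set `U`. -/
structure HasWeakDiv (U : Set Plane) (V : Fin 2 → Plane → ℂ) (d : Plane → ℂ) : Prop where
  locInt : ∀ i, LocallyIntegrableOn (V i) U volume
  locInt_div : LocallyIntegrableOn d U volume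
  integral_eq : ∀ φ : Plane → ℝ, IsTestFunction U φ →
    ∫ x in U, ∑ i, partialDeriv i φ x • V i x = -∫ x in U, φ x • d x

/-- `f ∈ H²(U)`: `f` and its weak derivatives of order one and two are in `L²(U)`. -/
def MemH2 (U : Set Plane) (f : Plane → ℂ) : Prop :=
  MemLp f 2 (volume.restrict U) ∧
  ∃ (g : Fin 2 → Plane → ℂ) (G : Fin 2 → Fin 2 → Plane → ℂ),
    (∀ i, MemLp (g i) 2 (volume.restrict U) ∧ HasWeakPartial U i f (g i)) ∧
    (∀ i l, MemLp (G i l) 2 (volume.restrict U) ∧ HasWeakPartial U l (g i) (G i l))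

/-- `τ` (a function of the angle) is the trace on the circle of radius `R` of `f ∈ H¹(U)`, where `U`
is the disk of radius `R` or its exterior. The trace operator is the continuous extension to `H¹(U)`
of the restriction operator on functions smooth up to the boundary: there are `F l ∈ C_c^∞(ℝ²)` with
`F l → f` in `H¹(U)` and `F l → τ` in `L²` of the circle. -/
def HasTrace (U : Set Plane) (R : ℝ) (f : Plane → ℂ) (τ : ℝ → ℂ) : Prop :=
  MemLp τ 2 (volume.restrict (Ioc 0 (2 * π))) ∧
  ∃ (g : Fin 2 → Plane → ℂ) (F : ℕ → Plane → ℂ),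
    (∀ i, HasWeakPartial U i f (g i)) ∧
    (∀ l, ContDiff ℝ ∞ (F l) ∧ HasCompactSupport (F l)) ∧
    Tendsto (fun l => eLpNorm (fun x => F l x - f x) 2 (volume.restrict U)) atTop (𝓝 0) ∧
    (∀ i, Tendsto (fun l => eLpNorm (fun x => partialDeriv i (F l) x - g i x) 2
      (volume.restrict U)) atTop (𝓝 0)) ∧
    Tendsto (fun l => eLpNorm (fun θ => F l (polarPoint R θ) - τ θ) 2
      (volume.restrict (Ioc 0 (2 * π)))) atTop (𝓝 0)

/-! ## The transmission problem and its quasi-pairs -/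

/-- The open disk `Ω` of radius `R`. -/
def disk (R : ℝ) : Set Plane := Metric.ball 0 R

/-- The open exterior `ℝ² \ Ω̄` of the disk of radius `R`. -/
def exterior (R : ℝ) : Set Plane := (Metric.closedBall 0 R)ᶜ

/-- The domain `H²_p(ℝ², Ω)`: functions in `L²(ℝ²)` that are `H²` on both sides of `∂Ω`, with
`[u] = 0` and `[n^{p-1} ∂_ν u] = 0` across `∂Ω` in the sense of traces. The outer trace of `n` is `1`
and the unit normal at the angle `θ` is `(cos θ, sin θ)`. -/
structure InDomain (n : ℝ → ℝ) (R : ℝ) (p : ℤ) (u : Plane → ℂ) : Prop where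
  memLp : MemLp u 2 volume
  memH2_in : MemH2 (disk R) u
  memH2_out : MemH2 (exterior R) u
  jump : ∃ τ : ℝ → ℂ, HasTrace (disk R) R u τ ∧ HasTrace (exterior R) R u τ
  conormal_jump : ∃ (g : Fin 2 → Plane → ℂ) (τin τout : Fin 2 → ℝ → ℂ),
    (∀ i, HasWeakPartial (disk R) i u (g i) ∧ HasWeakPartial (exterior R) i u (g i)) ∧
    (∀ i, HasTrace (disk R) R (g i) (τin i) ∧ HasTrace (exterior R) R (g i) (τout i)) ∧
    ∀ᵐ θ ∂(volume.restrict (Ioc 0 (2 * π))),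
      ((n R ^ (p - 1) : ℝ) : ℂ) * (Real.cos θ * τin 0 θ + Real.sin θ * τin 1 θ) =
        Real.cos θ * τout 0 θ + Real.sin θ * τout 1 θ

/-- `F ∈ L²(ℝ²)` is the residual `-div (n^{p-1} ∇u) - k² n^{p+1} u`, the differential operators being
taken in the weak sense in `Ω` and in `ℝ² \ Ω̄`. -/
def IsResidual (n : ℝ → ℝ) (R : ℝ) (p : ℤ) (k : ℝ) (u F : Plane → ℂ) : Prop :=
  MemLp F 2 volume ∧
  ∃ (g : Fin 2 → Plane → ℂ) (d : Plane → ℂ),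
    (∀ i, HasWeakPartial (disk R) i u (g i) ∧ HasWeakPartial (exterior R) i u (g i)) ∧
    HasWeakDiv (disk R) (fun i x => ((n ‖x‖ ^ (p - 1) : ℝ) : ℂ) * g i x) d ∧
    HasWeakDiv (exterior R) (fun i x => ((n ‖x‖ ^ (p - 1) : ℝ) : ℂ) * g i x) d ∧
    F =ᵐ[volume] fun x => -d x - ((k ^ 2 * n ‖x‖ ^ (p + 1) : ℝ) : ℂ) * u x

/-- The `L²` norms of the residuals of `(k m, u m)`, `m ≥ m₀`, are `O(m^{-∞})`. -/
def ResidualRapid (n : ℝ → ℝ) (R : ℝ) (p : ℤ) (m₀ : ℕ) (k : ℕ → ℝ) (u : ℕ → Plane → ℂ) : Prop :=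
  ∃ F : ℕ → Plane → ℂ,
    (∀ m, m₀ ≤ m → IsResidual n R p (k m) (u m) (F m)) ∧
    ∀ N : ℕ, ∃ C : ℝ, ∀ m, m₀ ≤ m →
      eLpNorm (F m) 2 volume ≤ ENNReal.ofReal (C * (m : ℝ) ^ (-(N : ℤ)))

/-- `X` is a smooth cut-off function on the plane, `X ∈ C_c^∞(ℝ²)` and `0 ≤ X ≤ 1`. -/
structure IsCutoff (X : Plane → ℝ) : Prop where
  smooth : ContDiff ℝ ∞ X
  compactSupport : HasCompactSupport X
  nonneg : ∀ x, 0 ≤ X x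
  le_one : ∀ x, X x ≤ 1

/-- For `m ≥ m₀` the functions `X u(m)` are in the domain, have `L²` norm at least `1/2`, and satisfy
the quasi-pair estimate together with `k(m)`. -/
structure LocalizedBy (n : ℝ → ℝ) (R : ℝ) (p : ℤ) (m₀ : ℕ) (k : ℕ → ℝ) (u : ℕ → Plane → ℂ)
    (X : Plane → ℝ) : Prop where
  inDomain : ∀ m, m₀ ≤ m → InDomain n R p (fun x => X x • u m x)
  half_le : ∀ m, m₀ ≤ m → 1 / 2 ≤ eLpNorm (fun x => X x • u m x) 2 volume
  residual : ResidualRapid n R p m₀ k (fun m x => X x • u m x)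

/-- `k(m)/m = 𝐊(m^{-β})` for all `m ≥ 1`, with `𝐊` smooth on `[0,1]`. -/
def RegularInM (k : ℕ → ℝ) (β : ℝ) : Prop :=
  ∃ K : ℝ → ℝ, ContDiffOn ℝ ∞ K (Icc 0 1) ∧
    ∀ m : ℕ, 1 ≤ m → k m / m = K ((m : ℝ) ^ (-β))

/-- Families of resonance quasi-pairs; only the indices `m ≥ 1` are relevant. -/
structure IsQuasiPairFamily (n : ℝ → ℝ) (R : ℝ) (p : ℤ) (k : ℕ → ℝ) (u : ℕ → Plane → ℂ) :
    Prop where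
  inDomain : ∀ m, 1 ≤ m → InDomain n R p (u m)
  normalized : ∀ m, 1 ≤ m → eLpNorm (u m) 2 volume = 1
  residual : ResidualRapid n R p 1 k u
  localized : ∃ X : Plane → ℝ, IsCutoff X ∧ LocalizedBy n R p 1 k u X
  regular : ∃ β : ℝ, 0 < β ∧ RegularInM k β

/-- Families of whispering gallery type: any cut-off function that is `1` in a neighbourhood of `∂Ω`
localizes the family, for `m` large enough. -/
structure IsWhisperingGallery (n : ℝ → ℝ) (R : ℝ) (p : ℤ) (k : ℕ → ℝ) (u : ℕ → Plane → ℂ) : Prop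
    extends IsQuasiPairFamily n R p k u where
  localized_of_eq_one : ∀ X : Plane → ℝ, IsCutoff X →
    (∃ V : Set Plane, IsOpen V ∧ Metric.sphere 0 R ⊆ V ∧ ∀ x ∈ V, X x = 1) →
    ∃ m₀ : ℕ, 1 ≤ m₀ ∧ LocalizedBy n R p m₀ k u X

/-! ## The optical index -/

/-- Assumption on the index: `n` is smooth on `[0,R]` with `n > 1` there, and `n = 1` for `r > R`. -/
structure IsOpticalIndex (n : ℝ → ℝ) (R : ℝ) : Prop where
  smooth : ContDiffOn ℝ ∞ n (Icc 0 R)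
  one_lt : ∀ r ∈ Icc 0 R, 1 < n r
  eq_one : ∀ r, R < r → n r = 1

/-- `n_i`, the value at `R` from inside of the `i`-th derivative of the index. -/
noncomputable def indexDeriv (n : ℝ → ℝ) (R : ℝ) (i : ℕ) : ℝ :=
  iteratedDerivWithin i n (Icc 0 R) R

/-- The effective adimensional curvature `κ = R (1/R + n₁/n₀)`. -/
noncomputable def effCurvature (n : ℝ → ℝ) (R : ℝ) : ℝ :=
  R * (1 / R + indexDeriv n R 1 / indexDeriv n R 0)

/-- The adimensional hessian `μ = R² (2/R² - n₂/n₀)`. -/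
noncomputable def adimHessian (n : ℝ → ℝ) (R : ℝ) : ℝ :=
  R ^ 2 * (2 / R ^ 2 - indexDeriv n R 2 / indexDeriv n R 0)

/-! ## The Airy function -/

/-- The Airy function `Ai(x) = (2πi)⁻¹ ∫ exp(ζ³/3 - xζ) dζ`, the integral being taken upwards along
the vertical line `ζ = 1 + iτ`, on which it converges absolutely. (Shifting the line to the imaginary
axis gives the improper integral `π⁻¹ ∫₀^∞ cos(τ³/3 + xτ) dτ`.) -/
noncomputable def airyAi (x : ℝ) : ℝ :=
  ((1 / (2 * π) : ℂ) * ∫ τ : ℝ, Complex.exp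
    ((1 + τ * Complex.I) ^ 3 / 3 - x * (1 + τ * Complex.I))).re

/-- The flipped Airy function `A(z) = Ai(-z)`. -/
noncomputable def flippedAiry (z : ℝ) : ℝ := airyAi (-z)

/-- The successive roots `0 < a₀ < a₁ < ⋯` of the flipped Airy function. -/
noncomputable def airyRoot : ℕ → ℝ
  | 0 => sInf {z : ℝ | 0 < z ∧ flippedAiry z = 0}
  | j + 1 => sInf {z : ℝ | airyRoot j < z ∧ flippedAiry z = 0}

/-! ## Profiles and explicit expansions -/

/-- `f ∈ C^∞([0,1], 𝓢(S))` for a closed half-line `S`: `(t, x) ↦ f t x` is smooth on `[0,1] × S`, and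
all its derivatives are rapidly decreasing in `x`, uniformly in `t`. -/
def IsSchwartzProfile (S : Set ℝ) (f : ℝ → ℝ → ℝ) : Prop :=
  ContDiffOn ℝ ∞ (Function.uncurry f) (Icc 0 1 ×ˢ S) ∧
  ∀ a b : ℕ, ∃ C : ℝ, ∀ t ∈ Icc (0 : ℝ) 1, ∀ x ∈ S,
    |x| ^ a * ‖iteratedFDerivWithin ℝ b (Function.uncurry f) (Icc 0 1 ×ˢ S) (t, x)‖ ≤ C

/-- The inner scaled variable `σ = m^{2/3} (r/R - 1)`. -/
noncomputable def sigmaVar (R : ℝ) (m : ℕ) (r : ℝ) : ℝ := (m : ℝ) ^ (2 / 3 : ℝ) * (r / R - 1)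

/-- The outer scaled variable `ρ = m (r/R - 1)`. -/
noncomputable def rhoVar (R : ℝ) (m : ℕ) (r : ℝ) : ℝ := m * (r / R - 1)

/-- First term of the expansion of the radial quasi-modes. -/
noncomputable def modeTerm0 (R κ : ℝ) (j m : ℕ) (r : ℝ) : ℝ :=
  if r < R then flippedAiry (airyRoot j + (2 * κ) ^ (1 / 3 : ℝ) * sigmaVar R m r) else 0

/-- Second term (coefficient of `m^{-1/3}`) of the expansion of the radial quasi-modes. -/
noncomputable def modeTerm1 (R κ n₀ : ℝ) (p : ℤ) (j m : ℕ) (r : ℝ) : ℝ :=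
  -(n₀ ^ p) * (2 * κ) ^ (1 / 3 : ℝ) / √(n₀ ^ 2 - 1) *
    if r < R then deriv flippedAiry (airyRoot j + (2 * κ) ^ (1 / 3 : ℝ) * sigmaVar R m r)
    else deriv flippedAiry (airyRoot j) * Real.exp (-(√(n₀ ^ 2 - 1) / n₀) * rhoVar R m r)

/-- The five-term expansion of `(R n₀ / m) k(m)`; here `s` stands for `2κ/m` and `a` for a root of
the flipped Airy function. -/
noncomputable def bracket5 (κ μ n₀ : ℝ) (p : ℤ) (a s : ℝ) : ℝ :=
  1 + a / 2 * s ^ (2 / 3 : ℝ) - n₀ ^ p / (2 * √(n₀ ^ 2 - 1)) * s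
    + a ^ 2 / 15 * (17 / 8 - 3 / κ + μ / κ ^ 2) * s ^ (4 / 3 : ℝ)
    + -(a * n₀ ^ p / (12 * √(n₀ ^ 2 - 1))) *
        ((3 * n₀ ^ 2 - 2 * n₀ ^ (2 * p)) / (n₀ ^ 2 - 1) + 2 - 6 / κ + 2 * μ / κ ^ 2)
        * s ^ (5 / 3 : ℝ)

/-- The eight-term expansion of `(R n₀ / m) k(m)` for a constant index and `p = 1`, with `s = 2/m`. -/
noncomputable def bracket8TM (n₀ a s : ℝ) : ℝ :=
  1 + a / 2 * s ^ (2 / 3 : ℝ)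
    - n₀ / (2 * (n₀ ^ 2 - 1) ^ (1 / 2 : ℝ)) * s
    + 3 * a ^ 2 / 40 * s ^ (4 / 3 : ℝ)
    - a * n₀ ^ 3 / (12 * (n₀ ^ 2 - 1) ^ (3 / 2 : ℝ)) * s ^ (5 / 3 : ℝ)
    + (10 - a ^ 3) / 2800 * s ^ 2
    + a ^ 2 * n₀ ^ 3 * (n₀ ^ 2 - 4) / (80 * (n₀ ^ 2 - 1) ^ (5 / 2 : ℝ)) * s ^ (7 / 3 : ℝ)
    - a / 144 * (1 / 175 + 479 * a ^ 3 / 7000 + 2 * n₀ ^ 6 / (n₀ ^ 2 - 1) ^ 3) * s ^ (8 / 3 : ℝ)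

/-- The eight-term expansion of `(R n₀ / m) k(m)` for a constant index and `p = -1`, with `s = 2/m`. -/
noncomputable def bracket8TE (n₀ a s : ℝ) : ℝ :=
  1 + a / 2 * s ^ (2 / 3 : ℝ)
    - 1 / (2 * n₀ * (n₀ ^ 2 - 1) ^ (1 / 2 : ℝ)) * s
    + 3 * a ^ 2 / 40 * s ^ (4 / 3 : ℝ)
    - a * (3 * n₀ ^ 4 - 2) / (12 * n₀ ^ 3 * (n₀ ^ 2 - 1) ^ (3 / 2 : ℝ)) * s ^ (5 / 3 : ℝ)
    + 1 / 8 * (1 / 35 - a ^ 3 / 350 + 1 / (n₀ ^ 4 * (n₀ ^ 2 - 1))) * s ^ 2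
    - a ^ 2 * (3 * n₀ ^ 8 + 12 * n₀ ^ 6 - 12 * n₀ ^ 4 - 8 * n₀ ^ 2 + 8) /
        (80 * n₀ ^ 5 * (n₀ ^ 2 - 1) ^ (5 / 2 : ℝ)) * s ^ (7 / 3 : ℝ)
    - a / 144 * (1 / 175 + 479 * a ^ 3 / 7000 +
        (18 * n₀ ^ 8 - 45 * n₀ ^ 6 + 12 * n₀ ^ 4 + 45 * n₀ ^ 2 - 28) /
          (n₀ ^ 6 * (n₀ ^ 2 - 1) ^ 3)) * s ^ (8 / 3 : ℝ)

/-- `K l`, `l ≥ 0`, are the coefficients of the asymptotic expansion of `k(m)/m` in powers of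
`m^{-1/3}`. -/
def HasExpansion (k : ℕ → ℝ) (K : ℕ → ℝ) : Prop :=
  ∀ N : ℕ, 1 ≤ N → ∃ C : ℝ, ∀ m : ℕ, 1 ≤ m →
    |k m / m - ∑ l ∈ Finset.range N, K l * (m : ℝ) ^ (-(l : ℝ) / 3)| ≤ C * (m : ℝ) ^ (-(N : ℝ) / 3)

/-- Boundary layer structure of the quasi-modes: up to a positive normalizing constant `c m`,
`u(m)` is `w(m; r) e^{imθ}`, where `w` is a cut-off function times a profile in `σ` for `r < R` and a
profile in `ρ` for `r > R` (the common limit value is used at `r = R`), and the first two terms of `w`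
are explicit, with an error `O(m^{-2/3})` uniform in `r`. -/
def HasBoundaryLayerForm (R κ n₀ : ℝ) (p : ℤ) (j : ℕ) (u : ℕ → Plane → ℂ) : Prop :=
  ∃ (c : ℕ → ℝ) (w : ℕ → ℝ → ℝ) (X : ℝ → ℝ) (Φ Ψ : ℝ → ℝ → ℝ),
    (∀ m, 1 ≤ m → 0 < c m) ∧
    (∀ m : ℕ, 1 ≤ m → ∀ r θ : ℝ, 0 < r →
      u m (polarPoint r θ) = ((c m * w m r : ℝ) : ℂ) * Complex.exp (m * θ * Complex.I)) ∧
    ContDiff ℝ ∞ X ∧ HasCompactSupport X ∧ tsupport X ⊆ Ioi 0 ∧ (∀ᶠ r in 𝓝 R, X r = 1) ∧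
    IsSchwartzProfile (Iic 0) Φ ∧ IsSchwartzProfile (Ici 0) Ψ ∧
    (∀ m : ℕ, 1 ≤ m → Φ ((m : ℝ) ^ (-(1 / 3) : ℝ)) 0 = Ψ ((m : ℝ) ^ (-(1 / 3) : ℝ)) 0) ∧
    (∀ m : ℕ, 1 ≤ m → ∀ r : ℝ, 0 < r →
      w m r = X r * if r < R then Φ ((m : ℝ) ^ (-(1 / 3) : ℝ)) (sigmaVar R m r)
        else Ψ ((m : ℝ) ^ (-(1 / 3) : ℝ)) (rhoVar R m r)) ∧
    ∃ C : ℝ, ∀ m : ℕ, 1 ≤ m → ∀ r : ℝ, 0 < r →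
      |w m r - X r * (modeTerm0 R κ j m r +
        (1 / (m : ℝ)) ^ (1 / 3 : ℝ) * modeTerm1 R κ n₀ p j m r)| ≤ C * (m : ℝ) ^ (-(2 / 3) : ℝ)

/-! Separation of variables u = w(r) e^{imθ} turns the problem into a radial transmission problem
with the large parameter m. Put ε = (2κ/m)^{1/3} and look for k = m (1 + ε² ρ(ε)) / (R n₀). In the
inner variable y = (2κ)^{1/3} σ ≤ 0 the radial equation is, after division by ε², a perturbation in
powers of ε of f'' + (y + 2ρ(0)) f = 0. Here κ > 0 is what gives the linear potential the slope that
confines the mode against the boundary. In the outer variable τ = (m/w)(r/R - 1), with w = n₀/√(n₀²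
- 1), it is a perturbation of f'' = f, whose decaying solution is e^{-τ}.

The outer length is shorter than the inner one by a factor of order ε, so the conormal condition
reads Ψ' = γ ε Φ' at the interface, with γ = n₀^{p-1} w. To leading order the outer part vanishes
and the inner part obeys a Dirichlet condition: 2ρ(0) is a zero a of the flipped Airy function A,
and Φ = A(a + y).

All orders are solved algebraically. With Φ = P A(a + ·) + Q A'(a + ·) and Ψ = A'(a) S e^{-τ}, where
P, Q, S are series in ε with polynomial coefficients, the relation A'' = -zA turns the equations
into identities between polynomials. Since A(a) = 0 and A'(a) ≠ 0, continuity is Q(0) = S(0) and the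
conormal condition is S' - S = γ ε (P + Q') at 0. At each order the outer coefficient is found
first, from the normal derivative given by the previous inner order; its value at 0 is the boundary
datum of the inner problem, and the next coefficient of ρ adjusts that datum (`exists_outer_step`,
`exists_inner_step`, `FormalStep.exists_update`). The operators met here are triangular on
monomials, hence onto.

Borel summation (`exists_borel_sum`) makes smooth families of Schwartz functions out of the formal
series. Their residuals have zero expansion and so are O(ε^N) for every N (`inner_residual_bound`,
`outer_residual_bound`). The transmission defects are also flat in ε, and a compactly supported
correction of the outer profile removes them exactly (`exists_scaledMode`). The leading coefficient
is approximated uniformly in ε, within η, so no mode degenerates, even for small m. This is why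
normalization works for all m ≥ 1 and not just for large m.

On the plane, the cut-off mode is smooth up to the circle from each side. Weak derivatives, traces
and residuals are therefore classical. The commutator with the cut-off lives away from the circle,
where the profiles are O(ε^N). The norm before normalization is at least of order ε²
(`exists_le_eLpNorm_planeMode`), a polynomial loss that rapidly decreasing residuals absorb
(`exists_isWhisperingGallery_planeMode`).

The stated coefficients come from explicit initial segments of the formal solution: four orders for
a general index, seven for a constant one. They are verified equation by equation and then extended
by the recursion (`exists_formal_solution`). -/

/-! ## The Airy function -/

/-- The integrand of the Airy integral, with the weight `ζ ^ k`, `ζ = 1 + iτ`. -/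
noncomputable def airyKernel (k : ℕ) (x τ : ℝ) : ℂ :=
  (1 + τ * Complex.I) ^ k * Complex.exp ((1 + τ * Complex.I) ^ 3 / 3 - x * (1 + τ * Complex.I))

/-- The moments `∫ ζ ^ k exp (ζ³/3 - xζ) dτ` along the line `ζ = 1 + iτ`. -/
noncomputable def airyMoment (k : ℕ) (x : ℝ) : ℂ := ∫ τ : ℝ, airyKernel k x τ

lemma continuous_airyKernel (k : ℕ) (x : ℝ) : Continuous (airyKernel k x) := by
  unfold airyKernel; fun_prop

/-- On ζ = 1 + iτ the real part of ζ³/3 is 1/3 - τ², so the cubic exponent gives Gaussian decay, and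
x enters the modulus only through e^{-x}. Integrability, differentiation under the integral and the
decay of Ai all rest on this. -/
lemma norm_airyKernel (k : ℕ) (x τ : ℝ) :
    ‖airyKernel k x τ‖ = Real.exp (1 / 3 - x) * (√(1 + τ ^ 2) ^ k * Real.exp (-τ ^ 2)) := by
  have h1 : ‖(1 + τ * Complex.I : ℂ)‖ = √(1 + τ ^ 2) := by
    rw [Complex.norm_eq_sqrt_sq_add_sq]; simp
  have h2 : ((1 + τ * Complex.I) ^ 3 / 3 - x * (1 + τ * Complex.I) : ℂ).re = 1 / 3 - x + -τ ^ 2 := by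
    have : ((1 + τ * Complex.I) ^ 3 / 3 - x * (1 + τ * Complex.I) : ℂ)
        = ((1 / 3 - x + -τ ^ 2 : ℝ) : ℂ) + ((τ - τ ^ 3 / 3 - x * τ : ℝ) : ℂ) * Complex.I := by
      push_cast
      linear_combination (τ ^ 2 + Complex.I * τ ^ 3 / 3 : ℂ) * Complex.I_sq
    rw [this, Complex.add_re, Complex.ofReal_re, Complex.re_ofReal_mul, Complex.I_re, mul_zero,
      add_zero]
  rw [airyKernel, norm_mul, norm_pow, h1, Complex.norm_exp, h2, Real.exp_add]
  ring

lemma integrable_airyWeight (k : ℕ) :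
    Integrable fun τ : ℝ => √(1 + τ ^ 2) ^ k * Real.exp (-τ ^ 2) := by
  have h : Integrable fun τ : ℝ => (1 + |τ| ^ (k : ℝ)) * 2 ^ k * Real.exp (-τ ^ 2) := by
    have h1 := integrable_exp_neg_mul_sq (b := 1) one_pos
    have h2 := integrable_rpow_mul_exp_neg_mul_sq (b := 1) one_pos (s := k) (by
      have : (0:ℝ) ≤ k := Nat.cast_nonneg k
      linarith)
    have h3 : Integrable fun τ : ℝ => |τ| ^ (k : ℝ) * Real.exp (-1 * τ ^ 2) := by
      refine h2.norm.congr (Eventually.of_forall fun τ => ?_)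
      simp only [norm_mul, Real.norm_eq_abs, Real.abs_exp, Real.rpow_natCast, abs_pow]
    refine ((h1.add h3).mul_const (2 ^ k)).congr (Eventually.of_forall fun τ => ?_)
    simp only [Pi.add_apply]; ring_nf
  refine h.mono' (by fun_prop) (Eventually.of_forall fun τ => ?_)
  rw [Real.norm_of_nonneg (by positivity)]
  gcongr
  rw [Real.rpow_natCast]
  have h1 : √(1 + τ ^ 2) ≤ 1 + |τ| := by
    rw [Real.sqrt_le_left (by positivity)]
    nlinarith [sq_abs τ, abs_nonneg τ]
  rcases le_total |τ| 1 with h2 | h2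
  · calc √(1 + τ ^ 2) ^ k ≤ 2 ^ k := by gcongr; linarith
      _ ≤ (1 + |τ| ^ k) * 2 ^ k := by
        nlinarith [pow_pos (two_pos : (0:ℝ) < 2) k, pow_nonneg (abs_nonneg τ) k]
  · calc √(1 + τ ^ 2) ^ k ≤ (|τ| * 2) ^ k := by gcongr; linarith
      _ = |τ| ^ k * 2 ^ k := mul_pow _ _ _
      _ ≤ (1 + |τ| ^ k) * 2 ^ k := by gcongr; linarith

lemma integrable_airyKernel (k : ℕ) (x : ℝ) : Integrable (airyKernel k x) := by
  refine ((integrable_airyWeight k).const_mul (Real.exp (1 / 3 - x))).mono'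
    (continuous_airyKernel k x).aestronglyMeasurable (Eventually.of_forall fun τ => ?_)
  rw [norm_airyKernel]

/-- The factor e^{-x} of the modulus comes out of the integral. After x = -z it is decay like e^z at
-∞: weaker than the true Airy asymptotics, but it beats every polynomial, which is all that the
inner profiles need. -/
lemma exists_norm_airyMoment_le (k : ℕ) : ∃ C : ℝ, ∀ x, ‖airyMoment k x‖ ≤ C * Real.exp (-x) := by
  refine ⟨Real.exp (1 / 3) * ∫ τ : ℝ, √(1 + τ ^ 2) ^ k * Real.exp (-τ ^ 2), fun x => ?_⟩
  refine (norm_integral_le_integral_norm _).trans (le_of_eq ?_)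
  simp_rw [norm_airyKernel]
  rw [integral_const_mul, sub_eq_add_neg, Real.exp_add]
  ring

lemma hasDerivAt_airyKernel (k : ℕ) (x τ : ℝ) :
    HasDerivAt (fun x => airyKernel k x τ) (-airyKernel (k + 1) x τ) x := by
  unfold airyKernel
  have h1 : HasDerivAt (fun x : ℝ => (1 + τ * Complex.I) ^ 3 / 3 - x * (1 + τ * Complex.I))
      (-(1 + τ * Complex.I)) x := by
    have := (Complex.ofRealCLM.hasDerivAt (x := x)).mul_const (1 + τ * Complex.I)
    simpa using this.const_sub ((1 + τ * Complex.I) ^ 3 / 3)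
  refine (h1.cexp.const_mul ((1 + τ * Complex.I) ^ k)).congr_deriv ?_
  ring

lemma hasDerivAt_airyMoment (k : ℕ) (x : ℝ) :
    HasDerivAt (airyMoment k) (-airyMoment (k + 1) x) x := by
  have h := hasDerivAt_integral_of_dominated_loc_of_deriv_le (μ := volume)
    (F := fun x τ => airyKernel k x τ) (F' := fun x τ => -airyKernel (k + 1) x τ) (x₀ := x)
    (s := Metric.ball x 1)
    -- For y within distance 1 of x, e^{1/3 - y} is at most e^{4/3 - x}.
    (bound := fun τ => Real.exp (4 / 3 - x) * (√(1 + τ ^ 2) ^ (k + 1) * Real.exp (-τ ^ 2)))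
    (Metric.ball_mem_nhds x one_pos)
    (Eventually.of_forall fun y => (continuous_airyKernel k y).aestronglyMeasurable)
    (integrable_airyKernel k x)
    (continuous_airyKernel (k + 1) x).neg.aestronglyMeasurable
    (Eventually.of_forall fun τ y hy => ?_)
    ((integrable_airyWeight (k + 1)).const_mul _)
    (Eventually.of_forall fun τ y _ => hasDerivAt_airyKernel k y τ)
  · rw [integral_neg] at h; exact h.2
  · rw [norm_neg, norm_airyKernel]
    have := (abs_lt.1 (Metric.mem_ball.1 hy)).1
    exact mul_le_mul_of_nonneg_right (Real.exp_le_exp.2 (by linarith)) (by positivity)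

/-- Airy's equation: up to the factor i, (ζ² - x) e^{ζ³/3 - xζ} is the τ-derivative of an integrable
function, so its integral vanishes. -/
lemma airyMoment_two (x : ℝ) : airyMoment 2 x = x * airyMoment 0 x := by
  have hd (τ : ℝ) : HasDerivAt (airyKernel 0 x)
      (Complex.I * (airyKernel 2 x τ - x * airyKernel 0 x τ)) τ := by
    unfold airyKernel
    have h0 : HasDerivAt (fun τ : ℝ => (1 + τ * Complex.I : ℂ)) Complex.I τ := by
      simpa using ((Complex.ofRealCLM.hasDerivAt (x := τ)).mul_const Complex.I).const_add 1
    have h1 := ((h0.pow 3).div_const 3).sub (h0.const_mul (x : ℂ))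
    refine ((h1.cexp).const_mul (1 : ℂ)).congr_deriv ?_ |>.congr_of_eventuallyEq ?_
    · simp only [Pi.pow_apply, Pi.sub_apply]; push_cast; ring
    · exact Eventually.of_forall fun τ => by simp
  have hi : Integrable fun τ => Complex.I * (airyKernel 2 x τ - x * airyKernel 0 x τ) :=
    ((integrable_airyKernel 2 x).sub ((integrable_airyKernel 0 x).const_mul _)).const_mul _
  have h := integral_eq_zero_of_hasDerivAt_of_integrable hd hi (integrable_airyKernel 0 x)
  rw [integral_const_mul, integral_sub (integrable_airyKernel 2 x)
    ((integrable_airyKernel 0 x).const_mul _), integral_const_mul] at h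
  have := (mul_eq_zero.1 h).resolve_left Complex.I_ne_zero
  exact sub_eq_zero.1 this

/-- The derivative of the flipped Airy function. -/
noncomputable def flippedAiry' (z : ℝ) : ℝ := ((1 / (2 * π) : ℂ) * airyMoment 1 (-z)).re

lemma flippedAiry_eq (z : ℝ) : flippedAiry z = ((1 / (2 * π) : ℂ) * airyMoment 0 (-z)).re := by
  simp [flippedAiry, airyAi, airyMoment, airyKernel]

lemma hasDerivAt_re_airyMoment (k : ℕ) (z : ℝ) :
    HasDerivAt (fun z : ℝ => ((1 / (2 * π) : ℂ) * airyMoment k (-z)).re)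
      ((1 / (2 * π) : ℂ) * airyMoment (k + 1) (-z)).re z := by
  have h := ((hasDerivAt_airyMoment k (-z)).scomp z (hasDerivAt_neg z)).const_mul (1 / (2 * π) : ℂ)
  have := Complex.reCLM.hasFDerivAt.comp_hasDerivAt z h
  simpa [Function.comp_def] using this

lemma hasDerivAt_flippedAiry (z : ℝ) : HasDerivAt flippedAiry (flippedAiry' z) z :=
  (hasDerivAt_re_airyMoment 0 z).congr_of_eventuallyEq (Eventually.of_forall flippedAiry_eq)

lemma hasDerivAt_flippedAiry' (z : ℝ) : HasDerivAt flippedAiry' (-z * flippedAiry z) z := by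
  refine (hasDerivAt_re_airyMoment 1 z).congr_deriv ?_
  rw [flippedAiry_eq, airyMoment_two, ← Complex.re_ofReal_mul]
  congr 1; push_cast; ring

lemma deriv_flippedAiry : deriv flippedAiry = flippedAiry' :=
  funext fun z => (hasDerivAt_flippedAiry z).deriv

lemma exists_abs_re_airyMoment_le (k : ℕ) :
    ∃ C : ℝ, ∀ z, |((1 / (2 * π) : ℂ) * airyMoment k (-z)).re| ≤ C * Real.exp z := by
  obtain ⟨C, hC⟩ := exists_norm_airyMoment_le k
  refine ⟨‖(1 / (2 * π) : ℂ)‖ * C, fun z => (Complex.abs_re_le_norm _).trans ?_⟩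
  rw [norm_mul, mul_assoc]
  gcongr
  simpa using hC (-z)

lemma exists_abs_flippedAiry_le : ∃ C : ℝ, ∀ z, |flippedAiry z| ≤ C * Real.exp z := by
  simpa only [flippedAiry_eq] using exists_abs_re_airyMoment_le 0

lemma exists_abs_flippedAiry'_le : ∃ C : ℝ, ∀ z, |flippedAiry' z| ≤ C * Real.exp z :=
  exists_abs_re_airyMoment_le 1

/-- The two functions go through the induction together, because A'' = -zA sends the derivative of
each back to the other. -/
lemma contDiff_flippedAiry_aux (N : ℕ) : ContDiff ℝ N flippedAiry ∧ ContDiff ℝ N flippedAiry' := by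
  have d1 : Differentiable ℝ flippedAiry := fun z => (hasDerivAt_flippedAiry z).differentiableAt
  have d2 : Differentiable ℝ flippedAiry' := fun z => (hasDerivAt_flippedAiry' z).differentiableAt
  have e2 : deriv flippedAiry' = fun z => -z * flippedAiry z :=
    funext fun z => (hasDerivAt_flippedAiry' z).deriv
  induction N with
  | zero => exact ⟨contDiff_zero.2 d1.continuous, contDiff_zero.2 d2.continuous⟩
  | succ N ih =>
    have hc : ((N + 1 : ℕ) : WithTop ℕ∞) = (N : WithTop ℕ∞) + 1 := by norm_cast
    rw [hc]
    refine ⟨contDiff_succ_iff_deriv.2 ⟨d1, by simp, ?_⟩, contDiff_succ_iff_deriv.2 ⟨d2, by simp, ?_⟩⟩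
    · rw [deriv_flippedAiry]; exact ih.2
    · rw [e2]; exact contDiff_neg.mul ih.1

lemma contDiff_flippedAiry : ContDiff ℝ ∞ flippedAiry :=
  contDiff_infty.2 fun N => (contDiff_flippedAiry_aux N).1

lemma contDiff_flippedAiry' : ContDiff ℝ ∞ flippedAiry' :=
  contDiff_infty.2 fun N => (contDiff_flippedAiry_aux N).2

/-- Conjugation amounts to the substitution τ ↦ -τ. Hence the real part in the definition of Ai
loses nothing, and a nonzero moment gives a nonzero value of A. -/
lemma airyMoment_conj (x : ℝ) : (starRingEnd ℂ) (airyMoment 0 x) = airyMoment 0 x := by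
  rw [airyMoment, ← integral_conj, ← integral_neg_eq_self]
  refine integral_congr_ae (Eventually.of_forall fun τ => ?_)
  simp only [airyKernel, pow_zero, one_mul, ← Complex.exp_conj]
  congr 1
  simp [map_ofNat]

/-! ### Nontriviality and zeros of the flipped Airy function -/

/-- At x = 2πt the zeroth moment is e^{-2πt} times the Fourier transform at t of a continuous
integrable function. Were it zero for all x, Fourier inversion would make that function vanish at 0,
where its value is an exponential. -/
lemma airyMoment_zero_ne : ∃ x, airyMoment 0 x ≠ 0 := by
  by_contra! h
  set g : ℝ → ℂ := airyKernel 0 0 with hg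
  have hF : FourierTransform.fourier g = 0 := by
    funext t
    have := h (2 * π * t)
    rw [Real.fourier_real_eq_integral_exp_smul]
    have h2 : (∫ v : ℝ, Complex.exp (↑(-2 * π * v * t) * Complex.I) • g v)
        = Complex.exp (2 * π * t) * airyMoment 0 (2 * π * t) := by
      rw [airyMoment, ← integral_const_mul]
      refine integral_congr_ae (Eventually.of_forall fun τ => ?_)
      simp only [hg, airyKernel, pow_zero, one_mul, smul_eq_mul, ← Complex.exp_add]
      congr 1; push_cast; ring
    rw [h2, this]; simp
  have hi : Integrable g := integrable_airyKernel 0 0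
  have hinv := hi.fourierInv_fourier_eq (by rw [hF]; exact integrable_zero _ _ _)
    (v := 0) (continuous_airyKernel 0 0).continuousAt
  rw [hF, Real.fourierInv_eq'] at hinv
  simp [hg, airyKernel] at hinv
  exact Complex.exp_ne_zero _ hinv.symm

lemma flippedAiry_ne_zero : ∃ z, flippedAiry z ≠ 0 := by
  obtain ⟨x, hx⟩ := airyMoment_zero_ne
  refine ⟨-x, fun h => hx ?_⟩
  rw [flippedAiry_eq, neg_neg] at h
  have h1 : ((airyMoment 0 x).re : ℂ) = airyMoment 0 x := Complex.conj_eq_iff_re.1 (airyMoment_conj x)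
  rw [← h1] at h ⊢
  have h2 : ((1 / (2 * π) : ℂ) * ((airyMoment 0 x).re : ℂ)).re = 1 / (2 * π) * (airyMoment 0 x).re := by
    rw [show (1 / (2 * π) : ℂ) = ((1 / (2 * π) : ℝ) : ℂ) by push_cast; rfl, ← Complex.ofReal_mul,
      Complex.ofReal_re]
  rw [h2] at h
  have := (mul_eq_zero.1 h).resolve_left (by positivity)
  simp [this]

/-- A solution of the flipped Airy equation with vanishing Cauchy data is zero. -/
lemma flippedAiry'_ne_zero {a : ℝ} (ha : flippedAiry a = 0) : flippedAiry' a ≠ 0 := by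
  intro ha'
  obtain ⟨z, hz⟩ := flippedAiry_ne_zero
  -- The interval (-M, M) contains both a and z, and since M ≥ 1 the field (p₁, p₂) ↦ (p₂, -t p₁) is
  -- M-Lipschitz on it in the sup norm.
  set M : ℝ := 1 + |a| + |z| with hM
  set f : ℝ → ℝ × ℝ := fun t => (flippedAiry t, flippedAiry' t) with hf
  set v : ℝ → ℝ × ℝ → ℝ × ℝ := fun t p => (p.2, -t * p.1)
  have hfd (t : ℝ) : HasDerivAt f (v t (f t)) t :=
    (hasDerivAt_flippedAiry t).prodMk (hasDerivAt_flippedAiry' t)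
  have hv : ∀ t ∈ Ioo (-M) M, LipschitzOnWith (Real.toNNReal M) (v t) univ := by
    intro t ht
    refine LipschitzOnWith.of_dist_le_mul fun p _ q _ => ?_
    have hM1 : 1 ≤ M := by rw [hM]; linarith [abs_nonneg a, abs_nonneg z]
    rw [Real.coe_toNNReal M (by linarith), Prod.dist_eq, Prod.dist_eq]
    simp only [Real.dist_eq, v]
    have h0 : |-t * p.1 - -t * q.1| = |t| * |p.1 - q.1| := by
      rw [← mul_sub, abs_mul, abs_neg]
    have ht' : |t| ≤ M := (abs_lt.2 ⟨ht.1, ht.2⟩).le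
    rw [h0]
    refine max_le ?_ ?_
    · have := le_max_right |p.1 - q.1| |p.2 - q.2|
      nlinarith [abs_nonneg (p.2 - q.2)]
    · exact mul_le_mul ht' (le_max_left _ _) (abs_nonneg _) (by linarith)
  have ha0 : a ∈ Ioo (-M) M := by
    exact abs_lt.1 (by rw [hM]; linarith [abs_nonneg z])
  have key := ODE_solution_unique_of_mem_Ioo hv ha0 (f := f) (g := fun _ => (0, 0))
    (fun t _ => ⟨hfd t, mem_univ _⟩)
    (fun t _ => ⟨by simpa [v, Prod.zero_eq_mk] using hasDerivAt_const t ((0 : ℝ), (0 : ℝ)), mem_univ _⟩)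
    (by simp [hf, ha, ha'])
  have hz0 : z ∈ Ioo (-M) M := abs_lt.1 (by rw [hM]; linarith [abs_nonneg a])
  exact hz (congrArg Prod.fst (key hz0))

/-- Oscillation by concavity. Without zeros beyond a, some multiple ±A is positive from b ≥ 1 on,
hence concave there since y'' = -z y. A positive concave function on a half-line is nondecreasing,
so y'' ≤ -y(b) and y' becomes negative after a finite length, a contradiction. -/
lemma exists_flippedAiry_root_gt (a : ℝ) : ∃ z, a < z ∧ flippedAiry z = 0 := by
  by_contra! hne
  have hc : Continuous flippedAiry := contDiff_flippedAiry.continuous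
  set b := max (a + 1) 1
  have hb1 : 1 ≤ b := le_max_right _ _
  have hab : a < b := lt_of_lt_of_le (by linarith) (le_max_left _ _)
  obtain ⟨s, hs, hpos⟩ : ∃ s : ℝ, (s = 1 ∨ s = -1) ∧ ∀ z, b ≤ z → 0 < s * flippedAiry z := by
    have hsign : ∀ z, b ≤ z → 0 < flippedAiry b * flippedAiry z := by
      intro z hz
      by_contra! hle
      have h0 : (0 : ℝ) ∈ uIcc (flippedAiry b) (flippedAiry z) := by
        rcases le_total 0 (flippedAiry b) with h | h
        · have hb := lt_of_le_of_ne h (hne b hab).symm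
          exact mem_uIcc.2 (Or.inr ⟨by nlinarith, h⟩)
        · have hb := lt_of_le_of_ne h (hne b hab)
          exact mem_uIcc.2 (Or.inl ⟨h, by nlinarith⟩)
      obtain ⟨t, ht, ht0⟩ := intermediate_value_uIcc hc.continuousOn h0
      rw [uIcc_of_le hz] at ht
      exact hne t (hab.trans_le ht.1) ht0
    rcases lt_or_gt_of_ne (hne b hab) with h | h
    · exact ⟨-1, Or.inr rfl, fun z hz => by nlinarith [hsign z hz]⟩
    · exact ⟨1, Or.inl rfl, fun z hz => by nlinarith [hsign z hz]⟩
  set y : ℝ → ℝ := fun z => s * flippedAiry z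
  set y' : ℝ → ℝ := fun z => s * flippedAiry' z
  have hy (z : ℝ) : HasDerivAt y (y' z) z := (hasDerivAt_flippedAiry z).const_mul s
  have hy' (z : ℝ) : HasDerivAt y' (-z * y z) z :=
    ((hasDerivAt_flippedAiry' z).const_mul s).congr_deriv (by simp only [y]; ring)
  have cy : Continuous y := continuous_iff_continuousAt.2 fun z => (hy z).continuousAt
  have cy' : Continuous y' := continuous_iff_continuousAt.2 fun z => (hy' z).continuousAt
  have hanti : AntitoneOn y' (Ici b) := by
    refine antitoneOn_of_deriv_nonpos (convex_Ici b) cy'.continuousOn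
      (fun z _ => (hy' z).differentiableAt.differentiableWithinAt) fun z hz => ?_
    rw [interior_Ici] at hz
    rw [(hy' z).deriv]
    nlinarith [hpos z hz.le, mem_Ioi.1 hz]
  -- the derivative of a positive concave function on a half-line is nonnegative
  have hlin : ∀ z₀, b ≤ z₀ → ∀ z, z₀ ≤ z → y z ≤ y z₀ + y' z₀ * (z - z₀) := by
    intro z₀ hz₀ z hz
    rcases hz.eq_or_lt with rfl | hlt
    · simp
    obtain ⟨t, ht, hteq⟩ := exists_hasDerivAt_eq_slope y y' hlt cy.continuousOn (fun t _ => hy t)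
    have h1 : y' t ≤ y' z₀ := hanti hz₀ (hz₀.trans ht.1.le) ht.1.le
    rw [hteq, div_le_iff₀ (by linarith)] at h1
    linarith
  have hnn : ∀ z, b ≤ z → 0 ≤ y' z := by
    intro z hz
    by_contra! hneg
    have := hlin z hz (z + y z / (-y' z)) (by
      have : 0 < y z / (-y' z) := div_pos (hpos z hz) (by linarith)
      linarith)
    have h2 : y' z * (z + y z / (-y' z) - z) = -y z := by
      have : y' z ≠ 0 := hneg.ne
      field_simp
      ring
    rw [h2] at this
    have h3 := hpos (z + y z / (-y' z)) (by
      have : 0 < y z / (-y' z) := div_pos (hpos z hz) (by linarith)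
      linarith)
    simp only [y] at this h3
    linarith
  have hmono : ∀ z, b ≤ z → y b ≤ y z := by
    intro z hz
    refine monotoneOn_of_deriv_nonneg (convex_Ici b) cy.continuousOn
      (fun z _ => (hy z).differentiableAt.differentiableWithinAt) (fun t ht => ?_)
      self_mem_Ici hz hz
    rw [interior_Ici] at ht
    rw [(hy t).deriv]
    exact hnn t ht.le
  -- On an interval of length T the derivative falls by at least y(b) T = y'(b) + y(b), more than it
  -- had.
  set T := y' b / y b + 1
  have hyb : 0 < y b := hpos b le_rfl
  have hT : 0 < T := by have := div_nonneg (hnn b le_rfl) hyb.le; positivity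
  obtain ⟨t, ht, hteq⟩ := exists_hasDerivAt_eq_slope y' (fun z => -z * y z)
    (show b < b + T by linarith) cy'.continuousOn (fun t _ => hy' t)
  rw [add_sub_cancel_left, eq_div_iff hT.ne'] at hteq
  have h1 := hmono t ht.1.le
  have h2 := hnn (b + T) (by linarith)
  have h3 : y b ≤ t * y t := by nlinarith [ht.1]
  have h4 : y b * T = y' b + y b := by simp only [T]; field_simp
  nlinarith

lemma isClosed_flippedAiry_zeros : IsClosed {z | flippedAiry z = 0} :=
  isClosed_eq contDiff_flippedAiry.continuous continuous_const

/-- Zeros are simple, hence isolated, so those beyond a all lie in some [b, ∞) with b > a and form a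
nonempty closed set, which contains its infimum. This makes the recursive infima of `airyRoot`
genuine zeros, strictly increasing. -/
lemma next_flippedAiry_root (a : ℝ) :
    sInf {z | a < z ∧ flippedAiry z = 0} ∈ {z | a < z ∧ flippedAiry z = 0} := by
  set S := {z | a < z ∧ flippedAiry z = 0}
  have hev : ∀ᶠ z in 𝓝[>] a, flippedAiry z ≠ 0 := by
    by_cases ha : flippedAiry a = 0
    · have := (hasDerivAt_flippedAiry a).eventually_ne (c := 0) (flippedAiry'_ne_zero ha)
      exact this.filter_mono (nhdsWithin_mono a fun z hz => ne_of_gt hz)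
    · exact (contDiff_flippedAiry.continuous.continuousAt.eventually_ne ha).filter_mono
        nhdsWithin_le_nhds
  obtain ⟨b, hab, hb⟩ := mem_nhdsGT_iff_exists_Ioo_subset.1 hev
  have hS : S = Ici b ∩ {z | flippedAiry z = 0} := by
    ext z
    constructor
    · rintro ⟨h1, h2⟩
      refine ⟨?_, h2⟩
      by_contra hzb
      exact hb ⟨h1, not_le.1 hzb⟩ h2
    · rintro ⟨h1, h2⟩
      exact ⟨lt_of_lt_of_le hab h1, h2⟩
  refine IsClosed.csInf_mem (hS ▸ isClosed_Ici.inter isClosed_flippedAiry_zeros)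
    (exists_flippedAiry_root_gt a) ⟨a, fun z hz => hz.1.le⟩

lemma flippedAiry_airyRoot (j : ℕ) : flippedAiry (airyRoot j) = 0 := by
  cases j with
  | zero => exact (next_flippedAiry_root 0).2
  | succ j => exact (next_flippedAiry_root (airyRoot j)).2

lemma strictMono_airyRoot : StrictMono airyRoot :=
  strictMono_nat_of_lt_succ fun j => (next_flippedAiry_root (airyRoot j)).1

/-! ## Borel summation of Schwartz profiles -/

open scoped SchwartzMap

lemma exists_bound_of_hasCompactSupport {E F : Type*} [TopologicalSpace E] [NormedAddCommGroup F]
    {f : E → F} (hf : Continuous f) (hc : HasCompactSupport f) : ∃ C : ℝ, 0 ≤ C ∧ ∀ x, ‖f x‖ ≤ C := by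
  obtain ⟨C, hC⟩ := hc.exists_bound_of_continuous hf
  exact ⟨max C 0, le_max_right _ _, fun x => (hC x).trans (le_max_left _ _)⟩

lemma exists_bound_iteratedDeriv {f : ℝ → ℝ} (hf : ContDiff ℝ ∞ f) (hc : HasCompactSupport f) (k : ℕ) :
    ∃ C : ℝ, 0 ≤ C ∧ ∀ x, |iteratedDeriv k f x| ≤ C := by
  obtain ⟨C, h0, hC⟩ := exists_bound_of_hasCompactSupport
    (hf.continuous_iteratedFDeriv (m := k) (mod_cast le_top)) (hc.iteratedFDeriv (𝕜 := ℝ) k)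
  refine ⟨C, h0, fun x => ?_⟩
  rw [← Real.norm_eq_abs, ← norm_iteratedFDeriv_eq_norm_iteratedDeriv]
  exact hC x

/-- Smooth substitutes for the monomials `t ^ l` that are small with all their derivatives. -/
lemma exists_small_monomials (S : ℕ → ℝ) (hS : ∀ l, 0 ≤ S l) : ∃ u : ℕ → ℝ → ℝ,
    (∀ l, ContDiff ℝ ∞ (u l)) ∧ (u 0 = fun _ => 1) ∧
    (∀ l k, ∃ C, 0 ≤ C ∧ ∀ t, |iteratedDeriv k (u l) t| ≤ C) ∧
    (∀ l k, k < l → ∀ t, |iteratedDeriv k (u l) t| * S l ≤ (1 / 2) ^ l) ∧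
    (∀ l N, N < l → ∀ t, 0 ≤ t → |u l t| * S l ≤ t ^ N * (1 / 2) ^ l) ∧
    (∀ l N E, ∃ C, 0 ≤ C ∧ ∀ t ∈ Icc (0 : ℝ) E, |u l t - t ^ l| ≤ C * t ^ N) := by
  let χ : ContDiffBump (0 : ℝ) := ⟨1, 2, one_pos, by norm_num⟩
  have hχ1 : ∀ t : ℝ, |t| ≤ 1 → χ t = 1 := fun t ht =>
    χ.one_of_mem_closedBall (by simpa using ht)
  have hχ2 : ∀ t : ℝ, 2 ≤ |t| → χ t = 0 := fun t ht =>
    χ.zero_of_le_dist (by simpa using ht)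
  have hχs : ContDiff ℝ ∞ χ := χ.contDiff
  let v : ℕ → ℝ → ℝ := fun l t => t ^ l * χ t
  have hv : ∀ l, ContDiff ℝ ∞ (v l) := fun l => (contDiff_id.pow l).mul hχs
  have hvc : ∀ l, HasCompactSupport (v l) := fun l => χ.hasCompactSupport.mul_left
  choose b hb0 hb using fun l k => exists_bound_iteratedDeriv (hv l) (hvc l) k
  let M : ℕ → ℝ := fun l => ∑ k ∈ Finset.range l, b l k
  have hM0 : ∀ l, 0 ≤ M l := fun l => Finset.sum_nonneg fun k _ => hb0 l k
  have hM : ∀ l k, k < l → b l k ≤ M l := fun l k hk =>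
    Finset.single_le_sum (f := b l) (fun k _ => hb0 l k) (Finset.mem_range.2 hk)
  -- Dilation of the cut-off by L multiplies a derivative of order k < l by L^{k-l} ≤ 1/L. The
  -- summand M l brings these derivatives, times S l, below 2^{-l}. The summand 2^l does the same
  -- for the bound by t^N, where t < 2/L on the support yields t^{l-N} ≤ 2^l / L.
  let L : ℕ → ℝ := fun l => 1 + 2 ^ l * ((M l + 2 ^ l) * S l)
  have hL1 : ∀ l, 1 ≤ L l := fun l => by
    have := hM0 l; have := hS l; simp only [L]; linarith [show 0 ≤ 2 ^ l * ((M l + 2 ^ l) * S l) by positivity]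
  -- The constant monomial is not cut off, so the leading coefficient enters the Borel sum unchanged
  -- for every t.
  let u : ℕ → ℝ → ℝ := fun l t => if l = 0 then 1 else (L l)⁻¹ ^ l * v l (L l * t)
  have hu0 : u 0 = fun _ => 1 := by funext t; simp [u]
  have hul : ∀ l, l ≠ 0 → u l = fun t => (L l)⁻¹ ^ l * v l (L l * t) := fun l hl => by
    funext t; simp [u, hl]
  have hul' : ∀ l, l ≠ 0 → ∀ t, u l t = t ^ l * χ (L l * t) := fun l hl t => by
    have : L l ≠ 0 := by linarith [hL1 l]
    rw [hul l hl]; simp only [v]; rw [← mul_assoc, ← mul_pow, inv_mul_cancel_left₀ this]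
  have hus : ∀ l, ContDiff ℝ ∞ (u l) := fun l => by
    rcases eq_or_ne l 0 with rfl | hl
    · rw [hu0]; exact contDiff_const
    · rw [hul l hl]; exact contDiff_const.mul ((hv l).comp (contDiff_const.mul contDiff_id))
  have hder : ∀ l k, l ≠ 0 → ∀ t, iteratedDeriv k (u l) t =
      (L l)⁻¹ ^ l * ((L l) ^ k * iteratedDeriv k (v l) (L l * t)) := fun l k hl t => by
    rw [hul l hl, iteratedDeriv_const_mul_field,
      iteratedDeriv_comp_const_mul ((hv l).of_le (mod_cast le_top))]
  refine ⟨u, hus, hu0, ?_, ?_, ?_, ?_⟩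
  · intro l k
    rcases eq_or_ne l 0 with rfl | hl
    · refine ⟨1, one_pos.le, fun t => ?_⟩
      rw [hu0, iteratedDeriv_const]
      split_ifs <;> simp
    · have hL0 : 0 < L l := by linarith [hL1 l]
      refine ⟨(L l)⁻¹ ^ l * ((L l) ^ k * b l k), by have := hb0 l k; positivity, fun t => ?_⟩
      rw [hder l k hl, abs_mul, abs_mul, abs_of_nonneg (by positivity : (0:ℝ) ≤ (L l)⁻¹ ^ l),
        abs_of_nonneg (by positivity : (0:ℝ) ≤ (L l) ^ k)]
      gcongr
      exact hb l k _
  · intro l k hk t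
    have hl : l ≠ 0 := by omega
    have hL0 : 0 < L l := by linarith [hL1 l]
    have h1 : (L l)⁻¹ ^ l * (L l) ^ k ≤ (L l)⁻¹ := by
      obtain ⟨d, rfl⟩ : ∃ d, l = k + 1 + d := ⟨l - k - 1, by omega⟩
      have : (L (k + 1 + d))⁻¹ ^ (k + 1 + d) * (L (k + 1 + d)) ^ k
          = (L (k + 1 + d))⁻¹ * (L (k + 1 + d))⁻¹ ^ d := by
        have h : (L (k + 1 + d))⁻¹ ^ k * (L (k + 1 + d)) ^ k = 1 := by
          rw [← mul_pow, inv_mul_cancel₀ hL0.ne', one_pow]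
        rw [pow_add, pow_add]
        linear_combination (L (k + 1 + d))⁻¹ * (L (k + 1 + d))⁻¹ ^ d * h
      rw [this]
      exact mul_le_of_le_one_right (by positivity)
        (pow_le_one₀ (by positivity) (inv_le_one_of_one_le₀ (hL1 _)))
    rw [hder l k hl, ← mul_assoc, abs_mul, abs_of_nonneg (by positivity : (0:ℝ) ≤ (L l)⁻¹ ^ l * (L l) ^ k)]
    have h2 : |iteratedDeriv k (v l) (L l * t)| ≤ M l := (hb l k _).trans (hM l k hk)
    have := hM0 l; have := hS l
    calc (L l)⁻¹ ^ l * (L l) ^ k * |iteratedDeriv k (v l) (L l * t)| * S l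
        ≤ (L l)⁻¹ * M l * S l := by gcongr
      _ ≤ (1 / 2) ^ l := by
        rw [mul_assoc, inv_mul_le_iff₀ hL0, one_div, inv_pow, ← div_eq_mul_inv, le_div_iff₀ (by positivity)]
        have : 0 ≤ 2 ^ l * (2 ^ l * S l) := by positivity
        simp only [L]; nlinarith
  · intro l N hN t ht
    have hl : l ≠ 0 := by omega
    have hL0 : 0 < L l := by linarith [hL1 l]
    have := hM0 l; have := hS l
    rw [hul' l hl]
    rcases le_or_gt 2 |L l * t| with h | h
    · rw [hχ2 _ h]; simp; positivity
    · rw [abs_of_nonneg (by positivity)] at h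
      obtain ⟨d, rfl⟩ : ∃ d, l = N + 1 + d := ⟨l - N - 1, by omega⟩
      set l := N + 1 + d
      have h1 : t ≤ 2 / L l := by rw [le_div_iff₀ hL0]; linarith
      have h2 : t ^ (1 + d) ≤ 2 ^ l / L l := by
        calc t ^ (1 + d) ≤ (2 / L l) ^ (1 + d) := by gcongr
          _ = 2 ^ (1 + d) / (L l * (L l) ^ d) := by rw [div_pow, pow_add (L l), pow_one]
          _ ≤ 2 ^ l / (L l * 1) := by
            gcongr
            · norm_num
            · omega
            · exact one_le_pow₀ (hL1 l)
          _ = _ := by rw [mul_one]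
      have h3 : |t ^ l * χ (L l * t)| ≤ t ^ N * (2 ^ l / L l) := by
        rw [abs_mul, abs_of_nonneg (by positivity : 0 ≤ t ^ l), abs_of_nonneg χ.nonneg]
        calc t ^ l * χ (L l * t) ≤ t ^ l * 1 := by gcongr; exact χ.le_one
          _ = t ^ N * t ^ (1 + d) := by rw [mul_one, ← pow_add, ← add_assoc]
          _ ≤ _ := by gcongr
      calc _ ≤ t ^ N * (2 ^ l / L l) * S l := by gcongr
        _ = t ^ N * (2 ^ l * S l / L l) := by ring
        _ ≤ t ^ N * (1 / 2) ^ l := by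
          gcongr
          rw [one_div, inv_pow, div_le_iff₀ hL0, ← div_eq_inv_mul, le_div_iff₀ (by positivity)]
          have : 0 ≤ 2 ^ l * (M l * S l) := by positivity
          simp only [L]; nlinarith
  · intro l N E
    rcases eq_or_ne l 0 with rfl | hl
    · exact ⟨0, le_rfl, fun t _ => by simp [hu0]⟩
    have hL0 : 0 < L l := by linarith [hL1 l]
    refine ⟨|E| ^ l * (L l) ^ N, by positivity, fun t ht => ?_⟩
    have ht0 := ht.1
    rw [hul' l hl]
    rcases le_or_gt |L l * t| 1 with h | h
    · rw [hχ1 _ h]; simp; positivity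
    · rw [abs_of_nonneg (by positivity)] at h
      have h1 : |t ^ l * χ (L l * t) - t ^ l| ≤ t ^ l := by
        have h2 := χ.nonneg (x := L l * t)
        have h3 := χ.le_one (x := L l * t)
        have h4 : 0 ≤ t ^ l := by positivity
        rw [abs_le]; constructor <;> nlinarith
      calc _ ≤ t ^ l := h1
        _ ≤ |E| ^ l * 1 := by rw [mul_one]; gcongr; exact ht.2.trans (le_abs_self E)
        _ ≤ |E| ^ l * (L l * t) ^ N := by gcongr; exact one_le_pow₀ h.le
        _ = _ := by rw [mul_pow]; ring

lemma exists_summable_bound (C : ℕ → ℝ) (K : ℕ) {c : ℝ} (hc : 0 ≤ c) {f : ℕ → ℝ}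
    (h1 : ∀ l, l ≤ K → f l ≤ C l) (h2 : ∀ l, K < l → f l ≤ c * (1 / 2) ^ l) :
    f ≤ (fun l => (if l ≤ K then C l else 0) + c * (1 / 2) ^ l) := by
  intro l
  by_cases hl : l ≤ K
  · simp only [hl, if_true]
    exact (h1 l hl).trans (by have : (0:ℝ) ≤ c * (1 / 2) ^ l := by positivity
                              linarith)
  · simp only [hl, if_false, zero_add]
    exact h2 l (not_le.1 hl)

lemma summable_initial_add_geometric (C : ℕ → ℝ) (K : ℕ) (c : ℝ) :
    Summable (fun l => (if l ≤ K then C l else 0) + c * (1 / 2 : ℝ) ^ l) := by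
  refine Summable.add ?_ (summable_geometric_two.mul_left c)
  refine summable_of_ne_finset_zero (s := Finset.range (K + 1)) fun l hl => ?_
  rw [Finset.mem_range] at hl
  simp [show ¬ l ≤ K by omega]

lemma norm_iteratedFDeriv_comp_fst_le {u : ℝ → ℝ} (hu : ContDiff ℝ ∞ u) (k : ℕ) (p : ℝ × ℝ) :
    ‖iteratedFDeriv ℝ k (fun p : ℝ × ℝ => u p.1) p‖ ≤ |iteratedDeriv k u p.1| := by
  have h := (ContinuousLinearMap.fst ℝ ℝ ℝ).iteratedFDeriv_comp_right hu p
    (i := k) (mod_cast le_top)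
  have h2 : (fun p : ℝ × ℝ => u p.1) = u ∘ ContinuousLinearMap.fst ℝ ℝ ℝ := rfl
  rw [h2, h]
  refine (ContinuousMultilinearMap.norm_compContinuousLinearMap_le _ _).trans ?_
  rw [← Real.norm_eq_abs, ← norm_iteratedFDeriv_eq_norm_iteratedDeriv]
  refine mul_le_of_le_one_right (norm_nonneg _) (Finset.prod_le_one (fun _ _ => norm_nonneg _) ?_)
  exact fun _ _ => ContinuousLinearMap.norm_fst_le ℝ ℝ ℝ

lemma norm_iteratedFDeriv_comp_snd_le {u : ℝ → ℝ} (hu : ContDiff ℝ ∞ u) (k : ℕ) (p : ℝ × ℝ) :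
    ‖iteratedFDeriv ℝ k (fun p : ℝ × ℝ => u p.2) p‖ ≤ |iteratedDeriv k u p.2| := by
  have h := (ContinuousLinearMap.snd ℝ ℝ ℝ).iteratedFDeriv_comp_right hu p
    (i := k) (mod_cast le_top)
  have h2 : (fun p : ℝ × ℝ => u p.2) = u ∘ ContinuousLinearMap.snd ℝ ℝ ℝ := rfl
  rw [h2, h]
  refine (ContinuousMultilinearMap.norm_compContinuousLinearMap_le _ _).trans ?_
  rw [← Real.norm_eq_abs, ← norm_iteratedFDeriv_eq_norm_iteratedDeriv]
  refine mul_le_of_le_one_right (norm_nonneg _) (Finset.prod_le_one (fun _ _ => norm_nonneg _) ?_)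
  exact fun _ _ => ContinuousLinearMap.norm_snd_le ℝ ℝ ℝ

/-- A diagonal choice: one number per l controls weights and orders up to l. For a fixed weight and
order only finitely many l escape it, and these do not affect summability. -/
lemma exists_bound_schwartz (g : ℕ → 𝓢(ℝ, ℝ)) : ∃ S : ℕ → ℝ, (∀ l, 0 ≤ S l) ∧
    ∀ l a i, a ≤ l → i ≤ l → ∀ x, (1 + |x|) ^ a * |iteratedDeriv i (g l) x| ≤ S l := by
  refine ⟨fun l => 2 ^ l * ((Finset.Iic (l, l)).sup
    (fun m : ℕ × ℕ => SchwartzMap.seminorm ℝ m.1 m.2)) (g l),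
    fun l => mul_nonneg (by positivity) (apply_nonneg _ _), fun l a i ha hi x => ?_⟩
  rw [← Real.norm_eq_abs (iteratedDeriv i (g l) x), ← norm_iteratedFDeriv_eq_norm_iteratedDeriv]
  exact SchwartzMap.one_add_le_sup_seminorm_apply (m := (l, l)) ha hi (g l) x

lemma exists_bound_schwartz' (g : 𝓢(ℝ, ℝ)) (a i : ℕ) : ∃ C : ℝ, 0 ≤ C ∧
    ∀ x, (1 + |x|) ^ a * |iteratedDeriv i g x| ≤ C := by
  refine ⟨2 ^ a * ((Finset.Iic (a, i)).sup
    (fun m : ℕ × ℕ => SchwartzMap.seminorm ℝ m.1 m.2)) g,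
    mul_nonneg (by positivity) (apply_nonneg _ _), fun x => ?_⟩
  rw [← Real.norm_eq_abs (iteratedDeriv i g x), ← norm_iteratedFDeriv_eq_norm_iteratedDeriv]
  exact SchwartzMap.one_add_le_sup_seminorm_apply (m := (a, i)) le_rfl le_rfl g x

lemma hasDerivAt_iteratedDeriv {f : ℝ → ℝ} (hf : ContDiff ℝ ∞ f) (i : ℕ) (x : ℝ) :
    HasDerivAt (iteratedDeriv i f) (iteratedDeriv (i + 1) f x) x := by
  rw [iteratedDeriv_succ]
  have h : Differentiable ℝ (iteratedDeriv i f) :=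
    hf.differentiable_iteratedDeriv i (WithTop.coe_lt_coe.2 (WithTop.coe_lt_top i))
  exact (h x).hasDerivAt

set_option maxHeartbeats 400000 in
/-- Borel summation: a sequence of Schwartz functions is the sequence of coefficients of the
expansion in powers of `t` of a smooth family of Schwartz functions. -/
theorem exists_borel_sum (g : ℕ → 𝓢(ℝ, ℝ)) {δ : ℝ} (hδ : 0 < δ) : ∃ F : ℕ → ℝ → ℝ → ℝ,
    ContDiff ℝ ∞ (Function.uncurry (F 0)) ∧
    (∀ a b : ℕ, ∃ C, ∀ p : ℝ × ℝ,
      |p.2| ^ a * ‖iteratedFDeriv ℝ b (Function.uncurry (F 0)) p‖ ≤ C) ∧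
    (∀ t x, |F 0 t x - g 0 x| ≤ δ) ∧
    (∀ i t x, HasDerivAt (F i t) (F (i + 1) t x) x) ∧
    (∀ i N a : ℕ, ∀ E : ℝ, ∃ C, 0 ≤ C ∧ ∀ t ∈ Icc (0 : ℝ) E, ∀ x,
      (1 + |x|) ^ a * |F i t x - ∑ l ∈ Finset.range N, t ^ l * iteratedDeriv i (g l) x|
        ≤ C * t ^ N) := by
  obtain ⟨S₀, hS₀, hg₀⟩ := exists_bound_schwartz g
  -- The inflated weight also satisfies S₀ ≤ δ S, so that all terms after the first add up to at
  -- most δ, uniformly in t.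
  set S : ℕ → ℝ := fun l => S₀ l * (1 + δ⁻¹) with hSdef
  have hS : ∀ l, 0 ≤ S l := fun l => by have := hS₀ l; positivity
  have hSS : ∀ l, S₀ l ≤ S l := fun l => by
    have := mul_nonneg (hS₀ l) (inv_pos.2 hδ).le
    simp only [S]; linarith
  have hSδ : ∀ l, S₀ l ≤ δ * S l := fun l => by
    have : δ * S l = S₀ l * δ + S₀ l := by simp only [S]; field_simp
    rw [this]; nlinarith [hS₀ l]
  obtain ⟨u, hus, hu0, hub, hud, hut, hur⟩ := exists_small_monomials S hS
  have hg : ∀ l a i, a ≤ l → i ≤ l → ∀ x, (1 + |x|) ^ a * |iteratedDeriv i (g l) x| ≤ S l :=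
    fun l a i ha hi x => (hg₀ l a i ha hi x).trans (hSS l)
  choose b hb0 hb using hub
  choose G hG0 hG using fun l a i => exists_bound_schwartz' (g l) a i
  have hgs : ∀ l, ContDiff ℝ ∞ (g l) := fun l => (g l).smooth ⊤
  let F : ℕ → ℝ → ℝ → ℝ := fun i t x => ∑' l, u l t * iteratedDeriv i (g l) x
  -- summable bounds
  let B : ℕ → ℕ → ℕ → ℝ := fun a i l =>
    (if l ≤ max a i then b l 0 * G l a i else 0) + 1 * (1 / 2) ^ l
  have hBs : ∀ a i, Summable (B a i) := fun a i => summable_initial_add_geometric _ _ _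
  have hB : ∀ a i l t x, (1 + |x|) ^ a * |u l t * iteratedDeriv i (g l) x| ≤ B a i l := by
    intro a i l t x
    refine exists_summable_bound (fun l => b l 0 * G l a i) (max a i) zero_le_one
      (f := fun l => (1 + |x|) ^ a * |u l t * iteratedDeriv i (g l) x|) (fun l _ => ?_)
      (fun l hl => ?_) l
    · have h1 := hb l 0 t
      rw [iteratedDeriv_zero] at h1
      calc _ = |u l t| * ((1 + |x|) ^ a * |iteratedDeriv i (g l) x|) := by rw [abs_mul]; ring
        _ ≤ _ := by gcongr; exacts [hb0 l 0, hG l a i x]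
    · have h1 := hud l 0 (by omega) t
      rw [iteratedDeriv_zero] at h1
      calc _ = |u l t| * ((1 + |x|) ^ a * |iteratedDeriv i (g l) x|) := by rw [abs_mul]; ring
        _ ≤ |u l t| * S l := by gcongr; exact hg l a i (by omega) (by omega) x
        _ ≤ 1 * (1 / 2) ^ l := by rw [one_mul]; exact h1
  have hsum : ∀ i t x, Summable fun l => u l t * iteratedDeriv i (g l) x := fun i t x =>
    Summable.of_norm_bounded (hBs 0 i) fun l => by simpa using hB 0 i l t x
  have hfs : ∀ l, ContDiff ℝ ∞ (fun p : ℝ × ℝ => u l p.1 * g l p.2) := fun l =>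
    ((hus l).comp contDiff_fst).mul ((hgs l).comp contDiff_snd)
  -- Leibniz' rule produces binomial weights of total mass 2^k, each multiplying a term below 2^{-l}
  -- once l > max a k. The finitely many earlier terms only need to be bounded.
  let V : ℕ → ℕ → ℕ → ℝ := fun a k l =>
    (if l ≤ max a k then ∑ i ∈ Finset.range (k + 1), (k.choose i : ℝ) * b l i * G l a (k - i) else 0)
      + 2 ^ k * (1 / 2) ^ l
  have hVs : ∀ a k, Summable (V a k) := fun a k => summable_initial_add_geometric _ _ _
  have hV : ∀ a k l (p : ℝ × ℝ),
      (1 + |p.2|) ^ a * ‖iteratedFDeriv ℝ k (fun p : ℝ × ℝ => u l p.1 * g l p.2) p‖ ≤ V a k l := by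
    intro a k l p
    have h0 : ∀ l, (1 + |p.2|) ^ a * ‖iteratedFDeriv ℝ k (fun p : ℝ × ℝ => u l p.1 * g l p.2) p‖ ≤
        ∑ i ∈ Finset.range (k + 1), (k.choose i : ℝ) * |iteratedDeriv i (u l) p.1| *
          ((1 + |p.2|) ^ a * |iteratedDeriv (k - i) (g l) p.2|) := by
      intro l
      refine (mul_le_mul_of_nonneg_left (norm_iteratedFDeriv_mul_le
        (((hus l).comp contDiff_fst)) ((hgs l).comp contDiff_snd) p
        (n := k) (mod_cast le_top)) (by positivity)).trans ?_
      rw [Finset.mul_sum]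
      refine Finset.sum_le_sum fun i _ => ?_
      calc _ = (k.choose i : ℝ) * ‖iteratedFDeriv ℝ i (fun p : ℝ × ℝ => u l p.1) p‖ *
            ((1 + |p.2|) ^ a * ‖iteratedFDeriv ℝ (k - i) (fun p : ℝ × ℝ => g l p.2) p‖) := by
              simp only [Function.comp_def]; ring
        _ ≤ _ := by
          gcongr
          · exact norm_iteratedFDeriv_comp_fst_le (hus l) i p
          · exact norm_iteratedFDeriv_comp_snd_le (hgs l) (k - i) p
    refine exists_summable_bound
      (fun l => ∑ i ∈ Finset.range (k + 1), (k.choose i : ℝ) * b l i * G l a (k - i)) (max a k)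
      (by positivity)
      (f := fun l => (1 + |p.2|) ^ a *
        ‖iteratedFDeriv ℝ k (fun p : ℝ × ℝ => u l p.1 * g l p.2) p‖) (fun l _ => ?_)
      (fun l hl => ?_) l
    · refine (h0 l).trans (Finset.sum_le_sum fun i _ => ?_)
      gcongr
      · exact mul_nonneg (by positivity) (hb0 l i)
      · exact hb l i _
      · exact hG l a _ _
    · refine (h0 l).trans ?_
      have : ((2 : ℝ) ^ k) = ∑ i ∈ Finset.range (k + 1), (k.choose i : ℝ) := by
        exact_mod_cast (Nat.sum_range_choose k).symm
      rw [this, Finset.sum_mul]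
      refine Finset.sum_le_sum fun i hi => ?_
      rw [Finset.mem_range] at hi
      rw [mul_assoc]
      gcongr
      calc _ ≤ |iteratedDeriv i (u l) p.1| * S l := by
            gcongr; exact hg l a _ (by omega) (by omega) _
        _ ≤ _ := hud l i (by omega) _
  have hV0 : ∀ (k l : ℕ) (p : ℝ × ℝ), ((k : ℕ∞) ≤ (⊤ : ℕ∞)) →
      ‖iteratedFDeriv ℝ k (fun p : ℝ × ℝ => u l p.1 * g l p.2) p‖ ≤ V 0 k l := fun k l p _ => by
    simpa using hV 0 k l p
  have hF0 : Function.uncurry (F 0) = fun p : ℝ × ℝ => ∑' l, u l p.1 * g l p.2 := by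
    funext p; simp [F, Function.uncurry]
  refine ⟨F, ?_, ?_, ?_, ?_, ?_⟩
  · rw [hF0]
    exact contDiff_tsum hfs (fun k _ => hVs 0 k) hV0
  · intro a k
    refine ⟨∑' l, V a k l, fun p => ?_⟩
    rw [hF0, iteratedFDeriv_tsum hfs (fun k _ => hVs 0 k) hV0 le_top]
    have hb1 : ∀ l, ‖|p.2| ^ a • iteratedFDeriv ℝ k (fun p : ℝ × ℝ => u l p.1 * g l p.2) p‖
        ≤ V a k l := fun l => by
      rw [norm_smul, Real.norm_of_nonneg (by positivity)]
      refine le_trans ?_ (hV a k l p)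
      gcongr
      linarith
    have hs1 : Summable fun l => iteratedFDeriv ℝ k (fun p : ℝ × ℝ => u l p.1 * g l p.2) p :=
      Summable.of_norm_bounded (hVs 0 k) fun l => hV0 k l p le_top
    calc _ = ‖∑' l, |p.2| ^ a • iteratedFDeriv ℝ k (fun p : ℝ × ℝ => u l p.1 * g l p.2) p‖ := by
          rw [hs1.tsum_const_smul, norm_smul, Real.norm_of_nonneg (by positivity)]
      _ ≤ _ := tsum_of_norm_bounded (hVs a k).hasSum hb1
  · intro t x
    have h1 : F 0 t x - g 0 x = ∑' l, u (l + 1) t * g (l + 1) x := by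
      have := (hsum 0 t x).tsum_eq_zero_add
      simp only [iteratedDeriv_zero] at this
      simp only [F, iteratedDeriv_zero]
      rw [this, hu0]; ring
    rw [h1, ← Real.norm_eq_abs]
    refine tsum_of_norm_bounded (g := fun l => δ * ((1 / 2 : ℝ) / 2 ^ l)) (a := δ) ?_ fun l => ?_
    · simpa using (hasSum_geometric_two' (1 : ℝ)).mul_left δ
    · have h2 := hud (l + 1) 0 (by omega) t
      have h3 := hg₀ (l + 1) 0 0 (by omega) (by omega) x
      rw [iteratedDeriv_zero] at h2 h3
      rw [pow_zero, one_mul] at h3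
      rw [norm_mul, Real.norm_eq_abs, Real.norm_eq_abs]
      calc _ ≤ |u (l + 1) t| * (δ * S (l + 1)) := by gcongr; exact h3.trans (hSδ _)
        _ = δ * (|u (l + 1) t| * S (l + 1)) := by ring
        _ ≤ δ * (1 / 2) ^ (l + 1) := by gcongr
        _ = _ := by rw [pow_succ, one_div, inv_pow]; ring
  · intro i t x
    have hd : ∀ l y, HasDerivAt (fun y => u l t * iteratedDeriv i (g l) y)
        (u l t * iteratedDeriv (i + 1) (g l) y) y := fun l y =>
      (hasDerivAt_iteratedDeriv (hgs l) i y).const_mul (u l t)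
    have hd' : ∀ l y, ‖u l t * iteratedDeriv (i + 1) (g l) y‖ ≤ B 0 (i + 1) l := fun l y => by
      have := hB 0 (i + 1) l t y
      rwa [pow_zero, one_mul] at this
    exact hasDerivAt_tsum (hBs 0 (i + 1)) hd hd' (hsum i t 0) x
  · intro i N a E
    choose R hR0 hR using fun l => hur l N E
    -- From K on, l exceeds N, a and i simultaneously and the tail is below a multiple of t^N. The
    -- terms before K are compared with the monomials one by one.
    set K := max N (max a i) + 1 with hK
    refine ⟨∑ l ∈ Finset.range K, (R l + (1 + |E|) ^ l) * G l a i + 2, by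
      have : 0 ≤ ∑ l ∈ Finset.range K, (R l + (1 + |E|) ^ l) * G l a i :=
        Finset.sum_nonneg fun l _ => mul_nonneg (add_nonneg (hR0 l) (by positivity)) (hG0 l a i)
      linarith, fun t ht x => ?_⟩
    have ht0 := ht.1
    have htE : t ≤ |E| := ht.2.trans (le_abs_self E)
    have e1 : F i t x - ∑ l ∈ Finset.range N, t ^ l * iteratedDeriv i (g l) x =
        ∑ l ∈ Finset.range K, (u l t - if l < N then t ^ l else 0) * iteratedDeriv i (g l) x
          + ∑' l, u (l + K) t * iteratedDeriv i (g (l + K)) x := by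
      have h1 := (hsum i t x).sum_add_tsum_nat_add K
      have h2 : ∑ l ∈ Finset.range N, t ^ l * iteratedDeriv i (g l) x =
          ∑ l ∈ Finset.range K, (if l < N then t ^ l else 0) * iteratedDeriv i (g l) x := by
        rw [← Finset.sum_subset (Finset.range_mono (show N ≤ K by omega))]
        · exact Finset.sum_congr rfl fun l hl => by rw [if_pos (Finset.mem_range.1 hl)]
        · intro l _ hl
          rw [Finset.mem_range] at hl
          simp [hl]
      simp only [F]
      rw [← h1, h2]
      simp only [sub_mul, Finset.sum_sub_distrib]
      ring
    have e2 : ∀ l ∈ Finset.range K, (1 + |x|) ^ a *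
        |(u l t - if l < N then t ^ l else 0) * iteratedDeriv i (g l) x| ≤
          (R l + (1 + |E|) ^ l) * G l a i * t ^ N := by
      intro l _
      have h3 : |u l t - if l < N then t ^ l else 0| ≤ (R l + (1 + |E|) ^ l) * t ^ N := by
        have h4 := hR l t ht
        split_ifs with h
        · refine h4.trans ?_
          gcongr
          linarith [show 0 ≤ (1 + |E|) ^ l by positivity]
        · obtain ⟨d, rfl⟩ : ∃ d, l = N + d := ⟨l - N, by omega⟩
          have h5 : t ^ (N + d) ≤ (1 + |E|) ^ (N + d) * t ^ N := by
            rw [pow_add, mul_comm]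
            gcongr ?_ * _
            calc t ^ d ≤ (1 + |E|) ^ d := by gcongr; linarith
              _ ≤ _ := pow_le_pow_right₀ (by linarith [abs_nonneg E]) (by omega)
          calc |u (N + d) t - 0| = |(u (N + d) t - t ^ (N + d)) + t ^ (N + d)| := by
                rw [sub_zero, sub_add_cancel]
            _ ≤ R (N + d) * t ^ N + t ^ (N + d) := (abs_add_le _ _).trans (by
                rw [abs_of_nonneg (by positivity : 0 ≤ t ^ (N + d))]; gcongr)
            _ ≤ _ := by rw [add_mul]; gcongr
      calc _ = |u l t - if l < N then t ^ l else 0| * ((1 + |x|) ^ a * |iteratedDeriv i (g l) x|) := by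
            rw [abs_mul]; ring
        _ ≤ (R l + (1 + |E|) ^ l) * t ^ N * G l a i := by
            gcongr
            · exact mul_nonneg (add_nonneg (hR0 l) (by positivity)) (by positivity)
            · exact hG l a i x
        _ = _ := by ring
    have e3 : ∀ l, ‖(1 + |x|) ^ a * (u (l + K) t * iteratedDeriv i (g (l + K)) x)‖ ≤
        t ^ N * (2 * ((1 / 2 : ℝ) / 2 ^ l)) := by
      intro l
      rw [norm_mul, Real.norm_of_nonneg (by positivity), Real.norm_eq_abs]
      calc _ = |u (l + K) t| * ((1 + |x|) ^ a * |iteratedDeriv i (g (l + K)) x|) := by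
            rw [abs_mul]; ring
        _ ≤ |u (l + K) t| * S (l + K) := by
            gcongr; exact hg (l + K) a i (by omega) (by omega) x
        _ ≤ t ^ N * (1 / 2) ^ (l + K) := hut (l + K) N (by omega) t ht0
        _ ≤ t ^ N * (1 / 2) ^ l := by
            gcongr ?_ * ?_
            exact pow_le_pow_of_le_one (by norm_num) (by norm_num) (by omega)
        _ = _ := by rw [one_div, inv_pow]; ring
    have e4 : |(1 + |x|) ^ a * ∑' l, u (l + K) t * iteratedDeriv i (g (l + K)) x| ≤ 2 * t ^ N := by
      rw [← tsum_mul_left, ← Real.norm_eq_abs]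
      have := ((hasSum_geometric_two' (1 : ℝ)).mul_left 2).mul_left (t ^ N)
      rw [show t ^ N * (2 * 1) = 2 * t ^ N by ring] at this
      exact tsum_of_norm_bounded this e3
    rw [e1]
    rw [abs_mul, abs_of_nonneg (by positivity : 0 ≤ (1 + |x|) ^ a)] at e4
    calc _ ≤ (1 + |x|) ^ a * (∑ l ∈ Finset.range K,
          |(u l t - if l < N then t ^ l else 0) * iteratedDeriv i (g l) x|
          + |∑' l, u (l + K) t * iteratedDeriv i (g (l + K)) x|) := by
            gcongr
            exact (abs_add_le _ _).trans (by gcongr; exact Finset.abs_sum_le_sum_abs _ _)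
      _ ≤ ∑ l ∈ Finset.range K, (R l + (1 + |E|) ^ l) * G l a i * t ^ N + 2 * t ^ N := by
            rw [mul_add, Finset.mul_sum]
            exact add_le_add (Finset.sum_le_sum e2) e4
      _ = _ := by rw [← Finset.sum_mul]; ring

/-! ### Schwartz functions from functions decaying on one side -/

/-- A smooth cut-off between 1 and 2 removes the right end, where Airy functions oscillate without
rapid decay. Agreement on the open set y < 1, a neighbourhood of the closed left half-line,
preserves all derivatives at the interface y = 0. -/
lemma exists_schwartz_eq_on_left {f : ℝ → ℝ} (hf : ContDiff ℝ ∞ f)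
    (hb : ∀ k n : ℕ, ∃ C, ∀ y ≤ 1, |y| ^ k * |iteratedDeriv n f y| ≤ C) :
    ∃ g : 𝓢(ℝ, ℝ), ∀ y < 1, g y = f y := by
  let θ : ℝ → ℝ := fun y => Real.smoothTransition (2 - y)
  have hθ : ContDiff ℝ ∞ θ := Real.smoothTransition.contDiff.comp (contDiff_const.sub contDiff_id)
  have h1 : ∀ y < 1, (fun y => θ y * f y) =ᶠ[𝓝 y] f := fun y hy => by
    filter_upwards [Iio_mem_nhds hy] with z hz
    simp [θ, Real.smoothTransition.one_of_one_le (show 1 ≤ 2 - z by linarith [mem_Iio.1 hz])]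
  have h2 : ∀ y > 2, (fun y => θ y * f y) =ᶠ[𝓝 y] fun _ => 0 := fun y hy => by
    filter_upwards [Ioi_mem_nhds hy] with z hz
    simp [θ, Real.smoothTransition.zero_of_nonpos (show 2 - z ≤ 0 by linarith [mem_Ioi.1 hz])]
  have hs : ContDiff ℝ ∞ (fun y => θ y * f y) := hθ.mul hf
  refine ⟨⟨fun y => θ y * f y, hs, fun k n => ?_⟩, fun y hy => (h1 y hy).eq_of_nhds⟩
  obtain ⟨C, hC⟩ := hb k n
  have hcont : Continuous fun y => ‖y‖ ^ k * ‖iteratedFDeriv ℝ n (fun y => θ y * f y) y‖ :=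
    (continuous_norm.pow k).mul (hs.continuous_iteratedFDeriv (m := n) (mod_cast le_top)).norm
  obtain ⟨C', hC'⟩ := (isCompact_Icc (a := (1 : ℝ)) (b := 2)).exists_bound_of_continuousOn
    hcont.continuousOn
  refine ⟨max (max C C') 0, fun y => ?_⟩
  rcases lt_or_ge y 1 with hy | hy
  · rw [((h1 y hy).iteratedFDeriv ℝ n).eq_of_nhds, norm_iteratedFDeriv_eq_norm_iteratedDeriv]
    exact (hC y hy.le).trans ((le_max_left _ _).trans (le_max_left _ _))
  rcases lt_or_ge 2 y with hy2 | hy2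
  · rw [((h2 y hy2).iteratedFDeriv ℝ n).eq_of_nhds]
    simp
  · exact ((le_abs_self _).trans (hC' y ⟨hy, hy2⟩)).trans ((le_max_right _ _).trans (le_max_left _ _))

open Polynomial in
lemma exists_bound_polynomial_mul_exp (P : ℝ[X]) :
    ∃ C, 0 ≤ C ∧ ∀ y ≤ 1, |P.eval y| * Real.exp y ≤ C := by
  induction P using Polynomial.induction_on' with
  | add p q hp hq =>
    obtain ⟨C, h0, hC⟩ := hp
    obtain ⟨D, h0', hD⟩ := hq
    refine ⟨C + D, by positivity, fun y hy => ?_⟩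
    rw [eval_add]
    calc _ ≤ (|p.eval y| + |q.eval y|) * Real.exp y := by gcongr; exact abs_add_le _ _
      _ ≤ C + D := by rw [add_mul]; exact add_le_add (hC y hy) (hD y hy)
  | monomial n a =>
    refine ⟨|a| * (n.factorial + Real.exp 1), by positivity, fun y hy => ?_⟩
    rw [eval_monomial, abs_mul, abs_pow, mul_assoc]
    gcongr
    rcases le_total 0 y with h | h
    · rw [abs_of_nonneg h]
      calc y ^ n * Real.exp y ≤ 1 * Real.exp 1 := by gcongr; exact pow_le_one₀ h hy
        _ ≤ _ := by rw [one_mul]; linarith [show (0:ℝ) ≤ n.factorial by positivity]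
    · have := Real.pow_div_factorial_le_exp (-y) (by linarith) n
      rw [div_le_iff₀ (by positivity)] at this
      rw [abs_of_nonpos h]
      calc (-y) ^ n * Real.exp y ≤ Real.exp (-y) * n.factorial * Real.exp y := by gcongr
        _ = n.factorial := by rw [mul_right_comm, ← Real.exp_add]; simp
        _ ≤ _ := by linarith [Real.exp_pos 1]

open Polynomial in
/-- The combination `P A(a + ·) + Q A'(a + ·)` of shifted Airy functions. -/
noncomputable def airyComb (a : ℝ) (P Q : ℝ[X]) (y : ℝ) : ℝ :=
  P.eval y * flippedAiry (a + y) + Q.eval y * flippedAiry' (a + y)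

-- The span of A and A' over the polynomials is stable under differentiation because A'' = -zA. This
-- is what turns the inner differential equation into two polynomial identities.
open Polynomial in
lemma hasDerivAt_airyComb (a : ℝ) (P Q : ℝ[X]) (y : ℝ) :
    HasDerivAt (airyComb a P Q)
      (airyComb a (derivative P - (C a + X) * Q) (P + derivative Q) y) y := by
  have h0 : HasDerivAt (fun y => a + y) 1 y := (hasDerivAt_id y).const_add a
  have h1 : HasDerivAt (fun y => flippedAiry (a + y)) (flippedAiry' (a + y)) y := by
    simpa [Function.comp_def] using (hasDerivAt_flippedAiry (a + y)).comp y h0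
  have h2 : HasDerivAt (fun y => flippedAiry' (a + y)) (-(a + y) * flippedAiry (a + y)) y := by
    exact ((hasDerivAt_flippedAiry' (a + y)).comp y h0).congr_deriv (mul_one _)
  refine (((P.hasDerivAt y).mul h1).add ((Q.hasDerivAt y).mul h2)).congr_deriv ?_
  simp [airyComb]; ring

open Polynomial in
lemma contDiff_airyComb (a : ℝ) (P Q : ℝ[X]) : ContDiff ℝ ∞ (airyComb a P Q) := by
  have h0 : ContDiff ℝ ∞ fun y : ℝ => a + y := contDiff_const.add contDiff_id
  have hP : ∀ P : ℝ[X], ContDiff ℝ ∞ fun y => P.eval y := fun P => by simpa using P.contDiff_aeval (𝕜 := ℝ) ∞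
  exact ((hP P).mul (contDiff_flippedAiry.comp h0)).add ((hP Q).mul (contDiff_flippedAiry'.comp h0))

open Polynomial in
lemma iteratedDeriv_airyComb (a : ℝ) (n : ℕ) : ∀ P Q : ℝ[X], ∃ P' Q' : ℝ[X],
    iteratedDeriv n (airyComb a P Q) = airyComb a P' Q' := by
  induction n with
  | zero => exact fun P Q => ⟨P, Q, iteratedDeriv_zero⟩
  | succ n ih =>
    intro P Q
    obtain ⟨P', Q', h⟩ := ih (derivative P - (C a + X) * Q) (P + derivative Q)
    refine ⟨P', Q', ?_⟩
    rw [iteratedDeriv_succ', ← h]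
    congr 1
    exact funext fun y => (hasDerivAt_airyComb a P Q y).deriv

open Polynomial in
lemma exists_bound_airyComb (a : ℝ) (P Q : ℝ[X]) :
    ∃ C, ∀ y ≤ 1, |airyComb a P Q y| ≤ C := by
  obtain ⟨A, hA⟩ := exists_abs_flippedAiry_le
  obtain ⟨B, hB⟩ := exists_abs_flippedAiry'_le
  obtain ⟨CP, hP0, hP⟩ := exists_bound_polynomial_mul_exp P
  obtain ⟨CQ, hQ0, hQ⟩ := exists_bound_polynomial_mul_exp Q
  refine ⟨|A| * Real.exp a * CP + |B| * Real.exp a * CQ, fun y hy => ?_⟩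
  have e1 : |flippedAiry (a + y)| ≤ |A| * Real.exp a * Real.exp y := by
    rw [mul_assoc, ← Real.exp_add]
    exact (hA _).trans (by gcongr; exact le_abs_self A)
  have e2 : |flippedAiry' (a + y)| ≤ |B| * Real.exp a * Real.exp y := by
    rw [mul_assoc, ← Real.exp_add]
    exact (hB _).trans (by gcongr; exact le_abs_self B)
  calc _ ≤ |P.eval y| * |flippedAiry (a + y)| + |Q.eval y| * |flippedAiry' (a + y)| := by
        rw [← abs_mul, ← abs_mul]; exact abs_add_le _ _
    _ ≤ |P.eval y| * (|A| * Real.exp a * Real.exp y) + |Q.eval y| * (|B| * Real.exp a * Real.exp y) := by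
        gcongr
    _ = |A| * Real.exp a * (|P.eval y| * Real.exp y) + |B| * Real.exp a * (|Q.eval y| * Real.exp y) := by
        ring
    _ ≤ _ := by
        gcongr
        · exact hP y hy
        · exact hQ y hy

open Polynomial in
lemma exists_schwartz_airyComb (a : ℝ) (P Q : ℝ[X]) :
    ∃ g : 𝓢(ℝ, ℝ), ∀ y < 1, g y = airyComb a P Q y := by
  refine exists_schwartz_eq_on_left (contDiff_airyComb a P Q) fun k n => ?_
  obtain ⟨P', Q', h⟩ := iteratedDeriv_airyComb a n P Q
  obtain ⟨C, hC⟩ := exists_bound_airyComb a (X ^ k * P') (X ^ k * Q')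
  refine ⟨C, fun y hy => (le_of_eq ?_).trans (hC y hy)⟩
  rw [h, ← abs_pow, ← abs_mul]
  congr 1
  simp [airyComb]; ring

open Polynomial in
/-- The function `S e^{-τ}`. -/
noncomputable def expComb (S : ℝ[X]) (τ : ℝ) : ℝ := S.eval τ * Real.exp (-τ)

open Polynomial in
lemma hasDerivAt_expComb (S : ℝ[X]) (τ : ℝ) :
    HasDerivAt (expComb S) (expComb (derivative S - S) τ) τ := by
  refine ((S.hasDerivAt τ).mul (hasDerivAt_neg τ).exp).congr_deriv ?_
  simp [expComb]; ring

open Polynomial in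
lemma exists_schwartz_expComb (S : ℝ[X]) :
    ∃ g : 𝓢(ℝ, ℝ), ∀ τ > -1, g τ = expComb S τ := by
  -- reflect, to use the previous lemma on the left half-line
  let f : ℝ[X] → ℝ → ℝ := fun P y => P.eval y * Real.exp y
  have hd : ∀ P y, HasDerivAt (f P) (f (derivative P + P) y) y := fun P y => by
    refine ((P.hasDerivAt y).mul (Real.hasDerivAt_exp y)).congr_deriv ?_
    simp [f]; ring
  have hi : ∀ n P, ∃ P', iteratedDeriv n (f P) = f P' := fun n => by
    induction n with
    | zero => exact fun P => ⟨P, iteratedDeriv_zero⟩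
    | succ n ih =>
      intro P
      obtain ⟨P', h⟩ := ih (derivative P + P)
      refine ⟨P', ?_⟩
      rw [iteratedDeriv_succ', ← h]
      congr 1
      exact funext fun y => (hd P y).deriv
  have hs : ∀ P : ℝ[X], ContDiff ℝ ∞ (f P) := fun P =>
    (show ContDiff ℝ ∞ fun y => P.eval y by simpa using P.contDiff_aeval (𝕜 := ℝ) ∞).mul Real.contDiff_exp
  obtain ⟨g, hg⟩ := exists_schwartz_eq_on_left (hs (S.comp (-X))) fun k n => by
    obtain ⟨P', h⟩ := hi n (S.comp (-X))
    obtain ⟨C, _, hC⟩ := exists_bound_polynomial_mul_exp (X ^ k * P')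
    refine ⟨C, fun y hy => (le_of_eq ?_).trans (hC y hy)⟩
    rw [h]
    simp [f, abs_mul, mul_assoc]
  refine ⟨SchwartzMap.compCLMOfContinuousLinearEquiv ℝ (ContinuousLinearEquiv.neg ℝ) g,
    fun τ hτ => ?_⟩
  have := hg (-τ) (by linarith)
  simpa [f, expComb] using this

/-! ## Formal solutions -/

section FormalSolutions

open Polynomial

/-- Power series in the small parameter, with polynomial coefficients. -/
abbrev PolySeries : Type := PowerSeries (Polynomial ℝ)

/-- Differentiation of the coefficients. -/
noncomputable def coeffDeriv (F : PolySeries) : PolySeries :=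
  PowerSeries.mk fun l => derivative (PowerSeries.coeff l F)

@[simp] lemma coeff_coeffDeriv (l : ℕ) (F : PolySeries) :
    PowerSeries.coeff l (coeffDeriv F) = derivative (PowerSeries.coeff l F) := by simp [coeffDeriv]

lemma coeffDeriv_add (F G : PolySeries) : coeffDeriv (F + G) = coeffDeriv F + coeffDeriv G := by ext1 l; simp

lemma coeffDeriv_X_pow_mul (n : ℕ) (F : PolySeries) :
    coeffDeriv ((PowerSeries.X : PolySeries) ^ n * F) = PowerSeries.X ^ n * coeffDeriv F := by
  ext1 l
  rw [coeff_coeffDeriv, PowerSeries.coeff_X_pow_mul', PowerSeries.coeff_X_pow_mul']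
  split_ifs <;> simp

lemma constantCoeff_coeffDeriv (F : PolySeries) :
    PowerSeries.constantCoeff (coeffDeriv F) = derivative (PowerSeries.constantCoeff F) := by
  rw [← PowerSeries.coeff_zero_eq_constantCoeff_apply, coeff_coeffDeriv,
    PowerSeries.coeff_zero_eq_constantCoeff_apply]

/-- A linear map which is triangular with nonzero diagonal in the monomial basis is onto. -/
lemma surjective_of_triangular (L : ℝ[X] →ₗ[ℝ] ℝ[X]) (c : ℕ → ℝ) (hc : ∀ n, c n ≠ 0)
    (hL : ∀ n m, n ≤ m → (L (Polynomial.X ^ n)).coeff m = if m = n then c n else 0) :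
    Function.Surjective L := by
  have key : ∀ n : ℕ, ∀ f : ℝ[X], f.degree < n → ∃ g, L g = f := by
    intro n
    induction n with
    | zero =>
      intro f hf
      have : f = 0 := by
        refine Polynomial.ext fun m => ?_
        exact (Polynomial.degree_lt_iff_coeff_zero f 0).1 hf m (Nat.zero_le m)
      exact ⟨0, by simp [this]⟩
    | succ n ih =>
      intro f hf
      obtain ⟨g, hg⟩ := ih (f - L ((f.coeff n / c n) • Polynomial.X ^ n)) (by
        rw [Polynomial.degree_lt_iff_coeff_zero]
        intro m hm
        rw [map_smul, Polynomial.coeff_sub, Polynomial.coeff_smul, hL n m hm]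
        rcases eq_or_ne m n with rfl | h
        · have := hc m
          simp; field_simp; ring
        · have : f.coeff m = 0 :=
            (Polynomial.degree_lt_iff_coeff_zero f (n + 1)).1 (by exact_mod_cast hf) m (by omega)
          simp [h, this])
      exact ⟨g + (f.coeff n / c n) • Polynomial.X ^ n, by rw [map_add, hg]; ring⟩
  intro f
  exact key (f.natDegree + 1) f (lt_of_le_of_lt Polynomial.degree_le_natDegree (by
    exact_mod_cast Nat.lt_succ_self _))

lemma exists_antiderivative (f : ℝ[X]) : ∃ g : ℝ[X], derivative g = f ∧ g.eval 0 = 0 := by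
  obtain ⟨g, hg⟩ := surjective_of_triangular
    (derivative ∘ₗ LinearMap.mulLeft ℝ (Polynomial.X : ℝ[X])) (fun n => n + 1)
    (fun n => by positivity) (fun n m _ => by
      have h : (derivative ∘ₗ LinearMap.mulLeft ℝ (Polynomial.X : ℝ[X])) (Polynomial.X ^ n)
          = Polynomial.C ((n : ℝ) + 1) * Polynomial.X ^ n := by
        simp [← pow_succ']
      rw [h, Polynomial.coeff_C_mul, Polynomial.coeff_X_pow]
      split_ifs <;> simp) f
  exact ⟨Polynomial.X * g, by simpa using hg, by simp⟩

lemma exists_derivative_sub (f : ℝ[X]) : ∃ g : ℝ[X], derivative g - 2 * g = f := by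
  obtain ⟨g, hg⟩ := surjective_of_triangular
    (derivative - (2 : ℝ) • LinearMap.id) (fun _ => -2) (fun n => by norm_num) (fun n m hm => by
      have : m + 1 ≠ n := by omega
      simp only [LinearMap.sub_apply, LinearMap.smul_apply, LinearMap.id_apply, Polynomial.coeff_sub,
        Polynomial.coeff_smul, Polynomial.coeff_derivative, Polynomial.coeff_X_pow, this, if_false]
      split_ifs <;> simp) f
  refine ⟨g, ?_⟩
  rw [← hg]
  simp [Polynomial.smul_eq_C_mul, show (Polynomial.C 2 : ℝ[X]) = 2 from rfl]

/-- This is the equation left for q after elimination of p' from the two components of the inner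
problem. On X^n the operator has top coefficient 2n + 1 ≠ 0 and does not raise the degree, so it is
triangular. -/
lemma exists_airy_reduced (a : ℝ) (f : ℝ[X]) : ∃ q : ℝ[X],
    Polynomial.C (1 / 2) * derivative (derivative (derivative q))
      + 2 * (Polynomial.C a + Polynomial.X) * derivative q + q = f := by
  obtain ⟨g, hg⟩ := surjective_of_triangular
    ((1 / 2 : ℝ) • (derivative ∘ₗ derivative ∘ₗ derivative)
      + (2 * a) • derivative + (2 : ℝ) • (LinearMap.mulLeft ℝ (Polynomial.X : ℝ[X]) ∘ₗ derivative)
        + LinearMap.id)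
    (fun n => 2 * n + 1) (fun n => by positivity) (fun n m hm => by
      have h1 : m + 1 ≠ n := by omega
      have h3 : m + 1 + 1 + 1 ≠ n := by omega
      rcases m with _ | m
      · obtain rfl : n = 0 := by omega
        simp
      · simp [Polynomial.coeff_derivative, Polynomial.coeff_X_pow, h1, h3]
        split_ifs with h
        · rw [← h]; push_cast; ring
        · ring
      ) f
  refine ⟨g, ?_⟩
  rw [← hg]
  simp [Polynomial.smul_eq_C_mul, show (Polynomial.C 2 : ℝ[X]) = 2 from rfl]
  ring

/-- Solution of the leading outer equation. -/
lemma exists_outer_step (f : ℝ[X]) (b : ℝ) : ∃ s : ℝ[X],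
    derivative (derivative s) - 2 * derivative s = f ∧ (derivative s).eval 0 - s.eval 0 = b := by
  obtain ⟨T, hT⟩ := exists_derivative_sub f
  obtain ⟨s, hs, hs0⟩ := exists_antiderivative T
  exact ⟨s + Polynomial.C (T.eval 0 - b), by simp [hs, hT], by simp [hs, hs0]⟩

/-- Solution of the leading inner equation: the spectral unknown `t` adjusts the boundary value. -/
lemma exists_inner_step (a : ℝ) (f g : ℝ[X]) (b : ℝ) : ∃ (p q : ℝ[X]) (t : ℝ),
    derivative (derivative p) - 2 * (Polynomial.C a + Polynomial.X) * derivative q - q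
      + 2 * Polynomial.C t = f ∧
    derivative (derivative q) + 2 * derivative p = g ∧ q.eval 0 = b := by
  obtain ⟨q, hq⟩ := exists_airy_reduced a (Polynomial.C (1 / 2) * derivative g - f)
  obtain ⟨p, hp, -⟩ := exists_antiderivative
    (Polynomial.C (1 / 2) * (g - derivative (derivative q)))
  -- A constant added to q disturbs only the first equation, by minus that constant, and 2t absorbs
  -- it. So any boundary value of q can be reached.
  refine ⟨p, q + Polynomial.C (b - q.eval 0), (b - q.eval 0) / 2, ?_, ?_, by simp⟩
  · have h2 : (2 : ℝ[X]) * Polynomial.C ((b - q.eval 0) / 2) = Polynomial.C (b - q.eval 0) := by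
      rw [show (2 : ℝ[X]) = Polynomial.C 2 from rfl, ← Polynomial.C_mul]; congr 1; ring
    rw [h2, hp]
    simp only [derivative_add, derivative_sub, derivative_mul, derivative_C]
    linear_combination -hq
  · have h2 : (2 : ℝ[X]) * Polynomial.C (1 / 2) = 1 := by
      rw [show (2 : ℝ[X]) = Polynomial.C 2 from rfl, ← Polynomial.C_mul]; norm_num
    simp only [derivative_add, derivative_C, hp, add_zero]
    linear_combination (g - derivative (derivative q)) * h2


/-- A real constant as a power series. -/
noncomputable def constSeries (x : ℝ) : PolySeries := PowerSeries.C (Polynomial.C x)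

/-- The space variable as a power series. -/
noncomputable def varSeries : PolySeries := PowerSeries.C Polynomial.X

/-- The potential of the inner problem, where `r` is the spectral unknown. -/
noncomputable def potentialSeries (D r : PolySeries) : PolySeries :=
  D + (2 * r + PowerSeries.X ^ 2 * r ^ 2) * (1 + PowerSeries.X ^ 2 * D)

/-- The component along `A(a + ·)` of the inner equation for `P A(a + ·) + Q A'(a + ·)`. -/
noncomputable def innerEqA (a k : ℝ) (D B P Q r : PolySeries) : PolySeries :=
  (1 + PowerSeries.X ^ 2 * constSeries k * varSeries) ^ 2 *
      (coeffDeriv (coeffDeriv P) - 2 * (constSeries a + varSeries) * coeffDeriv Q - Q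
        - (constSeries a + varSeries) * P)
    + PowerSeries.X ^ 2 * constSeries k * B * (coeffDeriv P - (constSeries a + varSeries) * Q)
    + potentialSeries D r * P

/-- The component along `A'(a + ·)` of the inner equation for `P A(a + ·) + Q A'(a + ·)`. -/
noncomputable def innerEqB (a k : ℝ) (D B P Q r : PolySeries) : PolySeries :=
  (1 + PowerSeries.X ^ 2 * constSeries k * varSeries) ^ 2 *
      (coeffDeriv (coeffDeriv Q) + 2 * coeffDeriv P - (constSeries a + varSeries) * Q)
    + PowerSeries.X ^ 2 * constSeries k * B * (P + coeffDeriv Q)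
    + potentialSeries D r * Q

/-- The outer equation for `S e^{-τ}`. -/
noncomputable def outerEq (w k : ℝ) (S r : PolySeries) : PolySeries :=
  (1 + PowerSeries.X ^ 3 * constSeries (w * k) * varSeries) ^ 2 *
      (coeffDeriv (coeffDeriv S) - 2 * coeffDeriv S)
    + PowerSeries.X ^ 3 * constSeries (w * k) *
      (1 + PowerSeries.X ^ 3 * constSeries (w * k) * varSeries) * (coeffDeriv S - S)
    + (constSeries (w ^ 2) * (2 * (PowerSeries.X ^ 3 * constSeries (w * k) * varSeries)
          + (PowerSeries.X ^ 3 * constSeries (w * k) * varSeries) ^ 2)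
        + PowerSeries.X ^ 2 * (2 * r + PowerSeries.X ^ 2 * r ^ 2) * constSeries (w ^ 2 - 1) *
          (1 + PowerSeries.X ^ 3 * constSeries (w * k) * varSeries) ^ 2) * S

/-- The first variation of `innerEqA`. -/
noncomputable def innerVarA (a k : ℝ) (D B P r p q t : PolySeries) (n : ℕ) : PolySeries :=
  (1 + PowerSeries.X ^ 2 * constSeries k * varSeries) ^ 2 *
      (coeffDeriv (coeffDeriv p) - 2 * (constSeries a + varSeries) * coeffDeriv q - q
        - (constSeries a + varSeries) * p)
    + PowerSeries.X ^ 2 * constSeries k * B * (coeffDeriv p - (constSeries a + varSeries) * q)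
    + potentialSeries D r * p
    + (2 * t + PowerSeries.X ^ 2 * (2 * r * t + PowerSeries.X ^ n * t ^ 2)) *
      (1 + PowerSeries.X ^ 2 * D) * (P + PowerSeries.X ^ n * p)

/-- The first variation of `innerEqB`. -/
noncomputable def innerVarB (a k : ℝ) (D B Q r p q t : PolySeries) (n : ℕ) : PolySeries :=
  (1 + PowerSeries.X ^ 2 * constSeries k * varSeries) ^ 2 *
      (coeffDeriv (coeffDeriv q) + 2 * coeffDeriv p - (constSeries a + varSeries) * q)
    + PowerSeries.X ^ 2 * constSeries k * B * (p + coeffDeriv q)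
    + potentialSeries D r * q
    + (2 * t + PowerSeries.X ^ 2 * (2 * r * t + PowerSeries.X ^ n * t ^ 2)) *
      (1 + PowerSeries.X ^ 2 * D) * (Q + PowerSeries.X ^ n * q)

/-- The first variation of `outerEq`. -/
noncomputable def outerVar (w k : ℝ) (S r s t : PolySeries) (n : ℕ) : PolySeries :=
  (1 + PowerSeries.X ^ 3 * constSeries (w * k) * varSeries) ^ 2 *
      (coeffDeriv (coeffDeriv s) - 2 * coeffDeriv s)
    + PowerSeries.X ^ 3 * constSeries (w * k) *
      (1 + PowerSeries.X ^ 3 * constSeries (w * k) * varSeries) * (coeffDeriv s - s)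
    + (constSeries (w ^ 2) * (2 * (PowerSeries.X ^ 3 * constSeries (w * k) * varSeries)
          + (PowerSeries.X ^ 3 * constSeries (w * k) * varSeries) ^ 2)
        + PowerSeries.X ^ 2 * (2 * r + PowerSeries.X ^ 2 * r ^ 2) * constSeries (w ^ 2 - 1) *
          (1 + PowerSeries.X ^ 3 * constSeries (w * k) * varSeries) ^ 2) * s
    + PowerSeries.X ^ 2 * (2 * t + PowerSeries.X ^ 2 * (2 * r * t + PowerSeries.X ^ n * t ^ 2)) *
      constSeries (w ^ 2 - 1) *
      (1 + PowerSeries.X ^ 3 * constSeries (w * k) * varSeries) ^ 2 * (S + PowerSeries.X ^ n * s)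

/-- The increment is exact, the term quadratic in t included. The same formula therefore shows that
coefficients beyond order l do not influence the equation of order l, and isolates the linear
problem for the coefficient of order l itself. -/
lemma innerEqA_add (a k : ℝ) (D B P Q r p q t : PolySeries) (n : ℕ) :
    innerEqA a k D B (P + PowerSeries.X ^ n * p) (Q + PowerSeries.X ^ n * q)
        (r + PowerSeries.X ^ n * t)
      = innerEqA a k D B P Q r + PowerSeries.X ^ n * innerVarA a k D B P r p q t n := by
  simp only [innerEqA, innerVarA, potentialSeries, coeffDeriv_add, coeffDeriv_X_pow_mul]
  ring

lemma innerEqB_add (a k : ℝ) (D B P Q r p q t : PolySeries) (n : ℕ) :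
    innerEqB a k D B (P + PowerSeries.X ^ n * p) (Q + PowerSeries.X ^ n * q)
        (r + PowerSeries.X ^ n * t)
      = innerEqB a k D B P Q r + PowerSeries.X ^ n * innerVarB a k D B Q r p q t n := by
  simp only [innerEqB, innerVarB, potentialSeries, coeffDeriv_add, coeffDeriv_X_pow_mul]
  ring

lemma outerEq_add (w k : ℝ) (S r s t : PolySeries) (n : ℕ) :
    outerEq w k (S + PowerSeries.X ^ n * s) (r + PowerSeries.X ^ n * t)
      = outerEq w k S r + PowerSeries.X ^ n * outerVar w k S r s t n := by
  simp only [outerEq, outerVar, coeffDeriv_add, coeffDeriv_X_pow_mul]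
  ring

/-- Coefficients `(P, Q, S, r)` of the formal solution at a given order. -/
abbrev FormalCoeff : Type := Polynomial ℝ × Polynomial ℝ × Polynomial ℝ × ℝ

/-- The series of the `P`-coefficients. -/
noncomputable def serP (U : ℕ → FormalCoeff) : PolySeries := PowerSeries.mk fun l => (U l).1
/-- The series of the `Q`-coefficients. -/
noncomputable def serQ (U : ℕ → FormalCoeff) : PolySeries := PowerSeries.mk fun l => (U l).2.1
/-- The series of the `S`-coefficients. -/
noncomputable def serS (U : ℕ → FormalCoeff) : PolySeries := PowerSeries.mk fun l => (U l).2.2.1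
/-- The series of the spectral coefficients. -/
noncomputable def serR (U : ℕ → FormalCoeff) : PolySeries :=
  PowerSeries.mk fun l => Polynomial.C (U l).2.2.2

/-- The equations of order `l` for the formal solution: inner and outer equations, continuity and
the condition on the derivatives at the interface. -/
structure FormalStep (a w γ k : ℝ) (D B : PolySeries) (l : ℕ) (U : ℕ → FormalCoeff) : Prop where
  init : l = 0 → U 0 = (1, 0, 0, a / 2)
  eqA : PowerSeries.coeff l (innerEqA a k D B (serP U) (serQ U) (serR U)) = 0
  eqB : PowerSeries.coeff l (innerEqB a k D B (serP U) (serQ U) (serR U)) = 0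
  outer : PowerSeries.coeff l (outerEq w k (serS U) (serR U)) = 0
  cont : (U l).2.1.eval 0 = (U l).2.2.1.eval 0
  deriv : ∀ l', l = l' + 1 → (derivative (U l).2.2.1).eval 0 - (U l).2.2.1.eval 0
    = γ * ((U l').1.eval 0 + (derivative (U l').2.1).eval 0)

lemma eq_add_X_pow_mul {R : Type*} [CommRing R] (F G : PowerSeries R) (n : ℕ)
    (h : ∀ i < n, PowerSeries.coeff i F = PowerSeries.coeff i G) :
    ∃ H, G = F + PowerSeries.X ^ n * H := by
  have : (PowerSeries.X : PowerSeries R) ^ n ∣ G - F := by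
    rw [PowerSeries.X_pow_dvd_iff]
    intro m hm
    rw [map_sub, h m hm, sub_self]
  obtain ⟨H, hH⟩ := this
  exact ⟨H, by rw [← hH]; ring⟩

lemma coeff_add_X_pow_succ_mul {R : Type*} [CommRing R] (F H : PowerSeries R) (l : ℕ) :
    PowerSeries.coeff l (F + PowerSeries.X ^ (l + 1) * H) = PowerSeries.coeff l F := by
  rw [map_add, PowerSeries.coeff_X_pow_mul', if_neg (by omega), add_zero]

lemma coeff_add_X_pow_mul {R : Type*} [CommRing R] (F H : PowerSeries R) (l : ℕ) :
    PowerSeries.coeff l (F + PowerSeries.X ^ l * H)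
      = PowerSeries.coeff l F + PowerSeries.constantCoeff H := by
  rw [map_add, PowerSeries.coeff_X_pow_mul', if_pos le_rfl, Nat.sub_self,
    PowerSeries.coeff_zero_eq_constantCoeff_apply]

lemma mk_eq_add_X_pow_mul_C {R : Type*} [CommRing R] (f g : ℕ → R) (n : ℕ) (e : R)
    (h : ∀ i, i ≠ n → f i = g i) (hn : f n = g n + e) :
    PowerSeries.mk f = PowerSeries.mk g + PowerSeries.X ^ n * PowerSeries.C e := by
  refine PowerSeries.ext fun i => ?_
  rw [map_add, PowerSeries.coeff_X_pow_mul', PowerSeries.coeff_C]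
  rcases eq_or_ne i n with rfl | hi
  · simp [hn]
  · rw [PowerSeries.coeff_mk, PowerSeries.coeff_mk, h i hi]
    split_ifs with h1 h2
    · omega
    · rw [add_zero]
    · rw [add_zero]

/-- The equations of order l see the coefficients up to order l only: a change by a multiple of
X^{l+1} alters the equations by such a multiple. -/
lemma FormalStep.congr {a w γ k : ℝ} {D B : PolySeries} {l : ℕ} {U V : ℕ → FormalCoeff}
    (hUV : ∀ i ≤ l, U i = V i) (h : FormalStep a w γ k D B l U) : FormalStep a w γ k D B l V := by
  obtain ⟨p, hp⟩ := eq_add_X_pow_mul (serP U) (serP V) (l + 1) fun i hi => by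
    simp [serP, hUV i (by omega)]
  obtain ⟨q, hq⟩ := eq_add_X_pow_mul (serQ U) (serQ V) (l + 1) fun i hi => by
    simp [serQ, hUV i (by omega)]
  obtain ⟨s, hs⟩ := eq_add_X_pow_mul (serS U) (serS V) (l + 1) fun i hi => by
    simp [serS, hUV i (by omega)]
  obtain ⟨t, ht⟩ := eq_add_X_pow_mul (serR U) (serR V) (l + 1) fun i hi => by
    simp [serR, hUV i (by omega)]
  refine ⟨fun hl => by rw [← hUV 0 (by omega)]; exact h.init hl, ?_, ?_, ?_, ?_, ?_⟩
  · rw [hp, hq, ht, innerEqA_add, coeff_add_X_pow_succ_mul]; exact h.eqA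
  · rw [hp, hq, ht, innerEqB_add, coeff_add_X_pow_succ_mul]; exact h.eqB
  · rw [hs, ht, outerEq_add, coeff_add_X_pow_succ_mul]; exact h.outer
  · rw [← hUV l le_rfl]; exact h.cont
  · intro l' hl'
    rw [← hUV l le_rfl, ← hUV l' (by omega)]; exact h.deriv l' hl'

/-- With P₀ = 1, Q₀ = S₀ = 0, 2r₀ = a and D = y + ⋯, the constant coefficient of the variation is
the leading operator of the inner and outer steps. In particular the new spectral coefficient t
appears as 2t in the A-component alone. -/
lemma FormalStep.exists_update {a w γ k : ℝ} {D B : PolySeries}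
    (hD : PowerSeries.constantCoeff D = Polynomial.X) {l : ℕ} (hl : 1 ≤ l) {U : ℕ → FormalCoeff}
    (h : ∀ i < l, FormalStep a w γ k D B i U) :
    ∃ e, FormalStep a w γ k D B l (Function.update U l e) := by
  -- With the unknown coefficient set to zero, the order-l equations evaluate to the source terms of
  -- the linear problem.
  set V := Function.update U l 0 with hV
  have hV0 : V 0 = (1, 0, 0, a / 2) := by
    rw [hV, Function.update_of_ne (by omega)]; exact (h 0 (by omega)).init rfl
  obtain ⟨l', rfl⟩ : ∃ l', l = l' + 1 := ⟨l - 1, by omega⟩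
  -- The outer coefficient is independent of the new t, which enters the outer equation two orders
  -- later. Its condition at 0 involves the inner coefficients of the previous order, and its value
  -- at 0 then serves as boundary datum for the inner step.
  obtain ⟨s, hs1, hs2⟩ := exists_outer_step (-PowerSeries.coeff (l' + 1) (outerEq w k (serS V) (serR V)))
    (γ * ((U l').1.eval 0 + (derivative (U l').2.1).eval 0))
  obtain ⟨p, q, t, hpq1, hpq2, hq⟩ := exists_inner_step a
    (-PowerSeries.coeff (l' + 1) (innerEqA a k D B (serP V) (serQ V) (serR V)))
    (-PowerSeries.coeff (l' + 1) (innerEqB a k D B (serP V) (serQ V) (serR V))) (s.eval 0)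
  set W := Function.update U (l' + 1) (p, q, s, t) with hW
  have hWl : W (l' + 1) = (p, q, s, t) := by rw [hW, Function.update_self]
  have hWl' : W l' = U l' := by rw [hW, Function.update_of_ne (by omega)]
  have hVl : V (l' + 1) = 0 := by rw [hV, Function.update_self]
  have hne : ∀ i, i ≠ l' + 1 → W i = V i := fun i hi => by
    rw [hW, hV, Function.update_of_ne hi, Function.update_of_ne hi]
  have hP : serP W = serP V + PowerSeries.X ^ (l' + 1) * PowerSeries.C p :=
    mk_eq_add_X_pow_mul_C _ _ _ _ (fun i hi => by rw [hne i hi]) (by simp [hWl, hVl])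
  have hQ : serQ W = serQ V + PowerSeries.X ^ (l' + 1) * PowerSeries.C q :=
    mk_eq_add_X_pow_mul_C _ _ _ _ (fun i hi => by rw [hne i hi]) (by simp [hWl, hVl])
  have hS : serS W = serS V + PowerSeries.X ^ (l' + 1) * PowerSeries.C s :=
    mk_eq_add_X_pow_mul_C _ _ _ _ (fun i hi => by rw [hne i hi]) (by simp [hWl, hVl])
  have hR : serR W = serR V + PowerSeries.X ^ (l' + 1) * PowerSeries.C (Polynomial.C t) :=
    mk_eq_add_X_pow_mul_C _ _ _ _ (fun i hi => by rw [hne i hi]) (by simp [hWl, hVl])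
  have cP : PowerSeries.constantCoeff (serP V) = 1 := by
    rw [← PowerSeries.coeff_zero_eq_constantCoeff_apply]; simp [serP, hV0]
  have cQ : PowerSeries.constantCoeff (serQ V) = 0 := by
    rw [← PowerSeries.coeff_zero_eq_constantCoeff_apply]; simp [serQ, hV0]
  have cR : PowerSeries.constantCoeff (serR V) = Polynomial.C (a / 2) := by
    rw [← PowerSeries.coeff_zero_eq_constantCoeff_apply]; simp [serR, hV0]
  have hC2 : 2 * Polynomial.C (a / 2) = Polynomial.C a := by
    rw [show (2 : ℝ[X]) = Polynomial.C 2 from rfl, ← Polynomial.C_mul]; congr 1; ring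
  refine ⟨(p, q, s, t), fun h0 => by omega, ?_, ?_, ?_, ?_, ?_⟩
  · rw [← hW, hP, hQ, hR, innerEqA_add, coeff_add_X_pow_mul]
    simp only [innerVarA, potentialSeries, constSeries, varSeries, map_add, map_mul, map_sub,
      map_pow, map_one, map_ofNat, PowerSeries.constantCoeff_X, PowerSeries.constantCoeff_C,
      constantCoeff_coeffDeriv, cP, cR, hD, ne_eq, OfNat.ofNat_ne_zero, not_false_eq_true,
      zero_pow, Nat.succ_ne_zero]
    linear_combination hpq1 + p * hC2
  · rw [← hW, hP, hQ, hR, innerEqB_add, coeff_add_X_pow_mul]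
    simp only [innerVarB, potentialSeries, constSeries, varSeries, map_add, map_mul, map_sub,
      map_pow, map_one, map_ofNat, PowerSeries.constantCoeff_X, PowerSeries.constantCoeff_C,
      constantCoeff_coeffDeriv, cQ, cR, hD, ne_eq, OfNat.ofNat_ne_zero, not_false_eq_true,
      zero_pow, Nat.succ_ne_zero]
    linear_combination hpq2 + q * hC2
  · rw [← hW, hS, hR, outerEq_add, coeff_add_X_pow_mul]
    simp only [outerVar, constSeries, varSeries, map_add, map_mul, map_sub,
      map_pow, map_one, map_ofNat, PowerSeries.constantCoeff_X, PowerSeries.constantCoeff_C,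
      constantCoeff_coeffDeriv, ne_eq, OfNat.ofNat_ne_zero, not_false_eq_true,
      zero_pow, Nat.succ_ne_zero]
    linear_combination hs1
  · rw [← hW, hWl]; exact hq
  · intro l'' hl''
    obtain rfl : l'' = l' := by omega
    rw [← hW, hWl, hWl']; exact hs2

/-- Recursive construction of a sequence from a given initial segment. -/
lemma exists_seq_of_step {E : Type*} (Step : ℕ → (ℕ → E) → Prop)
    (hcongr : ∀ l U V, (∀ i ≤ l, U i = V i) → Step l U → Step l V) (L : ℕ)
    (hex : ∀ l U, L ≤ l → (∀ i < l, Step i U) → ∃ e, Step l (Function.update U l e))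
    (U₀ : ℕ → E) (h₀ : ∀ i < L, Step i U₀) :
    ∃ U, (∀ i < L, U i = U₀ i) ∧ ∀ l, Step l U := by
  have hstep : ∀ n (U : ℕ → E), (∀ i < L + n, Step i U) →
      ∃ V : ℕ → E, (∀ i < L + n, V i = U i) ∧ ∀ i < L + (n + 1), Step i V := by
    intro n U hU
    obtain ⟨e, he⟩ := hex (L + n) U (by omega) hU
    refine ⟨Function.update U (L + n) e, fun i hi => Function.update_of_ne (by omega) _ _,
      fun i hi => ?_⟩
    rcases (show i = L + n ∨ i < L + n by omega) with rfl | h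
    · exact he
    · exact hcongr i U _ (fun j hj => (Function.update_of_ne (by omega) _ _).symm) (hU i h)
  choose! f hf1 hf2 using hstep
  let W : ℕ → ℕ → E := fun n => Nat.rec U₀ (fun n U => f n U) n
  have hW : ∀ n, ∀ i < L + n, Step i (W n) := by
    intro n
    induction n with
    | zero => exact h₀
    | succ n ih => exact hf2 n (W n) ih
  have hWn : ∀ n, ∀ i < L + n, W (n + 1) i = W n i := fun n => hf1 n (W n) (hW n)
  have hWd : ∀ n d, ∀ i < L + n, W (n + d) i = W n i := by
    intro n d i hi
    induction d with
    | zero => rfl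
    | succ d ih => rw [← ih]; exact hWn (n + d) i (by omega)
  -- Diagonal choice: the i-th coefficient is final from stage i + 1 on.
  refine ⟨fun i => W (i + 1) i, fun i hi => ?_, fun l => ?_⟩
  · have := hWd 0 (i + 1) i (by omega)
    rw [Nat.zero_add] at this
    exact this
  · refine hcongr l (W (l + 1)) _ (fun i hi => ?_) (hW (l + 1) l (by omega))
    have := hWd (i + 1) (l - i) i (by omega)
    rw [show i + 1 + (l - i) = l + 1 by omega] at this
    exact this

/-- A prescribed initial segment is kept as soon as it passes the equations of its own orders.
Explicit coefficients enter in this way, without any uniqueness statement for the recursion. -/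
theorem exists_formal_solution {a w γ k : ℝ} {D B : PolySeries}
    (hD : PowerSeries.constantCoeff D = Polynomial.X) {L : ℕ} (hL : 1 ≤ L) (U₀ : ℕ → FormalCoeff)
    (h₀ : ∀ i < L, FormalStep a w γ k D B i U₀) :
    ∃ U, (∀ i < L, U i = U₀ i) ∧ ∀ l, FormalStep a w γ k D B l U :=
  exists_seq_of_step _ (fun _ _ _ h h' => h'.congr h) L
    (fun _ _ hl h => FormalStep.exists_update hD (hL.trans hl) h) U₀ h₀

end FormalSolutions

/-! ### The first terms of the formal solutions -/

section FormalSolutions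

open Polynomial

lemma coeff_mul_range {R : Type*} [CommRing R] (l : ℕ) (F G : PowerSeries R) :
    PowerSeries.coeff l (F * G) =
      ∑ i ∈ Finset.range (l + 1), PowerSeries.coeff i F * PowerSeries.coeff (l - i) G := by
  rw [PowerSeries.coeff_mul]
  exact Finset.Nat.sum_antidiagonal_eq_sum_range_succ
    (fun i j => PowerSeries.coeff i F * PowerSeries.coeff j G) l

lemma coeff_potentialSeries (D r : PolySeries) (l : ℕ) :
    PowerSeries.coeff l (potentialSeries D r) = PowerSeries.coeff l D + 2 * PowerSeries.coeff l r
      + (if 2 ≤ l then PowerSeries.coeff (l - 2) (r * r) + 2 * PowerSeries.coeff (l - 2) (r * D)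
          else 0)
      + (if 4 ≤ l then PowerSeries.coeff (l - 4) (r * r * D) else 0) := by
  have h : potentialSeries D r = D + PowerSeries.C 2 * r
      + PowerSeries.X ^ 2 * (r * r + PowerSeries.C 2 * (r * D)) + PowerSeries.X ^ 4 * (r * r * D) := by
    simp only [potentialSeries, map_ofNat]; ring
  rw [h]
  simp only [map_add, PowerSeries.coeff_X_pow_mul', PowerSeries.coeff_C_mul]

lemma coeff_sq_one_add_X_pow_mul (n : ℕ) (c : ℝ) (F : PolySeries) (l : ℕ) :
    PowerSeries.coeff l ((1 + PowerSeries.X ^ n * constSeries c * varSeries) ^ 2 * F)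
      = PowerSeries.coeff l F
        + (if n ≤ l then 2 * C c * X * PowerSeries.coeff (l - n) F else 0)
        + (if 2 * n ≤ l then C c ^ 2 * X ^ 2 * PowerSeries.coeff (l - 2 * n) F else 0) := by
  have h : (1 + PowerSeries.X ^ n * constSeries c * varSeries) ^ 2 * F = F
      + PowerSeries.X ^ n * (PowerSeries.C (2 * C c * X) * F)
      + PowerSeries.X ^ (2 * n) * (PowerSeries.C (C c ^ 2 * X ^ 2) * F) := by
    simp only [constSeries, varSeries, map_mul, map_pow, map_ofNat]; ring
  rw [h]
  simp only [map_add, PowerSeries.coeff_X_pow_mul', PowerSeries.coeff_C_mul]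

lemma coeff_innerEqA (a k : ℝ) (D B P Q r : PolySeries) (l : ℕ) :
    PowerSeries.coeff l (innerEqA a k D B P Q r) =
      PowerSeries.coeff l ((1 + PowerSeries.X ^ 2 * constSeries k * varSeries) ^ 2 *
        (coeffDeriv (coeffDeriv P) - PowerSeries.C (2 * (C a + X)) * coeffDeriv Q - Q
          - PowerSeries.C (C a + X) * P))
      + (if 2 ≤ l then C k * PowerSeries.coeff (l - 2)
          (B * (coeffDeriv P - PowerSeries.C (C a + X) * Q)) else 0)
      + PowerSeries.coeff l (potentialSeries D r * P) := by
  have h : innerEqA a k D B P Q r = (1 + PowerSeries.X ^ 2 * constSeries k * varSeries) ^ 2 *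
        (coeffDeriv (coeffDeriv P) - PowerSeries.C (2 * (C a + X)) * coeffDeriv Q - Q
          - PowerSeries.C (C a + X) * P)
      + PowerSeries.X ^ 2 * (PowerSeries.C (C k) *
          (B * (coeffDeriv P - PowerSeries.C (C a + X) * Q)))
      + potentialSeries D r * P := by
    simp only [innerEqA, constSeries, varSeries, map_mul, map_add, map_ofNat]; ring
  rw [h]
  simp only [map_add, PowerSeries.coeff_X_pow_mul', PowerSeries.coeff_C_mul]

lemma coeff_innerEqB (a k : ℝ) (D B P Q r : PolySeries) (l : ℕ) :
    PowerSeries.coeff l (innerEqB a k D B P Q r) =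
      PowerSeries.coeff l ((1 + PowerSeries.X ^ 2 * constSeries k * varSeries) ^ 2 *
        (coeffDeriv (coeffDeriv Q) + PowerSeries.C 2 * coeffDeriv P
          - PowerSeries.C (C a + X) * Q))
      + (if 2 ≤ l then C k * PowerSeries.coeff (l - 2) (B * (P + coeffDeriv Q)) else 0)
      + PowerSeries.coeff l (potentialSeries D r * Q) := by
  have h : innerEqB a k D B P Q r = (1 + PowerSeries.X ^ 2 * constSeries k * varSeries) ^ 2 *
        (coeffDeriv (coeffDeriv Q) + PowerSeries.C 2 * coeffDeriv P
          - PowerSeries.C (C a + X) * Q)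
      + PowerSeries.X ^ 2 * (PowerSeries.C (C k) * (B * (P + coeffDeriv Q)))
      + potentialSeries D r * Q := by
    simp only [innerEqB, constSeries, varSeries, map_add, map_ofNat]; ring
  rw [h]
  simp only [map_add, PowerSeries.coeff_X_pow_mul', PowerSeries.coeff_C_mul]

/-- The spectral part of the potential in the outer equation. -/
noncomputable def outerSpectralSeries (w : ℝ) (r : PolySeries) : PolySeries :=
  PowerSeries.C (C (w ^ 2 - 1)) * (PowerSeries.C 2 * r + PowerSeries.X ^ 2 * (r * r))

lemma coeff_outerSpectralSeries (w : ℝ) (r : PolySeries) (l : ℕ) :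
    PowerSeries.coeff l (outerSpectralSeries w r) = C (w ^ 2 - 1) * (2 * PowerSeries.coeff l r
      + if 2 ≤ l then PowerSeries.coeff (l - 2) (r * r) else 0) := by
  simp only [outerSpectralSeries, map_add, PowerSeries.coeff_X_pow_mul', PowerSeries.coeff_C_mul]

lemma coeff_outerEq (w k : ℝ) (S r : PolySeries) (l : ℕ) :
    PowerSeries.coeff l (outerEq w k S r) =
      PowerSeries.coeff l ((1 + PowerSeries.X ^ 3 * constSeries (w * k) * varSeries) ^ 2 *
        (coeffDeriv (coeffDeriv S) - PowerSeries.C 2 * coeffDeriv S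
          + PowerSeries.C (C (w ^ 2)) * S))
      - C (w ^ 2) * PowerSeries.coeff l S
      + (if 3 ≤ l then C (w * k) * (PowerSeries.coeff (l - 3) (coeffDeriv S - S)) else 0)
      + (if 6 ≤ l then C (w * k) ^ 2 * X * (PowerSeries.coeff (l - 6) (coeffDeriv S - S)) else 0)
      + (if 2 ≤ l then PowerSeries.coeff (l - 2)
          ((1 + PowerSeries.X ^ 3 * constSeries (w * k) * varSeries) ^ 2 *
            (outerSpectralSeries w r * S)) else 0) := by
  have h : outerEq w k S r = (1 + PowerSeries.X ^ 3 * constSeries (w * k) * varSeries) ^ 2 *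
        (coeffDeriv (coeffDeriv S) - PowerSeries.C 2 * coeffDeriv S
          + PowerSeries.C (C (w ^ 2)) * S)
      - PowerSeries.C (C (w ^ 2)) * S
      + PowerSeries.X ^ 3 * (PowerSeries.C (C (w * k)) * (coeffDeriv S - S))
      + PowerSeries.X ^ 6 * (PowerSeries.C (C (w * k) ^ 2 * X) * (coeffDeriv S - S))
      + PowerSeries.X ^ 2 * ((1 + PowerSeries.X ^ 3 * constSeries (w * k) * varSeries) ^ 2 *
            (outerSpectralSeries w r * S)) := by
    simp only [outerEq, outerSpectralSeries, constSeries, varSeries, map_mul, map_pow, map_ofNat]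
    ring
  rw [h]
  simp only [map_add, map_sub, PowerSeries.coeff_X_pow_mul', PowerSeries.coeff_C_mul]

/-- The coefficients of the potential. -/
noncomputable def potentialCoeff (D : PolySeries) (U : ℕ → FormalCoeff) (l : ℕ) : ℝ[X] :=
  PowerSeries.coeff l D + 2 * C (U l).2.2.2
    + (if 2 ≤ l then ∑ i ∈ Finset.range (l - 2 + 1), C (U i).2.2.2 *
        (C (U (l - 2 - i)).2.2.2 + 2 * PowerSeries.coeff (l - 2 - i) D) else 0)
    + (if 4 ≤ l then ∑ i ∈ Finset.range (l - 4 + 1),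
        (∑ j ∈ Finset.range (i + 1), C (U j).2.2.2 * C (U (i - j)).2.2.2) *
          PowerSeries.coeff (l - 4 - i) D else 0)

lemma coeff_potentialSeries_serR (D : PolySeries) (U : ℕ → FormalCoeff) (l : ℕ) :
    PowerSeries.coeff l (potentialSeries D (serR U)) = potentialCoeff D U l := by
  have h1 : ∀ l, PowerSeries.coeff l (serR U) = C (U l).2.2.2 := fun l => PowerSeries.coeff_mk _ _
  have h2 : ∀ l, PowerSeries.coeff l (serR U * serR U) + 2 * PowerSeries.coeff l (serR U * D)
      = ∑ i ∈ Finset.range (l + 1), C (U i).2.2.2 *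
        (C (U (l - i)).2.2.2 + 2 * PowerSeries.coeff (l - i) D) := fun l => by
    rw [coeff_mul_range, coeff_mul_range, Finset.mul_sum, ← Finset.sum_add_distrib]
    refine Finset.sum_congr rfl fun i _ => ?_
    rw [h1, h1]; ring
  have h3 : ∀ l, PowerSeries.coeff l (serR U * serR U * D) = ∑ i ∈ Finset.range (l + 1),
        (∑ j ∈ Finset.range (i + 1), C (U j).2.2.2 * C (U (i - j)).2.2.2) *
          PowerSeries.coeff (l - i) D := fun l => by
    rw [coeff_mul_range]
    refine Finset.sum_congr rfl fun i _ => ?_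
    rw [coeff_mul_range]
    simp only [h1]
  rw [coeff_potentialSeries, potentialCoeff, h1, h2, h3]

/-- The leading part of the first inner equation. -/
noncomputable def leadA (a : ℝ) (u : FormalCoeff) : ℝ[X] :=
  derivative (derivative u.1) - 2 * (C a + X) * derivative u.2.1 - u.2.1 - (C a + X) * u.1

/-- The leading part of the second inner equation. -/
noncomputable def leadB (a : ℝ) (u : FormalCoeff) : ℝ[X] :=
  derivative (derivative u.2.1) + 2 * derivative u.1 - (C a + X) * u.2.1

/-- Products of power series become finite convolution sums of the data `U`. For given l and
explicit coefficients the equation is then an identity between polynomials, decidable by evaluation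
and `ring`. -/
lemma coeff_innerEqA_ser (a k : ℝ) (D B : PolySeries) (U : ℕ → FormalCoeff) (l : ℕ) :
    PowerSeries.coeff l (innerEqA a k D B (serP U) (serQ U) (serR U)) =
      leadA a (U l)
      + (if 2 ≤ l then 2 * C k * X * leadA a (U (l - 2)) + C k * ∑ i ∈ Finset.range (l - 2 + 1),
          PowerSeries.coeff i B *
            (derivative (U (l - 2 - i)).1 - (C a + X) * (U (l - 2 - i)).2.1) else 0)
      + (if 4 ≤ l then C k ^ 2 * X ^ 2 * leadA a (U (l - 4)) else 0)
      + ∑ i ∈ Finset.range (l + 1), potentialCoeff D U i * (U (l - i)).1 := by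
  have h1 : ∀ l, PowerSeries.coeff l (coeffDeriv (coeffDeriv (serP U)) - PowerSeries.C (2 * (C a + X)) * coeffDeriv (serQ U) - serQ U
          - PowerSeries.C (C a + X) * serP U) = leadA a (U l) := fun l => by
    simp only [LinearMap.map_add, LinearMap.map_sub, PowerSeries.coeff_C_mul, coeff_coeffDeriv, serP, serQ,
      PowerSeries.coeff_mk, leadA]
  have h2 : ∀ l, PowerSeries.coeff l (B * (coeffDeriv (serP U) - PowerSeries.C (C a + X) * serQ U))
      = ∑ i ∈ Finset.range (l + 1), PowerSeries.coeff i B * (derivative (U (l - i)).1 - (C a + X) * (U (l - i)).2.1) := fun l => by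
    rw [coeff_mul_range]
    simp only [LinearMap.map_add, LinearMap.map_sub, PowerSeries.coeff_C_mul, coeff_coeffDeriv, serP, serQ,
      PowerSeries.coeff_mk]
  have h3 : ∀ l, PowerSeries.coeff l (potentialSeries D (serR U) * serP U)
      = ∑ i ∈ Finset.range (l + 1), potentialCoeff D U i * (U (l - i)).1 := fun l => by
    rw [coeff_mul_range]
    simp only [coeff_potentialSeries_serR, serP, PowerSeries.coeff_mk]
  rw [coeff_innerEqA, coeff_sq_one_add_X_pow_mul, h2, h3]
  simp only [h1]
  split_ifs <;> first | omega | ring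

lemma coeff_innerEqB_ser (a k : ℝ) (D B : PolySeries) (U : ℕ → FormalCoeff) (l : ℕ) :
    PowerSeries.coeff l (innerEqB a k D B (serP U) (serQ U) (serR U)) =
      leadB a (U l)
      + (if 2 ≤ l then 2 * C k * X * leadB a (U (l - 2)) + C k * ∑ i ∈ Finset.range (l - 2 + 1),
          PowerSeries.coeff i B * ((U (l - 2 - i)).1 + derivative (U (l - 2 - i)).2.1) else 0)
      + (if 4 ≤ l then C k ^ 2 * X ^ 2 * leadB a (U (l - 4)) else 0)
      + ∑ i ∈ Finset.range (l + 1), potentialCoeff D U i * (U (l - i)).2.1 := by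
  have h1 : ∀ l, PowerSeries.coeff l (coeffDeriv (coeffDeriv (serQ U)) + PowerSeries.C 2 * coeffDeriv (serP U)
          - PowerSeries.C (C a + X) * serQ U) = leadB a (U l) := fun l => by
    simp only [LinearMap.map_add, LinearMap.map_sub, PowerSeries.coeff_C_mul, coeff_coeffDeriv, serP, serQ,
      PowerSeries.coeff_mk, leadB]
  have h2 : ∀ l, PowerSeries.coeff l (B * (serP U + coeffDeriv (serQ U)))
      = ∑ i ∈ Finset.range (l + 1), PowerSeries.coeff i B * ((U (l - i)).1 + derivative (U (l - i)).2.1) := fun l => by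
    rw [coeff_mul_range]
    simp only [LinearMap.map_add, LinearMap.map_sub, PowerSeries.coeff_C_mul, coeff_coeffDeriv, serP, serQ,
      PowerSeries.coeff_mk]
  have h3 : ∀ l, PowerSeries.coeff l (potentialSeries D (serR U) * serQ U)
      = ∑ i ∈ Finset.range (l + 1), potentialCoeff D U i * (U (l - i)).2.1 := fun l => by
    rw [coeff_mul_range]
    simp only [coeff_potentialSeries_serR, serQ, PowerSeries.coeff_mk]
  rw [coeff_innerEqB, coeff_sq_one_add_X_pow_mul, h2, h3]
  simp only [h1]
  split_ifs <;> first | omega | ring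

/-- The leading part of the outer equation. -/
noncomputable def leadS (w : ℝ) (s : ℝ[X]) : ℝ[X] :=
  derivative (derivative s) - 2 * derivative s + C (w ^ 2) * s

/-- The coefficients of the spectral part of the outer potential, multiplied by `S`. -/
noncomputable def outerSpectralCoeff (w : ℝ) (U : ℕ → FormalCoeff) (l : ℕ) : ℝ[X] :=
  ∑ i ∈ Finset.range (l + 1), C (w ^ 2 - 1) * (2 * C (U i).2.2.2
    + if 2 ≤ i then ∑ j ∈ Finset.range (i - 2 + 1), C (U j).2.2.2 * C (U (i - 2 - j)).2.2.2 else 0)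
      * (U (l - i)).2.2.1

lemma coeff_outerEq_ser (w k : ℝ) (U : ℕ → FormalCoeff) (l : ℕ) :
    PowerSeries.coeff l (outerEq w k (serS U) (serR U)) =
      leadS w (U l).2.2.1 - C (w ^ 2) * (U l).2.2.1
      + (if 2 ≤ l then outerSpectralCoeff w U (l - 2) else 0)
      + (if 3 ≤ l then 2 * C (w * k) * X * leadS w (U (l - 3)).2.2.1
          + C (w * k) * (derivative (U (l - 3)).2.2.1 - (U (l - 3)).2.2.1) else 0)
      + (if 6 ≤ l then C (w * k) ^ 2 * X ^ 2 * leadS w (U (l - 6)).2.2.1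
          + C (w * k) ^ 2 * X * (derivative (U (l - 6)).2.2.1 - (U (l - 6)).2.2.1) else 0)
      + (if 5 ≤ l then 2 * C (w * k) * X * outerSpectralCoeff w U (l - 5) else 0)
      + (if 8 ≤ l then C (w * k) ^ 2 * X ^ 2 * outerSpectralCoeff w U (l - 8) else 0) := by
  have hs : ∀ l, PowerSeries.coeff l (outerSpectralSeries w (serR U) * serS U)
      = outerSpectralCoeff w U l := fun l => by
    simp only [coeff_mul_range, coeff_outerSpectralSeries, outerSpectralCoeff, serS, serR,
      PowerSeries.coeff_mk]
  have h1 : ∀ l, PowerSeries.coeff l (coeffDeriv (coeffDeriv (serS U))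
      - PowerSeries.C 2 * coeffDeriv (serS U) + PowerSeries.C (C (w ^ 2)) * serS U)
      = leadS w (U l).2.2.1 := fun l => by
    simp only [LinearMap.map_add, LinearMap.map_sub, PowerSeries.coeff_C_mul, coeff_coeffDeriv, serS,
      PowerSeries.coeff_mk, leadS]
  have h2 : ∀ l, PowerSeries.coeff l (coeffDeriv (serS U) - serS U)
      = derivative (U l).2.2.1 - (U l).2.2.1 := fun l => by
    simp only [map_sub, coeff_coeffDeriv, serS, PowerSeries.coeff_mk]
  have h3 : PowerSeries.coeff l (serS U) = (U l).2.2.1 := PowerSeries.coeff_mk _ _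
  rw [coeff_outerEq, coeff_sq_one_add_X_pow_mul, coeff_sq_one_add_X_pow_mul]
  simp only [hs, h1, h2, h3]
  split_ifs <;> first | omega | ring1 | (simp only [Nat.sub_sub]; ring1)

end FormalSolutions

/-! ### Verification of four explicit orders for a general index -/

set_option linter.unusedSimpArgs false
set_option linter.unusedVariables false

section FormalSolutions

open Polynomial

set_option maxHeartbeats 1000000 in
/-- First coefficients of the formal solution for a general index. -/
noncomputable def generalInitial (a w γ k b d : ℝ) : ℕ → FormalCoeff
  | 0 => (1,
      0,
      0,
      1/2*a)
  | 1 => (0,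
      C (-γ : ℝ),
      C (-γ : ℝ),
      -1/2*γ)
  | 2 => (C (-1/2*γ^2 - 1/2*k*b + 2/5*k - 1/5*d : ℝ) * X,
      C (-2/15*a*k - 4/15*a*d + 1/3*a : ℝ) * X + C (-2/5*k + 1/5*d : ℝ) * X ^ 2,
      0,
      -2/15*a^2*k - 4/15*a^2*d + 5/24*a^2)
  | 3 => (C (-2/15*a^2*γ*k - 4/15*a^2*γ*d + 1/3*a^2*γ : ℝ) * X + C (-8/15*a*γ*k - 1/15*a*γ*d
      + 1/3*a*γ : ℝ) * X ^ 2 + C (-2/5*γ*k + 1/5*γ*d : ℝ) * X ^ 3,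
      C (-1/2*a*w^2*γ + 2/15*a*γ*k + 4/15*a*γ*d + 1/6*a*γ : ℝ) + C (1/6*γ^3 + 1/2*γ*k*b
      - 4/15*γ*k + 7/15*γ*d - 1/3*γ : ℝ) * X,
      C (-1/2*a*w^2*γ + 2/15*a*γ*k + 4/15*a*γ*d + 1/6*a*γ : ℝ) + C (-1/2*a*w^2*γ
      + 1/2*a*γ : ℝ) * X,
      -1/4*a*w^2*γ + 1/6*a*γ^3 + 1/3*a*γ*k + 2/3*a*γ*d - 1/3*a*γ)
  | _ => 0

/-- The coefficients of the potential are put in closed form once and for all, since each occurs in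
both inner equations of every later order; the convolution sums then stay small enough for `ring`.
-/
lemma potentialCoeff_generalInitial_zero (a w γ k b d : ℝ) {D : PolySeries}
    (hD : ∀ i < 4, PowerSeries.coeff i D = if i = 0 then X else if i = 2 then C d * X ^ 2 else 0) :
    potentialCoeff D (generalInitial a w γ k b d) 0 =
      C (a : ℝ) + C (1 : ℝ) * X := by
  refine Polynomial.funext fun y => ?_
  simp only [potentialCoeff, Finset.sum_range_succ, Finset.sum_range_zero, generalInitial,
    hD _ (show 0 < 4 by norm_num), eval_add, eval_mul, eval_sub, eval_neg, eval_C, eval_X,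
    eval_pow, eval_zero, eval_one, eval_ofNat, derivative_add, derivative_C_mul, derivative_C,
    derivative_X, derivative_X_pow, derivative_zero, derivative_one, mul_zero, zero_mul, zero_add,
    add_zero, mul_one, Nat.reduceSub, Nat.reduceAdd, Nat.reduceLeDiff, Nat.reduceEqDiff,
    reduceIte, Nat.cast_ofNat, Nat.cast_one, tsub_self, le_refl, OfNat.ofNat_ne_zero,
    OfNat.ofNat_ne_one, one_ne_zero, nonpos_iff_eq_zero, Nat.sub_zero, sub_zero, pow_zero,
    zero_sub, neg_zero, pow_one]
  try ring

lemma potentialCoeff_generalInitial_one (a w γ k b d : ℝ) {D : PolySeries}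
    (hD : ∀ i < 4, PowerSeries.coeff i D = if i = 0 then X else if i = 2 then C d * X ^ 2 else 0) :
    potentialCoeff D (generalInitial a w γ k b d) 1 =
      C (-γ : ℝ) := by
  refine Polynomial.funext fun y => ?_
  simp only [potentialCoeff, Finset.sum_range_succ, Finset.sum_range_zero, generalInitial,
    hD _ (show 1 < 4 by norm_num), eval_add, eval_mul, eval_sub, eval_neg, eval_C, eval_X,
    eval_pow, eval_zero, eval_one, eval_ofNat, derivative_add, derivative_C_mul, derivative_C,
    derivative_X, derivative_X_pow, derivative_zero, derivative_one, mul_zero, zero_mul, zero_add,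
    add_zero, mul_one, Nat.reduceSub, Nat.reduceAdd, Nat.reduceLeDiff, Nat.reduceEqDiff,
    reduceIte, Nat.cast_ofNat, Nat.cast_one, tsub_self, le_refl, OfNat.ofNat_ne_zero,
    OfNat.ofNat_ne_one, one_ne_zero, nonpos_iff_eq_zero, Nat.sub_zero, sub_zero, pow_zero,
    zero_sub, neg_zero, pow_one]
  try ring

lemma potentialCoeff_generalInitial_two (a w γ k b d : ℝ) {D : PolySeries}
    (hD : ∀ i < 4, PowerSeries.coeff i D = if i = 0 then X else if i = 2 then C d * X ^ 2 else 0) :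
    potentialCoeff D (generalInitial a w γ k b d) 2 =
      C (-4/15*a^2*k - 8/15*a^2*d + 2/3*a^2 : ℝ) + C (a : ℝ) * X + C (d : ℝ) * X ^ 2 := by
  refine Polynomial.funext fun y => ?_
  simp only [potentialCoeff, Finset.sum_range_succ, Finset.sum_range_zero, generalInitial,
    hD _ (show 2 < 4 by norm_num), hD _ (show 0 < 4 by norm_num), eval_add, eval_mul, eval_sub,
    eval_neg, eval_C, eval_X, eval_pow, eval_zero, eval_one, eval_ofNat, derivative_add,
    derivative_C_mul, derivative_C, derivative_X, derivative_X_pow, derivative_zero,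
    derivative_one, mul_zero, zero_mul, zero_add, add_zero, mul_one, Nat.reduceSub, Nat.reduceAdd,
    Nat.reduceLeDiff, Nat.reduceEqDiff, reduceIte, Nat.cast_ofNat, Nat.cast_one, tsub_self,
    le_refl, OfNat.ofNat_ne_zero, OfNat.ofNat_ne_one, one_ne_zero, nonpos_iff_eq_zero,
    Nat.sub_zero, sub_zero, pow_zero, zero_sub, neg_zero, pow_one]
  try ring

lemma potentialCoeff_generalInitial_three (a w γ k b d : ℝ) {D : PolySeries}
    (hD : ∀ i < 4, PowerSeries.coeff i D = if i = 0 then X else if i = 2 then C d * X ^ 2 else 0) :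
    potentialCoeff D (generalInitial a w γ k b d) 3 =
      C (-1/2*a*w^2*γ + 1/3*a*γ^3 + 2/3*a*γ*k + 4/3*a*γ*d - 7/6*a*γ : ℝ) + C (-γ : ℝ) * X := by
  refine Polynomial.funext fun y => ?_
  simp only [potentialCoeff, Finset.sum_range_succ, Finset.sum_range_zero, generalInitial,
    hD _ (show 3 < 4 by norm_num), hD _ (show 0 < 4 by norm_num), hD _ (show 1 < 4 by norm_num),
    eval_add, eval_mul, eval_sub, eval_neg, eval_C, eval_X, eval_pow, eval_zero, eval_one,
    eval_ofNat, derivative_add, derivative_C_mul, derivative_C, derivative_X, derivative_X_pow,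
    derivative_zero, derivative_one, mul_zero, zero_mul, zero_add, add_zero, mul_one,
    Nat.reduceSub, Nat.reduceAdd, Nat.reduceLeDiff, Nat.reduceEqDiff, reduceIte, Nat.cast_ofNat,
    Nat.cast_one, tsub_self, le_refl, OfNat.ofNat_ne_zero, OfNat.ofNat_ne_one, one_ne_zero,
    nonpos_iff_eq_zero, Nat.sub_zero, sub_zero, pow_zero, zero_sub, neg_zero, pow_one]
  try ring

set_option maxHeartbeats 1000000 in
lemma formalStep_generalInitial_zero (a w γ k b d : ℝ) {D B : PolySeries}
    (hD : ∀ i < 4, PowerSeries.coeff i D = if i = 0 then X else if i = 2 then C d * X ^ 2 else 0)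
    (hB : ∀ i < 2, PowerSeries.coeff i B = if i = 0 then C b else 0) :
    FormalStep a w γ k D B 0 (generalInitial a w γ k b d) := by
  refine ⟨fun h => by simp [generalInitial]; ring, ?_, ?_, ?_, ?_, ?_⟩
  · rw [coeff_innerEqA_ser]
    refine Polynomial.funext fun y => ?_
    simp only [Finset.sum_range_succ, Finset.sum_range_zero, leadA,
      potentialCoeff_generalInitial_zero a w γ k b d hD, generalInitial, eval_add, eval_mul,
      eval_sub, eval_neg, eval_C, eval_X, eval_pow, eval_zero, eval_one, eval_ofNat,
      derivative_add, derivative_C_mul, derivative_C, derivative_X, derivative_X_pow,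
      derivative_zero, derivative_one, mul_zero, zero_mul, zero_add, add_zero, mul_one,
      Nat.reduceSub, Nat.reduceAdd, Nat.reduceLeDiff, Nat.reduceEqDiff, reduceIte, Nat.cast_ofNat,
      Nat.cast_one, tsub_self, le_refl, OfNat.ofNat_ne_zero, OfNat.ofNat_ne_one, one_ne_zero,
      nonpos_iff_eq_zero, Nat.sub_zero, sub_zero, pow_zero, zero_sub, neg_zero, pow_one]
    try ring
  · rw [coeff_innerEqB_ser]
    refine Polynomial.funext fun y => ?_
    simp only [Finset.sum_range_succ, Finset.sum_range_zero, leadB,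
      potentialCoeff_generalInitial_zero a w γ k b d hD, generalInitial, eval_add, eval_mul,
      eval_sub, eval_neg, eval_C, eval_X, eval_pow, eval_zero, eval_one, eval_ofNat,
      derivative_add, derivative_C_mul, derivative_C, derivative_X, derivative_X_pow,
      derivative_zero, derivative_one, mul_zero, zero_mul, zero_add, add_zero, mul_one,
      Nat.reduceSub, Nat.reduceAdd, Nat.reduceLeDiff, Nat.reduceEqDiff, reduceIte, Nat.cast_ofNat,
      Nat.cast_one, tsub_self, le_refl, OfNat.ofNat_ne_zero, OfNat.ofNat_ne_one, one_ne_zero,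
      nonpos_iff_eq_zero, Nat.sub_zero, sub_zero, pow_zero, zero_sub, neg_zero, pow_one]
    try ring
  · rw [coeff_outerEq_ser]
    refine Polynomial.funext fun y => ?_
    simp only [Finset.sum_range_succ, Finset.sum_range_zero, leadS, outerSpectralCoeff,
      generalInitial, eval_add, eval_mul, eval_sub, eval_neg, eval_C, eval_X, eval_pow, eval_zero,
      eval_one, eval_ofNat, derivative_add, derivative_C_mul, derivative_C, derivative_X,
      derivative_X_pow, derivative_zero, derivative_one, mul_zero, zero_mul, zero_add, add_zero,
      mul_one, Nat.reduceSub, Nat.reduceAdd, Nat.reduceLeDiff, Nat.reduceEqDiff, reduceIte,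
      Nat.cast_ofNat, Nat.cast_one, tsub_self, le_refl, OfNat.ofNat_ne_zero, OfNat.ofNat_ne_one,
      one_ne_zero, nonpos_iff_eq_zero, Nat.sub_zero, sub_zero, pow_zero, zero_sub, neg_zero,
      pow_one]
    try ring
  · simp [generalInitial]
  · rintro l' h
    omega

set_option maxHeartbeats 1000000 in
lemma formalStep_generalInitial_one (a w γ k b d : ℝ) {D B : PolySeries}
    (hD : ∀ i < 4, PowerSeries.coeff i D = if i = 0 then X else if i = 2 then C d * X ^ 2 else 0)
    (hB : ∀ i < 2, PowerSeries.coeff i B = if i = 0 then C b else 0) :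
    FormalStep a w γ k D B 1 (generalInitial a w γ k b d) := by
  refine ⟨fun h => by omega, ?_, ?_, ?_, ?_, ?_⟩
  · rw [coeff_innerEqA_ser]
    refine Polynomial.funext fun y => ?_
    simp only [Finset.sum_range_succ, Finset.sum_range_zero, leadA,
      potentialCoeff_generalInitial_zero a w γ k b d hD,
      potentialCoeff_generalInitial_one a w γ k b d hD, generalInitial, eval_add, eval_mul,
      eval_sub, eval_neg, eval_C, eval_X, eval_pow, eval_zero, eval_one, eval_ofNat,
      derivative_add, derivative_C_mul, derivative_C, derivative_X, derivative_X_pow,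
      derivative_zero, derivative_one, mul_zero, zero_mul, zero_add, add_zero, mul_one,
      Nat.reduceSub, Nat.reduceAdd, Nat.reduceLeDiff, Nat.reduceEqDiff, reduceIte, Nat.cast_ofNat,
      Nat.cast_one, tsub_self, le_refl, OfNat.ofNat_ne_zero, OfNat.ofNat_ne_one, one_ne_zero,
      nonpos_iff_eq_zero, Nat.sub_zero, sub_zero, pow_zero, zero_sub, neg_zero, pow_one]
    try ring
  · rw [coeff_innerEqB_ser]
    refine Polynomial.funext fun y => ?_
    simp only [Finset.sum_range_succ, Finset.sum_range_zero, leadB,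
      potentialCoeff_generalInitial_zero a w γ k b d hD,
      potentialCoeff_generalInitial_one a w γ k b d hD, generalInitial, eval_add, eval_mul,
      eval_sub, eval_neg, eval_C, eval_X, eval_pow, eval_zero, eval_one, eval_ofNat,
      derivative_add, derivative_C_mul, derivative_C, derivative_X, derivative_X_pow,
      derivative_zero, derivative_one, mul_zero, zero_mul, zero_add, add_zero, mul_one,
      Nat.reduceSub, Nat.reduceAdd, Nat.reduceLeDiff, Nat.reduceEqDiff, reduceIte, Nat.cast_ofNat,
      Nat.cast_one, tsub_self, le_refl, OfNat.ofNat_ne_zero, OfNat.ofNat_ne_one, one_ne_zero,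
      nonpos_iff_eq_zero, Nat.sub_zero, sub_zero, pow_zero, zero_sub, neg_zero, pow_one]
    try ring
  · rw [coeff_outerEq_ser]
    refine Polynomial.funext fun y => ?_
    simp only [Finset.sum_range_succ, Finset.sum_range_zero, leadS, outerSpectralCoeff,
      generalInitial, eval_add, eval_mul, eval_sub, eval_neg, eval_C, eval_X, eval_pow, eval_zero,
      eval_one, eval_ofNat, derivative_add, derivative_C_mul, derivative_C, derivative_X,
      derivative_X_pow, derivative_zero, derivative_one, mul_zero, zero_mul, zero_add, add_zero,
      mul_one, Nat.reduceSub, Nat.reduceAdd, Nat.reduceLeDiff, Nat.reduceEqDiff, reduceIte,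
      Nat.cast_ofNat, Nat.cast_one, tsub_self, le_refl, OfNat.ofNat_ne_zero, OfNat.ofNat_ne_one,
      one_ne_zero, nonpos_iff_eq_zero, Nat.sub_zero, sub_zero, pow_zero, zero_sub, neg_zero,
      pow_one]
    try ring
  · simp [generalInitial]
  · rintro l' h
    obtain rfl : l' = 0 := by omega
    simp [generalInitial, derivative_pow]
    try ring

set_option maxHeartbeats 1000000 in
lemma formalStep_generalInitial_two (a w γ k b d : ℝ) {D B : PolySeries}
    (hD : ∀ i < 4, PowerSeries.coeff i D = if i = 0 then X else if i = 2 then C d * X ^ 2 else 0)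
    (hB : ∀ i < 2, PowerSeries.coeff i B = if i = 0 then C b else 0) :
    FormalStep a w γ k D B 2 (generalInitial a w γ k b d) := by
  refine ⟨fun h => by omega, ?_, ?_, ?_, ?_, ?_⟩
  · rw [coeff_innerEqA_ser]
    refine Polynomial.funext fun y => ?_
    simp only [Finset.sum_range_succ, Finset.sum_range_zero, leadA,
      potentialCoeff_generalInitial_zero a w γ k b d hD,
      potentialCoeff_generalInitial_one a w γ k b d hD,
      potentialCoeff_generalInitial_two a w γ k b d hD, generalInitial,
      hB _ (show 0 < 2 by norm_num), eval_add, eval_mul, eval_sub, eval_neg, eval_C, eval_X,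
      eval_pow, eval_zero, eval_one, eval_ofNat, derivative_add, derivative_C_mul, derivative_C,
      derivative_X, derivative_X_pow, derivative_zero, derivative_one, mul_zero, zero_mul,
      zero_add, add_zero, mul_one, Nat.reduceSub, Nat.reduceAdd, Nat.reduceLeDiff,
      Nat.reduceEqDiff, reduceIte, Nat.cast_ofNat, Nat.cast_one, tsub_self, le_refl,
      OfNat.ofNat_ne_zero, OfNat.ofNat_ne_one, one_ne_zero, nonpos_iff_eq_zero, Nat.sub_zero,
      sub_zero, pow_zero, zero_sub, neg_zero, pow_one]
    try ring
  · rw [coeff_innerEqB_ser]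
    refine Polynomial.funext fun y => ?_
    simp only [Finset.sum_range_succ, Finset.sum_range_zero, leadB,
      potentialCoeff_generalInitial_zero a w γ k b d hD,
      potentialCoeff_generalInitial_one a w γ k b d hD,
      potentialCoeff_generalInitial_two a w γ k b d hD, generalInitial,
      hB _ (show 0 < 2 by norm_num), eval_add, eval_mul, eval_sub, eval_neg, eval_C, eval_X,
      eval_pow, eval_zero, eval_one, eval_ofNat, derivative_add, derivative_C_mul, derivative_C,
      derivative_X, derivative_X_pow, derivative_zero, derivative_one, mul_zero, zero_mul,
      zero_add, add_zero, mul_one, Nat.reduceSub, Nat.reduceAdd, Nat.reduceLeDiff,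
      Nat.reduceEqDiff, reduceIte, Nat.cast_ofNat, Nat.cast_one, tsub_self, le_refl,
      OfNat.ofNat_ne_zero, OfNat.ofNat_ne_one, one_ne_zero, nonpos_iff_eq_zero, Nat.sub_zero,
      sub_zero, pow_zero, zero_sub, neg_zero, pow_one]
    try ring
  · rw [coeff_outerEq_ser]
    refine Polynomial.funext fun y => ?_
    simp only [Finset.sum_range_succ, Finset.sum_range_zero, leadS, outerSpectralCoeff,
      generalInitial, eval_add, eval_mul, eval_sub, eval_neg, eval_C, eval_X, eval_pow, eval_zero,
      eval_one, eval_ofNat, derivative_add, derivative_C_mul, derivative_C, derivative_X,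
      derivative_X_pow, derivative_zero, derivative_one, mul_zero, zero_mul, zero_add, add_zero,
      mul_one, Nat.reduceSub, Nat.reduceAdd, Nat.reduceLeDiff, Nat.reduceEqDiff, reduceIte,
      Nat.cast_ofNat, Nat.cast_one, tsub_self, le_refl, OfNat.ofNat_ne_zero, OfNat.ofNat_ne_one,
      one_ne_zero, nonpos_iff_eq_zero, Nat.sub_zero, sub_zero, pow_zero, zero_sub, neg_zero,
      pow_one]
    try ring
  · simp [generalInitial]
  · rintro l' h
    obtain rfl : l' = 1 := by omega
    simp [generalInitial, derivative_pow]
    try ring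

set_option maxHeartbeats 1000000 in
lemma formalStep_generalInitial_three (a w γ k b d : ℝ) {D B : PolySeries}
    (hD : ∀ i < 4, PowerSeries.coeff i D = if i = 0 then X else if i = 2 then C d * X ^ 2 else 0)
    (hB : ∀ i < 2, PowerSeries.coeff i B = if i = 0 then C b else 0) :
    FormalStep a w γ k D B 3 (generalInitial a w γ k b d) := by
  refine ⟨fun h => by omega, ?_, ?_, ?_, ?_, ?_⟩
  · rw [coeff_innerEqA_ser]
    refine Polynomial.funext fun y => ?_
    simp only [Finset.sum_range_succ, Finset.sum_range_zero, leadA,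
      potentialCoeff_generalInitial_zero a w γ k b d hD,
      potentialCoeff_generalInitial_one a w γ k b d hD,
      potentialCoeff_generalInitial_two a w γ k b d hD,
      potentialCoeff_generalInitial_three a w γ k b d hD, generalInitial,
      hB _ (show 0 < 2 by norm_num), hB _ (show 1 < 2 by norm_num), eval_add, eval_mul, eval_sub,
      eval_neg, eval_C, eval_X, eval_pow, eval_zero, eval_one, eval_ofNat, derivative_add,
      derivative_C_mul, derivative_C, derivative_X, derivative_X_pow, derivative_zero,
      derivative_one, mul_zero, zero_mul, zero_add, add_zero, mul_one, Nat.reduceSub,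
      Nat.reduceAdd, Nat.reduceLeDiff, Nat.reduceEqDiff, reduceIte, Nat.cast_ofNat, Nat.cast_one,
      tsub_self, le_refl, OfNat.ofNat_ne_zero, OfNat.ofNat_ne_one, one_ne_zero,
      nonpos_iff_eq_zero, Nat.sub_zero, sub_zero, pow_zero, zero_sub, neg_zero, pow_one]
    try ring
  · rw [coeff_innerEqB_ser]
    refine Polynomial.funext fun y => ?_
    simp only [Finset.sum_range_succ, Finset.sum_range_zero, leadB,
      potentialCoeff_generalInitial_zero a w γ k b d hD,
      potentialCoeff_generalInitial_one a w γ k b d hD,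
      potentialCoeff_generalInitial_two a w γ k b d hD,
      potentialCoeff_generalInitial_three a w γ k b d hD, generalInitial,
      hB _ (show 0 < 2 by norm_num), hB _ (show 1 < 2 by norm_num), eval_add, eval_mul, eval_sub,
      eval_neg, eval_C, eval_X, eval_pow, eval_zero, eval_one, eval_ofNat, derivative_add,
      derivative_C_mul, derivative_C, derivative_X, derivative_X_pow, derivative_zero,
      derivative_one, mul_zero, zero_mul, zero_add, add_zero, mul_one, Nat.reduceSub,
      Nat.reduceAdd, Nat.reduceLeDiff, Nat.reduceEqDiff, reduceIte, Nat.cast_ofNat, Nat.cast_one,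
      tsub_self, le_refl, OfNat.ofNat_ne_zero, OfNat.ofNat_ne_one, one_ne_zero,
      nonpos_iff_eq_zero, Nat.sub_zero, sub_zero, pow_zero, zero_sub, neg_zero, pow_one]
    try ring
  · rw [coeff_outerEq_ser]
    refine Polynomial.funext fun y => ?_
    simp only [Finset.sum_range_succ, Finset.sum_range_zero, leadS, outerSpectralCoeff,
      generalInitial, eval_add, eval_mul, eval_sub, eval_neg, eval_C, eval_X, eval_pow, eval_zero,
      eval_one, eval_ofNat, derivative_add, derivative_C_mul, derivative_C, derivative_X,
      derivative_X_pow, derivative_zero, derivative_one, mul_zero, zero_mul, zero_add, add_zero,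
      mul_one, Nat.reduceSub, Nat.reduceAdd, Nat.reduceLeDiff, Nat.reduceEqDiff, reduceIte,
      Nat.cast_ofNat, Nat.cast_one, tsub_self, le_refl, OfNat.ofNat_ne_zero, OfNat.ofNat_ne_one,
      one_ne_zero, nonpos_iff_eq_zero, Nat.sub_zero, sub_zero, pow_zero, zero_sub, neg_zero,
      pow_one]
    try ring
  · simp [generalInitial]
  · rintro l' h
    obtain rfl : l' = 2 := by omega
    simp [generalInitial, derivative_pow]
    try ring

end FormalSolutions

/-! ### Verification of seven explicit orders for a constant index -/

set_option linter.unusedSimpArgs false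
set_option linter.unusedVariables false

section FormalSolutions

open Polynomial

set_option maxHeartbeats 1000000 in
/-- First coefficients of the formal solution for a constant index. -/
noncomputable def constantInitial (a w γ : ℝ) : ℕ → FormalCoeff
  | 0 => (1,
      0,
      0,
      1/2*a)
  | 1 => (0,
      C (-γ : ℝ),
      C (-γ : ℝ),
      -1/2*γ)
  | 2 => (C (-1/2*γ^2 - 1/10 : ℝ) * X,
      C (1/5*a : ℝ) * X + C (-3/20 : ℝ) * X ^ 2,
      0,
      3/40*a^2)
  | 3 => (C (1/5*a^2*γ : ℝ) * X + C (1/20*a*γ : ℝ) * X ^ 2 + C (-3/20*γ : ℝ) * X ^ 3,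
      C (-1/2*a*w^2*γ + 3/10*a*γ : ℝ) + C (1/6*γ^3 - 1/10*γ : ℝ) * X,
      C (-1/2*a*w^2*γ + 3/10*a*γ : ℝ) + C (-1/2*a*w^2*γ + 1/2*a*γ : ℝ) * X,
      -1/4*a*w^2*γ + 1/6*a*γ^3)
  | 4 => (C (-1/2*a*w^2*γ^2 + 1/6*a*γ^4 - 3/175*a : ℝ) * X + C (-1/50*a^3 + 1/24*γ^4 - 3/40*γ^2
      + 3/140 : ℝ) * X ^ 2 + C (1/100*a^2 : ℝ) * X ^ 3 + C (3/160*a : ℝ) * X ^ 4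
      + C (-9/800 : ℝ) * X ^ 5,
      C (-1/4*w^3*γ + 1/2*w^2*γ^2 + 1/4*w*γ - 1/6*γ^4 - 2/5*γ^2 : ℝ) + C (3/175*a^2 : ℝ) * X
      + C (-1/10*a*γ^2 - 23/700*a : ℝ) * X ^ 2 + C (3/40*γ^2 + 17/280 : ℝ) * X ^ 3,
      C (-1/4*w^3*γ + 1/2*w^2*γ^2 + 1/4*w*γ - 1/6*γ^4 - 2/5*γ^2 : ℝ) + C (-1/4*w^3*γ
      + 1/2*w^2*γ^2 + 1/4*w*γ - 1/2*γ^2 : ℝ) * X + C (-1/4*w^3*γ : ℝ) * X ^ 2,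
      -1/2800*a^3 - 1/8*w^3*γ + 1/4*w^2*γ^2 + 1/8*w*γ - 1/8*γ^4 - 1/8*γ^2 + 1/280)
  | 5 => (C (1/10*a^3*w^2*γ - 3/70*a^3*γ - 1/4*w^3*γ^2 + 1/2*w^2*γ^3 + 1/4*w*γ^2 - 1/5*γ^5
      - 3/10*γ^3 + 3/175*γ : ℝ) * X + C (1/40*a^2*w^2*γ - 1/30*a^2*γ^3
      + 41/1400*a^2*γ : ℝ) * X ^ 2 + C (-3/40*a*w^2*γ - 1/120*a*γ^3 + 37/700*a*γ : ℝ) * X ^ 3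
      + C (1/40*γ^3 + 47/1120*γ : ℝ) * X ^ 4,
      C (-3/8*a^2*w^4*γ + 9/20*a^2*w^2*γ - 129/1400*a^2*γ : ℝ) + C (1/4*a*w^2*γ^3 - 1/20*a*w^2*γ
      - 1/10*a*γ^5 - 1/20*a*γ^3 + 9/700*a*γ : ℝ) * X + C (1/50*a^3*γ - 1/120*γ^5 + 7/120*γ^3
      + 2/175*γ : ℝ) * X ^ 2 + C (-1/100*a^2*γ : ℝ) * X ^ 3 + C (-3/160*a*γ : ℝ) * X ^ 4
      + C (9/800*γ : ℝ) * X ^ 5,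
      C (-3/8*a^2*w^4*γ + 9/20*a^2*w^2*γ - 129/1400*a^2*γ : ℝ) + C (-3/8*a^2*w^4*γ
      + 9/20*a^2*w^2*γ - 3/40*a^2*γ : ℝ) * X + C (-1/8*a^2*w^4*γ + 1/4*a^2*w^2*γ
      - 1/8*a^2*γ : ℝ) * X ^ 2,
      -3/16*a^2*w^4*γ + 1/4*a^2*w^2*γ^3 + 3/20*a^2*w^2*γ - 1/10*a^2*γ^5 - 1/10*a^2*γ^3)
  | 6 => (C (-1/2*a^2*w^4*γ^2 + 1/20*a^2*w^3*γ + 1/3*a^2*w^2*γ^4 + 1/5*a^2*w^2*γ^2 - 1/20*a^2*w*γ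
      - 1/10*a^2*γ^6 - 1/15*a^2*γ^4 + 2/25*a^2*γ^2 + 1/525*a^2 : ℝ) * X + C (-3/875*a^4
      + 1/80*a*w^3*γ + 1/12*a*w^2*γ^4 - 1/10*a*w^2*γ^2 - 1/80*a*w*γ - 7/180*a*γ^6 + 1/30*a*γ^4
      + 1/35*a*γ^2 + 13/2100*a : ℝ) * X ^ 2 + C (1/100*a^3*γ^2 + 1/420*a^3 - 3/80*w^3*γ
      + 3/40*w^2*γ^2 + 3/80*w*γ - 1/720*γ^6 - 1/120*γ^4 - 163/2800*γ^2 - 73/12600 : ℝ) * X ^ 3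
      + C (-1/200*a^2*γ^2 - 11/2800*a^2 : ℝ) * X ^ 4 + C (-3/320*a*γ^2
      - 467/56000*a : ℝ) * X ^ 5 + C (9/1600*γ^2 + 957/112000 : ℝ) * X ^ 6,
      C (-1/2*a*w^5*γ + a*w^4*γ^2 + 7/10*a*w^3*γ - 1/2*a*w^2*γ^4 - 13/10*a*w^2*γ^2 - 1/5*a*w*γ
      + 1/10*a*γ^6 + 3/10*a*γ^4 + 59/175*a*γ^2 : ℝ) + C (-2/1575*a^3 + 1/8*w^3*γ^3 - 1/40*w^3*γ
      - 1/4*w^2*γ^4 + 1/20*w^2*γ^2 - 1/8*w*γ^3 + 1/40*w*γ + 19/180*γ^6 + 2/15*γ^4 - 1/25*γ^2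
      + 23/6300 : ℝ) * X + C (-1/10*a^2*w^2*γ^2 + 1/30*a^2*γ^4 - 3/350*a^2*γ^2
      - 13/2100*a^2 : ℝ) * X ^ 2 + C (-1/750*a^4 + 3/40*a*w^2*γ^2 - 1/60*a*γ^4 - 3/350*a*γ^2
      + 137/12600*a : ℝ) * X ^ 3 + C (1/600*a^3 - 1/160*γ^4 - 13/1120*γ^2
      - 611/25200 : ℝ) * X ^ 4 + C (3/4000*a^2 : ℝ) * X ^ 5 + C (-27/16000*a : ℝ) * X ^ 6
      + C (9/16000 : ℝ) * X ^ 7,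
      C (-1/2*a*w^5*γ + a*w^4*γ^2 + 7/10*a*w^3*γ - 1/2*a*w^2*γ^4 - 13/10*a*w^2*γ^2 - 1/5*a*w*γ
      + 1/10*a*γ^6 + 3/10*a*γ^4 + 59/175*a*γ^2 : ℝ) + C (-1/2*a*w^5*γ + a*w^4*γ^2 + 7/10*a*w^3*γ
      - 1/4*a*w^2*γ^4 - 27/20*a*w^2*γ^2 - 1/5*a*w*γ + 1/4*a*γ^4 + 7/20*a*γ^2 : ℝ) * X
      + C (-3/8*a*w^5*γ + 1/4*a*w^4*γ^2 + 9/20*a*w^3*γ - 1/2*a*w^2*γ^2 - 1/8*a*w*γ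
      + 1/4*a*γ^2 : ℝ) * X ^ 2 + C (-1/8*a*w^5*γ + 1/8*a*w^3*γ : ℝ) * X ^ 3,
      -479/1008000*a^4 - 1/4*a*w^5*γ + 1/2*a*w^4*γ^2 + 1/8*a*w^3*γ^3 + 5/16*a*w^3*γ
      - 7/12*a*w^2*γ^4 - 1/2*a*w^2*γ^2 - 1/8*a*w*γ^3 - 1/16*a*w*γ + 7/36*a*γ^6 + 5/16*a*γ^4
      + 1/16*a*γ^2 - 1/25200*a)
  | _ => 0

lemma potentialCoeff_constantInitial_zero (a w γ : ℝ) {D : PolySeries}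
    (hD : ∀ i < 7, PowerSeries.coeff i D = if i = 0 then X else if i = 2 then C (1 / 4) * X ^ 2 else 0) :
    potentialCoeff D (constantInitial a w γ) 0 =
      C (a : ℝ) + C (1 : ℝ) * X := by
  refine Polynomial.funext fun y => ?_
  simp only [potentialCoeff, Finset.sum_range_succ, Finset.sum_range_zero, constantInitial,
    hD _ (show 0 < 7 by norm_num), eval_add, eval_mul, eval_sub, eval_neg, eval_C, eval_X,
    eval_pow, eval_zero, eval_one, eval_ofNat, derivative_add, derivative_C_mul, derivative_C,
    derivative_X, derivative_X_pow, derivative_zero, derivative_one, mul_zero, zero_mul, zero_add,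
    add_zero, mul_one, Nat.reduceSub, Nat.reduceAdd, Nat.reduceLeDiff, Nat.reduceEqDiff,
    reduceIte, Nat.cast_ofNat, Nat.cast_one, tsub_self, le_refl, OfNat.ofNat_ne_zero,
    OfNat.ofNat_ne_one, one_ne_zero, nonpos_iff_eq_zero, Nat.sub_zero, sub_zero, pow_zero,
    zero_sub, neg_zero, pow_one]
  try ring

lemma potentialCoeff_constantInitial_one (a w γ : ℝ) {D : PolySeries}
    (hD : ∀ i < 7, PowerSeries.coeff i D = if i = 0 then X else if i = 2 then C (1 / 4) * X ^ 2 else 0) :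
    potentialCoeff D (constantInitial a w γ) 1 =
      C (-γ : ℝ) := by
  refine Polynomial.funext fun y => ?_
  simp only [potentialCoeff, Finset.sum_range_succ, Finset.sum_range_zero, constantInitial,
    hD _ (show 1 < 7 by norm_num), eval_add, eval_mul, eval_sub, eval_neg, eval_C, eval_X,
    eval_pow, eval_zero, eval_one, eval_ofNat, derivative_add, derivative_C_mul, derivative_C,
    derivative_X, derivative_X_pow, derivative_zero, derivative_one, mul_zero, zero_mul, zero_add,
    add_zero, mul_one, Nat.reduceSub, Nat.reduceAdd, Nat.reduceLeDiff, Nat.reduceEqDiff,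
    reduceIte, Nat.cast_ofNat, Nat.cast_one, tsub_self, le_refl, OfNat.ofNat_ne_zero,
    OfNat.ofNat_ne_one, one_ne_zero, nonpos_iff_eq_zero, Nat.sub_zero, sub_zero, pow_zero,
    zero_sub, neg_zero, pow_one]
  try ring

lemma potentialCoeff_constantInitial_two (a w γ : ℝ) {D : PolySeries}
    (hD : ∀ i < 7, PowerSeries.coeff i D = if i = 0 then X else if i = 2 then C (1 / 4) * X ^ 2 else 0) :
    potentialCoeff D (constantInitial a w γ) 2 =
      C (2/5*a^2 : ℝ) + C (a : ℝ) * X + C (1/4 : ℝ) * X ^ 2 := by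
  refine Polynomial.funext fun y => ?_
  simp only [potentialCoeff, Finset.sum_range_succ, Finset.sum_range_zero, constantInitial,
    hD _ (show 2 < 7 by norm_num), hD _ (show 0 < 7 by norm_num), eval_add, eval_mul, eval_sub,
    eval_neg, eval_C, eval_X, eval_pow, eval_zero, eval_one, eval_ofNat, derivative_add,
    derivative_C_mul, derivative_C, derivative_X, derivative_X_pow, derivative_zero,
    derivative_one, mul_zero, zero_mul, zero_add, add_zero, mul_one, Nat.reduceSub, Nat.reduceAdd,
    Nat.reduceLeDiff, Nat.reduceEqDiff, reduceIte, Nat.cast_ofNat, Nat.cast_one, tsub_self,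
    le_refl, OfNat.ofNat_ne_zero, OfNat.ofNat_ne_one, one_ne_zero, nonpos_iff_eq_zero,
    Nat.sub_zero, sub_zero, pow_zero, zero_sub, neg_zero, pow_one]
  try ring

lemma potentialCoeff_constantInitial_three (a w γ : ℝ) {D : PolySeries}
    (hD : ∀ i < 7, PowerSeries.coeff i D = if i = 0 then X else if i = 2 then C (1 / 4) * X ^ 2 else 0) :
    potentialCoeff D (constantInitial a w γ) 3 =
      C (-1/2*a*w^2*γ + 1/3*a*γ^3 - 1/2*a*γ : ℝ) + C (-γ : ℝ) * X := by
  refine Polynomial.funext fun y => ?_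
  simp only [potentialCoeff, Finset.sum_range_succ, Finset.sum_range_zero, constantInitial,
    hD _ (show 3 < 7 by norm_num), hD _ (show 0 < 7 by norm_num), hD _ (show 1 < 7 by norm_num),
    eval_add, eval_mul, eval_sub, eval_neg, eval_C, eval_X, eval_pow, eval_zero, eval_one,
    eval_ofNat, derivative_add, derivative_C_mul, derivative_C, derivative_X, derivative_X_pow,
    derivative_zero, derivative_one, mul_zero, zero_mul, zero_add, add_zero, mul_one,
    Nat.reduceSub, Nat.reduceAdd, Nat.reduceLeDiff, Nat.reduceEqDiff, reduceIte, Nat.cast_ofNat,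
    Nat.cast_one, tsub_self, le_refl, OfNat.ofNat_ne_zero, OfNat.ofNat_ne_one, one_ne_zero,
    nonpos_iff_eq_zero, Nat.sub_zero, sub_zero, pow_zero, zero_sub, neg_zero, pow_one]
  try ring

lemma potentialCoeff_constantInitial_four (a w γ : ℝ) {D : PolySeries}
    (hD : ∀ i < 7, PowerSeries.coeff i D = if i = 0 then X else if i = 2 then C (1 / 4) * X ^ 2 else 0) :
    potentialCoeff D (constantInitial a w γ) 4 =
      C (13/175*a^3 - 1/4*w^3*γ + 1/2*w^2*γ^2 + 1/4*w*γ - 1/4*γ^4 + 1/140 : ℝ)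
      + C (2/5*a^2 : ℝ) * X + C (1/4*a : ℝ) * X ^ 2 := by
  refine Polynomial.funext fun y => ?_
  simp only [potentialCoeff, Finset.sum_range_succ, Finset.sum_range_zero, constantInitial,
    hD _ (show 4 < 7 by norm_num), hD _ (show 0 < 7 by norm_num), hD _ (show 1 < 7 by norm_num),
    hD _ (show 2 < 7 by norm_num), eval_add, eval_mul, eval_sub, eval_neg, eval_C, eval_X,
    eval_pow, eval_zero, eval_one, eval_ofNat, derivative_add, derivative_C_mul, derivative_C,
    derivative_X, derivative_X_pow, derivative_zero, derivative_one, mul_zero, zero_mul, zero_add,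
    add_zero, mul_one, Nat.reduceSub, Nat.reduceAdd, Nat.reduceLeDiff, Nat.reduceEqDiff,
    reduceIte, Nat.cast_ofNat, Nat.cast_one, tsub_self, le_refl, OfNat.ofNat_ne_zero,
    OfNat.ofNat_ne_one, one_ne_zero, nonpos_iff_eq_zero, Nat.sub_zero, sub_zero, pow_zero,
    zero_sub, neg_zero, pow_one]
  try ring

lemma potentialCoeff_constantInitial_five (a w γ : ℝ) {D : PolySeries}
    (hD : ∀ i < 7, PowerSeries.coeff i D = if i = 0 then X else if i = 2 then C (1 / 4) * X ^ 2 else 0) :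
    potentialCoeff D (constantInitial a w γ) 5 =
      C (-3/8*a^2*w^4*γ + 1/2*a^2*w^2*γ^3 + 1/20*a^2*w^2*γ - 1/5*a^2*γ^5 - 1/30*a^2*γ^3
      - 3/40*a^2*γ : ℝ) + C (-1/2*a*w^2*γ + 1/3*a*γ^3 - 1/2*a*γ : ℝ) * X
      + C (-1/4*γ : ℝ) * X ^ 2 := by
  refine Polynomial.funext fun y => ?_
  simp only [potentialCoeff, Finset.sum_range_succ, Finset.sum_range_zero, constantInitial,
    hD _ (show 5 < 7 by norm_num), hD _ (show 0 < 7 by norm_num), hD _ (show 1 < 7 by norm_num),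
    hD _ (show 2 < 7 by norm_num), hD _ (show 3 < 7 by norm_num), eval_add, eval_mul, eval_sub,
    eval_neg, eval_C, eval_X, eval_pow, eval_zero, eval_one, eval_ofNat, derivative_add,
    derivative_C_mul, derivative_C, derivative_X, derivative_X_pow, derivative_zero,
    derivative_one, mul_zero, zero_mul, zero_add, add_zero, mul_one, Nat.reduceSub, Nat.reduceAdd,
    Nat.reduceLeDiff, Nat.reduceEqDiff, reduceIte, Nat.cast_ofNat, Nat.cast_one, tsub_self,
    le_refl, OfNat.ofNat_ne_zero, OfNat.ofNat_ne_one, one_ne_zero, nonpos_iff_eq_zero,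
    Nat.sub_zero, sub_zero, pow_zero, zero_sub, neg_zero, pow_one]
  try ring

lemma potentialCoeff_constantInitial_six (a w γ : ℝ) {D : PolySeries}
    (hD : ∀ i < 7, PowerSeries.coeff i D = if i = 0 then X else if i = 2 then C (1 / 4) * X ^ 2 else 0) :
    potentialCoeff D (constantInitial a w γ) 6 =
      C (34/7875*a^4 - 1/2*a*w^5*γ + a*w^4*γ^2 + 1/4*a*w^3*γ^3 + 1/2*a*w^3*γ - 7/6*a*w^2*γ^4
      - 1/2*a*w^2*γ^2 - 1/4*a*w*γ^3 + 7/18*a*γ^6 + 1/3*a*γ^4 + 11/3150*a : ℝ) + C (13/175*a^3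
      - 1/4*w^3*γ + 1/2*w^2*γ^2 + 1/4*w*γ - 1/4*γ^4 + 1/140 : ℝ) * X + C (1/10*a^2 : ℝ) * X ^ 2 := by
  refine Polynomial.funext fun y => ?_
  simp only [potentialCoeff, Finset.sum_range_succ, Finset.sum_range_zero, constantInitial,
    hD _ (show 6 < 7 by norm_num), hD _ (show 0 < 7 by norm_num), hD _ (show 1 < 7 by norm_num),
    hD _ (show 2 < 7 by norm_num), hD _ (show 3 < 7 by norm_num), hD _ (show 4 < 7 by norm_num),
    eval_add, eval_mul, eval_sub, eval_neg, eval_C, eval_X, eval_pow, eval_zero, eval_one,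
    eval_ofNat, derivative_add, derivative_C_mul, derivative_C, derivative_X, derivative_X_pow,
    derivative_zero, derivative_one, mul_zero, zero_mul, zero_add, add_zero, mul_one,
    Nat.reduceSub, Nat.reduceAdd, Nat.reduceLeDiff, Nat.reduceEqDiff, reduceIte, Nat.cast_ofNat,
    Nat.cast_one, tsub_self, le_refl, OfNat.ofNat_ne_zero, OfNat.ofNat_ne_one, one_ne_zero,
    nonpos_iff_eq_zero, Nat.sub_zero, sub_zero, pow_zero, zero_sub, neg_zero, pow_one]
  try ring

set_option maxHeartbeats 1000000 in
lemma formalStep_constantInitial_zero (a w γ : ℝ) {D B : PolySeries}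
    (hD : ∀ i < 7, PowerSeries.coeff i D = if i = 0 then X else if i = 2 then C (1 / 4) * X ^ 2 else 0)
    (hB : ∀ i < 5, PowerSeries.coeff i B = if i = 0 then 1 else if i = 2 then C (1 / 2) * X else 0) :
    FormalStep a w γ (1 / 2) D B 0 (constantInitial a w γ) := by
  refine ⟨fun h => by simp [constantInitial]; ring, ?_, ?_, ?_, ?_, ?_⟩
  · rw [coeff_innerEqA_ser]
    refine Polynomial.funext fun y => ?_
    simp only [Finset.sum_range_succ, Finset.sum_range_zero, leadA,
      potentialCoeff_constantInitial_zero a w γ hD, constantInitial, eval_add, eval_mul, eval_sub,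
      eval_neg, eval_C, eval_X, eval_pow, eval_zero, eval_one, eval_ofNat, derivative_add,
      derivative_C_mul, derivative_C, derivative_X, derivative_X_pow, derivative_zero,
      derivative_one, mul_zero, zero_mul, zero_add, add_zero, mul_one, Nat.reduceSub,
      Nat.reduceAdd, Nat.reduceLeDiff, Nat.reduceEqDiff, reduceIte, Nat.cast_ofNat, Nat.cast_one,
      tsub_self, le_refl, OfNat.ofNat_ne_zero, OfNat.ofNat_ne_one, one_ne_zero,
      nonpos_iff_eq_zero, Nat.sub_zero, sub_zero, pow_zero, zero_sub, neg_zero, pow_one]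
    try ring
  · rw [coeff_innerEqB_ser]
    refine Polynomial.funext fun y => ?_
    simp only [Finset.sum_range_succ, Finset.sum_range_zero, leadB,
      potentialCoeff_constantInitial_zero a w γ hD, constantInitial, eval_add, eval_mul, eval_sub,
      eval_neg, eval_C, eval_X, eval_pow, eval_zero, eval_one, eval_ofNat, derivative_add,
      derivative_C_mul, derivative_C, derivative_X, derivative_X_pow, derivative_zero,
      derivative_one, mul_zero, zero_mul, zero_add, add_zero, mul_one, Nat.reduceSub,
      Nat.reduceAdd, Nat.reduceLeDiff, Nat.reduceEqDiff, reduceIte, Nat.cast_ofNat, Nat.cast_one,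
      tsub_self, le_refl, OfNat.ofNat_ne_zero, OfNat.ofNat_ne_one, one_ne_zero,
      nonpos_iff_eq_zero, Nat.sub_zero, sub_zero, pow_zero, zero_sub, neg_zero, pow_one]
    try ring
  · rw [coeff_outerEq_ser]
    refine Polynomial.funext fun y => ?_
    simp only [Finset.sum_range_succ, Finset.sum_range_zero, leadS, outerSpectralCoeff,
      constantInitial, eval_add, eval_mul, eval_sub, eval_neg, eval_C, eval_X, eval_pow,
      eval_zero, eval_one, eval_ofNat, derivative_add, derivative_C_mul, derivative_C,
      derivative_X, derivative_X_pow, derivative_zero, derivative_one, mul_zero, zero_mul,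
      zero_add, add_zero, mul_one, Nat.reduceSub, Nat.reduceAdd, Nat.reduceLeDiff,
      Nat.reduceEqDiff, reduceIte, Nat.cast_ofNat, Nat.cast_one, tsub_self, le_refl,
      OfNat.ofNat_ne_zero, OfNat.ofNat_ne_one, one_ne_zero, nonpos_iff_eq_zero, Nat.sub_zero,
      sub_zero, pow_zero, zero_sub, neg_zero, pow_one]
    try ring
  · simp [constantInitial]
  · rintro l' h
    omega

set_option maxHeartbeats 1000000 in
lemma formalStep_constantInitial_one (a w γ : ℝ) {D B : PolySeries}
    (hD : ∀ i < 7, PowerSeries.coeff i D = if i = 0 then X else if i = 2 then C (1 / 4) * X ^ 2 else 0)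
    (hB : ∀ i < 5, PowerSeries.coeff i B = if i = 0 then 1 else if i = 2 then C (1 / 2) * X else 0) :
    FormalStep a w γ (1 / 2) D B 1 (constantInitial a w γ) := by
  refine ⟨fun h => by omega, ?_, ?_, ?_, ?_, ?_⟩
  · rw [coeff_innerEqA_ser]
    refine Polynomial.funext fun y => ?_
    simp only [Finset.sum_range_succ, Finset.sum_range_zero, leadA,
      potentialCoeff_constantInitial_zero a w γ hD, potentialCoeff_constantInitial_one a w γ hD,
      constantInitial, eval_add, eval_mul, eval_sub, eval_neg, eval_C, eval_X, eval_pow,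
      eval_zero, eval_one, eval_ofNat, derivative_add, derivative_C_mul, derivative_C,
      derivative_X, derivative_X_pow, derivative_zero, derivative_one, mul_zero, zero_mul,
      zero_add, add_zero, mul_one, Nat.reduceSub, Nat.reduceAdd, Nat.reduceLeDiff,
      Nat.reduceEqDiff, reduceIte, Nat.cast_ofNat, Nat.cast_one, tsub_self, le_refl,
      OfNat.ofNat_ne_zero, OfNat.ofNat_ne_one, one_ne_zero, nonpos_iff_eq_zero, Nat.sub_zero,
      sub_zero, pow_zero, zero_sub, neg_zero, pow_one]
    try ring
  · rw [coeff_innerEqB_ser]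
    refine Polynomial.funext fun y => ?_
    simp only [Finset.sum_range_succ, Finset.sum_range_zero, leadB,
      potentialCoeff_constantInitial_zero a w γ hD, potentialCoeff_constantInitial_one a w γ hD,
      constantInitial, eval_add, eval_mul, eval_sub, eval_neg, eval_C, eval_X, eval_pow,
      eval_zero, eval_one, eval_ofNat, derivative_add, derivative_C_mul, derivative_C,
      derivative_X, derivative_X_pow, derivative_zero, derivative_one, mul_zero, zero_mul,
      zero_add, add_zero, mul_one, Nat.reduceSub, Nat.reduceAdd, Nat.reduceLeDiff,
      Nat.reduceEqDiff, reduceIte, Nat.cast_ofNat, Nat.cast_one, tsub_self, le_refl,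
      OfNat.ofNat_ne_zero, OfNat.ofNat_ne_one, one_ne_zero, nonpos_iff_eq_zero, Nat.sub_zero,
      sub_zero, pow_zero, zero_sub, neg_zero, pow_one]
    try ring
  · rw [coeff_outerEq_ser]
    refine Polynomial.funext fun y => ?_
    simp only [Finset.sum_range_succ, Finset.sum_range_zero, leadS, outerSpectralCoeff,
      constantInitial, eval_add, eval_mul, eval_sub, eval_neg, eval_C, eval_X, eval_pow,
      eval_zero, eval_one, eval_ofNat, derivative_add, derivative_C_mul, derivative_C,
      derivative_X, derivative_X_pow, derivative_zero, derivative_one, mul_zero, zero_mul,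
      zero_add, add_zero, mul_one, Nat.reduceSub, Nat.reduceAdd, Nat.reduceLeDiff,
      Nat.reduceEqDiff, reduceIte, Nat.cast_ofNat, Nat.cast_one, tsub_self, le_refl,
      OfNat.ofNat_ne_zero, OfNat.ofNat_ne_one, one_ne_zero, nonpos_iff_eq_zero, Nat.sub_zero,
      sub_zero, pow_zero, zero_sub, neg_zero, pow_one]
    try ring
  · simp [constantInitial]
  · rintro l' h
    obtain rfl : l' = 0 := by omega
    simp [constantInitial, derivative_pow]
    try ring

set_option maxHeartbeats 1000000 in
lemma formalStep_constantInitial_two (a w γ : ℝ) {D B : PolySeries}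
    (hD : ∀ i < 7, PowerSeries.coeff i D = if i = 0 then X else if i = 2 then C (1 / 4) * X ^ 2 else 0)
    (hB : ∀ i < 5, PowerSeries.coeff i B = if i = 0 then 1 else if i = 2 then C (1 / 2) * X else 0) :
    FormalStep a w γ (1 / 2) D B 2 (constantInitial a w γ) := by
  refine ⟨fun h => by omega, ?_, ?_, ?_, ?_, ?_⟩
  · rw [coeff_innerEqA_ser]
    refine Polynomial.funext fun y => ?_
    simp only [Finset.sum_range_succ, Finset.sum_range_zero, leadA,
      potentialCoeff_constantInitial_zero a w γ hD, potentialCoeff_constantInitial_one a w γ hD,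
      potentialCoeff_constantInitial_two a w γ hD, constantInitial, hB _ (show 0 < 5 by norm_num),
      eval_add, eval_mul, eval_sub, eval_neg, eval_C, eval_X, eval_pow, eval_zero, eval_one,
      eval_ofNat, derivative_add, derivative_C_mul, derivative_C, derivative_X, derivative_X_pow,
      derivative_zero, derivative_one, mul_zero, zero_mul, zero_add, add_zero, mul_one,
      Nat.reduceSub, Nat.reduceAdd, Nat.reduceLeDiff, Nat.reduceEqDiff, reduceIte, Nat.cast_ofNat,
      Nat.cast_one, tsub_self, le_refl, OfNat.ofNat_ne_zero, OfNat.ofNat_ne_one, one_ne_zero,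
      nonpos_iff_eq_zero, Nat.sub_zero, sub_zero, pow_zero, zero_sub, neg_zero, pow_one]
    try ring
  · rw [coeff_innerEqB_ser]
    refine Polynomial.funext fun y => ?_
    simp only [Finset.sum_range_succ, Finset.sum_range_zero, leadB,
      potentialCoeff_constantInitial_zero a w γ hD, potentialCoeff_constantInitial_one a w γ hD,
      potentialCoeff_constantInitial_two a w γ hD, constantInitial, hB _ (show 0 < 5 by norm_num),
      eval_add, eval_mul, eval_sub, eval_neg, eval_C, eval_X, eval_pow, eval_zero, eval_one,
      eval_ofNat, derivative_add, derivative_C_mul, derivative_C, derivative_X, derivative_X_pow,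
      derivative_zero, derivative_one, mul_zero, zero_mul, zero_add, add_zero, mul_one,
      Nat.reduceSub, Nat.reduceAdd, Nat.reduceLeDiff, Nat.reduceEqDiff, reduceIte, Nat.cast_ofNat,
      Nat.cast_one, tsub_self, le_refl, OfNat.ofNat_ne_zero, OfNat.ofNat_ne_one, one_ne_zero,
      nonpos_iff_eq_zero, Nat.sub_zero, sub_zero, pow_zero, zero_sub, neg_zero, pow_one]
    try ring
  · rw [coeff_outerEq_ser]
    refine Polynomial.funext fun y => ?_
    simp only [Finset.sum_range_succ, Finset.sum_range_zero, leadS, outerSpectralCoeff,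
      constantInitial, eval_add, eval_mul, eval_sub, eval_neg, eval_C, eval_X, eval_pow,
      eval_zero, eval_one, eval_ofNat, derivative_add, derivative_C_mul, derivative_C,
      derivative_X, derivative_X_pow, derivative_zero, derivative_one, mul_zero, zero_mul,
      zero_add, add_zero, mul_one, Nat.reduceSub, Nat.reduceAdd, Nat.reduceLeDiff,
      Nat.reduceEqDiff, reduceIte, Nat.cast_ofNat, Nat.cast_one, tsub_self, le_refl,
      OfNat.ofNat_ne_zero, OfNat.ofNat_ne_one, one_ne_zero, nonpos_iff_eq_zero, Nat.sub_zero,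
      sub_zero, pow_zero, zero_sub, neg_zero, pow_one]
    try ring
  · simp [constantInitial]
  · rintro l' h
    obtain rfl : l' = 1 := by omega
    simp [constantInitial, derivative_pow]
    try ring

set_option maxHeartbeats 1000000 in
lemma formalStep_constantInitial_three (a w γ : ℝ) {D B : PolySeries}
    (hD : ∀ i < 7, PowerSeries.coeff i D = if i = 0 then X else if i = 2 then C (1 / 4) * X ^ 2 else 0)
    (hB : ∀ i < 5, PowerSeries.coeff i B = if i = 0 then 1 else if i = 2 then C (1 / 2) * X else 0) :
    FormalStep a w γ (1 / 2) D B 3 (constantInitial a w γ) := by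
  refine ⟨fun h => by omega, ?_, ?_, ?_, ?_, ?_⟩
  · rw [coeff_innerEqA_ser]
    refine Polynomial.funext fun y => ?_
    simp only [Finset.sum_range_succ, Finset.sum_range_zero, leadA,
      potentialCoeff_constantInitial_zero a w γ hD, potentialCoeff_constantInitial_one a w γ hD,
      potentialCoeff_constantInitial_two a w γ hD, potentialCoeff_constantInitial_three a w γ hD,
      constantInitial, hB _ (show 0 < 5 by norm_num), hB _ (show 1 < 5 by norm_num), eval_add,
      eval_mul, eval_sub, eval_neg, eval_C, eval_X, eval_pow, eval_zero, eval_one, eval_ofNat,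
      derivative_add, derivative_C_mul, derivative_C, derivative_X, derivative_X_pow,
      derivative_zero, derivative_one, mul_zero, zero_mul, zero_add, add_zero, mul_one,
      Nat.reduceSub, Nat.reduceAdd, Nat.reduceLeDiff, Nat.reduceEqDiff, reduceIte, Nat.cast_ofNat,
      Nat.cast_one, tsub_self, le_refl, OfNat.ofNat_ne_zero, OfNat.ofNat_ne_one, one_ne_zero,
      nonpos_iff_eq_zero, Nat.sub_zero, sub_zero, pow_zero, zero_sub, neg_zero, pow_one]
    try ring
  · rw [coeff_innerEqB_ser]
    refine Polynomial.funext fun y => ?_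
    simp only [Finset.sum_range_succ, Finset.sum_range_zero, leadB,
      potentialCoeff_constantInitial_zero a w γ hD, potentialCoeff_constantInitial_one a w γ hD,
      potentialCoeff_constantInitial_two a w γ hD, potentialCoeff_constantInitial_three a w γ hD,
      constantInitial, hB _ (show 0 < 5 by norm_num), hB _ (show 1 < 5 by norm_num), eval_add,
      eval_mul, eval_sub, eval_neg, eval_C, eval_X, eval_pow, eval_zero, eval_one, eval_ofNat,
      derivative_add, derivative_C_mul, derivative_C, derivative_X, derivative_X_pow,
      derivative_zero, derivative_one, mul_zero, zero_mul, zero_add, add_zero, mul_one,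
      Nat.reduceSub, Nat.reduceAdd, Nat.reduceLeDiff, Nat.reduceEqDiff, reduceIte, Nat.cast_ofNat,
      Nat.cast_one, tsub_self, le_refl, OfNat.ofNat_ne_zero, OfNat.ofNat_ne_one, one_ne_zero,
      nonpos_iff_eq_zero, Nat.sub_zero, sub_zero, pow_zero, zero_sub, neg_zero, pow_one]
    try ring
  · rw [coeff_outerEq_ser]
    refine Polynomial.funext fun y => ?_
    simp only [Finset.sum_range_succ, Finset.sum_range_zero, leadS, outerSpectralCoeff,
      constantInitial, eval_add, eval_mul, eval_sub, eval_neg, eval_C, eval_X, eval_pow,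
      eval_zero, eval_one, eval_ofNat, derivative_add, derivative_C_mul, derivative_C,
      derivative_X, derivative_X_pow, derivative_zero, derivative_one, mul_zero, zero_mul,
      zero_add, add_zero, mul_one, Nat.reduceSub, Nat.reduceAdd, Nat.reduceLeDiff,
      Nat.reduceEqDiff, reduceIte, Nat.cast_ofNat, Nat.cast_one, tsub_self, le_refl,
      OfNat.ofNat_ne_zero, OfNat.ofNat_ne_one, one_ne_zero, nonpos_iff_eq_zero, Nat.sub_zero,
      sub_zero, pow_zero, zero_sub, neg_zero, pow_one]
    try ring
  · simp [constantInitial]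
  · rintro l' h
    obtain rfl : l' = 2 := by omega
    simp [constantInitial, derivative_pow]
    try ring

set_option maxHeartbeats 1000000 in
lemma formalStep_constantInitial_four (a w γ : ℝ) {D B : PolySeries}
    (hD : ∀ i < 7, PowerSeries.coeff i D = if i = 0 then X else if i = 2 then C (1 / 4) * X ^ 2 else 0)
    (hB : ∀ i < 5, PowerSeries.coeff i B = if i = 0 then 1 else if i = 2 then C (1 / 2) * X else 0) :
    FormalStep a w γ (1 / 2) D B 4 (constantInitial a w γ) := by
  refine ⟨fun h => by omega, ?_, ?_, ?_, ?_, ?_⟩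
  · rw [coeff_innerEqA_ser]
    refine Polynomial.funext fun y => ?_
    simp only [Finset.sum_range_succ, Finset.sum_range_zero, leadA,
      potentialCoeff_constantInitial_zero a w γ hD, potentialCoeff_constantInitial_one a w γ hD,
      potentialCoeff_constantInitial_two a w γ hD, potentialCoeff_constantInitial_three a w γ hD,
      potentialCoeff_constantInitial_four a w γ hD, constantInitial,
      hB _ (show 0 < 5 by norm_num), hB _ (show 1 < 5 by norm_num), hB _ (show 2 < 5 by norm_num),
      eval_add, eval_mul, eval_sub, eval_neg, eval_C, eval_X, eval_pow, eval_zero, eval_one,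
      eval_ofNat, derivative_add, derivative_C_mul, derivative_C, derivative_X, derivative_X_pow,
      derivative_zero, derivative_one, mul_zero, zero_mul, zero_add, add_zero, mul_one,
      Nat.reduceSub, Nat.reduceAdd, Nat.reduceLeDiff, Nat.reduceEqDiff, reduceIte, Nat.cast_ofNat,
      Nat.cast_one, tsub_self, le_refl, OfNat.ofNat_ne_zero, OfNat.ofNat_ne_one, one_ne_zero,
      nonpos_iff_eq_zero, Nat.sub_zero, sub_zero, pow_zero, zero_sub, neg_zero, pow_one]
    try ring
  · rw [coeff_innerEqB_ser]
    refine Polynomial.funext fun y => ?_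
    simp only [Finset.sum_range_succ, Finset.sum_range_zero, leadB,
      potentialCoeff_constantInitial_zero a w γ hD, potentialCoeff_constantInitial_one a w γ hD,
      potentialCoeff_constantInitial_two a w γ hD, potentialCoeff_constantInitial_three a w γ hD,
      potentialCoeff_constantInitial_four a w γ hD, constantInitial,
      hB _ (show 0 < 5 by norm_num), hB _ (show 1 < 5 by norm_num), hB _ (show 2 < 5 by norm_num),
      eval_add, eval_mul, eval_sub, eval_neg, eval_C, eval_X, eval_pow, eval_zero, eval_one,
      eval_ofNat, derivative_add, derivative_C_mul, derivative_C, derivative_X, derivative_X_pow,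
      derivative_zero, derivative_one, mul_zero, zero_mul, zero_add, add_zero, mul_one,
      Nat.reduceSub, Nat.reduceAdd, Nat.reduceLeDiff, Nat.reduceEqDiff, reduceIte, Nat.cast_ofNat,
      Nat.cast_one, tsub_self, le_refl, OfNat.ofNat_ne_zero, OfNat.ofNat_ne_one, one_ne_zero,
      nonpos_iff_eq_zero, Nat.sub_zero, sub_zero, pow_zero, zero_sub, neg_zero, pow_one]
    try ring
  · rw [coeff_outerEq_ser]
    refine Polynomial.funext fun y => ?_
    simp only [Finset.sum_range_succ, Finset.sum_range_zero, leadS, outerSpectralCoeff,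
      constantInitial, eval_add, eval_mul, eval_sub, eval_neg, eval_C, eval_X, eval_pow,
      eval_zero, eval_one, eval_ofNat, derivative_add, derivative_C_mul, derivative_C,
      derivative_X, derivative_X_pow, derivative_zero, derivative_one, mul_zero, zero_mul,
      zero_add, add_zero, mul_one, Nat.reduceSub, Nat.reduceAdd, Nat.reduceLeDiff,
      Nat.reduceEqDiff, reduceIte, Nat.cast_ofNat, Nat.cast_one, tsub_self, le_refl,
      OfNat.ofNat_ne_zero, OfNat.ofNat_ne_one, one_ne_zero, nonpos_iff_eq_zero, Nat.sub_zero,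
      sub_zero, pow_zero, zero_sub, neg_zero, pow_one]
    try ring
  · simp [constantInitial]
  · rintro l' h
    obtain rfl : l' = 3 := by omega
    simp [constantInitial, derivative_pow]
    try ring

set_option maxHeartbeats 1000000 in
lemma formalStep_constantInitial_five (a w γ : ℝ) {D B : PolySeries}
    (hD : ∀ i < 7, PowerSeries.coeff i D = if i = 0 then X else if i = 2 then C (1 / 4) * X ^ 2 else 0)
    (hB : ∀ i < 5, PowerSeries.coeff i B = if i = 0 then 1 else if i = 2 then C (1 / 2) * X else 0) :
    FormalStep a w γ (1 / 2) D B 5 (constantInitial a w γ) := by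
  refine ⟨fun h => by omega, ?_, ?_, ?_, ?_, ?_⟩
  · rw [coeff_innerEqA_ser]
    refine Polynomial.funext fun y => ?_
    simp only [Finset.sum_range_succ, Finset.sum_range_zero, leadA,
      potentialCoeff_constantInitial_zero a w γ hD, potentialCoeff_constantInitial_one a w γ hD,
      potentialCoeff_constantInitial_two a w γ hD, potentialCoeff_constantInitial_three a w γ hD,
      potentialCoeff_constantInitial_four a w γ hD, potentialCoeff_constantInitial_five a w γ hD,
      constantInitial, hB _ (show 0 < 5 by norm_num), hB _ (show 1 < 5 by norm_num),
      hB _ (show 2 < 5 by norm_num), hB _ (show 3 < 5 by norm_num), eval_add, eval_mul, eval_sub,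
      eval_neg, eval_C, eval_X, eval_pow, eval_zero, eval_one, eval_ofNat, derivative_add,
      derivative_C_mul, derivative_C, derivative_X, derivative_X_pow, derivative_zero,
      derivative_one, mul_zero, zero_mul, zero_add, add_zero, mul_one, Nat.reduceSub,
      Nat.reduceAdd, Nat.reduceLeDiff, Nat.reduceEqDiff, reduceIte, Nat.cast_ofNat, Nat.cast_one,
      tsub_self, le_refl, OfNat.ofNat_ne_zero, OfNat.ofNat_ne_one, one_ne_zero,
      nonpos_iff_eq_zero, Nat.sub_zero, sub_zero, pow_zero, zero_sub, neg_zero, pow_one]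
    try ring
  · rw [coeff_innerEqB_ser]
    refine Polynomial.funext fun y => ?_
    simp only [Finset.sum_range_succ, Finset.sum_range_zero, leadB,
      potentialCoeff_constantInitial_zero a w γ hD, potentialCoeff_constantInitial_one a w γ hD,
      potentialCoeff_constantInitial_two a w γ hD, potentialCoeff_constantInitial_three a w γ hD,
      potentialCoeff_constantInitial_four a w γ hD, potentialCoeff_constantInitial_five a w γ hD,
      constantInitial, hB _ (show 0 < 5 by norm_num), hB _ (show 1 < 5 by norm_num),
      hB _ (show 2 < 5 by norm_num), hB _ (show 3 < 5 by norm_num), eval_add, eval_mul, eval_sub,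
      eval_neg, eval_C, eval_X, eval_pow, eval_zero, eval_one, eval_ofNat, derivative_add,
      derivative_C_mul, derivative_C, derivative_X, derivative_X_pow, derivative_zero,
      derivative_one, mul_zero, zero_mul, zero_add, add_zero, mul_one, Nat.reduceSub,
      Nat.reduceAdd, Nat.reduceLeDiff, Nat.reduceEqDiff, reduceIte, Nat.cast_ofNat, Nat.cast_one,
      tsub_self, le_refl, OfNat.ofNat_ne_zero, OfNat.ofNat_ne_one, one_ne_zero,
      nonpos_iff_eq_zero, Nat.sub_zero, sub_zero, pow_zero, zero_sub, neg_zero, pow_one]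
    try ring
  · rw [coeff_outerEq_ser]
    refine Polynomial.funext fun y => ?_
    simp only [Finset.sum_range_succ, Finset.sum_range_zero, leadS, outerSpectralCoeff,
      constantInitial, eval_add, eval_mul, eval_sub, eval_neg, eval_C, eval_X, eval_pow,
      eval_zero, eval_one, eval_ofNat, derivative_add, derivative_C_mul, derivative_C,
      derivative_X, derivative_X_pow, derivative_zero, derivative_one, mul_zero, zero_mul,
      zero_add, add_zero, mul_one, Nat.reduceSub, Nat.reduceAdd, Nat.reduceLeDiff,
      Nat.reduceEqDiff, reduceIte, Nat.cast_ofNat, Nat.cast_one, tsub_self, le_refl,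
      OfNat.ofNat_ne_zero, OfNat.ofNat_ne_one, one_ne_zero, nonpos_iff_eq_zero, Nat.sub_zero,
      sub_zero, pow_zero, zero_sub, neg_zero, pow_one]
    try ring
  · simp [constantInitial]
  · rintro l' h
    obtain rfl : l' = 4 := by omega
    simp [constantInitial, derivative_pow]
    try ring

set_option maxHeartbeats 1000000 in
lemma formalStep_constantInitial_six (a w γ : ℝ) {D B : PolySeries}
    (hD : ∀ i < 7, PowerSeries.coeff i D = if i = 0 then X else if i = 2 then C (1 / 4) * X ^ 2 else 0)
    (hB : ∀ i < 5, PowerSeries.coeff i B = if i = 0 then 1 else if i = 2 then C (1 / 2) * X else 0) :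
    FormalStep a w γ (1 / 2) D B 6 (constantInitial a w γ) := by
  refine ⟨fun h => by omega, ?_, ?_, ?_, ?_, ?_⟩
  · rw [coeff_innerEqA_ser]
    refine Polynomial.funext fun y => ?_
    simp only [Finset.sum_range_succ, Finset.sum_range_zero, leadA,
      potentialCoeff_constantInitial_zero a w γ hD, potentialCoeff_constantInitial_one a w γ hD,
      potentialCoeff_constantInitial_two a w γ hD, potentialCoeff_constantInitial_three a w γ hD,
      potentialCoeff_constantInitial_four a w γ hD, potentialCoeff_constantInitial_five a w γ hD,
      potentialCoeff_constantInitial_six a w γ hD, constantInitial, hB _ (show 0 < 5 by norm_num),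
      hB _ (show 1 < 5 by norm_num), hB _ (show 2 < 5 by norm_num), hB _ (show 3 < 5 by norm_num),
      hB _ (show 4 < 5 by norm_num), eval_add, eval_mul, eval_sub, eval_neg, eval_C, eval_X,
      eval_pow, eval_zero, eval_one, eval_ofNat, derivative_add, derivative_C_mul, derivative_C,
      derivative_X, derivative_X_pow, derivative_zero, derivative_one, mul_zero, zero_mul,
      zero_add, add_zero, mul_one, Nat.reduceSub, Nat.reduceAdd, Nat.reduceLeDiff,
      Nat.reduceEqDiff, reduceIte, Nat.cast_ofNat, Nat.cast_one, tsub_self, le_refl,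
      OfNat.ofNat_ne_zero, OfNat.ofNat_ne_one, one_ne_zero, nonpos_iff_eq_zero, Nat.sub_zero,
      sub_zero, pow_zero, zero_sub, neg_zero, pow_one]
    try ring
  · rw [coeff_innerEqB_ser]
    refine Polynomial.funext fun y => ?_
    simp only [Finset.sum_range_succ, Finset.sum_range_zero, leadB,
      potentialCoeff_constantInitial_zero a w γ hD, potentialCoeff_constantInitial_one a w γ hD,
      potentialCoeff_constantInitial_two a w γ hD, potentialCoeff_constantInitial_three a w γ hD,
      potentialCoeff_constantInitial_four a w γ hD, potentialCoeff_constantInitial_five a w γ hD,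
      potentialCoeff_constantInitial_six a w γ hD, constantInitial, hB _ (show 0 < 5 by norm_num),
      hB _ (show 1 < 5 by norm_num), hB _ (show 2 < 5 by norm_num), hB _ (show 3 < 5 by norm_num),
      hB _ (show 4 < 5 by norm_num), eval_add, eval_mul, eval_sub, eval_neg, eval_C, eval_X,
      eval_pow, eval_zero, eval_one, eval_ofNat, derivative_add, derivative_C_mul, derivative_C,
      derivative_X, derivative_X_pow, derivative_zero, derivative_one, mul_zero, zero_mul,
      zero_add, add_zero, mul_one, Nat.reduceSub, Nat.reduceAdd, Nat.reduceLeDiff,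
      Nat.reduceEqDiff, reduceIte, Nat.cast_ofNat, Nat.cast_one, tsub_self, le_refl,
      OfNat.ofNat_ne_zero, OfNat.ofNat_ne_one, one_ne_zero, nonpos_iff_eq_zero, Nat.sub_zero,
      sub_zero, pow_zero, zero_sub, neg_zero, pow_one]
    try ring
  · rw [coeff_outerEq_ser]
    refine Polynomial.funext fun y => ?_
    simp only [Finset.sum_range_succ, Finset.sum_range_zero, leadS, outerSpectralCoeff,
      constantInitial, eval_add, eval_mul, eval_sub, eval_neg, eval_C, eval_X, eval_pow,
      eval_zero, eval_one, eval_ofNat, derivative_add, derivative_C_mul, derivative_C,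
      derivative_X, derivative_X_pow, derivative_zero, derivative_one, mul_zero, zero_mul,
      zero_add, add_zero, mul_one, Nat.reduceSub, Nat.reduceAdd, Nat.reduceLeDiff,
      Nat.reduceEqDiff, reduceIte, Nat.cast_ofNat, Nat.cast_one, tsub_self, le_refl,
      OfNat.ofNat_ne_zero, OfNat.ofNat_ne_one, one_ne_zero, nonpos_iff_eq_zero, Nat.sub_zero,
      sub_zero, pow_zero, zero_sub, neg_zero, pow_one]
    try ring
  · simp [constantInitial]
  · rintro l' h
    obtain rfl : l' = 5 := by omega
    simp [constantInitial, derivative_pow]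
    try ring

end FormalSolutions

/-! ### Calculus of asymptotic expansions in powers of the small parameter -/

/-- Partial sums of a formal series with functions as coefficients. -/
noncomputable def seriesSum (F : PowerSeries (ℝ → ℝ)) (N : ℕ) (ε y : ℝ) : ℝ :=
  ∑ l ∈ Finset.range N, ε ^ l * PowerSeries.coeff l F y

/-- `g ∼ G` on `𝒟`, with remainders of polynomial growth in the second variable. -/
def PolyExp (𝒟 : Set (ℝ × ℝ)) (g : ℝ → ℝ → ℝ) (G : PowerSeries (ℝ → ℝ)) : Prop :=
  ∀ N, ∃ (a : ℕ) (C : ℝ), 0 ≤ C ∧ ∀ ε y, (ε, y) ∈ 𝒟 →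
    |g ε y - seriesSum G N ε y| ≤ C * (1 + |y|) ^ a * ε ^ N

/-- `f ∼ F` on `𝒟`, with remainders that decrease rapidly in the second variable. -/
def RapidExp (𝒟 : Set (ℝ × ℝ)) (f : ℝ → ℝ → ℝ) (F : PowerSeries (ℝ → ℝ)) : Prop :=
  ∀ N a : ℕ, ∃ C : ℝ, 0 ≤ C ∧ ∀ ε y, (ε, y) ∈ 𝒟 →
    (1 + |y|) ^ a * |f ε y - seriesSum F N ε y| ≤ C * ε ^ N

/-- The first variable is positive and bounded on `𝒟`. -/
def SmallParam (𝒟 : Set (ℝ × ℝ)) (E : ℝ) : Prop := ∀ ε y, (ε, y) ∈ 𝒟 → 0 < ε ∧ ε ≤ E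

section Expansions

variable {𝒟 : Set (ℝ × ℝ)} {E : ℝ} {f g : ℝ → ℝ → ℝ} {F G : PowerSeries (ℝ → ℝ)}

lemma seriesSum_succ (F : PowerSeries (ℝ → ℝ)) (N : ℕ) (ε y : ℝ) :
    seriesSum F (N + 1) ε y = seriesSum F N ε y + ε ^ N * PowerSeries.coeff N F y :=
  Finset.sum_range_succ _ _

lemma seriesSum_add (F G : PowerSeries (ℝ → ℝ)) (N : ℕ) (ε y : ℝ) :
    seriesSum (F + G) N ε y = seriesSum F N ε y + seriesSum G N ε y := by
  simp [seriesSum, mul_add, Finset.sum_add_distrib]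

/-- The truncated product is regrouped so that each coefficient of F meets the partial sum of G of
complementary length. Comparing that sum with the function expanded by G gives the product remainder
term by term. -/
lemma seriesSum_mul (F G : PowerSeries (ℝ → ℝ)) (N : ℕ) (ε y : ℝ) :
    seriesSum (F * G) N ε y =
      ∑ i ∈ Finset.range N, ε ^ i * PowerSeries.coeff i F y * seriesSum G (N - i) ε y := by
  induction N with
  | zero => simp [seriesSum]
  | succ N ih =>
    rw [seriesSum_succ, ih, Finset.sum_range_succ, coeff_mul_range, Finset.sum_apply,
      Finset.sum_range_succ, mul_add, ← add_assoc]
    have h : ∀ i ∈ Finset.range N, ε ^ i * PowerSeries.coeff i F y * seriesSum G (N + 1 - i) ε y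
        = ε ^ i * PowerSeries.coeff i F y * seriesSum G (N - i) ε y
          + ε ^ N * (PowerSeries.coeff i F * PowerSeries.coeff (N - i) G) y := fun i hi => by
      have hi' : i ≤ N := (Finset.mem_range.1 hi).le
      rw [show N + 1 - i = N - i + 1 by omega, seriesSum_succ, Pi.mul_apply]
      rw [mul_add, ← mul_assoc, ← mul_assoc,
        show ε ^ N = ε ^ i * ε ^ (N - i) by rw [← pow_add, Nat.add_sub_cancel' hi']]
      ring
    rw [Finset.sum_congr rfl h, Finset.sum_add_distrib, Finset.mul_sum]
    simp [seriesSum]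
    ring

lemma seriesSum_monomial (n N : ℕ) (c : ℝ → ℝ) (ε y : ℝ) :
    seriesSum (PowerSeries.monomial n c) N ε y = if n < N then ε ^ n * c y else 0 := by
  rw [seriesSum]
  have : ∀ l, ε ^ l * PowerSeries.coeff l (PowerSeries.monomial n c) y
      = if n = l then ε ^ n * c y else 0 := fun l => by
    rw [PowerSeries.coeff_monomial]
    split_ifs with h1 h2 h2
    · rw [h1]
    · omega
    · omega
    · simp
  rw [Finset.sum_congr rfl fun l _ => this l, Finset.sum_ite_eq]
  simp

lemma RapidExp.add (hf : RapidExp 𝒟 f F) (hg : RapidExp 𝒟 g G) :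
    RapidExp 𝒟 (fun ε y => f ε y + g ε y) (F + G) := by
  intro N a
  obtain ⟨C, hC, h⟩ := hf N a
  obtain ⟨C', hC', h'⟩ := hg N a
  refine ⟨C + C', by positivity, fun ε y hy => ?_⟩
  rw [seriesSum_add, add_mul]
  refine le_trans ?_ (add_le_add (h ε y hy) (h' ε y hy))
  rw [← mul_add]
  gcongr
  rw [show f ε y + g ε y - (seriesSum F N ε y + seriesSum G N ε y)
    = (f ε y - seriesSum F N ε y) + (g ε y - seriesSum G N ε y) by ring]
  exact abs_add_le _ _

/-- Two consecutive remainders differ by ε^l times the coefficient; division by ε^l > 0 yields its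
decay at the points y that occur in 𝒟. -/
lemma RapidExp.coeff_bound (hE : SmallParam 𝒟 E) (hf : RapidExp 𝒟 f F) (l a : ℕ) :
    ∃ C : ℝ, 0 ≤ C ∧ ∀ ε y, (ε, y) ∈ 𝒟 → (1 + |y|) ^ a * |PowerSeries.coeff l F y| ≤ C := by
  obtain ⟨C, hC, h⟩ := hf l a
  obtain ⟨C', hC', h'⟩ := hf (l + 1) a
  refine ⟨C + C' * |E|, by positivity, fun ε y hy => ?_⟩
  obtain ⟨h0, h1⟩ := hE ε y hy
  have hp : 0 < ε ^ l := by positivity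
  refine le_of_mul_le_mul_right ?_ hp
  calc (1 + |y|) ^ a * |PowerSeries.coeff l F y| * ε ^ l
      = (1 + |y|) ^ a * |ε ^ l * PowerSeries.coeff l F y| := by
        rw [abs_mul, abs_of_pos hp]; ring
    _ = (1 + |y|) ^ a *
        |(f ε y - seriesSum F l ε y) - (f ε y - seriesSum F (l + 1) ε y)| := by
        rw [seriesSum_succ]; congr 2; ring
    _ ≤ (1 + |y|) ^ a * |f ε y - seriesSum F l ε y|
        + (1 + |y|) ^ a * |f ε y - seriesSum F (l + 1) ε y| := by
        rw [← mul_add]; gcongr; exact abs_sub _ _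
    _ ≤ C * ε ^ l + C' * ε ^ (l + 1) := add_le_add (h ε y hy) (h' ε y hy)
    _ = (C + C' * ε) * ε ^ l := by ring
    _ ≤ (C + C' * |E|) * ε ^ l := by
        gcongr
        exact h1.trans (le_abs_self E)

lemma PolyExp.add (hf : PolyExp 𝒟 f F) (hg : PolyExp 𝒟 g G) (hE : SmallParam 𝒟 E) :
    PolyExp 𝒟 (fun ε y => f ε y + g ε y) (F + G) := by
  intro N
  obtain ⟨a, C, hC, h⟩ := hf N
  obtain ⟨a', C', hC', h'⟩ := hg N
  refine ⟨a + a', C + C', by positivity, fun ε y hy => ?_⟩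
  obtain ⟨h0, _⟩ := hE ε y hy
  have h1 : (1 : ℝ) ≤ 1 + |y| := by linarith [abs_nonneg y]
  rw [seriesSum_add, add_mul, add_mul,
    show f ε y + g ε y - (seriesSum F N ε y + seriesSum G N ε y)
    = (f ε y - seriesSum F N ε y) + (g ε y - seriesSum G N ε y) by ring]
  refine (abs_add_le _ _).trans (add_le_add ((h ε y hy).trans ?_) ((h' ε y hy).trans ?_))
  · gcongr; omega
  · gcongr; omega

/-- The remainder of the product splits into the remainder of f times g, and coefficients of f times
remainders of g. Polynomial growth of g is paid for by a larger decay weight on f, which is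
available at every order. -/
lemma PolyExp.mul_rapid (hE : SmallParam 𝒟 E) (hg : PolyExp 𝒟 g G) (hf : RapidExp 𝒟 f F) :
    RapidExp 𝒟 (fun ε y => g ε y * f ε y) (G * F) := by
  intro N a
  obtain ⟨b, B, hB, hg0⟩ := hg 0
  choose b' B' hB' hgN using hg
  obtain ⟨C, hC, hfN⟩ := hf N (a + b)
  choose C' hC' hfc using fun i => hf.coeff_bound hE i (a + b' (N - i))
  refine ⟨C * B + ∑ i ∈ Finset.range N, C' i * B' (N - i), add_nonneg (by positivity)
    (Finset.sum_nonneg fun i _ => mul_nonneg (hC' i) (hB' _)), fun ε y hy => ?_⟩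
  obtain ⟨h0, h1⟩ := hE ε y hy
  have key : g ε y * f ε y - seriesSum (G * F) N ε y =
      (f ε y - seriesSum F N ε y) * g ε y + ∑ i ∈ Finset.range N,
        ε ^ i * PowerSeries.coeff i F y * (g ε y - seriesSum G (N - i) ε y) := by
    rw [mul_comm G F, seriesSum_mul]
    simp only [mul_sub, Finset.sum_sub_distrib, ← Finset.sum_mul]
    rw [seriesSum]; ring
  have hg0' : |g ε y| ≤ B * (1 + |y|) ^ b := by simpa [seriesSum] using hg0 ε y hy
  rw [key]
  refine (mul_le_mul_of_nonneg_left (abs_add_le _ _) (by positivity)).trans ?_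
  rw [mul_add, add_mul]
  refine add_le_add ?_ ?_
  · calc (1 + |y|) ^ a * |(f ε y - seriesSum F N ε y) * g ε y|
        = (1 + |y|) ^ a * |f ε y - seriesSum F N ε y| * |g ε y| := by rw [abs_mul]; ring
      _ ≤ (1 + |y|) ^ a * |f ε y - seriesSum F N ε y| * (B * (1 + |y|) ^ b) := by gcongr
      _ = (1 + |y|) ^ (a + b) * |f ε y - seriesSum F N ε y| * B := by rw [pow_add]; ring
      _ ≤ C * ε ^ N * B := mul_le_mul_of_nonneg_right (hfN ε y hy) hB
      _ = C * B * ε ^ N := by ring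
  · rw [Finset.sum_mul]
    refine (mul_le_mul_of_nonneg_left (Finset.abs_sum_le_sum_abs _ _) (by positivity)).trans ?_
    rw [Finset.mul_sum]
    refine Finset.sum_le_sum fun i hi => ?_
    have hi' : i ≤ N := (Finset.mem_range.1 hi).le
    calc (1 + |y|) ^ a * |ε ^ i * PowerSeries.coeff i F y * (g ε y - seriesSum G (N - i) ε y)|
        = ε ^ i * ((1 + |y|) ^ a * |PowerSeries.coeff i F y|)
            * |g ε y - seriesSum G (N - i) ε y| := by
          rw [abs_mul, abs_mul, abs_of_pos (pow_pos h0 i)]; ring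
      _ ≤ ε ^ i * ((1 + |y|) ^ a * |PowerSeries.coeff i F y|)
            * (B' (N - i) * (1 + |y|) ^ b' (N - i) * ε ^ (N - i)) := by
          gcongr; exact hgN _ ε y hy
      _ = ((1 + |y|) ^ (a + b' (N - i)) * |PowerSeries.coeff i F y|) * B' (N - i)
            * (ε ^ i * ε ^ (N - i)) := by rw [pow_add]; ring
      _ = ((1 + |y|) ^ (a + b' (N - i)) * |PowerSeries.coeff i F y|) * B' (N - i) * ε ^ N := by
          rw [← pow_add, Nat.add_sub_cancel' hi']
      _ ≤ C' i * B' (N - i) * ε ^ N := by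
          gcongr
          exacts [hB' _, hfc i ε y hy]

lemma polyExp_monomial (hE : SmallParam 𝒟 E) (n : ℕ) {c : ℝ → ℝ} {a : ℕ} {C : ℝ}
    (hc : ∀ y, |c y| ≤ C * (1 + |y|) ^ a) :
    PolyExp 𝒟 (fun ε y => ε ^ n * c y) (PowerSeries.monomial n c) := by
  have hC : 0 ≤ C := by
    have := (abs_nonneg _).trans (hc 0)
    simpa using this
  intro N
  refine ⟨a, C * |E| ^ (n - N), by positivity, fun ε y hy => ?_⟩
  obtain ⟨h0, h1⟩ := hE ε y hy
  rw [seriesSum_monomial]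
  split_ifs with h
  · simp only [sub_self, abs_zero]; positivity
  · rw [sub_zero, abs_mul, abs_of_pos (pow_pos h0 n)]
    calc ε ^ n * |c y| ≤ (|E| ^ (n - N) * ε ^ N) * (C * (1 + |y|) ^ a) := by
          gcongr ?_ * ?_
          · rw [← Nat.sub_add_cancel (not_lt.1 h), pow_add, Nat.sub_add_cancel (not_lt.1 h)]
            gcongr
            exact h1.trans (le_abs_self E)
          · exact hc y
      _ = _ := by ring

lemma polyExp_const (hE : SmallParam 𝒟 E) (n : ℕ) (c : ℝ) :
    PolyExp 𝒟 (fun ε _ => ε ^ n * c) (PowerSeries.monomial n fun _ => c) :=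
  polyExp_monomial hE n (c := fun _ => c) (a := 0) (C := |c|) fun _ => by simp

lemma polyExp_linear (hE : SmallParam 𝒟 E) (n : ℕ) (c : ℝ) :
    PolyExp 𝒟 (fun ε y => ε ^ n * (c * y)) (PowerSeries.monomial n fun y => c * y) :=
  polyExp_monomial hE n (c := fun y => c * y) (a := 1) (C := |c|) fun y => by
    rw [abs_mul, pow_one]
    gcongr
    linarith

/-- It is enough to estimate remainders of arbitrarily high order. -/
lemma polyExp_of_frequently (hE : SmallParam 𝒟 E)
    (hc : ∀ l, ∃ (a : ℕ) (C : ℝ), ∀ ε y, (ε, y) ∈ 𝒟 →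
      |PowerSeries.coeff l G y| ≤ C * (1 + |y|) ^ a)
    (h : ∀ N, ∃ M ≥ N, ∃ (a : ℕ) (C : ℝ), 0 ≤ C ∧ ∀ ε y, (ε, y) ∈ 𝒟 →
      |g ε y - seriesSum G M ε y| ≤ C * (1 + |y|) ^ a * ε ^ M) :
    PolyExp 𝒟 g G := by
  have step : ∀ M, (∃ (a : ℕ) (C : ℝ), 0 ≤ C ∧ ∀ ε y, (ε, y) ∈ 𝒟 →
      |g ε y - seriesSum G (M + 1) ε y| ≤ C * (1 + |y|) ^ a * ε ^ (M + 1)) →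
      ∃ (a : ℕ) (C : ℝ), 0 ≤ C ∧ ∀ ε y, (ε, y) ∈ 𝒟 →
      |g ε y - seriesSum G M ε y| ≤ C * (1 + |y|) ^ a * ε ^ M := by
    rintro M ⟨a, C, hC, h⟩
    obtain ⟨b, B, hB⟩ := hc M
    refine ⟨a + b, C * |E| + |B|, by positivity, fun ε y hy => ?_⟩
    obtain ⟨h0, h1⟩ := hE ε y hy
    have hy1 : (1 : ℝ) ≤ 1 + |y| := by linarith [abs_nonneg y]
    have e : g ε y - seriesSum G M ε y
        = (g ε y - seriesSum G (M + 1) ε y) + ε ^ M * PowerSeries.coeff M G y := by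
      rw [seriesSum_succ]; ring
    rw [e]
    refine (abs_add_le _ _).trans ?_
    rw [add_mul, add_mul]
    refine add_le_add ((h ε y hy).trans ?_) ?_
    · rw [pow_succ]
      calc C * (1 + |y|) ^ a * (ε ^ M * ε) ≤ C * (1 + |y|) ^ (a + b) * (ε ^ M * |E|) := by
            gcongr
            exacts [by omega, h1.trans (le_abs_self E)]
        _ = _ := by ring
    · rw [abs_mul, abs_of_pos (pow_pos h0 M)]
      calc ε ^ M * |PowerSeries.coeff M G y| ≤ ε ^ M * (|B| * (1 + |y|) ^ (a + b)) := by
            gcongr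
            refine (hB ε y hy).trans ?_
            gcongr
            exacts [le_abs_self B, by omega]
        _ = _ := by ring
  intro N
  obtain ⟨M, hM, hN⟩ := h N
  obtain ⟨d, rfl⟩ := Nat.exists_eq_add_of_le hM
  clear hM
  induction d with
  | zero => exact hN
  | succ d ih => exact ih (step _ hN)

/-- Substitution of the scaled variable in a Taylor expansion. -/
lemma polyExp_of_taylor (hE : SmallParam 𝒟 E) {φ : ℝ → ℝ} {c : ℕ → ℝ} {k δ : ℝ}
    (hφ : ∀ M : ℕ, ∃ C : ℝ, ∀ x ∈ Icc (-δ) 0, |φ x - ∑ i ∈ Finset.range M, c i * x ^ i| ≤ C * |x| ^ M)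
    (h𝒟 : ∀ ε y, (ε, y) ∈ 𝒟 → k * ε ^ 2 * y ∈ Icc (-δ) 0) :
    PolyExp 𝒟 (fun ε y => φ (k * ε ^ 2 * y))
      (PowerSeries.mk fun l y => if Even l then c (l / 2) * (k * y) ^ (l / 2) else 0) := by
  -- The Taylor remainder of order N is O(|k ε² y|^N), of order ε^{2N}; only even truncations have
  -- to be estimated.
  refine polyExp_of_frequently hE (fun l => ⟨l / 2, |c (l / 2)| * |k| ^ (l / 2), fun ε y _ => ?_⟩)
    fun N => ⟨2 * N, by omega, ?_⟩
  · rw [PowerSeries.coeff_mk]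
    split_ifs
    · rw [abs_mul, abs_pow, abs_mul, mul_pow, ← mul_assoc]
      gcongr
      linarith
    · rw [abs_zero]; positivity
  · obtain ⟨C, hC⟩ := hφ N
    refine ⟨N, |C| * |k| ^ N, by positivity, fun ε y hy => ?_⟩
    obtain ⟨h0, h1⟩ := hE ε y hy
    have hs : seriesSum (PowerSeries.mk fun l y => if Even l then c (l / 2) * (k * y) ^ (l / 2) else 0)
        (2 * N) ε y = ∑ i ∈ Finset.range N, c i * (k * ε ^ 2 * y) ^ i := by
      clear hC
      induction N with
      | zero => simp [seriesSum]
      | succ N ih =>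
        rw [show 2 * (N + 1) = 2 * N + 1 + 1 by ring, seriesSum_succ, seriesSum_succ, ih,
          Finset.sum_range_succ]
        simp only [PowerSeries.coeff_mk]
        rw [if_pos (even_two_mul N), if_neg (by simp), Nat.mul_div_cancel_left N two_pos]
        ring
    rw [hs]
    refine (hC _ (h𝒟 ε y hy)).trans ?_
    calc C * |k * ε ^ 2 * y| ^ N ≤ |C| * |k * ε ^ 2 * y| ^ N := by
          gcongr; exact le_abs_self C
      _ = |C| * |k| ^ N * |y| ^ N * ε ^ (2 * N) := by
          rw [abs_mul, abs_mul, abs_of_pos (pow_pos h0 2), mul_pow, mul_pow, ← pow_mul]; ring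
      _ ≤ |C| * |k| ^ N * (1 + |y|) ^ N * ε ^ (2 * N) := by
          gcongr
          linarith

end Expansions

/-! ### Residuals of Borel sums of formal solutions -/

section Residuals

open Polynomial

/-- Polynomials as functions. -/
noncomputable def polyFun : ℝ[X] →+* (ℝ → ℝ) := RingHom.pi fun y => evalRingHom y

@[simp] lemma polyFun_apply (P : ℝ[X]) (y : ℝ) : polyFun P y = P.eval y := rfl

/-- Series with polynomial coefficients as series with functions as coefficients. -/
noncomputable def funSeries : PolySeries →+* PowerSeries (ℝ → ℝ) := PowerSeries.map polyFun

lemma coeff_funSeries (l : ℕ) (F : PolySeries) (y : ℝ) :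
    PowerSeries.coeff l (funSeries F) y = (PowerSeries.coeff l F).eval y := by
  simp [funSeries]

/-- The series `P A(a + ·) + Q A'(a + ·)`. -/
noncomputable def airySeries (a : ℝ) (P Q : PolySeries) : PowerSeries (ℝ → ℝ) :=
  funSeries P * PowerSeries.C (fun y => flippedAiry (a + y))
    + funSeries Q * PowerSeries.C (fun y => flippedAiry' (a + y))

lemma coeff_airySeries (a : ℝ) (P Q : PolySeries) (l : ℕ) (y : ℝ) :
    PowerSeries.coeff l (airySeries a P Q) y
      = airyComb a (PowerSeries.coeff l P) (PowerSeries.coeff l Q) y := by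
  simp [airySeries, airyComb, PowerSeries.coeff_mul_C, funSeries]

/-- The series `S e^{-τ}`. -/
noncomputable def expSeries (S : PolySeries) : PowerSeries (ℝ → ℝ) :=
  funSeries S * PowerSeries.C (fun y => Real.exp (-y))

lemma coeff_expSeries (S : PolySeries) (l : ℕ) (y : ℝ) :
    PowerSeries.coeff l (expSeries S) y = expComb (PowerSeries.coeff l S) y := by
  simp [expSeries, expComb, PowerSeries.coeff_mul_C, funSeries]

/-- The series in `ε` obtained from a Taylor series in `k ε² y`. -/
noncomputable def taylorSeries (c : ℕ → ℝ) (k : ℝ) : PolySeries :=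
  PowerSeries.mk fun l => if Even l then C (c (l / 2) * k ^ (l / 2)) * X ^ (l / 2) else 0

lemma funSeries_taylorSeries (c : ℕ → ℝ) (k : ℝ) : funSeries (taylorSeries c k) =
    PowerSeries.mk fun l y => if Even l then c (l / 2) * (k * y) ^ (l / 2) else 0 := by
  refine PowerSeries.ext fun l => funext fun y => ?_
  rw [coeff_funSeries, taylorSeries, PowerSeries.coeff_mk, PowerSeries.coeff_mk]
  split_ifs
  · simp; ring
  · simp

/-- The series `D` such that `1 + ε² D` is the given Taylor series. -/
noncomputable def potentialTaylor (c : ℕ → ℝ) (k : ℝ) : PolySeries :=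
  PowerSeries.mk fun l => PowerSeries.coeff (l + 2) (taylorSeries c k)

lemma taylorSeries_eq {c : ℕ → ℝ} (h0 : c 0 = 1) (k : ℝ) :
    taylorSeries c k = 1 + PowerSeries.X ^ 2 * potentialTaylor c k := by
  refine PowerSeries.ext fun l => ?_
  rw [map_add, PowerSeries.coeff_X_pow_mul', PowerSeries.coeff_one]
  rcases l with _ | _ | l
  · simp [taylorSeries, h0, -PowerSeries.coeff_zero_eq_constantCoeff]
  · simp [taylorSeries]
  · simp [potentialTaylor]

lemma RapidExp.bound {𝒟 : Set (ℝ × ℝ)} {f : ℝ → ℝ → ℝ} {F : PowerSeries (ℝ → ℝ)}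
    (hf : RapidExp 𝒟 f F) (hF : F = 0) (N : ℕ) :
    ∃ C : ℝ, 0 ≤ C ∧ ∀ ε y, (ε, y) ∈ 𝒟 → |f ε y| ≤ C * ε ^ N := by
  subst hF
  obtain ⟨C, hC, hb⟩ := hf N 0
  exact ⟨C, hC, fun ε y hy => by simpa [seriesSum] using hb ε y hy⟩

lemma funSeries_X_pow (n : ℕ) :
    funSeries (PowerSeries.X ^ n) = PowerSeries.monomial n fun _ => 1 := by
  rw [funSeries, map_pow, PowerSeries.map_X, PowerSeries.X_pow_eq]; rfl

lemma funSeries_linear (n : ℕ) (c : ℝ) :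
    funSeries (PowerSeries.X ^ n * constSeries c * varSeries)
      = PowerSeries.monomial n fun y => c * y := by
  refine PowerSeries.ext fun l => funext fun y => ?_
  rw [coeff_funSeries, constSeries, varSeries, mul_assoc, ← map_mul,
    PowerSeries.coeff_mul_C, PowerSeries.coeff_X_pow, PowerSeries.coeff_monomial]
  split_ifs <;> simp

lemma funSeries_const (n : ℕ) (c : ℝ) :
    funSeries (PowerSeries.X ^ n * constSeries c) = PowerSeries.monomial n fun _ => c := by
  refine PowerSeries.ext fun l => funext fun y => ?_
  rw [coeff_funSeries, constSeries,
    PowerSeries.coeff_mul_C, PowerSeries.coeff_X_pow, PowerSeries.coeff_monomial]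
  split_ifs <;> simp

lemma coeffDeriv_mul_shift (a : ℝ) (Q : PolySeries) :
    coeffDeriv ((constSeries a + varSeries) * Q) = Q + (constSeries a + varSeries) * coeffDeriv Q := by
  refine PowerSeries.ext fun l => ?_
  simp only [constSeries, varSeries, ← map_add, coeff_coeffDeriv, PowerSeries.coeff_C_mul]
  rw [LinearMap.map_add, PowerSeries.coeff_C_mul]
  simp

lemma coeffDeriv_sub (F G : PolySeries) : coeffDeriv (F - G) = coeffDeriv F - coeffDeriv G := by
  ext1 l; simp

/-- Residual in the inner equation of a function whose expansion is a formal solution. -/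
lemma inner_residual_bound {𝒟 : Set (ℝ × ℝ)} {E : ℝ} (hE : SmallParam 𝒟 E) {a k δ : ℝ}
    {φ β : ℝ → ℝ} {c d : ℕ → ℝ} (hc0 : c 0 = 1)
    (hφ : ∀ M : ℕ, ∃ C : ℝ, ∀ x ∈ Icc (-δ) 0,
      |φ x - ∑ i ∈ Finset.range M, c i * x ^ i| ≤ C * |x| ^ M)
    (hβ : ∀ M : ℕ, ∃ C : ℝ, ∀ x ∈ Icc (-δ) 0,
      |β x - ∑ i ∈ Finset.range M, d i * x ^ i| ≤ C * |x| ^ M)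
    (h𝒟 : ∀ ε y, (ε, y) ∈ 𝒟 → k * ε ^ 2 * y ∈ Icc (-δ) 0)
    {P Q r : PolySeries}
    (hA : innerEqA a k (potentialTaylor c k) (taylorSeries d k) P Q r = 0)
    (hB : innerEqB a k (potentialTaylor c k) (taylorSeries d k) P Q r = 0)
    {ρ : ℝ → ℝ} (hρ : PolyExp 𝒟 (fun ε _ => ρ ε) (funSeries r)) {Φ : ℕ → ℝ → ℝ → ℝ}
    (h0 : RapidExp 𝒟 (Φ 0) (airySeries a P Q))
    (h1 : RapidExp 𝒟 (Φ 1) (airySeries a (coeffDeriv P - (constSeries a + varSeries) * Q)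
      (P + coeffDeriv Q)))
    (h2 : RapidExp 𝒟 (Φ 2) (airySeries a
      (coeffDeriv (coeffDeriv P - (constSeries a + varSeries) * Q)
        - (constSeries a + varSeries) * (P + coeffDeriv Q))
      (coeffDeriv P - (constSeries a + varSeries) * Q + coeffDeriv (P + coeffDeriv Q)))) (N : ℕ) :
    ∃ C : ℝ, 0 ≤ C ∧ ∀ ε y, (ε, y) ∈ 𝒟 →
      |ε ^ 2 * (1 + k * ε ^ 2 * y) ^ 2 * Φ 2 ε y + ε ^ 4 * k * β (k * ε ^ 2 * y) * Φ 1 ε y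
        + ((1 + ε ^ 2 * ρ ε) ^ 2 * φ (k * ε ^ 2 * y) - 1) * Φ 0 ε y| ≤ C * ε ^ N := by
  have e1 : PolyExp 𝒟 (fun ε _ => ε ^ 0 * 1) (funSeries 1) := by
    have := polyExp_const hE 0 1
    rwa [← funSeries_X_pow, pow_zero] at this
  have ex : PolyExp 𝒟 (fun ε y => ε ^ 0 * 1 + ε ^ 2 * (k * y))
      (funSeries 1 + funSeries (PowerSeries.X ^ 2 * constSeries k * varSeries)) := by
    refine e1.add ?_ hE
    rw [funSeries_linear]
    exact polyExp_linear hE 2 k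
  have e2 : PolyExp 𝒟 (fun ε _ => ε ^ 2 * 1) (funSeries (PowerSeries.X ^ 2)) := by
    rw [funSeries_X_pow]; exact polyExp_const hE 2 1
  have e4 : PolyExp 𝒟 (fun ε _ => ε ^ 4 * k) (funSeries (PowerSeries.X ^ 4 * constSeries k)) := by
    rw [funSeries_const]; exact polyExp_const hE 4 k
  have em : PolyExp 𝒟 (fun ε _ => ε ^ 0 * -1) (funSeries (PowerSeries.X ^ 0 * constSeries (-1))) := by
    rw [funSeries_const]; exact polyExp_const hE 0 (-1)
  have eφ : PolyExp 𝒟 (fun ε y => φ (k * ε ^ 2 * y)) (funSeries (taylorSeries c k)) := by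
    rw [funSeries_taylorSeries]; exact polyExp_of_taylor hE hφ h𝒟
  have eβ : PolyExp 𝒟 (fun ε y => β (k * ε ^ 2 * y)) (funSeries (taylorSeries d k)) := by
    rw [funSeries_taylorSeries]; exact polyExp_of_taylor hE hβ h𝒟
  have t2 := e2.mul_rapid hE (ex.mul_rapid hE (ex.mul_rapid hE h2))
  have t1 := e4.mul_rapid hE (eβ.mul_rapid hE h1)
  have t0 := eφ.mul_rapid hE h0
  -- Multiplication by 1 + ε²ρ, carried out twice, builds the factor (1 + ε²ρ)².
  have t0' := t0.add (e2.mul_rapid hE (hρ.mul_rapid hE t0))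
  have t0'' := (t0'.add (e2.mul_rapid hE (hρ.mul_rapid hE t0'))).add (em.mul_rapid hE h0)
  have key := (t2.add t1).add t0''
  -- The formal residual is X² times the two component equations: the common factor stems from the
  -- ε² in front of the second derivative and from 1 + ε²D in the potential, whose constant 1
  -- cancels.
  have hAB : (0 : PowerSeries (ℝ → ℝ)) = PowerSeries.X ^ 2 * (
      funSeries (innerEqA a k (potentialTaylor c k) (taylorSeries d k) P Q r)
        * PowerSeries.C (fun y => flippedAiry (a + y))
      + funSeries (innerEqB a k (potentialTaylor c k) (taylorSeries d k) P Q r)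
        * PowerSeries.C (fun y => flippedAiry' (a + y))) := by
    rw [hA, hB]; simp
  have hX : PowerSeries.X = funSeries PowerSeries.X := by
    rw [funSeries, PowerSeries.map_X]
  have hz : (funSeries (PowerSeries.X ^ 0 * constSeries (-1))) = -1 := by
    rw [pow_zero, one_mul, constSeries]
    simp [funSeries]
  obtain ⟨C, hC, hb⟩ := key.bound (by
    rw [hAB, hz, hX, taylorSeries_eq hc0]
    simp only [innerEqA, innerEqB, potentialSeries, airySeries, coeffDeriv_sub, coeffDeriv_add,
      coeffDeriv_mul_shift, map_add, map_sub, map_mul, map_pow, map_one, map_ofNat]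
    ring) N
  refine ⟨C, hC, fun ε y hy => (le_of_eq ?_).trans (hb ε y hy)⟩
  congr 1; ring

/-- Residual in the outer equation of a function whose expansion is a formal solution. -/
lemma outer_residual_bound {𝒟 : Set (ℝ × ℝ)} {E : ℝ} (hE : SmallParam 𝒟 E) {w k : ℝ}
    {S r : PolySeries} (hS : outerEq w k S r = 0)
    {ρ : ℝ → ℝ} (hρ : PolyExp 𝒟 (fun ε _ => ρ ε) (funSeries r)) {Ψ : ℕ → ℝ → ℝ → ℝ} {A : ℝ}
    (h0 : RapidExp 𝒟 (Ψ 0) (expSeries (constSeries A * S)))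
    (h1 : RapidExp 𝒟 (Ψ 1) (expSeries (constSeries A * (coeffDeriv S - S))))
    (h2 : RapidExp 𝒟 (Ψ 2) (expSeries (constSeries A *
      (coeffDeriv (coeffDeriv S - S) - (coeffDeriv S - S))))) (N : ℕ) :
    ∃ C : ℝ, 0 ≤ C ∧ ∀ ε y, (ε, y) ∈ 𝒟 →
      |(1 + ε ^ 3 * (w * k * y)) ^ 2 * Ψ 2 ε y
        + ε ^ 3 * (w * k) * (1 + ε ^ 3 * (w * k * y)) * Ψ 1 ε y
        + ((1 + ε ^ 2 * ρ ε) ^ 2 * (w ^ 2 - 1) * (1 + ε ^ 3 * (w * k * y)) ^ 2 - w ^ 2)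
          * Ψ 0 ε y| ≤ C * ε ^ N := by
  have e1 : PolyExp 𝒟 (fun ε _ => ε ^ 0 * 1) (funSeries 1) := by
    have := polyExp_const hE 0 1
    rwa [← funSeries_X_pow, pow_zero] at this
  have ex : PolyExp 𝒟 (fun ε y => ε ^ 0 * 1 + ε ^ 3 * (w * k * y))
      (funSeries 1 + funSeries (PowerSeries.X ^ 3 * constSeries (w * k) * varSeries)) := by
    refine e1.add ?_ hE
    rw [funSeries_linear]
    exact polyExp_linear hE 3 (w * k)
  have e2 : PolyExp 𝒟 (fun ε _ => ε ^ 2 * 1) (funSeries (PowerSeries.X ^ 2)) := by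
    rw [funSeries_X_pow]; exact polyExp_const hE 2 1
  have e3 : PolyExp 𝒟 (fun ε _ => ε ^ 3 * (w * k))
      (funSeries (PowerSeries.X ^ 3 * constSeries (w * k))) := by
    rw [funSeries_const]; exact polyExp_const hE 3 (w * k)
  have ec : ∀ c : ℝ, PolyExp 𝒟 (fun ε _ => ε ^ 0 * c)
      (funSeries (PowerSeries.X ^ 0 * constSeries c)) := fun c => by
    rw [funSeries_const]; exact polyExp_const hE 0 c
  have t2 := ex.mul_rapid hE (ex.mul_rapid hE h2)
  have t1 := e3.mul_rapid hE (ex.mul_rapid hE h1)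
  have t0 := (ec (w ^ 2 - 1)).mul_rapid hE (ex.mul_rapid hE (ex.mul_rapid hE h0))
  have t0' := t0.add (e2.mul_rapid hE (hρ.mul_rapid hE t0))
  have t0'' := (t0'.add (e2.mul_rapid hE (hρ.mul_rapid hE t0'))).add
    ((ec (-w ^ 2)).mul_rapid hE h0)
  have key := (t2.add t1).add t0''
  have hAB : (0 : PowerSeries (ℝ → ℝ)) = funSeries (constSeries A * outerEq w k S r)
        * PowerSeries.C (fun y => Real.exp (-y)) := by
    rw [hS]; simp
  have hX : PowerSeries.X = funSeries PowerSeries.X := by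
    rw [funSeries, PowerSeries.map_X]
  have hw1 : constSeries (w ^ 2 - 1) = constSeries (w ^ 2) - 1 := by simp [constSeries]
  have hw2 : constSeries (-w ^ 2) = -constSeries (w ^ 2) := by simp [constSeries]
  obtain ⟨C, hC, hb⟩ := key.bound (by
    rw [hAB, hw1, hw2]
    simp only [outerEq, expSeries, coeffDeriv_sub, hw1,
      map_add, map_sub, map_mul, map_pow, map_one, map_ofNat, map_neg, pow_zero, one_mul]
    ring) N
  refine ⟨C, hC, fun ε y hy => (le_of_eq ?_).trans (hb ε y hy)⟩
  congr 1; ring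

end Residuals

/-! ### Scaled quasimodes -/

/-- A derivative in the second variable is the total derivative applied to (0, 1), which is jointly
smooth. -/
lemma contDiff_uncurry_deriv {f g : ℝ → ℝ → ℝ} (hf : ContDiff ℝ ∞ (Function.uncurry f))
    (h : ∀ t x, HasDerivAt (f t) (g t x) x) : ContDiff ℝ ∞ (Function.uncurry g) := by
  have e : Function.uncurry g = fun p => fderiv ℝ (Function.uncurry f) p (0, 1) := by
    funext ⟨t, x⟩
    have h1 : HasFDerivAt (Function.uncurry f) (fderiv ℝ (Function.uncurry f) (t, x)) (t, x) :=
      (hf.differentiable (by simp) (t, x)).hasFDerivAt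
    have h2 : HasDerivAt (fun x => ((t, x) : ℝ × ℝ)) (0, 1) x :=
      (hasDerivAt_const x t).prodMk (hasDerivAt_id x)
    exact (h t x).unique (h1.comp_hasDerivAt x h2)
  rw [e]
  exact (hf.fderiv_right (m := ∞) (by simp)).clm_apply contDiff_const

/-- The scalar Borel theorem is the profile version for the multiples r_l g of one Schwartz function
with g(0) = 1, evaluated at x = 0. -/
lemma exists_borel_real (r : ℕ → ℝ) : ∃ ρ : ℝ → ℝ, ContDiff ℝ ∞ ρ ∧
    ∀ (N : ℕ) (E : ℝ), ∃ C, 0 ≤ C ∧ ∀ t ∈ Icc (0 : ℝ) E,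
      |ρ t - ∑ l ∈ Finset.range N, t ^ l * r l| ≤ C * t ^ N := by
  obtain ⟨g, hg⟩ := exists_schwartz_expComb 1
  have hg0 : g 0 = 1 := by rw [hg 0 (by norm_num)]; simp [expComb]
  obtain ⟨F, hF, -, -, -, hb⟩ := exists_borel_sum (fun l => r l • g) one_pos
  refine ⟨fun t => F 0 t 0, hF.comp (contDiff_id.prodMk contDiff_const), fun N E => ?_⟩
  obtain ⟨C, hC, h⟩ := hb 0 N 0 E
  refine ⟨C, hC, fun t ht => ?_⟩
  simpa [hg0] using h t ht 0

lemma iteratedDeriv_one_two_of_eq {f g g₁ g₂ : ℝ → ℝ} {s : Set ℝ} (hs : IsOpen s)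
    (h : ∀ x ∈ s, f x = g x) (h₁ : ∀ x, HasDerivAt g (g₁ x) x) (h₂ : ∀ x, HasDerivAt g₁ (g₂ x) x) :
    ∀ x ∈ s, iteratedDeriv 1 f x = g₁ x ∧ iteratedDeriv 2 f x = g₂ x := by
  intro x hx
  have e : f =ᶠ[𝓝 x] g := Filter.eventually_of_mem (hs.mem_nhds hx) h
  have d1 : deriv g = g₁ := funext fun x => (h₁ x).deriv
  have d2 : deriv g₁ = g₂ := funext fun x => (h₂ x).deriv
  refine ⟨?_, ?_⟩
  · rw [e.iteratedDeriv_eq, iteratedDeriv_one, d1]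
  · rw [e.iteratedDeriv_eq, iteratedDeriv_succ, iteratedDeriv_one, d1, d2]

/-- A profile, its derivatives in the second variable, and their rapid decrease for `t ∈ [0, E]`. -/
structure IsProfile (E : ℝ) (Φ : ℕ → ℝ → ℝ → ℝ) : Prop where
  smooth : ContDiff ℝ ∞ (Function.uncurry (Φ 0))
  schwartz : ∀ a b : ℕ, ∃ C, ∀ t ∈ Icc (0 : ℝ) E, ∀ x,
    |x| ^ a * ‖iteratedFDeriv ℝ b (Function.uncurry (Φ 0)) (t, x)‖ ≤ C
  hasDerivAt : ∀ i t x, HasDerivAt (Φ i t) (Φ (i + 1) t x) x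
  rapid : ∀ i a : ℕ, ∃ C, 0 ≤ C ∧ ∀ t ∈ Icc (0 : ℝ) E, ∀ x, (1 + |x|) ^ a * |Φ i t x| ≤ C

lemma IsProfile.smooth' {E : ℝ} {Φ : ℕ → ℝ → ℝ → ℝ} (h : IsProfile E Φ) (i : ℕ) :
    ContDiff ℝ ∞ (Function.uncurry (Φ i)) := by
  induction i with
  | zero => exact h.smooth
  | succ i ih => exact contDiff_uncurry_deriv ih (h.hasDerivAt i)

lemma IsProfile.add {E : ℝ} {Φ Ψ : ℕ → ℝ → ℝ → ℝ} (h : IsProfile E Φ) (h' : IsProfile E Ψ) :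
    IsProfile E (fun i t x => Φ i t x + Ψ i t x) where
  smooth := h.smooth.add h'.smooth
  schwartz a b := by
    obtain ⟨C, hC⟩ := h.schwartz a b
    obtain ⟨C', hC'⟩ := h'.schwartz a b
    refine ⟨C + C', fun t ht x => ?_⟩
    have e : Function.uncurry (fun t x => Φ 0 t x + Ψ 0 t x)
      = Function.uncurry (Φ 0) + Function.uncurry (Ψ 0) := rfl
    rw [e, iteratedFDeriv_add_apply (h.smooth.of_le (by exact_mod_cast le_top)).contDiffAt
      (h'.smooth.of_le (by exact_mod_cast le_top)).contDiffAt]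
    refine (mul_le_mul_of_nonneg_left (norm_add_le _ _) (by positivity)).trans ?_
    rw [mul_add]
    exact add_le_add (hC t ht x) (hC' t ht x)
  hasDerivAt i t x := (h.hasDerivAt i t x).add (h'.hasDerivAt i t x)
  rapid i a := by
    obtain ⟨C, h0, hC⟩ := h.rapid i a
    obtain ⟨C', h0', hC'⟩ := h'.rapid i a
    refine ⟨C + C', by positivity, fun t ht x => ?_⟩
    refine (mul_le_mul_of_nonneg_left (abs_add_le _ _) (by positivity)).trans ?_
    rw [mul_add]
    exact add_le_add (hC t ht x) (hC' t ht x)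

/-- Products of this type are added to the outer profile in order to repair the transmission
conditions. -/
lemma isProfile_mul_of_hasCompactSupport (E : ℝ) {e η : ℝ → ℝ} (he : ContDiff ℝ ∞ e)
    (hη : ContDiff ℝ ∞ η) (hc : HasCompactSupport η) :
    IsProfile E (fun i t x => e t * iteratedDeriv i η x) where
  smooth := by
    rw [iteratedDeriv_zero]
    exact (he.comp contDiff_fst).mul (hη.comp contDiff_snd)
  schwartz a b := by
    set f : ℝ × ℝ → ℝ := Function.uncurry fun t x => e t * iteratedDeriv 0 η x with hf
    have hs : ContDiff ℝ ∞ f := by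
      rw [hf, iteratedDeriv_zero]
      exact (he.comp contDiff_fst).mul (hη.comp contDiff_snd)
    have hcont : Continuous fun p : ℝ × ℝ => |p.2| ^ a * ‖iteratedFDeriv ℝ b f p‖ :=
      (continuous_snd.abs.pow a).mul (hs.continuous_iteratedFDeriv (by exact_mod_cast le_top)).norm
    obtain ⟨C, hC⟩ := ((isCompact_Icc (a := (0 : ℝ)) (b := E)).prod hc).bddAbove_image
      hcont.continuousOn
    refine ⟨max C 0, fun t ht x => ?_⟩
    by_cases hx : x ∈ tsupport η
    · exact (hC ⟨(t, x), ⟨ht, hx⟩, rfl⟩).trans (le_max_left _ _)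
    · have : f =ᶠ[𝓝 (t, x)] 0 := by
        have h1 : ∀ᶠ x' in 𝓝 x, η x' = 0 := by
          filter_upwards [(isClosed_tsupport η).isOpen_compl.mem_nhds hx] with x' hx'
          exact image_eq_zero_of_notMem_tsupport hx'
        have h2 : ∀ᶠ p : ℝ × ℝ in 𝓝 (t, x), η p.2 = 0 :=
          (continuous_snd.tendsto (t, x)).eventually h1
        filter_upwards [h2] with p hp
        simp [hf, Function.uncurry, hp]
      have h0 : iteratedFDeriv ℝ b f (t, x) = 0 := by
        by_contra h
        exact notMem_tsupport_iff_eventuallyEq.2 this (support_iteratedFDeriv_subset b h)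
      rw [h0]
      simp
  hasDerivAt i t x := by
    have := hasDerivAt_iteratedDeriv hη i x
    exact this.const_mul (e t)
  rapid i a := by
    obtain ⟨C₁, hC₁⟩ := (isCompact_Icc (a := (0 : ℝ)) (b := E)).exists_bound_of_continuousOn
      he.continuous.continuousOn
    have hcont : Continuous fun x => (1 + |x|) ^ a * |iteratedDeriv i η x| :=
      (by fun_prop : Continuous fun x : ℝ => (1 + |x|) ^ a).mul
        (hη.continuous_iteratedDeriv i (by exact_mod_cast le_top)).abs
    obtain ⟨C₂, hC₂⟩ := hc.isCompact.bddAbove_image hcont.continuousOn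
    refine ⟨|C₁| * |C₂|, by positivity, fun t ht x => ?_⟩
    have h1 : |e t| ≤ |C₁| := (hC₁ t ht).trans (le_abs_self _)
    by_cases hx : x ∈ tsupport η
    · have h2 : (1 + |x|) ^ a * |iteratedDeriv i η x| ≤ |C₂| :=
        (hC₂ ⟨x, hx, rfl⟩).trans (le_abs_self _)
      rw [abs_mul]
      calc (1 + |x|) ^ a * (|e t| * |iteratedDeriv i η x|)
          = |e t| * ((1 + |x|) ^ a * |iteratedDeriv i η x|) := by ring
        _ ≤ _ := by gcongr
    · have : iteratedDeriv i η x = 0 := by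
        by_contra h
        refine hx (support_iteratedFDeriv_subset (𝕜 := ℝ) i fun h' => h ?_)
        rw [iteratedDeriv_eq_iteratedFDeriv, h']
        rfl
      rw [this]; simp; positivity

/-- The scaled quasimode: spectral function, inner profile and outer profile. -/
structure IsScaledMode (a w γ k E δ η : ℝ) (φ β : ℝ → ℝ) (r : ℕ → ℝ) (ρ : ℝ → ℝ)
    (Φ Ψ : ℕ → ℝ → ℝ → ℝ) : Prop where
  smooth_spec : ContDiff ℝ ∞ ρ
  spec : ∀ N : ℕ, ∃ C, 0 ≤ C ∧ ∀ ε ∈ Icc (0 : ℝ) E,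
    |ρ ε - ∑ l ∈ Finset.range N, ε ^ l * r l| ≤ C * ε ^ N
  inner : IsProfile E Φ
  outer : IsProfile E Ψ
  cont : ∀ ε, Φ 0 ε 0 = Ψ 0 ε 0
  deriv : ∀ ε, Ψ 1 ε 0 = γ * ε * Φ 1 ε 0
  near : ∀ ε, ∀ y ≤ 0, |Φ 0 ε y - flippedAiry (a + y)| ≤ η
  inner_two : ∃ C, 0 ≤ C ∧ ∀ ε ∈ Icc (0 : ℝ) E, ∀ y ≤ 0,
    |Φ 0 ε y - (flippedAiry (a + y) - ε * (γ * flippedAiry' (a + y)))| ≤ C * ε ^ 2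
  outer_two : ∃ C, 0 ≤ C ∧ ∀ ε ∈ Icc (0 : ℝ) E, ∀ y, 0 ≤ y →
    |Ψ 0 ε y + ε * (γ * flippedAiry' a * Real.exp (-y))| ≤ C * ε ^ 2
  inner_res : ∀ N : ℕ, ∃ C, 0 ≤ C ∧ ∀ ε ∈ Ioc (0 : ℝ) E, ∀ y, k * ε ^ 2 * y ∈ Icc (-δ) 0 →
    |ε ^ 2 * (1 + k * ε ^ 2 * y) ^ 2 * Φ 2 ε y + ε ^ 4 * k * β (k * ε ^ 2 * y) * Φ 1 ε y
        + ((1 + ε ^ 2 * ρ ε) ^ 2 * φ (k * ε ^ 2 * y) - 1) * Φ 0 ε y| ≤ C * ε ^ N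
  outer_res : ∀ N : ℕ, ∃ C, 0 ≤ C ∧ ∀ ε ∈ Ioc (0 : ℝ) E, ∀ y, 0 ≤ y →
    |(1 + ε ^ 3 * (w * k * y)) ^ 2 * Ψ 2 ε y
        + ε ^ 3 * (w * k) * (1 + ε ^ 3 * (w * k * y)) * Ψ 1 ε y
        + ((1 + ε ^ 2 * ρ ε) ^ 2 * (w ^ 2 - 1) * (1 + ε ^ 3 * (w * k * y)) ^ 2 - w ^ 2)
          * Ψ 0 ε y| ≤ C * ε ^ N

section ScaledModes

open Polynomial
open scoped SchwartzMap

/-- The expansion is needed for the profile and two derivatives. The Schwartz extensions coincide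
with the Airy combinations on the open set y < 1, so differentiating them term by term is legitimate
up to y = 0. -/
lemma exists_inner_borel (a : ℝ) (P Q : ℕ → ℝ[X]) (E : ℝ) {η : ℝ} (hη : 0 < η) :
    ∃ Φ : ℕ → ℝ → ℝ → ℝ, IsProfile E Φ ∧
      (∀ t, ∀ y ≤ 0, |Φ 0 t y - airyComb a (P 0) (Q 0) y| ≤ η) ∧
      ∀ N : ℕ, ∀ b : ℕ, ∃ K, 0 ≤ K ∧ ∀ t ∈ Icc (0 : ℝ) E, ∀ y ≤ 0,
        (1 + |y|) ^ b * |Φ 0 t y - ∑ l ∈ Finset.range N, t ^ l * airyComb a (P l) (Q l) y|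
          ≤ K * t ^ N ∧
        (1 + |y|) ^ b * |Φ 1 t y - ∑ l ∈ Finset.range N, t ^ l * airyComb a
          (derivative (P l) - (C a + X) * Q l) (P l + derivative (Q l)) y| ≤ K * t ^ N ∧
        (1 + |y|) ^ b * |Φ 2 t y - ∑ l ∈ Finset.range N, t ^ l * airyComb a
          (derivative (derivative (P l) - (C a + X) * Q l) - (C a + X) * (P l + derivative (Q l)))
          (derivative (P l) - (C a + X) * Q l + derivative (P l + derivative (Q l))) y|
            ≤ K * t ^ N := by
  choose g hg using fun l => exists_schwartz_airyComb a (P l) (Q l)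
  obtain ⟨F, hF, hs, h0, hd, hb⟩ := exists_borel_sum g hη
  have hg12 := fun l => iteratedDeriv_one_two_of_eq isOpen_Iio (hg l)
    (hasDerivAt_airyComb a (P l) (Q l)) (hasDerivAt_airyComb a _ _)
  refine ⟨F, ⟨hF, fun a b => ?_, hd, fun i b => ?_⟩, fun t y hy => ?_, fun N b => ?_⟩
  · obtain ⟨C, hC⟩ := hs a b
    exact ⟨C, fun t _ x => hC (t, x)⟩
  · obtain ⟨C, hC, h⟩ := hb i 0 b E
    exact ⟨C, hC, fun t ht x => by simpa using h t ht x⟩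
  · rw [← hg 0 y (by linarith)]; exact h0 t y
  · obtain ⟨C₀, hC₀, k₀⟩ := hb 0 N b E
    obtain ⟨C₁, hC₁, k₁⟩ := hb 1 N b E
    obtain ⟨C₂, hC₂, k₂⟩ := hb 2 N b E
    refine ⟨C₀ + C₁ + C₂, by positivity, fun t ht y hy => ?_⟩
    have ht0 : 0 ≤ t ^ N := pow_nonneg ht.1 N
    have hy1 : y < 1 := by linarith
    have s0 := k₀ t ht y
    have s1 := k₁ t ht y
    have s2 := k₂ t ht y
    simp only [iteratedDeriv_zero, fun l => hg l y hy1] at s0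
    simp only [fun l => (hg12 l y hy1).1] at s1
    simp only [fun l => (hg12 l y hy1).2] at s2
    refine ⟨s0.trans ?_, s1.trans ?_, s2.trans ?_⟩ <;> gcongr <;> linarith

lemma exists_outer_borel (S : ℕ → ℝ[X]) (E : ℝ) :
    ∃ Φ : ℕ → ℝ → ℝ → ℝ, IsProfile E Φ ∧
      ∀ N : ℕ, ∀ b : ℕ, ∃ K, 0 ≤ K ∧ ∀ t ∈ Icc (0 : ℝ) E, ∀ y, 0 ≤ y →
        (1 + |y|) ^ b * |Φ 0 t y - ∑ l ∈ Finset.range N, t ^ l * expComb (S l) y| ≤ K * t ^ N ∧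
        (1 + |y|) ^ b * |Φ 1 t y - ∑ l ∈ Finset.range N, t ^ l * expComb
          (derivative (S l) - S l) y| ≤ K * t ^ N ∧
        (1 + |y|) ^ b * |Φ 2 t y - ∑ l ∈ Finset.range N, t ^ l * expComb
          (derivative (derivative (S l) - S l) - (derivative (S l) - S l)) y| ≤ K * t ^ N := by
  choose g hg using fun l => exists_schwartz_expComb (S l)
  obtain ⟨F, hF, hs, h0, hd, hb⟩ := exists_borel_sum g one_pos
  have hg12 := fun l => iteratedDeriv_one_two_of_eq isOpen_Ioi (hg l)
    (hasDerivAt_expComb (S l)) (hasDerivAt_expComb _)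
  refine ⟨F, ⟨hF, fun a b => ?_, hd, fun i b => ?_⟩, fun N b => ?_⟩
  · obtain ⟨C, hC⟩ := hs a b
    exact ⟨C, fun t _ x => hC (t, x)⟩
  · obtain ⟨C, hC, h⟩ := hb i 0 b E
    exact ⟨C, hC, fun t ht x => by simpa using h t ht x⟩
  · obtain ⟨C₀, hC₀, k₀⟩ := hb 0 N b E
    obtain ⟨C₁, hC₁, k₁⟩ := hb 1 N b E
    obtain ⟨C₂, hC₂, k₂⟩ := hb 2 N b E
    refine ⟨C₀ + C₁ + C₂, by positivity, fun t ht y hy => ?_⟩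
    have ht0 : 0 ≤ t ^ N := pow_nonneg ht.1 N
    have hy1 : y > -1 := by linarith
    have s0 := k₀ t ht y
    have s1 := k₁ t ht y
    have s2 := k₂ t ht y
    simp only [iteratedDeriv_zero, fun l => hg l y hy1] at s0
    simp only [fun l => (hg12 l y hy1).1] at s1
    simp only [fun l => (hg12 l y hy1).2] at s2
    refine ⟨s0.trans ?_, s1.trans ?_, s2.trans ?_⟩ <;> gcongr <;> linarith

/-- A perturbation flat in t has zero expansion, so corrections of this kind leave every residual
estimate intact. -/
lemma rapidExp_flat {𝒟 : Set (ℝ × ℝ)} {E : ℝ} (hE : SmallParam 𝒟 E) {f : ℝ → ℝ → ℝ}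
    {F : PowerSeries (ℝ → ℝ)} (hf : RapidExp 𝒟 f F) {e η : ℝ → ℝ}
    (he : ∀ N : ℕ, ∃ C, 0 ≤ C ∧ ∀ t ∈ Icc (0 : ℝ) E, |e t| ≤ C * t ^ N)
    (hη : ∀ a : ℕ, ∃ C, 0 ≤ C ∧ ∀ x, (1 + |x|) ^ a * |η x| ≤ C) :
    RapidExp 𝒟 (fun t x => f t x + e t * η x) F := by
  have : RapidExp 𝒟 (fun t x => e t * η x) 0 := by
    intro N a
    obtain ⟨C, hC, h⟩ := he N
    obtain ⟨C', hC', h'⟩ := hη a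
    refine ⟨C * C', by positivity, fun t x hx => ?_⟩
    obtain ⟨h0, h1⟩ := hE t x hx
    have hs : seriesSum 0 N t x = 0 := by simp [seriesSum]
    rw [hs, sub_zero, abs_mul]
    calc (1 + |x|) ^ a * (|e t| * |η x|) = |e t| * ((1 + |x|) ^ a * |η x|) := by ring
      _ ≤ (C * t ^ N) * C' := by
        gcongr
        exacts [h t ⟨h0.le, h1⟩, h' x]
      _ = _ := by ring
  simpa using hf.add this

end ScaledModes

/-! ### Borel sums of formal solutions, corrected at the interface -/

section ScaledModeExistence

open Polynomial

lemma coeff_shift_mul (a : ℝ) (Q : PolySeries) (l : ℕ) :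
    PowerSeries.coeff l ((constSeries a + varSeries) * Q) = (C a + X) * PowerSeries.coeff l Q := by
  rw [constSeries, varSeries, ← map_add, PowerSeries.coeff_C_mul]

lemma exists_bump_at_zero : ∃ χ : ℝ → ℝ, ContDiff ℝ ∞ χ ∧ HasCompactSupport χ ∧ χ =ᶠ[𝓝 0] 1 := by
  let f : ContDiffBump (0 : ℝ) := ⟨1, 2, one_pos, one_lt_two⟩
  exact ⟨f, f.contDiff, f.hasCompactSupport, f.eventuallyEq_one⟩

/-- Functions with prescribed value and derivative at the origin. -/
lemma exists_cauchy_basis : ∃ η₁ η₂ : ℝ → ℝ, (ContDiff ℝ ∞ η₁ ∧ HasCompactSupport η₁) ∧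
    (ContDiff ℝ ∞ η₂ ∧ HasCompactSupport η₂) ∧ η₁ 0 = 1 ∧ iteratedDeriv 1 η₁ 0 = 0 ∧
    η₂ 0 = 0 ∧ iteratedDeriv 1 η₂ 0 = 1 := by
  obtain ⟨χ, h1, h2, h3⟩ := exists_bump_at_zero
  refine ⟨χ, fun x => x * χ x, ⟨h1, h2⟩, ⟨contDiff_id.mul h1, h2.mul_left⟩, h3.self_of_nhds, ?_,
    by simp, ?_⟩
  · rw [iteratedDeriv_one, h3.deriv_eq]
    simp [Pi.one_def]
  · have : (fun x => x * χ x) =ᶠ[𝓝 0] fun x => x := by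
      filter_upwards [h3] with x hx
      rw [hx]; simp
    rw [iteratedDeriv_one, this.deriv_eq]
    simp

lemma rapid_iteratedDeriv {η : ℝ → ℝ} (h : ContDiff ℝ ∞ η) (hc : HasCompactSupport η) (i a : ℕ) :
    ∃ C, 0 ≤ C ∧ ∀ x, (1 + |x|) ^ a * |iteratedDeriv i η x| ≤ C := by
  obtain ⟨C, hC, hb⟩ := (isProfile_mul_of_hasCompactSupport 0 (e := fun _ => 1)
    contDiff_const h hc).rapid i a
  exact ⟨C, hC, fun x => by simpa using hb 0 (by simp) x⟩

/-- The Borel sums satisfy the differential equations up to O(ε^N) by the expansion calculus, and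
the transmission conditions up to flat defects e and f because A(a) = 0 and the formal conditions
hold at every order. The defects are cancelled exactly by changing the outer profile only, so the
uniform closeness of the inner profile to A(a + ·) is kept. The three conditions on the coefficients
of order one give the two-term expansions. -/
theorem exists_scaledMode {a w γ k E δ η : ℝ} (ha : flippedAiry a = 0) (hk : 0 < k)
    (hη : 0 < η) {φ β : ℝ → ℝ} {c d : ℕ → ℝ} (hc0 : c 0 = 1)
    (hφ : ∀ M : ℕ, ∃ C : ℝ, ∀ x ∈ Icc (-δ) 0,
      |φ x - ∑ i ∈ Finset.range M, c i * x ^ i| ≤ C * |x| ^ M)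
    (hβ : ∀ M : ℕ, ∃ C : ℝ, ∀ x ∈ Icc (-δ) 0,
      |β x - ∑ i ∈ Finset.range M, d i * x ^ i| ≤ C * |x| ^ M)
    {U : ℕ → FormalCoeff}
    (hU : ∀ l, FormalStep a w γ k (potentialTaylor c k) (taylorSeries d k) l U)
    (hP1 : (U 1).1 = 0) (hQ1 : (U 1).2.1 = C (-γ)) (hS1 : (U 1).2.2.1 = C (-γ)) :
    ∃ (ρ : ℝ → ℝ) (Φ Ψ : ℕ → ℝ → ℝ → ℝ),
      IsScaledMode a w γ k E δ η φ β (fun l => (U l).2.2.2) ρ Φ Ψ := by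
  obtain ⟨ρ, hρ, hρb⟩ := exists_borel_real fun l => (U l).2.2.2
  obtain ⟨Φ, hΦ, hΦη, hΦb⟩ := exists_inner_borel a (fun l => (U l).1) (fun l => (U l).2.1) E hη
  obtain ⟨Ψ, hΨ, hΨb⟩ := exists_outer_borel (fun l => C (flippedAiry' a) * (U l).2.2.1) E
  obtain ⟨η₁, η₂, ⟨s1, c1⟩, ⟨s2, c2⟩, v1, v1', v2, v2'⟩ := exists_cauchy_basis
  have hU0 : U 0 = (1, 0, 0, a / 2) := (hU 0).init rfl
  -- the defects in the transmission conditions are flat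
  set e : ℝ → ℝ := fun t => Φ 0 t 0 - Ψ 0 t 0 with he
  set f : ℝ → ℝ := fun t => γ * t * Φ 1 t 0 - Ψ 1 t 0 with hf
  have slice : ∀ {F : ℝ → ℝ → ℝ}, ContDiff ℝ ∞ (Function.uncurry F) → ContDiff ℝ ∞ fun t => F t 0 :=
    fun h => h.comp (contDiff_id.prodMk contDiff_const)
  have hes : ContDiff ℝ ∞ e := (slice hΦ.smooth).sub (slice hΨ.smooth)
  have hfs : ContDiff ℝ ∞ f :=
    ((contDiff_const.mul contDiff_id).mul (slice (hΦ.smooth' 1))).sub (slice (hΨ.smooth' 1))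
  have heb : ∀ N : ℕ, ∃ C, 0 ≤ C ∧ ∀ t ∈ Icc (0 : ℝ) E, |e t| ≤ C * t ^ N := by
    intro N
    obtain ⟨C₁, h₁, b₁⟩ := hΦb N 0
    obtain ⟨C₂, h₂, b₂⟩ := hΨb N 0
    refine ⟨C₁ + C₂, by positivity, fun t ht => ?_⟩
    have k1 := (b₁ t ht 0 le_rfl).1
    have k2 := (b₂ t ht 0 le_rfl).1
    have hs : ∑ l ∈ Finset.range N, t ^ l * airyComb a (U l).1 (U l).2.1 0
        = ∑ l ∈ Finset.range N, t ^ l * expComb (C (flippedAiry' a) * (U l).2.2.1) 0 :=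
      Finset.sum_congr rfl fun l _ => by
        simp only [airyComb, expComb, ha, (hU l).cont, add_zero, mul_zero, zero_add, eval_mul,
          eval_C, neg_zero, Real.exp_zero, mul_one]
        ring
    rw [pow_zero, one_mul] at k1 k2
    rw [hs] at k1
    have : e t = (Φ 0 t 0 - ∑ l ∈ Finset.range N, t ^ l * expComb (C (flippedAiry' a) * (U l).2.2.1) 0)
      - (Ψ 0 t 0 - ∑ l ∈ Finset.range N, t ^ l * expComb (C (flippedAiry' a) * (U l).2.2.1) 0) := by
      simp only [he]; ring
    rw [this, add_mul]
    exact (abs_sub _ _).trans (add_le_add k1 k2)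
  have hfb : ∀ N : ℕ, ∃ C, 0 ≤ C ∧ ∀ t ∈ Icc (0 : ℝ) E, |f t| ≤ C * t ^ N := by
    intro N
    obtain ⟨C₁, h₁, b₁⟩ := hΦb N 0
    obtain ⟨C₂, h₂, b₂⟩ := hΨb (N + 1) 0
    refine ⟨|γ| * |E| * C₁ + |E| * C₂, by positivity, fun t ht => ?_⟩
    have k1 := (b₁ t ht 0 le_rfl).2.1
    have k2 := (b₂ t ht 0 le_rfl).2.1
    have hs : ∑ l ∈ Finset.range (N + 1), t ^ l * expComb (derivative (C (flippedAiry' a) * (U l).2.2.1)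
          - C (flippedAiry' a) * (U l).2.2.1) 0
        = γ * t * ∑ l ∈ Finset.range N, t ^ l * airyComb a
          (derivative (U l).1 - (C a + X) * (U l).2.1) ((U l).1 + derivative (U l).2.1) 0 := by
      -- The conormal condition couples outer order l + 1 with inner order l; the unpaired outer
      -- term of order 0 vanishes because S₀ = 0.
      rw [Finset.sum_range_succ', Finset.mul_sum, hU0]
      have : ∀ l, t ^ (l + 1) * expComb (derivative (C (flippedAiry' a) * (U (l + 1)).2.2.1)
          - C (flippedAiry' a) * (U (l + 1)).2.2.1) 0 = γ * t * (t ^ l * airyComb a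
          (derivative (U l).1 - (C a + X) * (U l).2.1) ((U l).1 + derivative (U l).2.1) 0) := by
        intro l
        have := (hU (l + 1)).deriv l rfl
        simp only [airyComb, expComb, derivative_C_mul, eval_sub, eval_mul, eval_C, neg_zero,
          Real.exp_zero, mul_one, add_zero, ha, mul_zero, zero_add, eval_add]
        linear_combination t ^ (l + 1) * flippedAiry' a * this
      rw [Finset.sum_congr rfl fun l _ => this l]
      simp [expComb]
    rw [pow_zero, one_mul] at k1 k2
    rw [hs] at k2
    set T := ∑ l ∈ Finset.range N, t ^ l * airyComb a
          (derivative (U l).1 - (C a + X) * (U l).2.1) ((U l).1 + derivative (U l).2.1) 0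
    have : f t = γ * t * (Φ 1 t 0 - T) - (Ψ 1 t 0 - γ * t * T) := by
      simp only [hf]; ring
    have ht1 : |t| ≤ |E| := by rw [abs_of_nonneg ht.1]; exact ht.2.trans (le_abs_self E)
    have ht2 : t ≤ |E| := ht.2.trans (le_abs_self E)
    rw [this, add_mul]
    refine (abs_sub _ _).trans (add_le_add ?_ (k2.trans ?_))
    · rw [abs_mul, abs_mul]
      calc |γ| * |t| * |Φ 1 t 0 - T| ≤ |γ| * |E| * (C₁ * t ^ N) := by gcongr
        _ = _ := by ring
    · rw [pow_succ]
      calc C₂ * (t ^ N * t) ≤ C₂ * (t ^ N * |E|) := by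
            gcongr
            exact pow_nonneg ht.1 N
        _ = _ := by ring
  -- η₁ carries value 1 and slope 0 at the origin, η₂ value 0 and slope 1: the first correction
  -- restores continuity, the second the conormal condition, independently of each other.
  set Ψ' : ℕ → ℝ → ℝ → ℝ := fun i t x =>
    Ψ i t x + (e t * iteratedDeriv i η₁ x + f t * iteratedDeriv i η₂ x) with hΨ'
  have hΨ'p : IsProfile E Ψ' := hΨ.add
    ((isProfile_mul_of_hasCompactSupport E hes s1 c1).add
      (isProfile_mul_of_hasCompactSupport E hfs s2 c2))
  refine ⟨ρ, Φ, Ψ', hρ, fun N => hρb N E, hΦ, hΨ'p, fun ε => ?_, fun ε => ?_, fun ε y hy => ?_,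
    ?_, ?_, fun N => ?_, fun N => ?_⟩
  · simp only [hΨ', he, iteratedDeriv_zero, v1, v2]; ring
  · simp only [hΨ', hf, v1', v2']; ring
  · have := hΦη ε y hy
    simpa [hU0, airyComb] using this
  · obtain ⟨K, hK, hb⟩ := hΦb 2 0
    refine ⟨K, hK, fun ε hε y hy => ?_⟩
    have := (hb ε hε y hy).1
    simp only [Finset.sum_range_succ, Finset.sum_range_zero, hU0, hP1, hQ1, airyComb, eval_one,
      eval_zero, eval_C, pow_zero, one_mul, zero_mul, zero_add, add_zero, pow_one] at this
    refine (le_of_eq ?_).trans this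
    congr 1; ring
  · obtain ⟨K, hK, hb⟩ := hΨb 2 0
    obtain ⟨C₁, hC₁, b₁⟩ := heb 2
    obtain ⟨C₂, hC₂, b₂⟩ := hfb 2
    obtain ⟨M₁, hM₁, m₁⟩ := rapid_iteratedDeriv s1 c1 0 0
    obtain ⟨M₂, hM₂, m₂⟩ := rapid_iteratedDeriv s2 c2 0 0
    refine ⟨K + (C₁ * M₁ + C₂ * M₂), by positivity, fun ε hε y hy => ?_⟩
    have := (hb ε hε y hy).1
    simp only [Finset.sum_range_succ, Finset.sum_range_zero, hU0, hS1, expComb,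
      eval_zero, eval_C, pow_zero, one_mul, zero_mul, mul_zero, zero_add, pow_one, eval_mul]
      at this
    have e1 : Ψ' 0 ε y + ε * (γ * flippedAiry' a * Real.exp (-y))
      = (Ψ 0 ε y - ε * (flippedAiry' a * -γ * Real.exp (-y)))
        + (e ε * iteratedDeriv 0 η₁ y + f ε * iteratedDeriv 0 η₂ y) := by
      simp only [hΨ']; ring
    have n1 := m₁ y
    have n2 := m₂ y
    rw [pow_zero, one_mul] at n1 n2
    have hε2 : 0 ≤ ε ^ 2 := sq_nonneg ε
    rw [e1, add_mul]
    refine (abs_add_le _ _).trans (add_le_add this ((abs_add_le _ _).trans ?_))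
    rw [abs_mul, abs_mul]
    calc |e ε| * |iteratedDeriv 0 η₁ y| + |f ε| * |iteratedDeriv 0 η₂ y|
        ≤ (C₁ * ε ^ 2) * M₁ + (C₂ * ε ^ 2) * M₂ := by
          gcongr
          exacts [b₁ ε hε, b₂ ε hε]
      _ = _ := by ring
  · set 𝒟 : Set (ℝ × ℝ) := {q | q.1 ∈ Ioc 0 E ∧ k * q.1 ^ 2 * q.2 ∈ Icc (-δ) 0} with h𝒟
    have hE : SmallParam 𝒟 E := fun ε y h => h.1
    have hneg : ∀ ε y, (ε, y) ∈ 𝒟 → y ≤ 0 := fun ε y h => by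
      have h1 : 0 < k * ε ^ 2 := mul_pos hk (pow_pos h.1.1 2)
      by_contra hy
      exact absurd h.2.2 (not_le.2 (mul_pos h1 (not_le.1 hy)))
    have hρ' : PolyExp 𝒟 (fun ε _ => ρ ε) (funSeries (serR U)) := fun N => by
      obtain ⟨K, hK, hb⟩ := hρb N E
      refine ⟨0, K, hK, fun ε y hy => ?_⟩
      have := hb ε ⟨hy.1.1.le, hy.1.2⟩
      simpa [seriesSum, coeff_funSeries, serR] using this
    have hr : ∀ (i : ℕ) (P Q : PolySeries),
        (∀ N b : ℕ, ∃ K, 0 ≤ K ∧ ∀ t ∈ Icc (0 : ℝ) E, ∀ y ≤ 0, (1 + |y|) ^ b * |Φ i t y -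
          ∑ l ∈ Finset.range N, t ^ l * airyComb a (PowerSeries.coeff l P) (PowerSeries.coeff l Q) y|
            ≤ K * t ^ N) → RapidExp 𝒟 (Φ i) (airySeries a P Q) := fun i P Q h N b => by
      obtain ⟨K, hK, hb⟩ := h N b
      refine ⟨K, hK, fun ε y hy => ?_⟩
      simp only [seriesSum, coeff_airySeries]
      exact hb ε ⟨hy.1.1.le, hy.1.2⟩ y (hneg ε y hy)
    obtain ⟨K, hK, hb⟩ := inner_residual_bound hE hc0 hφ hβ (fun ε y h => h.2)
      (P := serP U) (Q := serQ U) (r := serR U)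
      (PowerSeries.ext fun l => by rw [(hU l).eqA, map_zero])
      (PowerSeries.ext fun l => by rw [(hU l).eqB, map_zero]) hρ'
      (hr 0 _ _ fun N b => by
        obtain ⟨K, hK, hb⟩ := hΦb N b
        refine ⟨K, hK, fun t ht y hy => ?_⟩
        simpa only [serP, serQ, PowerSeries.coeff_mk] using (hb t ht y hy).1)
      (hr 1 _ _ fun N b => by
        obtain ⟨K, hK, hb⟩ := hΦb N b
        refine ⟨K, hK, fun t ht y hy => ?_⟩
        simpa only [LinearMap.map_sub, LinearMap.map_add, coeff_shift_mul, coeff_coeffDeriv, serP, serQ,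
          PowerSeries.coeff_mk] using (hb t ht y hy).2.1)
      (hr 2 _ _ fun N b => by
        obtain ⟨K, hK, hb⟩ := hΦb N b
        refine ⟨K, hK, fun t ht y hy => ?_⟩
        simpa only [LinearMap.map_sub, LinearMap.map_add, coeff_shift_mul, coeff_coeffDeriv, serP, serQ,
          PowerSeries.coeff_mk] using (hb t ht y hy).2.2) N
    exact ⟨K, hK, fun ε hε y hy => hb ε y ⟨hε, hy⟩⟩
  · set 𝒟 : Set (ℝ × ℝ) := {q | q.1 ∈ Ioc 0 E ∧ 0 ≤ q.2} with h𝒟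
    have hE : SmallParam 𝒟 E := fun ε y h => h.1
    have hρ' : PolyExp 𝒟 (fun ε _ => ρ ε) (funSeries (serR U)) := fun N => by
      obtain ⟨K, hK, hb⟩ := hρb N E
      refine ⟨0, K, hK, fun ε y hy => ?_⟩
      have := hb ε ⟨hy.1.1.le, hy.1.2⟩
      simpa [seriesSum, coeff_funSeries, serR] using this
    have hr : ∀ (i : ℕ) (S : PolySeries),
        (∀ N b : ℕ, ∃ K, 0 ≤ K ∧ ∀ t ∈ Icc (0 : ℝ) E, ∀ y, 0 ≤ y → (1 + |y|) ^ b * |Ψ i t y -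
          ∑ l ∈ Finset.range N, t ^ l * expComb (PowerSeries.coeff l S) y|
            ≤ K * t ^ N) → RapidExp 𝒟 (Ψ' i) (expSeries S) := fun i S h => by
      have : RapidExp 𝒟 (Ψ i) (expSeries S) := fun N b => by
        obtain ⟨K, hK, hb⟩ := h N b
        refine ⟨K, hK, fun ε y hy => ?_⟩
        simp only [seriesSum, coeff_expSeries]
        exact hb ε ⟨hy.1.1.le, hy.1.2⟩ y hy.2
      have h2 := rapidExp_flat hE (rapidExp_flat hE this heb (rapid_iteratedDeriv s1 c1 i)) hfb
        (rapid_iteratedDeriv s2 c2 i)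
      simpa only [hΨ', add_assoc] using h2
    obtain ⟨K, hK, hb⟩ := outer_residual_bound hE (w := w) (k := k) (S := serS U) (r := serR U)
      (PowerSeries.ext fun l => by rw [(hU l).outer, map_zero]) hρ' (A := flippedAiry' a)
      (hr 0 _ fun N b => by
        obtain ⟨K, hK, hb⟩ := hΨb N b
        refine ⟨K, hK, fun t ht y hy => ?_⟩
        simpa only [constSeries, PowerSeries.coeff_C_mul, serS, PowerSeries.coeff_mk] using
          (hb t ht y hy).1)
      (hr 1 _ fun N b => by
        obtain ⟨K, hK, hb⟩ := hΨb N b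
        refine ⟨K, hK, fun t ht y hy => ?_⟩
        simpa only [constSeries, PowerSeries.coeff_C_mul, serS, PowerSeries.coeff_mk,
          LinearMap.map_sub, coeff_coeffDeriv, derivative_C_mul, mul_sub] using (hb t ht y hy).2.1)
      (hr 2 _ fun N b => by
        obtain ⟨K, hK, hb⟩ := hΨb N b
        refine ⟨K, hK, fun t ht y hy => ?_⟩
        simpa only [constSeries, PowerSeries.coeff_C_mul, serS, PowerSeries.coeff_mk,
          LinearMap.map_sub, coeff_coeffDeriv, derivative_C_mul, mul_sub, derivative_sub]
          using (hb t ht y hy).2.2) N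
    exact ⟨K, hK, fun ε hε y hy => hb ε y ⟨hε, hy⟩⟩

end ScaledModeExistence

/-! ### Taylor expansions at the interface -/

/-- Near x₀ the bound is Taylor's theorem of degree M, whose last term joins the remainder. Away
from x₀, |x - x₀|^M is bounded below and compactness suffices, so the estimate holds on the whole
interval. -/
lemma exists_taylor_bound {f : ℝ → ℝ} {a b x₀ : ℝ} (hab : a < b) (hx₀ : x₀ ∈ Icc a b)
    (hf : ContDiffOn ℝ ∞ f (Icc a b)) (M : ℕ) : ∃ C : ℝ, 0 ≤ C ∧ ∀ x ∈ Icc a b,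
      |f x - ∑ i ∈ Finset.range M, iteratedDerivWithin i f (Icc a b) x₀ / i.factorial * (x - x₀) ^ i|
        ≤ C * |x - x₀| ^ M := by
  set T : ℝ → ℝ := fun x =>
    ∑ i ∈ Finset.range M, iteratedDerivWithin i f (Icc a b) x₀ / i.factorial * (x - x₀) ^ i with hT
  have h1 := taylor_isLittleO (n := M) (convex_Icc a b) hx₀
    (hf.of_le (by exact_mod_cast le_top))
  have h2 : (fun x => f x - T x) =O[𝓝[Icc a b] x₀] fun x => (x - x₀) ^ M := by
    have h3 : (fun x => f x - T x) = fun x => (f x - taylorWithinEval f M (Icc a b) x₀ x)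
        + iteratedDerivWithin M f (Icc a b) x₀ / M.factorial * (x - x₀) ^ M := by
      funext x
      rw [taylor_within_apply, Finset.sum_range_succ]
      have : ∑ k ∈ Finset.range M, ((k.factorial : ℝ)⁻¹ * (x - x₀) ^ k) •
          iteratedDerivWithin k f (Icc a b) x₀ = T x :=
        Finset.sum_congr rfl fun i _ => by rw [smul_eq_mul]; ring
      rw [this, smul_eq_mul]; ring
    rw [h3]
    exact h1.isBigO.add ((Asymptotics.isBigO_refl _ _).const_mul_left _)
  obtain ⟨C₁, hC₁⟩ := h2.bound
  rw [Filter.Eventually, Metric.mem_nhdsWithin_iff] at hC₁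
  obtain ⟨e, he, hs⟩ := hC₁
  have hcont : ContinuousOn (fun x => f x - T x) (Icc a b) :=
    hf.continuousOn.sub (by fun_prop)
  obtain ⟨C₂, hC₂⟩ := isCompact_Icc.exists_bound_of_continuousOn hcont
  refine ⟨|C₁| + |C₂| / e ^ M, by positivity, fun x hx => ?_⟩
  rw [add_mul]
  by_cases hd : x ∈ Metric.ball x₀ e
  · have h4 := hs ⟨hd, hx⟩
    simp only [mem_ofPred_eq, Real.norm_eq_abs, abs_pow] at h4
    refine h4.trans ((mul_le_mul_of_nonneg_right (le_abs_self C₁) (by positivity)).trans ?_)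
    exact le_add_of_nonneg_right (by positivity)
  · have h5 : e ≤ |x - x₀| := by
      simpa [Real.dist_eq] using hd
    have h6 : |f x - T x| ≤ |C₂| := (hC₂ x hx).trans (le_abs_self _)
    refine h6.trans ((?_ : |C₂| ≤ |C₂| / e ^ M * |x - x₀| ^ M).trans
      (le_add_of_nonneg_left (by positivity)))
    rw [div_mul_eq_mul_div, le_div_iff₀ (by positivity)]
    gcongr

/-- Letting x → 0⁻ kills the constant term; division by |x| reduces the degree by one. -/
lemma eq_zero_of_sum_bound {δ : ℝ} (hδ : 0 < δ) : ∀ (M : ℕ) (d : ℕ → ℝ),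
    (∃ C : ℝ, ∀ x ∈ Ico (-δ) 0, |∑ i ∈ Finset.range M, d i * x ^ i| ≤ C * |x| ^ M) →
    ∀ i < M, d i = 0 := by
  intro M
  induction M with
  | zero => intro d _ i hi; omega
  | succ M ih =>
    rintro d ⟨C, hC⟩
    have h0 : d 0 = 0 := by
      have hcont : ContinuousWithinAt (fun x => C * |x| ^ (M + 1)
          - |∑ i ∈ Finset.range (M + 1), d i * x ^ i|) (Iio 0) 0 :=
        Continuous.continuousWithinAt (by fun_prop)
      have hev : ∀ᶠ x in 𝓝[<] (0 : ℝ), 0 ≤ C * |x| ^ (M + 1)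
          - |∑ i ∈ Finset.range (M + 1), d i * x ^ i| := by
        filter_upwards [Ico_mem_nhdsLT (neg_lt_zero.2 hδ)] with x hx
        exact sub_nonneg.2 (hC x hx)
      have h := ge_of_tendsto hcont.tendsto hev
      rw [Finset.sum_range_succ'] at h
      simpa using h
    have h1 := ih (fun i => d (i + 1)) ⟨C, fun x hx => by
      have hx0 : 0 < |x| := abs_pos.2 hx.2.ne
      have h := hC x hx
      rw [Finset.sum_range_succ', h0, zero_mul, add_zero,
        show ∑ i ∈ Finset.range M, d (i + 1) * x ^ (i + 1)
          = x * ∑ i ∈ Finset.range M, d (i + 1) * x ^ i by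
            rw [Finset.mul_sum]; exact Finset.sum_congr rfl fun i _ => by ring,
        abs_mul, pow_succ, ← mul_assoc, mul_comm _ |x|] at h
      exact le_of_mul_le_mul_left h hx0⟩
    intro i hi
    rcases i with _ | i
    · exact h0
    · exact h1 i (by omega)

/-- The sequence `c` gives the expansion of `f` at `0` on the left, to all orders. -/
def HasLeftTaylor (δ : ℝ) (f : ℝ → ℝ) (c : ℕ → ℝ) : Prop :=
  ∀ M : ℕ, ∃ C : ℝ, ∀ x ∈ Icc (-δ) 0, |f x - ∑ i ∈ Finset.range M, c i * x ^ i| ≤ C * |x| ^ M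

lemma exists_hasLeftTaylor {δ : ℝ} (hδ : 0 < δ) {f : ℝ → ℝ} (hf : ContDiffOn ℝ ∞ f (Icc (-δ) 0)) :
    ∃ c, HasLeftTaylor δ f c := by
  refine ⟨fun i => iteratedDerivWithin i f (Icc (-δ) 0) 0 / i.factorial, fun M => ?_⟩
  obtain ⟨C, _, h⟩ := exists_taylor_bound (x₀ := 0) (neg_lt_zero.2 hδ) ⟨by linarith, le_rfl⟩ hf M
  exact ⟨C, fun x hx => by simpa using h x hx⟩

lemma HasLeftTaylor.zero {δ : ℝ} (hδ : 0 < δ) {f : ℝ → ℝ} {c : ℕ → ℝ} (h : HasLeftTaylor δ f c) :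
    c 0 = f 0 := by
  obtain ⟨C, hC⟩ := h 1
  have := hC 0 ⟨by linarith, le_rfl⟩
  simp only [Finset.range_one, Finset.sum_singleton, pow_zero, mul_one, abs_zero, pow_one,
    mul_zero, abs_nonpos_iff] at this
  linarith

/-- Two expansions to order M differ by a polynomial of degree below M that is O(|x|^M), hence zero.
A remainder bound found by hand thus identifies the coefficients. -/
lemma HasLeftTaylor.unique {δ : ℝ} (hδ : 0 < δ) {f : ℝ → ℝ} {c : ℕ → ℝ} (h : HasLeftTaylor δ f c)
    {d : ℕ → ℝ} {M : ℕ} {C : ℝ}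
    (hd : ∀ x ∈ Icc (-δ) 0, |f x - ∑ i ∈ Finset.range M, d i * x ^ i| ≤ C * |x| ^ M) {i : ℕ}
    (hi : i < M) : c i = d i := by
  obtain ⟨C', hC'⟩ := h M
  have := eq_zero_of_sum_bound hδ M (fun i => c i - d i) ⟨C + C', fun x hx => by
    have hx' : x ∈ Icc (-δ) 0 := ⟨hx.1, hx.2.le⟩
    simp only [sub_mul, Finset.sum_sub_distrib]
    rw [show ∑ i ∈ Finset.range M, c i * x ^ i - ∑ i ∈ Finset.range M, d i * x ^ i
      = (f x - ∑ i ∈ Finset.range M, d i * x ^ i) - (f x - ∑ i ∈ Finset.range M, c i * x ^ i) by ring,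
      add_mul]
    exact (abs_sub _ _).trans (add_le_add (hd x hx') (hC' x hx'))⟩ i hi
  linarith

lemma hasLeftTaylor_of_eq {δ : ℝ} {f : ℝ → ℝ} {c : ℕ → ℝ} (L : ℕ) (hc : ∀ i, L ≤ i → c i = 0)
    (hf : ∀ x ∈ Icc (-δ) 0, f x = ∑ i ∈ Finset.range L, c i * x ^ i) : HasLeftTaylor δ f c := by
  intro M
  refine ⟨∑ i ∈ Finset.range L, |c i| * |δ| ^ (i - M), fun x hx => ?_⟩
  have hx1 : |x| ≤ |δ| := by
    rw [abs_of_nonpos hx.2]; exact (neg_le.1 hx.1).trans (le_abs_self δ)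
  have h1 : ∑ i ∈ Finset.range M, c i * x ^ i
      = ∑ i ∈ Finset.range L, if i < M then c i * x ^ i else 0 := by
    have e1 : ∑ i ∈ Finset.range (L + M), (if i < M then c i * x ^ i else 0)
        = ∑ i ∈ Finset.range M, c i * x ^ i := by
      rw [← Finset.sum_filter]
      refine Finset.sum_congr ?_ fun _ _ => rfl
      ext i; simp only [Finset.mem_filter, Finset.mem_range]; omega
    rw [← e1, Finset.sum_range_add]
    simp [hc]
  rw [hf x hx, h1, ← Finset.sum_sub_distrib, Finset.sum_mul]
  refine (Finset.abs_sum_le_sum_abs _ _).trans (Finset.sum_le_sum fun i _ => ?_)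
  split_ifs with h
  · rw [sub_self, abs_zero]; positivity
  · rw [sub_zero, abs_mul, abs_pow, mul_assoc]
    gcongr
    nth_rewrite 1 [← Nat.sub_add_cancel (not_lt.1 h)]
    rw [pow_add]
    gcongr

/-! ### The coefficients of the scaled inner equation -/

/-- The potential `(1 + x)² n(R (1 + x))² / n(R)²`. -/
noncomputable def innerPotential (n : ℝ → ℝ) (R x : ℝ) : ℝ :=
  (1 + x) ^ 2 * n (R * (1 + x)) ^ 2 / n R ^ 2

/-- The coefficient of the first-order term of the inner equation. -/
noncomputable def innerDrift (n : ℝ → ℝ) (R : ℝ) (p : ℤ) (x : ℝ) : ℝ :=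
  (1 + x) + (p - 1) * ((1 + x) ^ 2 *
    (R * derivWithin n (Icc 0 R) (R * (1 + x)) / n (R * (1 + x))))

section Coefficients

variable {n : ℝ → ℝ} {R δ : ℝ}

lemma mapsTo_scaled (hR : 0 < R) (hδ : δ ≤ 1) :
    MapsTo (fun x => R * (1 + x)) (Icc (-δ) 0) (Icc 0 R) := by
  intro x hx
  have h1 : 0 ≤ 1 + x := by linarith [hx.1]
  exact ⟨mul_nonneg hR.le h1, by nlinarith [hx.2]⟩

lemma contDiffOn_innerPotential (hR : 0 < R) (hn : IsOpticalIndex n R) (hδ : δ ≤ 1) :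
    ContDiffOn ℝ ∞ (innerPotential n R) (Icc (-δ) 0) := by
  have h1 : ContDiffOn ℝ ∞ (fun x => n (R * (1 + x))) (Icc (-δ) 0) :=
    hn.smooth.comp (by fun_prop) (mapsTo_scaled hR hδ)
  have h2 : ContDiffOn ℝ ∞ (fun x : ℝ => (1 + x) ^ 2) (Icc (-δ) 0) := by fun_prop
  exact (h2.mul (h1.pow 2)).div_const _

lemma contDiffOn_innerDrift (hR : 0 < R) (hn : IsOpticalIndex n R) (p : ℤ) (hδ : δ ≤ 1) :
    ContDiffOn ℝ ∞ (innerDrift n R p) (Icc (-δ) 0) := by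
  have h1 : ContDiffOn ℝ ∞ (fun x => n (R * (1 + x))) (Icc (-δ) 0) :=
    hn.smooth.comp (by fun_prop) (mapsTo_scaled hR hδ)
  have h2 : ContDiffOn ℝ ∞ (fun x => derivWithin n (Icc 0 R) (R * (1 + x))) (Icc (-δ) 0) :=
    (hn.smooth.derivWithin (uniqueDiffOn_Icc hR) (by simp)).comp (by fun_prop) (mapsTo_scaled hR hδ)
  have h3 : ContDiffOn ℝ ∞ (fun x : ℝ => (1 + x) ^ 2) (Icc (-δ) 0) := by fun_prop
  have h4 : ContDiffOn ℝ ∞ (fun x : ℝ => (1 + x)) (Icc (-δ) 0) := by fun_prop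
  refine h4.add (contDiffOn_const.mul (h3.mul ((contDiffOn_const.mul h2).div h1 fun x hx => ?_)))
  have := hn.one_lt _ (mapsTo_scaled hR hδ hx)
  linarith

lemma indexDeriv_zero (n : ℝ → ℝ) (R : ℝ) : indexDeriv n R 0 = n R := by
  simp [indexDeriv]

/-- By definition of κ and μ, n(R(1+x))/n₀ = 1 + (κ-1)x + (2-μ)x²/2 + O(x³). Multiplied by 1 + x
this is 1 + κx + (κ - μ/2)x² + O(x³), whose square has the stated coefficients. -/
lemma innerPotential_taylor_two (hR : 0 < R) (hn : IsOpticalIndex n R) (hδ0 : 0 < δ) (hδ : δ ≤ 1)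
    {c : ℕ → ℝ} (hc : HasLeftTaylor δ (innerPotential n R) c) :
    c 0 = 1 ∧ c 1 = 2 * effCurvature n R ∧
      c 2 = effCurvature n R ^ 2 + 2 * effCurvature n R - adimHessian n R := by
  have hn0 : n R ≠ 0 := by have := hn.one_lt R ⟨hR.le, le_rfl⟩; linarith
  obtain ⟨C, hC0, hC⟩ := exists_taylor_bound hR ⟨hR.le, le_rfl⟩ hn.smooth 3
  set n₁ := indexDeriv n R 1 with hn₁
  set n₂ := indexDeriv n R 2 with hn₂
  have hT : ∀ x ∈ Icc (-δ) 0, |n (R * (1 + x)) - (n R + R * n₁ * x + R ^ 2 * n₂ / 2 * x ^ 2)|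
      ≤ C * R ^ 3 * |x| ^ 3 := by
    intro x hx
    have := hC _ (mapsTo_scaled hR hδ hx)
    rw [show R * (1 + x) - R = R * x by ring, abs_mul, abs_of_pos hR] at this
    refine (le_of_eq ?_).trans (this.trans (le_of_eq (by ring)))
    congr 2
    simp only [Finset.sum_range_succ, Finset.sum_range_zero, zero_add, iteratedDerivWithin_zero,
      Nat.factorial, hn₁, hn₂, indexDeriv]
    push_cast
    ring
  -- bound the index
  obtain ⟨B, hB⟩ := isCompact_Icc.exists_bound_of_continuousOn hn.smooth.continuousOn
  have hbd : ∀ x ∈ Icc (-δ) 0, |n (R * (1 + x))| ≤ |B| := fun x hx =>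
    (hB _ (mapsTo_scaled hR hδ hx)).trans (le_abs_self B)
  have hκ : R * n₁ = (effCurvature n R - 1) * n R := by
    rw [effCurvature, indexDeriv_zero]; field_simp; ring
  have hμ : R ^ 2 * n₂ = (2 - adimHessian n R) * n R := by
    rw [adimHessian, indexDeriv_zero]; field_simp; ring
  set κ := effCurvature n R with hκd
  set μ := adimHessian n R with hμd
  set t : ℝ → ℝ := fun x => 1 + (κ - 1) * x + (2 - μ) / 2 * x ^ 2 with ht
  have htb : ∀ x ∈ Icc (-δ) 0, |t x| ≤ 1 + |κ - 1| + |(2 - μ) / 2| := by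
    intro x hx
    have hx1 : |x| ≤ 1 := by rw [abs_of_nonpos hx.2]; linarith [hx.1]
    calc |t x| ≤ |1| + |(κ - 1) * x| + |(2 - μ) / 2 * x ^ 2| :=
          (abs_add_le _ _).trans (add_le_add_left (abs_add_le _ _) _)
      _ ≤ 1 + |κ - 1| * 1 + |(2 - μ) / 2| * 1 := by
          rw [abs_one, abs_mul, abs_mul, abs_pow]
          gcongr
          exact pow_le_one₀ (abs_nonneg _) hx1
      _ = _ := by ring
  set d : ℕ → ℝ := fun i => if i = 0 then 1 else if i = 1 then 2 * κ else κ ^ 2 + 2 * κ - μ with hd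
  -- remainder of the square of the quadratic part
  set g : ℝ → ℝ := fun x => (2 * (1 - μ / 2) + 2 * κ * (κ - μ / 2))
    + ((κ - μ / 2) ^ 2 + 2 * κ * (1 - μ / 2)) * x + 2 * (κ - μ / 2) * (1 - μ / 2) * x ^ 2
    + (1 - μ / 2) ^ 2 * x ^ 3 with hg
  obtain ⟨G, hG⟩ := (isCompact_Icc (a := -δ) (b := 0)).exists_bound_of_continuousOn
    (f := g) (by fun_prop)
  have hmain : ∀ x ∈ Icc (-δ) 0,
      |innerPotential n R x - ∑ i ∈ Finset.range 3, d i * x ^ i| ≤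
        (C * R ^ 3 * (|B| + |n R| * (1 + |κ - 1| + |(2 - μ) / 2|)) / n R ^ 2 + G) * |x| ^ 3 := by
    intro x hx
    have hx1 : |1 + x| ≤ 1 := by rw [abs_le]; constructor <;> linarith [hx.1, hx.2]
    have h1 := hT x hx
    rw [show n R + R * n₁ * x + R ^ 2 * n₂ / 2 * x ^ 2 = n R * t x by
      rw [hκ, hμ]; simp only [ht]; ring] at h1
    -- n² - (n₀t)² is factored as a difference of squares: one factor is the Taylor remainder
    -- O(|x|³), the other is bounded. The cubic and higher terms of (1+x)²t² are collected in g x ·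
    -- x³.
    have e : innerPotential n R x - ∑ i ∈ Finset.range 3, d i * x ^ i
        = (1 + x) ^ 2 * ((n (R * (1 + x)) - n R * t x) * (n (R * (1 + x)) + n R * t x)) / n R ^ 2
          + g x * x ^ 3 := by
      simp only [innerPotential, Finset.sum_range_succ, Finset.sum_range_zero, hd, ht, hg]
      field_simp
      simp
      ring
    rw [e, add_mul (C * R ^ 3 * (|B| + |n R| * (1 + |κ - 1| + |(2 - μ) / 2|)) / n R ^ 2)]
    refine (abs_add_le _ _).trans (add_le_add ?_ ?_)
    · rw [abs_div, abs_of_nonneg (sq_nonneg (n R)), div_mul_eq_mul_div]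
      refine div_le_div_of_nonneg_right ?_ (sq_nonneg _)
      rw [abs_mul, abs_mul, abs_pow]
      have h2 : |n (R * (1 + x)) + n R * t x| ≤ |B| + |n R| * (1 + |κ - 1| + |(2 - μ) / 2|) := by
        refine (abs_add_le _ _).trans (add_le_add (hbd x hx) ?_)
        rw [abs_mul]
        exact mul_le_mul_of_nonneg_left (htb x hx) (abs_nonneg _)
      calc |1 + x| ^ 2 * (|n (R * (1 + x)) - n R * t x| * |n (R * (1 + x)) + n R * t x|)
          ≤ 1 ^ 2 * ((C * R ^ 3 * |x| ^ 3) * (|B| + |n R| * (1 + |κ - 1| + |(2 - μ) / 2|))) := by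
            gcongr
        _ = _ := by ring
    · rw [abs_mul, abs_pow]
      exact mul_le_mul_of_nonneg_right (hG x hx) (by positivity)
  have h := fun i (hi : i < 3) => hc.unique hδ0 hmain hi
  exact ⟨h 0 (by norm_num), h 1 (by norm_num), h 2 (by norm_num)⟩

lemma innerDrift_zero (hR : 0 < R) (p : ℤ) :
    innerDrift n R p 0 = 1 + (p - 1) * (effCurvature n R - 1) := by
  have : effCurvature n R - 1 = R * derivWithin n (Icc 0 R) R / n R := by
    rw [effCurvature, indexDeriv_zero, indexDeriv, iteratedDerivWithin_one, mul_add]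
    field_simp
    ring
  rw [this, innerDrift]
  simp

lemma constant_index_data (hR : 0 < R) (h : ∀ r ∈ Icc 0 R, n r = n R) :
    effCurvature n R = 1 ∧ adimHessian n R = 2 := by
  have h0 : ∀ i, iteratedDerivWithin i n (Icc 0 R) R
      = iteratedDerivWithin i (fun _ => n R) (Icc 0 R) R := fun i =>
    iteratedDerivWithin_congr (fun r hr => h r hr) ⟨hR.le, le_rfl⟩
  constructor
  · rw [effCurvature, indexDeriv, indexDeriv, h0 1, iteratedDerivWithin_one]
    simp [hR.ne']
  · rw [adimHessian, indexDeriv, indexDeriv, h0 2, iteratedDerivWithin_const]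
    simp only [OfNat.ofNat_ne_zero, if_false, zero_div, sub_zero]
    field_simp

lemma innerPotential_of_constant (hR : 0 < R) (hn : IsOpticalIndex n R) (hδ : δ ≤ 1)
    (h : ∀ r ∈ Icc 0 R, n r = n R) :
    HasLeftTaylor δ (innerPotential n R)
      (fun i => if i = 0 then 1 else if i = 1 then 2 else if i = 2 then 1 else 0) := by
  have hn0 : n R ≠ 0 := by have := hn.one_lt R ⟨hR.le, le_rfl⟩; linarith
  refine hasLeftTaylor_of_eq 3 (fun i hi => ?_) fun x hx => ?_
  · rw [if_neg (by omega), if_neg (by omega), if_neg (by omega)]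
  · rw [innerPotential, h _ (mapsTo_scaled hR hδ hx)]
    simp only [Finset.sum_range_succ, Finset.sum_range_zero]
    field_simp
    simp
    ring

lemma innerDrift_of_constant (hR : 0 < R) (p : ℤ) (hδ : δ ≤ 1)
    (h : ∀ r ∈ Icc 0 R, n r = n R) :
    HasLeftTaylor δ (innerDrift n R p) (fun i => if i = 0 then 1 else if i = 1 then 1 else 0) := by
  refine hasLeftTaylor_of_eq 2 (fun i hi => ?_) fun x hx => ?_
  · rw [if_neg (by omega), if_neg (by omega)]
  · have hd : derivWithin n (Icc 0 R) (R * (1 + x)) = 0 := by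
      rw [derivWithin_congr (fun r hr => h r hr) (h _ (mapsTo_scaled hR hδ hx))]
      simp
    rw [innerDrift, hd]
    simp [Finset.sum_range_succ]

end Coefficients

/-! ### From the optical index to scaled quasimodes -/

section FormalData

open Polynomial

variable {n : ℝ → ℝ} {R : ℝ}

lemma coeff_potentialTaylor (c : ℕ → ℝ) (k : ℝ) (l : ℕ) :
    PowerSeries.coeff l (potentialTaylor c k) = if Even l then
      C (c (l / 2 + 1) * k ^ (l / 2 + 1)) * X ^ (l / 2 + 1) else 0 := by
  rw [potentialTaylor, PowerSeries.coeff_mk, taylorSeries, PowerSeries.coeff_mk]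
  have : (l + 2) / 2 = l / 2 + 1 := by omega
  simp only [this, Nat.even_add, even_two, iff_true]

lemma coeff_taylorSeries (c : ℕ → ℝ) (k : ℝ) (l : ℕ) :
    PowerSeries.coeff l (taylorSeries c k) = if Even l then
      C (c (l / 2) * k ^ (l / 2)) * X ^ (l / 2) else 0 := by
  rw [taylorSeries, PowerSeries.coeff_mk]

/-- Formal solutions and scaled quasimodes for an optical index. -/
theorem exists_scaledModes_general (hR : 0 < R) (hn : IsOpticalIndex n R) (p : ℤ)
    (hκ : 0 < effCurvature n R) (E : ℝ) {a w γ δ η : ℝ} (hδ0 : 0 < δ) (hδ : δ ≤ 1) (hη : 0 < η)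
    (ha : flippedAiry a = 0) :
    ∃ (r : ℕ → ℝ) (ρ : ℝ → ℝ) (Φ Ψ : ℕ → ℝ → ℝ → ℝ),
      (∀ i < 4, r i = (generalInitial a w γ (1 / (2 * effCurvature n R))
        (1 + (p - 1) * (effCurvature n R - 1))
        ((effCurvature n R ^ 2 + 2 * effCurvature n R - adimHessian n R)
          * (1 / (2 * effCurvature n R)) ^ 2) i).2.2.2) ∧
      IsScaledMode a w γ (1 / (2 * effCurvature n R)) E δ η (innerPotential n R)
        (innerDrift n R p) r ρ Φ Ψ := by
  set κ := effCurvature n R with hκd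
  -- At this scale the first Taylor coefficient 2κ of the potential becomes 1, so D has constant
  -- coefficient y and the leading inner equation is exactly Airy's.
  set k := 1 / (2 * κ) with hk
  have hk0 : 0 < k := by positivity
  obtain ⟨c, hc⟩ := exists_hasLeftTaylor hδ0 (contDiffOn_innerPotential hR hn hδ)
  obtain ⟨d, hd⟩ := exists_hasLeftTaylor hδ0 (contDiffOn_innerDrift hR hn p hδ)
  obtain ⟨hc0, hc1, hc2⟩ := innerPotential_taylor_two hR hn hδ0 hδ hc
  have hd0 : d 0 = 1 + (p - 1) * (κ - 1) := by rw [hd.zero hδ0, innerDrift_zero hR]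
  have hck : c 1 * k = 1 := by rw [hc1, hk, ← hκd]; field_simp
  set b : ℝ := 1 + (p - 1) * (κ - 1) with hb
  set e := (κ ^ 2 + 2 * κ - adimHessian n R) * k ^ 2 with he
  have hD : ∀ i < 4, PowerSeries.coeff i (potentialTaylor c k)
      = if i = 0 then X else if i = 2 then C e * X ^ 2 else 0 := by
    intro i hi
    rw [coeff_potentialTaylor]
    interval_cases i
    · simp [hck, -map_mul]
    · simp
    · simp [hc2, he, ← hκd, -map_mul]
    · simp [show ¬ Even 3 by decide]
  have hB : ∀ i < 2, PowerSeries.coeff i (taylorSeries d k) = if i = 0 then C b else 0 := by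
    intro i hi
    rw [coeff_taylorSeries]
    interval_cases i
    · simp [hd0, -map_add, -map_mul, -map_sub]
    · simp
  obtain ⟨U, hU0, hU⟩ := exists_formal_solution (a := a) (w := w) (γ := γ) (k := k)
    (D := potentialTaylor c k) (B := taylorSeries d k)
    (by rw [← PowerSeries.coeff_zero_eq_constantCoeff_apply, hD 0 (by norm_num)]; simp)
    (L := 4) (by norm_num) (generalInitial a w γ k b e) (fun i hi => by
      interval_cases i
      · exact formalStep_generalInitial_zero a w γ k b e hD hB
      · exact formalStep_generalInitial_one a w γ k b e hD hB
      · exact formalStep_generalInitial_two a w γ k b e hD hB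
      · exact formalStep_generalInitial_three a w γ k b e hD hB)
  have h1 := hU0 1 (by norm_num)
  obtain ⟨ρ, Φ, Ψ, h⟩ := exists_scaledMode (E := E) ha hk0 hη hc0 hc hd hU
    (by rw [h1]; rfl) (by rw [h1]; rfl) (by rw [h1]; rfl)
  exact ⟨_, ρ, Φ, Ψ, fun i hi => by rw [hU0 i hi], h⟩

/-- Formal solutions and scaled quasimodes for a constant index. -/
theorem exists_scaledModes_constant (hR : 0 < R) (hn : IsOpticalIndex n R) (p : ℤ)
    (h : ∀ r ∈ Icc 0 R, n r = n R) (E : ℝ) {a w γ δ η : ℝ} (hδ : δ ≤ 1) (hη : 0 < η)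
    (ha : flippedAiry a = 0) :
    ∃ (r : ℕ → ℝ) (ρ : ℝ → ℝ) (Φ Ψ : ℕ → ℝ → ℝ → ℝ),
      (∀ i < 7, r i = (constantInitial a w γ i).2.2.2) ∧
      IsScaledMode a w γ (1 / 2) E δ η (innerPotential n R) (innerDrift n R p) r ρ Φ Ψ := by
  have hc := innerPotential_of_constant hR hn hδ h
  have hd := innerDrift_of_constant hR p hδ h
  set c : ℕ → ℝ := fun i => if i = 0 then 1 else if i = 1 then 2 else if i = 2 then 1 else 0
  set d : ℕ → ℝ := fun i => if i = 0 then 1 else if i = 1 then 1 else 0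
  have hD : ∀ i < 7, PowerSeries.coeff i (potentialTaylor c (1 / 2))
      = if i = 0 then X else if i = 2 then C (1 / 4) * X ^ 2 else 0 := by
    intro i hi
    rw [coeff_potentialTaylor]
    interval_cases i
    · simp [c, -map_mul]
    · simp
    · norm_num [c, -map_mul]
    · simp [show ¬ Even 3 by decide]
    · simp [c, -map_mul]
    · simp [show ¬ Even 5 by decide]
    · simp [c, -map_mul]
  have hB : ∀ i < 5, PowerSeries.coeff i (taylorSeries d (1 / 2))
      = if i = 0 then 1 else if i = 2 then C (1 / 2) * X else 0 := by
    intro i hi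
    rw [coeff_taylorSeries]
    interval_cases i
    · simp [d]
    · simp
    · simp [d, -map_mul]
    · simp [show ¬ Even 3 by decide]
    · simp [d, -map_mul]
  obtain ⟨U, hU0, hU⟩ := exists_formal_solution (a := a) (w := w) (γ := γ) (k := 1 / 2)
    (D := potentialTaylor c (1 / 2)) (B := taylorSeries d (1 / 2))
    (by rw [← PowerSeries.coeff_zero_eq_constantCoeff_apply, hD 0 (by norm_num)]; simp)
    (L := 7) (by norm_num) (constantInitial a w γ) (fun i hi => by
      interval_cases i
      · exact formalStep_constantInitial_zero a w γ hD hB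
      · exact formalStep_constantInitial_one a w γ hD hB
      · exact formalStep_constantInitial_two a w γ hD hB
      · exact formalStep_constantInitial_three a w γ hD hB
      · exact formalStep_constantInitial_four a w γ hD hB
      · exact formalStep_constantInitial_five a w γ hD hB
      · exact formalStep_constantInitial_six a w γ hD hB)
  have h1 := hU0 1 (by norm_num)
  obtain ⟨ρ, Φ, Ψ, h⟩ := exists_scaledMode (E := E) ha one_half_pos hη (by simp [c]) hc hd hU
    (by rw [h1]; rfl) (by rw [h1]; rfl) (by rw [h1]; rfl)
  exact ⟨_, ρ, Φ, Ψ, fun i hi => by rw [hU0 i hi], h⟩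

end FormalData

/-! ### Weak derivatives of piecewise smooth functions -/

lemma contDiffOn_partialDeriv {F : Type*} [NormedAddCommGroup F] [NormedSpace ℝ F] {U : Set Plane}
    (hU : IsOpen U) {f : Plane → F} {m k : ℕ∞} (hf : ContDiffOn ℝ k f U) (hm : m + 1 ≤ k)
    (i : Fin 2) : ContDiffOn ℝ m (partialDeriv i f) U :=
  (hf.fderiv_of_isOpen hU (by exact_mod_cast hm)).clm_apply contDiffOn_const

lemma contDiff_partialDeriv {F : Type*} [NormedAddCommGroup F] [NormedSpace ℝ F]
    {f : Plane → F} (hf : ContDiff ℝ ∞ f) (i : Fin 2) : ContDiff ℝ ∞ (partialDeriv i f) :=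
  (hf.fderiv_right (m := ∞) (by simp)).clm_apply contDiff_const

lemma hasCompactSupport_partialDeriv {F : Type*} [NormedAddCommGroup F] [NormedSpace ℝ F]
    {f : Plane → F} (hf : HasCompactSupport f) (i : Fin 2) :
    HasCompactSupport (partialDeriv i f) :=
  (hf.fderiv (𝕜 := ℝ)).comp_left (g := fun L : Plane →L[ℝ] F => L (EuclideanSpace.single i 1)) rfl

lemma partialDeriv_congr {F : Type*} [NormedAddCommGroup F] [NormedSpace ℝ F] {U : Set Plane}
    (hU : IsOpen U) {f g : Plane → F} (h : EqOn f g U) (i : Fin 2) :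
    EqOn (partialDeriv i f) (partialDeriv i g) U := fun x hx => by
  have : f =ᶠ[𝓝 x] g := Filter.eventually_of_mem (hU.mem_nhds hx) h
  simp only [partialDeriv, this.fderiv_eq]

/-- The integral of a partial derivative of a compactly supported function of class `C¹` is zero. -/
lemma integral_partialDeriv_eq_zero {f : Plane → ℂ} (hf : ContDiff ℝ 1 f) (hc : HasCompactSupport f)
    (i : Fin 2) : ∫ x, partialDeriv i f x = 0 := by
  have hd : Continuous (partialDeriv i f) :=
    (hf.continuous_fderiv (by simp)).clm_apply continuous_const
  have h := integral_smul_fderiv_eq_neg_fderiv_smul_of_integrable (μ := (volume : Measure Plane))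
    (𝕜 := ℝ) (f := fun _ : Plane => (1 : ℝ)) (g := f) (v := EuclideanSpace.single i 1)
    (by simp)
    (by simp only [one_smul]
        exact hd.integrable_of_hasCompactSupport (hasCompactSupport_partialDeriv hc i))
    (by simp only [one_smul]; exact hf.continuous.integrable_of_hasCompactSupport hc)
    (fun x _ => differentiableAt_const _) (fun x _ => hf.differentiable (by simp) x)
  simpa [partialDeriv] using h

/-- Integration by parts against a test function. -/
lemma integral_test_mul {U : Set Plane} (hU : IsOpen U) {V : Plane → ℂ} (hV : ContDiffOn ℝ 1 V U)
    {φ : Plane → ℝ} (hφ : IsTestFunction U φ) (i : Fin 2) :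
    IntegrableOn (fun x => partialDeriv i φ x • V x) U ∧
      IntegrableOn (fun x => φ x • partialDeriv i V x) U ∧
      ∫ x in U, partialDeriv i φ x • V x = -∫ x in U, φ x • partialDeriv i V x := by
  have hzero : ∀ x, x ∉ tsupport φ → φ =ᶠ[𝓝 x] 0 := fun x hx =>
    notMem_tsupport_iff_eventuallyEq.1 hx
  -- extension by zero
  have ext1 : ∀ {ψ : Plane → ℝ} {W : Plane → ℂ} {k : WithTop ℕ∞}, (∀ x, x ∉ tsupport φ → ψ =ᶠ[𝓝 x] 0) →
      ContDiff ℝ k ψ → ContDiffOn ℝ k W U → ContDiff ℝ k fun x => ψ x • W x := by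
    intro ψ W k h0 hψ hW
    refine contDiff_iff_contDiffAt.2 fun x => ?_
    by_cases hx : x ∈ tsupport φ
    · exact hψ.contDiffAt.smul (hW.contDiffAt (hU.mem_nhds (hφ.support_subset hx)))
    · have : (fun x => ψ x • W x) =ᶠ[𝓝 x] fun _ => 0 := by
        filter_upwards [h0 x hx] with y hy
        simp [hy]
      exact contDiffAt_const.congr_of_eventuallyEq this
  have hφ1 : ContDiff ℝ 1 φ := hφ.smooth.of_le (by exact_mod_cast le_top)
  have hdφ0 : ∀ x, x ∉ tsupport φ → partialDeriv i φ =ᶠ[𝓝 x] 0 := fun x hx => by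
    filter_upwards [(hzero x hx).fderiv (𝕜 := ℝ)] with y hy
    simp [partialDeriv, hy]
  have hF : ContDiff ℝ 1 fun x => φ x • V x := ext1 hzero hφ1 hV
  have hcF : HasCompactSupport fun x => φ x • V x := hφ.compactSupport.smul_right
  have hA : Continuous fun x => partialDeriv i φ x • V x :=
    (ext1 (k := 0) hdφ0 ((contDiff_partialDeriv hφ.smooth i).of_le (by simp))
      (hV.of_le (by simp))).continuous
  have hdV : ContDiffOn ℝ 0 (partialDeriv i V) U := by
    have := contDiffOn_partialDeriv hU (m := 0) (k := 1) (by exact_mod_cast hV) (by simp) i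
    exact_mod_cast this
  have hB : Continuous fun x => φ x • partialDeriv i V x :=
    (ext1 (k := 0) hzero (hφ1.of_le (by simp)) hdV).continuous
  have hcA : HasCompactSupport fun x => partialDeriv i φ x • V x :=
    (hasCompactSupport_partialDeriv hφ.compactSupport i).smul_right
  have hcB : HasCompactSupport fun x => φ x • partialDeriv i V x := hφ.compactSupport.smul_right
  have iA := hA.integrable_of_hasCompactSupport (μ := (volume : Measure Plane)) hcA
  have iB := hB.integrable_of_hasCompactSupport (μ := (volume : Measure Plane)) hcB
  have hsum : ∀ x, partialDeriv i (fun x => φ x • V x) x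
      = partialDeriv i φ x • V x + φ x • partialDeriv i V x := by
    intro x
    by_cases hx : x ∈ tsupport φ
    · have hVx : DifferentiableAt ℝ V x :=
        (hV.contDiffAt (hU.mem_nhds (hφ.support_subset hx))).differentiableAt (by simp)
      have h := (hφ1.differentiable (by simp) x).hasFDerivAt.smul hVx.hasFDerivAt
      have h' : fderiv ℝ (fun x => φ x • V x) x = _ := h.fderiv
      rw [partialDeriv, h', add_comm]
      rfl
    · have h1 : (fun x => φ x • V x) =ᶠ[𝓝 x] fun _ => 0 := by
        filter_upwards [hzero x hx] with y hy
        simp [hy]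
      have h2 := (hdφ0 x hx).self_of_nhds
      have h3 := (hzero x hx).self_of_nhds
      simp only [Pi.zero_apply] at h2 h3
      rw [h2, h3, partialDeriv, h1.fderiv_eq]
      simp
  have hz := integral_partialDeriv_eq_zero hF hcF i
  rw [integral_congr_ae (Filter.Eventually.of_forall hsum), integral_add iA iB] at hz
  have hsub : ∀ x, x ∉ U → x ∉ tsupport φ := fun x hx h => hx (hφ.support_subset h)
  refine ⟨iA.integrableOn, iB.integrableOn, ?_⟩
  rw [setIntegral_eq_integral_of_forall_compl_eq_zero, setIntegral_eq_integral_of_forall_compl_eq_zero]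
  · exact eq_neg_of_add_eq_zero_left hz
  · intro x hx
    have := (hzero x (hsub x hx)).self_of_nhds
    simp only [Pi.zero_apply] at this
    simp [this]
  · intro x hx
    have := (hdφ0 x (hsub x hx)).self_of_nhds
    simp only [Pi.zero_apply] at this
    simp [this]

lemma locallyIntegrableOn_of_continuousOn {U : Set Plane} (hU : IsOpen U) {f : Plane → ℂ}
    (hf : ContinuousOn f U) : LocallyIntegrableOn f U volume :=
  hf.locallyIntegrableOn hU.measurableSet

lemma hasWeakPartial_of_contDiffOn {U : Set Plane} (hU : IsOpen U) {f : Plane → ℂ}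
    (hf : ContDiffOn ℝ 1 f U) (i : Fin 2) : HasWeakPartial U i f (partialDeriv i f) where
  locInt := locallyIntegrableOn_of_continuousOn hU hf.continuousOn
  locInt_deriv := locallyIntegrableOn_of_continuousOn hU
    (contDiffOn_partialDeriv hU (m := 0) (k := 1) (by exact_mod_cast hf) (by simp) i).continuousOn
  integral_eq φ hφ := (integral_test_mul hU hf hφ i).2.2

lemma hasWeakDiv_of_contDiffOn {U : Set Plane} (hU : IsOpen U) {V : Fin 2 → Plane → ℂ}
    (hV : ∀ i, ContDiffOn ℝ 1 (V i) U) :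
    HasWeakDiv U V fun x => ∑ i, partialDeriv i (V i) x where
  locInt i := locallyIntegrableOn_of_continuousOn hU (hV i).continuousOn
  locInt_div := locallyIntegrableOn_of_continuousOn hU (continuousOn_finsetSum _ fun i _ =>
    (contDiffOn_partialDeriv hU (m := 0) (k := 1) (by exact_mod_cast hV i) (by simp) i).continuousOn)
  integral_eq φ hφ := by
    have h := fun i => integral_test_mul hU (hV i) hφ i
    simp only [Finset.smul_sum]
    rw [integral_finsetSum _ fun i _ => (h i).1, integral_finsetSum _ fun i _ => (h i).2.1,
      ← Finset.sum_neg_distrib]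
    exact Finset.sum_congr rfl fun i _ => (h i).2.2

/-! ### Functions with a smooth extension across the circle -/

section PiecewiseSmooth

variable {U : Set Plane} {u v : Plane → ℂ}

lemma memLp_of_eqOn (hU : IsOpen U) (hv : Continuous v) (hc : HasCompactSupport v)
    (h : EqOn u v U) : MemLp u 2 (volume.restrict U) := by
  have h1 : MemLp v 2 (volume.restrict U) := (hv.memLp_of_hasCompactSupport hc).restrict U
  refine h1.ae_eq ?_
  exact (ae_restrict_iff' hU.measurableSet).2 (Filter.Eventually.of_forall fun x hx => (h hx).symm)

/-- On the open set U the derivatives of u are those of the global extension v, which are continuous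
with compact support and hence square integrable. -/
lemma memH2_of_eqOn (hU : IsOpen U) (hv : ContDiff ℝ ∞ v) (hc : HasCompactSupport v)
    (h : EqOn u v U) : MemH2 U u := by
  have h1 := fun i => partialDeriv_congr hU h i
  have h2 := fun i l => partialDeriv_congr hU (h1 i) l
  have s0 : ContDiffOn ℝ 1 u U := ((hv.of_le (by exact_mod_cast le_top)).contDiffOn).congr h
  have s1 : ∀ i, ContDiffOn ℝ 1 (partialDeriv i u) U := fun i =>
    (((contDiff_partialDeriv hv i).of_le (by exact_mod_cast le_top)).contDiffOn).congr (h1 i)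
  exact ⟨memLp_of_eqOn hU hv.continuous hc h, fun i => partialDeriv i u,
    fun i l => partialDeriv l (partialDeriv i u),
    fun i => ⟨memLp_of_eqOn hU (contDiff_partialDeriv hv i).continuous
      (hasCompactSupport_partialDeriv hc i) (h1 i), hasWeakPartial_of_contDiffOn hU s0 i⟩,
    fun i l => ⟨memLp_of_eqOn hU (contDiff_partialDeriv (contDiff_partialDeriv hv i) l).continuous
      (hasCompactSupport_partialDeriv (hasCompactSupport_partialDeriv hc i) l) (h2 i l),
      hasWeakPartial_of_contDiffOn hU (s1 i) l⟩⟩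

lemma continuous_polarPoint (R : ℝ) : Continuous (polarPoint R) := by
  unfold polarPoint
  exact (PiLp.continuous_toLp 2 _).comp (continuous_pi fun i => by
    fin_cases i
    · exact continuous_const.mul Real.continuous_cos
    · exact continuous_const.mul Real.continuous_sin)

/-- The smooth extension v itself, taken as a constant approximating sequence, realizes the trace.
-/
lemma hasTrace_of_eqOn (hU : IsOpen U) (R : ℝ) (hv : ContDiff ℝ ∞ v) (hc : HasCompactSupport v)
    (h : EqOn u v U) : HasTrace U R u fun θ => v (polarPoint R θ) := by
  have s0 : ContDiffOn ℝ 1 u U := ((hv.of_le (by exact_mod_cast le_top)).contDiffOn).congr h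
  have hz : ∀ {f g : Plane → ℂ}, EqOn f g U →
      eLpNorm (fun x => g x - f x) 2 (volume.restrict U) = 0 := fun {f g} hfg => by
    have : (fun x => g x - f x) =ᵐ[volume.restrict U] 0 :=
      (ae_restrict_iff' hU.measurableSet).2 (Filter.Eventually.of_forall fun x hx => by
        simp [hfg hx])
    rw [eLpNorm_congr_ae this]; simp
  refine ⟨?_, fun i => partialDeriv i u, fun _ => v, fun i => hasWeakPartial_of_contDiffOn hU s0 i,
    fun _ => ⟨hv, hc⟩, ?_, fun i => ?_, ?_⟩
  · have hcont : Continuous fun θ => v (polarPoint R θ) := hv.continuous.comp (continuous_polarPoint R)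
    obtain ⟨C, hC⟩ := hv.continuous.bounded_above_of_compact_support hc
    exact MemLp.of_bound hcont.aestronglyMeasurable C (Filter.Eventually.of_forall fun θ => hC _)
  · simp only [hz h]; exact tendsto_const_nhds
  · simp only [hz (partialDeriv_congr hU h i)]; exact tendsto_const_nhds
  · simp

end PiecewiseSmooth

lemma isOpen_disk (R : ℝ) : IsOpen (disk R) := Metric.isOpen_ball

lemma isOpen_exterior (R : ℝ) : IsOpen (exterior R) := Metric.isClosed_closedBall.isOpen_compl

lemma ae_mem_disk_or_exterior (R : ℝ) : ∀ᵐ x : Plane, x ∈ disk R ∨ x ∈ exterior R := by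
  have h : volume (Metric.sphere (0 : Plane) R) = 0 := Measure.addHaar_sphere _ _ _
  filter_upwards [measure_eq_zero_iff_ae_notMem.1 h] with x hx
  rcases lt_trichotomy ‖x‖ R with h | h | h
  · left; simpa [disk] using h
  · exact absurd (by simpa using h) hx
  · right; simpa [exterior] using h

lemma memLp_of_disk_of_exterior {R : ℝ} {u : Plane → ℂ} (hi : MemLp u 2 (volume.restrict (disk R)))
    (ho : MemLp u 2 (volume.restrict (exterior R))) : MemLp u 2 := by
  rw [← memLp_indicator_iff_restrict (isOpen_disk R).measurableSet] at hi
  rw [← memLp_indicator_iff_restrict (isOpen_exterior R).measurableSet] at ho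
  refine (hi.add ho).ae_eq ?_
  filter_upwards [ae_mem_disk_or_exterior R] with x hx
  rcases hx with hx | hx
  · have hx' : x ∉ exterior R := fun h => h (Metric.ball_subset_closedBall hx)
    simp [hx, hx']
  · have hx' : x ∉ disk R := fun h => hx (Metric.ball_subset_closedBall h)
    simp [hx, hx']

/-- Functions that are smooth up to the circle from both sides and satisfy the transmission
conditions are in the domain. -/
lemma inDomain_of_eqOn {n : ℝ → ℝ} {R : ℝ} {p : ℤ} {u vi vo : Plane → ℂ}
    (hvi : ContDiff ℝ ∞ vi) (hci : HasCompactSupport vi)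
    (hvo : ContDiff ℝ ∞ vo) (hco : HasCompactSupport vo)
    (hi : EqOn u vi (disk R)) (ho : EqOn u vo (exterior R))
    (hu : ∀ θ, vi (polarPoint R θ) = vo (polarPoint R θ))
    (hν : ∀ θ, ((n R ^ (p - 1) : ℝ) : ℂ) * (Real.cos θ * partialDeriv 0 vi (polarPoint R θ)
        + Real.sin θ * partialDeriv 1 vi (polarPoint R θ))
      = Real.cos θ * partialDeriv 0 vo (polarPoint R θ)
        + Real.sin θ * partialDeriv 1 vo (polarPoint R θ)) :
    InDomain n R p u := by
  have s : ∀ {v : Plane → ℂ}, ContDiff ℝ ∞ v → ∀ U : Set Plane, EqOn u v U → ContDiffOn ℝ 1 u U :=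
    fun hv U h => ((hv.of_le (by exact_mod_cast le_top)).contDiffOn).congr h
  refine ⟨?_, memH2_of_eqOn (isOpen_disk R) hvi hci hi, memH2_of_eqOn (isOpen_exterior R) hvo hco ho,
    ⟨_, hasTrace_of_eqOn (isOpen_disk R) R hvi hci hi, ?_⟩, fun i => partialDeriv i u,
    fun i θ => partialDeriv i vi (polarPoint R θ), fun i θ => partialDeriv i vo (polarPoint R θ),
    fun i => ⟨hasWeakPartial_of_contDiffOn (isOpen_disk R) (s hvi _ hi) i,
      hasWeakPartial_of_contDiffOn (isOpen_exterior R) (s hvo _ ho) i⟩,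
    fun i => ⟨hasTrace_of_eqOn (isOpen_disk R) R (contDiff_partialDeriv hvi i)
        (hasCompactSupport_partialDeriv hci i) (partialDeriv_congr (isOpen_disk R) hi i),
      hasTrace_of_eqOn (isOpen_exterior R) R (contDiff_partialDeriv hvo i)
        (hasCompactSupport_partialDeriv hco i) (partialDeriv_congr (isOpen_exterior R) ho i)⟩,
    Filter.Eventually.of_forall fun θ => hν θ⟩
  · exact memLp_of_disk_of_exterior (memLp_of_eqOn (isOpen_disk R) hvi.continuous hci hi)
      (memLp_of_eqOn (isOpen_exterior R) hvo.continuous hco ho)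
  · have := hasTrace_of_eqOn (isOpen_exterior R) R hvo hco ho
    simpa only [hu] using this

/-- The residual of a function that is smooth on both sides of the circle. -/
noncomputable def residualFun (n : ℝ → ℝ) (p : ℤ) (k : ℝ) (u : Plane → ℂ) (x : Plane) : ℂ :=
  -(∑ i, partialDeriv i (fun y => ((n ‖y‖ ^ (p - 1) : ℝ) : ℂ) * partialDeriv i u y) x)
    - ((k ^ 2 * n ‖x‖ ^ (p + 1) : ℝ) : ℂ) * u x

/-- With classical regularity on both sides the weak residual is the pointwise one. A sup bound on a
bounded support then controls its L² norm, the circle being a null set. -/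
lemma isResidual_residualFun {n : ℝ → ℝ} {R : ℝ} {p : ℤ} {k : ℝ} {u : Plane → ℂ} {B L : ℝ}
    (hi : ContDiffOn ℝ 1 u (disk R)) (ho : ContDiffOn ℝ 1 u (exterior R))
    (hNi : ∀ i, ContDiffOn ℝ 1 (fun x => ((n ‖x‖ ^ (p - 1) : ℝ) : ℂ) * partialDeriv i u x) (disk R))
    (hNo : ∀ i, ContDiffOn ℝ 1 (fun x => ((n ‖x‖ ^ (p - 1) : ℝ) : ℂ) * partialDeriv i u x)
      (exterior R))
    (hni : ContinuousOn (fun x : Plane => n ‖x‖ ^ (p + 1)) (disk R))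
    (hno : ContinuousOn (fun x : Plane => n ‖x‖ ^ (p + 1)) (exterior R))
    (hB : ∀ x, x ∈ disk R ∨ x ∈ exterior R → ‖residualFun n p k u x‖ ≤ B)
    (hL : ∀ x : Plane, L ≤ ‖x‖ → residualFun n p k u x = 0) :
    IsResidual n R p k u (residualFun n p k u) ∧
      eLpNorm (residualFun n p k u) 2 volume ≤
        ENNReal.ofReal B * volume (Metric.ball (0 : Plane) L) ^ (1 / 2 : ℝ) := by
  have hc : ∀ {U : Set Plane}, IsOpen U → ContDiffOn ℝ 1 u U →
      (∀ i, ContDiffOn ℝ 1 (fun x => ((n ‖x‖ ^ (p - 1) : ℝ) : ℂ) * partialDeriv i u x) U) →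
      ContinuousOn (fun x : Plane => n ‖x‖ ^ (p + 1)) U →
      AEStronglyMeasurable (residualFun n p k u) (volume.restrict U) := by
    intro U hU h1 h2 h3
    refine ContinuousOn.aestronglyMeasurable ?_ hU.measurableSet
    refine (continuousOn_finsetSum _ fun i _ => (contDiffOn_partialDeriv hU (m := 0) (k := 1)
      (by exact_mod_cast h2 i) (by simp) i).continuousOn).neg.sub ?_
    exact (Complex.continuous_ofReal.comp_continuousOn (continuousOn_const.mul h3)).mul h1.continuousOn
  have hmeas : AEStronglyMeasurable (residualFun n p k u) volume := by
    have h : (volume : Measure Plane).restrict (disk R ∪ exterior R) = volume :=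
      Measure.restrict_eq_self_of_ae_mem (ae_mem_disk_or_exterior R)
    rw [← h]
    exact aestronglyMeasurable_union_iff.2 ⟨hc (isOpen_disk R) hi hNi hni,
      hc (isOpen_exterior R) ho hNo hno⟩
  have hind : (Metric.ball (0 : Plane) L).indicator (residualFun n p k u) = residualFun n p k u := by
    rw [indicator_eq_self]
    intro x hx
    by_contra h
    exact hx (hL x (by simpa using h))
  have hnorm : eLpNorm (residualFun n p k u) 2 volume ≤
      ENNReal.ofReal B * volume (Metric.ball (0 : Plane) L) ^ (1 / 2 : ℝ) := by
    rw [← hind, eLpNorm_indicator_eq_eLpNorm_restrict Metric.isOpen_ball.measurableSet]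
    refine (eLpNorm_le_of_ae_bound (C := B) (ae_restrict_of_ae ?_)).trans (le_of_eq ?_)
    · filter_upwards [ae_mem_disk_or_exterior R] with x hx using hB x hx
    · rw [mul_comm]; simp
  refine ⟨⟨⟨hmeas, hnorm.trans_lt ?_⟩, fun i => partialDeriv i u, _, fun i =>
    ⟨hasWeakPartial_of_contDiffOn (isOpen_disk R) hi i,
      hasWeakPartial_of_contDiffOn (isOpen_exterior R) ho i⟩,
    hasWeakDiv_of_contDiffOn (isOpen_disk R) hNi, hasWeakDiv_of_contDiffOn (isOpen_exterior R) hNo,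
    Filter.Eventually.of_forall fun x => rfl⟩, hnorm⟩
  exact ENNReal.mul_lt_top ENNReal.ofReal_lt_top
    (ENNReal.rpow_lt_top_of_nonneg (by norm_num) Metric.isBounded_ball.measure_lt_top.ne)

/-! ### Calculus of modes with a given angular frequency -/

/-- `f` is differentiable at `x` with gradient `G`. -/
structure HasGrad (f : Plane → ℂ) (G : Fin 2 → ℂ) (x : Plane) : Prop where
  differentiableAt : DifferentiableAt ℝ f x
  partialDeriv_eq : ∀ i, partialDeriv i f x = G i

namespace HasGrad

variable {f g : Plane → ℂ} {F G : Fin 2 → ℂ} {x : Plane}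

lemma add (hf : HasGrad f F x) (hg : HasGrad g G x) :
    HasGrad (fun y => f y + g y) (fun i => F i + G i) x := by
  refine ⟨hf.differentiableAt.add hg.differentiableAt, fun i => ?_⟩
  rw [← hf.partialDeriv_eq, ← hg.partialDeriv_eq, partialDeriv,
    fderiv_fun_add hf.differentiableAt hg.differentiableAt]
  rfl

lemma mul (hf : HasGrad f F x) (hg : HasGrad g G x) :
    HasGrad (fun y => f y * g y) (fun i => F i * g x + f x * G i) x := by
  refine ⟨hf.differentiableAt.mul hg.differentiableAt, fun i => ?_⟩
  rw [← hf.partialDeriv_eq, ← hg.partialDeriv_eq, partialDeriv,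
    fderiv_fun_mul hf.differentiableAt hg.differentiableAt]
  change f x * partialDeriv i g x + g x * partialDeriv i f x = _
  ring

lemma congr (hf : HasGrad f F x) (h : ∀ i, F i = G i) : HasGrad f G x :=
  ⟨hf.differentiableAt, fun i => (hf.partialDeriv_eq i).trans (h i)⟩

lemma congr_of_eventuallyEq (hf : HasGrad f F x) (h : g =ᶠ[𝓝 x] f) : HasGrad g F x :=
  ⟨hf.differentiableAt.congr_of_eventuallyEq h, fun i => by
    rw [← hf.partialDeriv_eq i]; simp only [partialDeriv, h.fderiv_eq]⟩

end HasGrad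

lemma hasGrad_partialDeriv {f : Plane → ℂ} {x : Plane} (h : DifferentiableAt ℝ f x) :
    HasGrad f (fun i => partialDeriv i f x) x := ⟨h, fun _ => rfl⟩

lemma hasGrad_const (c : ℂ) (x : Plane) : HasGrad (fun _ => c) (fun _ => 0) x :=
  ⟨differentiableAt_const c, fun i => by simp [partialDeriv]⟩

lemma hasGrad_coord (l : Fin 2) (x : Plane) :
    HasGrad (fun y => ((y l : ℝ) : ℂ)) (fun i => if i = l then 1 else 0) x := by
  have h : HasFDerivAt (fun y : Plane => ((y l : ℝ) : ℂ))
      (Complex.ofRealCLM.comp (EuclideanSpace.proj (𝕜 := ℝ) l)) x :=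
    (Complex.ofRealCLM.comp (EuclideanSpace.proj (𝕜 := ℝ) l : Plane →L[ℝ] ℝ)).hasFDerivAt
  refine ⟨h.differentiableAt, fun i => ?_⟩
  rw [partialDeriv, h.fderiv]
  by_cases hi : i = l
  · subst hi; simp
  · simp [hi, Ne.symm hi]

lemma hasGrad_radial {g : ℝ → ℝ} {g' : ℝ} {x : Plane} (hx : x ≠ 0) (hg : HasDerivAt g g' ‖x‖) :
    HasGrad (fun y => ((g ‖y‖ : ℝ) : ℂ)) (fun i => ((g' * (x i / ‖x‖) : ℝ) : ℂ)) x := by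
  have hx' : ‖x‖ ≠ 0 := norm_ne_zero_iff.2 hx
  have hn : HasFDerivAt (fun y : Plane => ‖y‖) (‖x‖⁻¹ • innerSL ℝ x) x := by
    have h1 : HasFDerivAt (fun y : Plane => √(‖y‖ ^ 2)) _ x :=
      ((hasStrictFDerivAt_norm_sq x).hasFDerivAt).sqrt (by positivity)
    simp only [Real.sqrt_sq (norm_nonneg _)] at h1
    have h2 : (1 / (2 * ‖x‖)) • 2 • (innerSL ℝ) x = ‖x‖⁻¹ • innerSL ℝ x := by
      rw [two_smul, ← two_smul ℝ, smul_smul]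
      congr 1
      field_simp
    rwa [h2] at h1
  have h := (Complex.ofRealCLM.hasFDerivAt (x := g ‖x‖)).comp x (hg.comp_hasFDerivAt x hn)
  refine ⟨h.differentiableAt, fun i => ?_⟩
  have h' : fderiv ℝ (fun y : Plane => ((g ‖y‖ : ℝ) : ℂ)) x = _ := h.fderiv
  rw [partialDeriv, h']
  simp [EuclideanSpace.inner_single_right]
  left
  field_simp

/-- `e^{imθ}` as a function on the plane. -/
noncomputable def angularPhase (m : ℕ) (x : Plane) : ℂ :=
  (((x 0 : ℝ) + (x 1 : ℝ) * Complex.I) * ((‖x‖⁻¹ : ℝ) : ℂ)) ^ m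

/-- The vector field of rotations. -/
def rotField (x : Plane) (i : Fin 2) : ℝ := if i = 0 then -x 1 else x 0

lemma norm_sq_plane (x : Plane) : ‖x‖ ^ 2 = x 0 ^ 2 + x 1 ^ 2 := by
  rw [EuclideanSpace.norm_sq_eq]; simp [Fin.sum_univ_two]

lemma norm_coord_le (x : Plane) (i : Fin 2) : |x i| ≤ ‖x‖ := by
  simpa using PiLp.norm_apply_le x i

lemma abs_rotField_le (x : Plane) (i : Fin 2) : |rotField x i| ≤ ‖x‖ := by
  fin_cases i
  · simpa [rotField] using norm_coord_le x 1
  · simpa [rotField] using norm_coord_le x 0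

lemma norm_angularPhase (m : ℕ) {x : Plane} (hx : x ≠ 0) : ‖angularPhase m x‖ = 1 := by
  have hx' : 0 < ‖x‖ := norm_pos_iff.2 hx
  have h : ‖((x 0 : ℝ) : ℂ) + (x 1 : ℝ) * Complex.I‖ = ‖x‖ := by
    rw [Complex.norm_add_mul_I, ← norm_sq_plane, Real.sqrt_sq hx'.le]
  rw [angularPhase, norm_pow, norm_mul, h, Complex.norm_real, norm_inv, norm_norm,
    mul_inv_cancel₀ hx'.ne', one_pow]

/-- Only frequency one needs a computation, with x₀² + x₁² = ‖x‖²; higher powers follow from the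
product rule by induction on m. -/
lemma hasGrad_angularPhase (m : ℕ) {x : Plane} (hx : x ≠ 0) :
    HasGrad (angularPhase m)
      (fun i => angularPhase m x * (m * Complex.I * ((rotField x i / ‖x‖ ^ 2 : ℝ) : ℂ))) x := by
  have hx' : ‖x‖ ≠ 0 := norm_ne_zero_iff.2 hx
  have hc : ((‖x‖ : ℝ) : ℂ) ≠ 0 := by exact_mod_cast hx'
  have h1 : HasGrad (fun x : Plane => ((x 0 : ℝ) + (x 1 : ℝ) * Complex.I) * ((‖x‖⁻¹ : ℝ) : ℂ))
      (fun i => (((x 0 : ℝ) + (x 1 : ℝ) * Complex.I) * ((‖x‖⁻¹ : ℝ) : ℂ)) *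
        (Complex.I * ((rotField x i / ‖x‖ ^ 2 : ℝ) : ℂ))) x := by
    refine (((hasGrad_coord 0 x).add ((hasGrad_coord 1 x).mul (hasGrad_const Complex.I x))).mul
      (hasGrad_radial hx (hasDerivAt_inv hx'))).congr fun i => ?_
    have hsq : ((‖x‖ : ℝ) : ℂ) ^ 2 = ((x 0 : ℝ) : ℂ) ^ 2 + ((x 1 : ℝ) : ℂ) ^ 2 := by
      exact_mod_cast norm_sq_plane x
    have hI : Complex.I ^ 2 = -1 := Complex.I_sq
    fin_cases i
    · simp [rotField]
      field_simp
      linear_combination hsq + ((x 1 : ℝ) : ℂ) ^ 2 * hI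
    · simp [rotField]
      field_simp
      linear_combination Complex.I * hsq - ((x 1 : ℝ) : ℂ) * ((x 0 : ℝ) : ℂ) * hI
  induction m with
  | zero => 
    refine ((hasGrad_const 1 x).congr_of_eventuallyEq (g := angularPhase 0)
      (Filter.Eventually.of_forall fun y => by simp [angularPhase])).congr fun i => by simp
  | succ m ih =>
    refine ((ih.mul h1).congr_of_eventuallyEq (g := angularPhase (m + 1))
      (Filter.Eventually.of_forall fun y => by rw [angularPhase, pow_succ]; rfl)).congr fun i => ?_
    simp only [angularPhase, pow_succ]
    push_cast
    ring

/-- The function `f(r) e^{imθ}`. -/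
noncomputable def angularMode (m : ℕ) (f : ℝ → ℝ) (x : Plane) : ℂ :=
  ((f ‖x‖ : ℝ) : ℂ) * angularPhase m x

lemma norm_angularMode (m : ℕ) (f : ℝ → ℝ) {x : Plane} (hx : x ≠ 0) :
    ‖angularMode m f x‖ = |f ‖x‖| := by
  rw [angularMode, norm_mul, norm_angularPhase m hx, mul_one, Complex.norm_real, Real.norm_eq_abs]

lemma contDiffAt_angularPhase (m : ℕ) {x : Plane} (hx : x ≠ 0) {k : WithTop ℕ∞} :
    ContDiffAt ℝ k (angularPhase m) x := by
  have hc : ∀ l : Fin 2, ContDiffAt ℝ k (fun y : Plane => ((y l : ℝ) : ℂ)) x := fun l =>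
    (Complex.ofRealCLM.comp
      (EuclideanSpace.proj (𝕜 := ℝ) l : Plane →L[ℝ] ℝ)).contDiff.contDiffAt
  have hn : ContDiffAt ℝ k (fun y : Plane => ((‖y‖⁻¹ : ℝ) : ℂ)) x :=
    Complex.ofRealCLM.contDiff.contDiffAt.comp x
      ((contDiffAt_norm ℝ hx).inv (norm_ne_zero_iff.2 hx))
  exact (((hc 0).add ((hc 1).mul contDiffAt_const)).mul hn).pow m

lemma contDiffAt_angularMode (m : ℕ) {f : ℝ → ℝ} {x : Plane} (hx : x ≠ 0) {k : WithTop ℕ∞}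
    (hf : ContDiffAt ℝ k f ‖x‖) : ContDiffAt ℝ k (angularMode m f) x :=
  (Complex.ofRealCLM.contDiff.contDiffAt.comp x (hf.comp x (contDiffAt_norm ℝ hx))).mul
    (contDiffAt_angularPhase m hx)

section Derivatives

variable {f f₁ f₂ : ℝ → ℝ} {x : Plane}

lemma hasGrad_angularMode (m : ℕ) (hx : x ≠ 0) (hf : HasDerivAt f (f₁ ‖x‖) ‖x‖) :
    HasGrad (angularMode m f)
      (fun i => ((f₁ ‖x‖ / ‖x‖ : ℝ) : ℂ) * ((x i : ℝ) * angularPhase m x) +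
        ((f ‖x‖ / ‖x‖ ^ 2 : ℝ) : ℂ) *
          ((m * Complex.I * (rotField x i : ℝ)) * angularPhase m x)) x := by
  refine ((hasGrad_radial hx hf).mul (hasGrad_angularPhase m hx)).congr fun i => ?_
  push_cast
  ring

lemma partialDeriv_angularMode (m : ℕ) (hx : x ≠ 0) (hf : HasDerivAt f (f₁ ‖x‖) ‖x‖) (i : Fin 2) :
    partialDeriv i (angularMode m f) x =
      ((f₁ ‖x‖ / ‖x‖ : ℝ) : ℂ) * ((x i : ℝ) * angularPhase m x) +
        ((f ‖x‖ / ‖x‖ ^ 2 : ℝ) : ℂ) * ((m * Complex.I * (rotField x i : ℝ)) * angularPhase m x) :=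
  (hasGrad_angularMode m hx hf).partialDeriv_eq i

lemma norm_partialDeriv_angularMode_le (m : ℕ) (hx : x ≠ 0) (hf : HasDerivAt f (f₁ ‖x‖) ‖x‖)
    (i : Fin 2) : ‖partialDeriv i (angularMode m f) x‖ ≤ |f₁ ‖x‖| + m * |f ‖x‖| / ‖x‖ := by
  have hx' : 0 < ‖x‖ := norm_pos_iff.2 hx
  rw [partialDeriv_angularMode m hx hf]
  refine (norm_add_le _ _).trans (add_le_add ?_ ?_)
  · simp only [norm_mul, norm_angularPhase m hx, Complex.norm_real, mul_one, norm_div, norm_norm,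
      Real.norm_eq_abs]
    rw [abs_of_pos hx', div_mul_eq_mul_div]
    exact div_le_of_le_mul₀ hx'.le (abs_nonneg _)
      (mul_le_mul_of_nonneg_left (norm_coord_le x i) (abs_nonneg _))
  · simp only [norm_mul, norm_angularPhase m hx, Complex.norm_real, mul_one, norm_div, norm_norm,
      Real.norm_eq_abs, norm_pow, Complex.norm_I, Complex.norm_natCast]
    rw [abs_of_pos hx', div_mul_eq_mul_div, div_le_div_iff₀ (by positivity) hx']
    have := mul_le_mul_of_nonneg_left (abs_rotField_le x i)
      (show 0 ≤ |f ‖x‖| * m * ‖x‖ by positivity)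
    nlinarith

lemma sum_coord_mul_partialDeriv_angularMode (m : ℕ) (hx : x ≠ 0)
    (hf : HasDerivAt f (f₁ ‖x‖) ‖x‖) :
    ∑ i, (((x i / ‖x‖ : ℝ)) : ℂ) * partialDeriv i (angularMode m f) x =
      ((f₁ ‖x‖ : ℝ) : ℂ) * angularPhase m x := by
  have hc : ((‖x‖ : ℝ) : ℂ) ≠ 0 := by exact_mod_cast norm_ne_zero_iff.2 hx
  have hsq : ((‖x‖ : ℝ) : ℂ) ^ 2 = ((x 0 : ℝ) : ℂ) ^ 2 + ((x 1 : ℝ) : ℂ) ^ 2 := by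
    exact_mod_cast norm_sq_plane x
  simp only [partialDeriv_angularMode m hx hf, Fin.sum_univ_two, rotField]
  push_cast
  simp
  field_simp
  linear_combination -((‖x‖ : ℝ) : ℂ) * ((f₁ ‖x‖ : ℝ) : ℂ) * angularPhase m x * hsq

/-- The Laplace operator in polar coordinates. -/
lemma sum_partialDeriv_partialDeriv_angularMode (m : ℕ) (hx : x ≠ 0)
    (hf : ∀ r, HasDerivAt f (f₁ r) r) (hf₁ : HasDerivAt f₁ (f₂ ‖x‖) ‖x‖) :
    ∑ i, partialDeriv i (partialDeriv i (angularMode m f)) x =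
      ((f₂ ‖x‖ + f₁ ‖x‖ / ‖x‖ - (m : ℝ) ^ 2 * f ‖x‖ / ‖x‖ ^ 2 : ℝ) : ℂ) * angularPhase m x := by
  have hx' : ‖x‖ ≠ 0 := norm_ne_zero_iff.2 hx
  have hc : ((‖x‖ : ℝ) : ℂ) ≠ 0 := by exact_mod_cast hx'
  have hsq : ((‖x‖ : ℝ) : ℂ) ^ 2 = ((x 0 : ℝ) : ℂ) ^ 2 + ((x 1 : ℝ) : ℂ) ^ 2 := by
    exact_mod_cast norm_sq_plane x
  have hev : ∀ i, partialDeriv i (angularMode m f) =ᶠ[𝓝 x] fun y =>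
      ((f₁ ‖y‖ / ‖y‖ : ℝ) : ℂ) * ((y i : ℝ) * angularPhase m y) +
        ((f ‖y‖ / ‖y‖ ^ 2 : ℝ) : ℂ) * ((m * Complex.I * (rotField y i : ℝ)) * angularPhase m y) :=
    fun i => by
      filter_upwards [isOpen_ne.mem_nhds hx] with y hy using partialDeriv_angularMode m hy (hf _) i
  have hA := hasGrad_radial hx (hf₁.div (hasDerivAt_id _) hx')
  have hB := hasGrad_radial hx ((hf ‖x‖).div (hasDerivAt_pow 2 _) (by positivity))
  have hE := hasGrad_angularPhase m hx
  have h0 := ((hA.mul ((hasGrad_coord 0 x).mul hE)).add (hB.mul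
    (((hasGrad_const (m * Complex.I) x).mul ((hasGrad_const (-1) x).mul (hasGrad_coord 1 x))).mul
      hE))).congr_of_eventuallyEq ((hev 0).trans (Filter.Eventually.of_forall fun y => by
        simp [rotField]))
  have h1 := ((hA.mul ((hasGrad_coord 1 x).mul hE)).add (hB.mul
    (((hasGrad_const (m * Complex.I) x).mul (hasGrad_coord 0 x)).mul
      hE))).congr_of_eventuallyEq ((hev 1).trans (Filter.Eventually.of_forall fun y => by
        simp [rotField]))
  rw [Fin.sum_univ_two, h0.partialDeriv_eq 0, h1.partialDeriv_eq 1]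
  simp [rotField]
  have hI : Complex.I ^ 2 = -1 := Complex.I_sq
  generalize hX : ((x 0 : ℝ) : ℂ) = X at *
  generalize hY : ((x 1 : ℝ) : ℂ) = Y at *
  generalize hr : ((‖x‖ : ℝ) : ℂ) = r at *
  -- Elimination of X² reduces both sides modulo the relation X² + Y² = r², after which they agree
  -- as polynomials.
  have hX2 : X ^ 2 = r ^ 2 - Y ^ 2 := by linear_combination -hsq
  field_simp
  ring_nf
  simp only [hX2, hI]
  ring

end Derivatives

lemma polarPoint_zero (r θ : ℝ) : polarPoint r θ 0 = r * Real.cos θ := by simp [polarPoint]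

lemma polarPoint_one (r θ : ℝ) : polarPoint r θ 1 = r * Real.sin θ := by simp [polarPoint]

lemma norm_polarPoint {r : ℝ} (hr : 0 ≤ r) (θ : ℝ) : ‖polarPoint r θ‖ = r := by
  rw [← pow_left_inj₀ (norm_nonneg _) hr two_ne_zero, norm_sq_plane, polarPoint_zero, polarPoint_one]
  linear_combination r ^ 2 * Real.cos_sq_add_sin_sq θ

lemma angularPhase_polarPoint (m : ℕ) {r : ℝ} (hr : 0 < r) (θ : ℝ) :
    angularPhase m (polarPoint r θ) = Complex.exp (m * θ * Complex.I) := by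
  have hc : ((r : ℝ) : ℂ) ≠ 0 := by exact_mod_cast hr.ne'
  rw [angularPhase, norm_polarPoint hr.le, polarPoint_zero, polarPoint_one, mul_assoc,
    Complex.exp_nat_mul, Complex.exp_mul_I]
  congr 1
  push_cast
  field_simp

/-! ### Angular modes with a cut-off function -/

/-- A cut-off function which is `1` near the circle of radius `R` and `0` away from it. -/
structure IsAnnularCutoff (R δ : ℝ) (χ : Plane → ℝ) : Prop extends IsCutoff χ where
  eq_zero : ∀ x, R / 4 < |‖x‖ - R| → χ x = 0
  eq_one : ∀ x, |‖x‖ - R| < δ → χ x = 1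

/-- The radial part of the operator `div (n^{p-1} ∇) + k² n^{p+1}` on functions with angular frequency
`m`. -/
noncomputable def radialOp (N N₁ M : ℝ) (m : ℕ) (r f f₁ f₂ : ℝ) : ℝ :=
  N₁ * f₁ + N * (f₂ + f₁ / r - (m : ℝ) ^ 2 * f / r ^ 2) + M * f

section Residual

variable {n : ℝ → ℝ} {p : ℤ} {k : ℝ} {u X : Plane → ℂ} {f f₁ f₂ : ℝ → ℝ} {x : Plane} {N₁ : ℝ} {m : ℕ}

lemma partialDeriv_mul_angularMode (hX : ContDiff ℝ ∞ X) (hx : x ≠ 0)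
    (hf : ∀ r, HasDerivAt f (f₁ r) r) (hu : u =ᶠ[𝓝 x] fun y => X y * angularMode m f y) (i : Fin 2) :
    partialDeriv i u =ᶠ[𝓝 x] fun y =>
      partialDeriv i X y * angularMode m f y + X y * partialDeriv i (angularMode m f) y := by
  filter_upwards [eventually_eventually_nhds.2 hu, isOpen_ne.mem_nhds hx] with y hy hy0
  have h1 := hasGrad_partialDeriv (hX.differentiable (by simp) y)
  have h2 := hasGrad_partialDeriv (hasGrad_angularMode m hy0 (hf _)).differentiableAt
  exact ((h1.mul h2).congr_of_eventuallyEq hy).partialDeriv_eq i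

/-- Product rule for X · f(r)e^{imθ}: the cut-off times the radial operator, plus commutator terms,
each of which contains a derivative of X. The angular part is handled by the formulas for the radial
derivative and for the Laplacian. -/
lemma residualFun_eq (hX : ContDiff ℝ ∞ X) (hx : x ≠ 0) (hfs : ContDiff ℝ ∞ f)
    (hN : HasDerivAt (fun r => n r ^ (p - 1)) N₁ ‖x‖)
    (hf : ∀ r, HasDerivAt f (f₁ r) r) (hf₁ : ∀ r, HasDerivAt f₁ (f₂ r) r)
    (hu : u =ᶠ[𝓝 x] fun y => X y * angularMode m f y) :
    residualFun n p k u x =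
      -(X x * ((radialOp (n ‖x‖ ^ (p - 1)) N₁ (k ^ 2 * n ‖x‖ ^ (p + 1)) m ‖x‖ (f ‖x‖) (f₁ ‖x‖)
          (f₂ ‖x‖) : ℝ) * angularPhase m x)
        + ∑ i, (2 * ((n ‖x‖ ^ (p - 1) : ℝ) * partialDeriv i X x * partialDeriv i (angularMode m f) x)
          + ((N₁ * (x i / ‖x‖) : ℝ) * partialDeriv i X x
            + (n ‖x‖ ^ (p - 1) : ℝ) * partialDeriv i (partialDeriv i X) x) * angularMode m f x)) := by
  have hg : ∀ i, partialDeriv i (fun y => ((n ‖y‖ ^ (p - 1) : ℝ) : ℂ) * partialDeriv i u y) x =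
      (N₁ * (x i / ‖x‖) : ℝ) * (partialDeriv i X x * angularMode m f x +
          X x * partialDeriv i (angularMode m f) x)
        + (n ‖x‖ ^ (p - 1) : ℝ) * ((partialDeriv i (partialDeriv i X) x * angularMode m f x
            + partialDeriv i X x * partialDeriv i (angularMode m f) x)
          + (partialDeriv i X x * partialDeriv i (angularMode m f) x
            + X x * partialDeriv i (partialDeriv i (angularMode m f)) x)) := by
    intro i
    have hW : ContDiffAt ℝ ∞ (angularMode m f) x := contDiffAt_angularMode m hx hfs.contDiffAt
    have hdW : DifferentiableAt ℝ (partialDeriv i (angularMode m f)) x :=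
      ((hW.fderiv_right (m := ∞) (by simp)).clm_apply
        contDiffAt_const).differentiableAt (by simp)
    have h1 := hasGrad_partialDeriv (hX.differentiable (by simp) x)
    have h2 := hasGrad_partialDeriv (hW.differentiableAt (by simp))
    have h3 := hasGrad_partialDeriv ((contDiff_partialDeriv hX i).differentiable (by simp) x)
    have h4 := hasGrad_partialDeriv hdW
    have h5 := ((h3.mul h2).add (h1.mul h4)).congr_of_eventuallyEq
      (partialDeriv_mul_angularMode hX hx hf hu i)
    have h6 := ((hasGrad_radial hx hN).mul h5).partialDeriv_eq i
    rw [h6, (partialDeriv_mul_angularMode hX hx hf hu i).self_of_nhds]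
  have hs := sum_coord_mul_partialDeriv_angularMode (f₁ := f₁) m hx (hf _)
  have hl := sum_partialDeriv_partialDeriv_angularMode m hx hf (hf₁ _)
  rw [Fin.sum_univ_two] at hs hl
  rw [residualFun, Fin.sum_univ_two, Fin.sum_univ_two, hg 0, hg 1, hu.self_of_nhds, radialOp]
  have ha : angularMode m f x = (f ‖x‖ : ℝ) * angularPhase m x := rfl
  push_cast at hs hl ⊢
  generalize partialDeriv 0 (partialDeriv 0 (angularMode m f)) x = d00 at *
  generalize partialDeriv 1 (partialDeriv 1 (angularMode m f)) x = d11 at *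
  generalize partialDeriv 0 (angularMode m f) x = d0 at *
  generalize partialDeriv 1 (angularMode m f) x = d1 at *
  linear_combination -(N₁ : ℂ) * X x * hs - ((n ‖x‖ : ℂ) ^ (p - 1)) * X x * hl
    - (k : ℂ) ^ 2 * (n ‖x‖ : ℂ) ^ (p + 1) * X x * ha

/-- Three zones. Beyond distance R/4 from the circle the cut-off vanishes near x, so everything
does. Within distance δ it is locally 1 and only the radial residual S survives. In between, the
commutator is bounded by the size S' of the radial function and its derivative, with ‖x‖ ≥ 3R/4
controlling the powers of 1/‖x‖. -/
lemma norm_residualFun_le {R δ S S' B BN : ℝ} {χ : Plane → ℝ} (hR : 0 < R)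
    (hχ : IsAnnularCutoff R δ χ) (hx : x ≠ 0) (hfs : ContDiff ℝ ∞ f) (hm : 1 ≤ m)
    (hN : HasDerivAt (fun r => n r ^ (p - 1)) N₁ ‖x‖)
    (hf : ∀ r, HasDerivAt f (f₁ r) r) (hf₁ : ∀ r, HasDerivAt f₁ (f₂ r) r)
    (hu : u =ᶠ[𝓝 x] fun y => ((χ y : ℝ) : ℂ) * angularMode m f y)
    (hB0 : 0 ≤ B) (hS0 : 0 ≤ S) (hS0' : 0 ≤ S')
    (hB : ∀ i y, ‖partialDeriv i (fun y => ((χ y : ℝ) : ℂ)) y‖ ≤ B)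
    (hB' : ∀ i y, ‖partialDeriv i (partialDeriv i (fun y => ((χ y : ℝ) : ℂ))) y‖ ≤ B)
    (hBN : |n ‖x‖ ^ (p - 1)| ≤ BN) (hBN₁ : |N₁| ≤ BN)
    (hS : |‖x‖ - R| ≤ R / 4 → |radialOp (n ‖x‖ ^ (p - 1)) N₁ (k ^ 2 * n ‖x‖ ^ (p + 1)) m ‖x‖ (f ‖x‖)
      (f₁ ‖x‖) (f₂ ‖x‖)| ≤ S)
    (hS' : |‖x‖ - R| ≤ R / 4 → δ ≤ |‖x‖ - R| → |f₁ ‖x‖| + m * |f ‖x‖| ≤ S') :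
    ‖residualFun n p k u x‖ ≤ S + BN * B * (8 + 8 / R) * S' := by
  have hBN0 : 0 ≤ BN := (abs_nonneg _).trans hBN
  set X : Plane → ℂ := fun y => ((χ y : ℝ) : ℂ) with hXdef
  have hX : ContDiff ℝ ∞ X := Complex.ofRealCLM.contDiff.comp hχ.smooth
  have hpos : 0 ≤ BN * B * (8 + 8 / R) * S' := by positivity
  have hconst : ∀ {c : ℂ}, X =ᶠ[𝓝 x] (fun _ => c) → ∀ i, partialDeriv i X x = 0 ∧
      partialDeriv i (partialDeriv i X) x = 0 := by
    intro c hc i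
    have h1 : partialDeriv i X =ᶠ[𝓝 x] fun _ => 0 := by
      filter_upwards [eventually_eventually_nhds.2 hc] with y hy
      rw [partialDeriv, Filter.EventuallyEq.fderiv_eq (f := fun _ => c) hy]; simp
    refine ⟨h1.self_of_nhds, ?_⟩
    rw [partialDeriv, h1.fderiv_eq]; simp
  have hcont : Continuous fun y : Plane => |‖y‖ - R| := by fun_prop
  rw [residualFun_eq (X := X) hX hx hfs hN hf hf₁ hu, norm_neg]
  by_cases h1 : R / 4 < |‖x‖ - R|
  · have h0 : X =ᶠ[𝓝 x] fun _ => 0 := by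
      filter_upwards [(isOpen_lt continuous_const hcont).mem_nhds h1] with y hy
      simp [hXdef, hχ.eq_zero y hy]
    simp only [(hconst h0 _).1, (hconst h0 _).2, h0.self_of_nhds]
    simp only [mul_zero, zero_mul, add_zero, Finset.sum_const_zero, norm_zero]
    positivity
  · push Not at h1
    have hr : 3 * R / 4 ≤ ‖x‖ := by linarith [neg_abs_le (‖x‖ - R)]
    have hr0 : 0 < ‖x‖ := by linarith
    refine (norm_add_le _ _).trans (add_le_add ?_ ?_)
    · rw [norm_mul, norm_mul, norm_angularPhase m hx, mul_one, Complex.norm_real, Complex.norm_real,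
        Real.norm_eq_abs, Real.norm_eq_abs, abs_of_nonneg (hχ.nonneg x)]
      exact (mul_le_mul (hχ.le_one x) (hS h1) (abs_nonneg _) zero_le_one).trans (by rw [one_mul])
    · by_cases h2 : |‖x‖ - R| < δ
      · have h0 : X =ᶠ[𝓝 x] fun _ => 1 := by
          filter_upwards [(isOpen_lt hcont continuous_const).mem_nhds h2] with y hy
          simp [hXdef, hχ.eq_one y hy]
        simp only [(hconst h0 _).1, (hconst h0 _).2]
        simpa using hpos
      · push Not at h2
        have hS2 := hS' h1 h2
        have hm' : (1 : ℝ) ≤ m := by exact_mod_cast hm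
        have hfS : |f ‖x‖| ≤ S' := by nlinarith [abs_nonneg (f₁ ‖x‖), abs_nonneg (f ‖x‖)]
        have hdS : ∀ i, ‖partialDeriv i (angularMode m f) x‖ ≤ (1 + 4 / (3 * R)) * S' := by
          intro i
          refine (norm_partialDeriv_angularMode_le m hx (hf _) i).trans ?_
          have hA : m * |f ‖x‖| / ‖x‖ ≤ S' / (3 * R / 4) := by
            gcongr
            linarith [abs_nonneg (f₁ ‖x‖)]
          have hA' : S' / (3 * R / 4) = 4 / (3 * R) * S' := by field_simp
          have : 0 ≤ m * |f ‖x‖| := by positivity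
          linarith
        have hxi : ∀ i, |x i / ‖x‖| ≤ 1 := fun i => by
          rw [abs_div, abs_norm]; exact div_le_one_of_le₀ (norm_coord_le x i) hr0.le
        have hi : ∀ i : Fin 2, ‖2 * (((n ‖x‖ ^ (p - 1) : ℝ) : ℂ) * partialDeriv i X x *
            partialDeriv i (angularMode m f) x) + (((N₁ * (x i / ‖x‖) : ℝ) : ℂ) * partialDeriv i X x
            + ((n ‖x‖ ^ (p - 1) : ℝ) : ℂ) * partialDeriv i (partialDeriv i X) x) * angularMode m f x‖
            ≤ 2 * (BN * B * ((1 + 4 / (3 * R)) * S')) + (BN * 1 * B + BN * B) * S' := by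
          intro i
          refine (norm_add_le _ _).trans (add_le_add ?_ ?_)
          · rw [norm_mul, norm_mul, norm_mul, Complex.norm_real, Real.norm_eq_abs, Complex.norm_ofNat]
            gcongr
            · exact hB i x
            · exact hdS i
          · rw [norm_mul, norm_angularMode m f hx]
            refine mul_le_mul ((norm_add_le _ _).trans (add_le_add ?_ ?_)) hfS (abs_nonneg _)
              (by positivity)
            · rw [norm_mul, Complex.norm_real, Real.norm_eq_abs, abs_mul]
              gcongr
              · exact hxi i
              · exact hB i x
            · rw [norm_mul, Complex.norm_real, Real.norm_eq_abs]
              gcongr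
              exact hB' i x
        refine (norm_sum_le _ _).trans ((Finset.sum_le_sum fun i _ => hi i).trans ?_)
        rw [Finset.sum_const, Finset.card_univ, Fintype.card_fin, nsmul_eq_mul]
        have : 4 / (3 * R) = 4 / 3 * (1 / R) := by field_simp
        rw [this, show 8 / R = 8 * (1 / R) by field_simp]
        have h3 : 0 ≤ BN * B * (1 / R) * S' := by positivity
        push_cast
        nlinarith

end Residual

/-- A mode given by two different radial functions inside and outside the disk. -/
noncomputable def cutMode (R : ℝ) (χ : Plane → ℝ) (m : ℕ) (fi fo : ℝ → ℝ) (x : Plane) : ℂ :=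
  ((χ x : ℝ) : ℂ) * if ‖x‖ < R then angularMode m fi x else angularMode m fo x

section CutMode

variable {n : ℝ → ℝ} {R δ : ℝ} {p : ℤ} {χ : Plane → ℝ} {m : ℕ} {fi fo : ℝ → ℝ}

lemma mem_disk {x : Plane} : x ∈ disk R ↔ ‖x‖ < R := by simp [disk]

lemma mem_exterior {x : Plane} : x ∈ exterior R ↔ R < ‖x‖ := by simp [exterior]

lemma cutMode_eqOn_disk :
    EqOn (cutMode R χ m fi fo) (fun x => ((χ x : ℝ) : ℂ) * angularMode m fi x) (disk R) :=
  fun x hx => by simp only [cutMode, if_pos (mem_disk.1 hx)]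

lemma cutMode_eqOn_exterior :
    EqOn (cutMode R χ m fi fo) (fun x => ((χ x : ℝ) : ℂ) * angularMode m fo x) (exterior R) :=
  fun x hx => by simp only [cutMode, if_neg (not_lt.2 (mem_exterior.1 hx).le)]

/-- The phase is singular only at the origin, where the cut-off vanishes identically nearby. -/
lemma IsAnnularCutoff.contDiff_mul (hR : 0 < R) (hχ : IsAnnularCutoff R δ χ) {f : ℝ → ℝ}
    (hf : ContDiff ℝ ∞ f) : ContDiff ℝ ∞ fun x => ((χ x : ℝ) : ℂ) * angularMode m f x := by
  refine contDiff_iff_contDiffAt.2 fun x => ?_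
  by_cases hx : x = 0
  · have hcont : Continuous fun y : Plane => |‖y‖ - R| := by fun_prop
    have h0 : R / 4 < |‖x‖ - R| := by
      rw [hx, norm_zero, zero_sub, abs_neg, abs_of_pos hR]; linarith
    have : (fun x => ((χ x : ℝ) : ℂ) * angularMode m f x) =ᶠ[𝓝 x] fun _ => 0 := by
      filter_upwards [(isOpen_lt continuous_const hcont).mem_nhds h0] with y hy
      simp [hχ.eq_zero y hy]
    exact contDiffAt_const.congr_of_eventuallyEq this
  · exact (Complex.ofRealCLM.contDiff.comp hχ.smooth).contDiffAt.mul
      (contDiffAt_angularMode m hx hf.contDiffAt)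

lemma IsAnnularCutoff.hasCompactSupport_mul (hχ : IsAnnularCutoff R δ χ) (f : ℝ → ℝ) :
    HasCompactSupport fun x => ((χ x : ℝ) : ℂ) * angularMode m f x :=
  (hχ.compactSupport.comp_left (g := fun t : ℝ => (t : ℂ)) Complex.ofReal_zero).mul_right

/-- The cut-off is 1 near the circle, so the normal derivative of the mode there is the radial
derivative times the phase, and the transmission conditions become two scalar equations at r = R. -/
lemma inDomain_cutMode (hR : 0 < R) (hδ : 0 < δ) (hχ : IsAnnularCutoff R δ χ)
    (hfi : ContDiff ℝ ∞ fi) (hfo : ContDiff ℝ ∞ fo) (h : fi R = fo R)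
    (h' : n R ^ (p - 1) * deriv fi R = deriv fo R) : InDomain n R p (cutMode R χ m fi fo) := by
  refine inDomain_of_eqOn (hχ.contDiff_mul hR hfi) (hχ.hasCompactSupport_mul fi)
    (hχ.contDiff_mul hR hfo) (hχ.hasCompactSupport_mul fo) cutMode_eqOn_disk cutMode_eqOn_exterior
    (fun θ => ?_) (fun θ => ?_)
  · simp only [angularMode, norm_polarPoint hR.le, h]
  · have hp : ‖polarPoint R θ‖ = R := norm_polarPoint hR.le θ
    have hp0 : polarPoint R θ ≠ 0 := norm_ne_zero_iff.1 (by rw [hp]; exact hR.ne')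
    have hcont : Continuous fun y : Plane => |‖y‖ - R| := by fun_prop
    have key : ∀ {f : ℝ → ℝ}, ContDiff ℝ ∞ f →
        (Real.cos θ : ℂ) * partialDeriv 0 (fun x => ((χ x : ℝ) : ℂ) * angularMode m f x) (polarPoint R θ)
        + Real.sin θ * partialDeriv 1 (fun x => ((χ x : ℝ) : ℂ) * angularMode m f x) (polarPoint R θ)
        = (deriv f R : ℝ) * angularPhase m (polarPoint R θ) := by
      intro f hf
      have hev : (fun x => ((χ x : ℝ) : ℂ) * angularMode m f x) =ᶠ[𝓝 (polarPoint R θ)]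
          angularMode m f := by
        filter_upwards [(isOpen_lt hcont continuous_const).mem_nhds
          (show |‖polarPoint R θ‖ - R| < δ by rw [hp]; simpa using hδ)] with y hy
        simp [hχ.eq_one y hy]
      have hs := sum_coord_mul_partialDeriv_angularMode (f₁ := deriv f) m hp0
        (hf.differentiable (by simp) _).hasDerivAt
      simp only [Fin.sum_univ_two, polarPoint_zero, polarPoint_one, hp,
        mul_div_cancel_left₀ _ hR.ne'] at hs
      simp only [partialDeriv, hev.fderiv_eq] at hs ⊢
      exact hs
    rw [key hfi, key hfo, ← mul_assoc, ← h']
    push_cast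
    ring

lemma exists_bound_partialDeriv (hχ : IsCutoff χ) : ∃ B, 0 ≤ B ∧
    (∀ i y, ‖partialDeriv i (fun y => ((χ y : ℝ) : ℂ)) y‖ ≤ B) ∧
    ∀ i y, ‖partialDeriv i (partialDeriv i (fun y => ((χ y : ℝ) : ℂ))) y‖ ≤ B := by
  have hX : ContDiff ℝ ∞ fun y => ((χ y : ℝ) : ℂ) := Complex.ofRealCLM.contDiff.comp hχ.smooth
  have hc : HasCompactSupport fun y => ((χ y : ℝ) : ℂ) :=
    hχ.compactSupport.comp_left (g := fun t : ℝ => (t : ℂ)) Complex.ofReal_zero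
  choose B1 hB1 using fun i => (contDiff_partialDeriv hX i).continuous.bounded_above_of_compact_support
    (hasCompactSupport_partialDeriv hc i)
  choose B2 hB2 using fun i =>
    (contDiff_partialDeriv (contDiff_partialDeriv hX i) i).continuous.bounded_above_of_compact_support
      (hasCompactSupport_partialDeriv (hasCompactSupport_partialDeriv hc i) i)
  have h1 : ∀ i, 0 ≤ B1 i := fun i => (norm_nonneg _).trans (hB1 i 0)
  have h2 : ∀ i, 0 ≤ B2 i := fun i => (norm_nonneg _).trans (hB2 i 0)
  refine ⟨∑ i, (B1 i + B2 i), Finset.sum_nonneg fun i _ => add_nonneg (h1 i) (h2 i),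
    fun i y => (hB1 i y).trans ?_, fun i y => (hB2 i y).trans ?_⟩
  · exact (le_add_of_nonneg_right (h2 i)).trans
      (Finset.single_le_sum (f := fun i => B1 i + B2 i) (fun i _ => add_nonneg (h1 i) (h2 i))
        (Finset.mem_univ i))
  · exact (le_add_of_nonneg_left (h1 i)).trans
      (Finset.single_le_sum (f := fun i => B1 i + B2 i) (fun i _ => add_nonneg (h1 i) (h2 i))
        (Finset.mem_univ i))

end CutMode

/-! ### Powers of the index and residuals of cut modes -/

section Index

variable {n : ℝ → ℝ} {R : ℝ}

lemma IsOpticalIndex.hasDerivAt_zpow (hn : IsOpticalIndex n R) (q : ℤ) {r : ℝ} (hr : r ∈ Ioo 0 R) :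
    HasDerivAt (fun r => n r ^ q) (q * n r ^ (q - 1) * derivWithin n (Icc 0 R) r) r := by
  have hm : Icc 0 R ∈ 𝓝 r := Icc_mem_nhds hr.1 hr.2
  have hd : DifferentiableAt ℝ n r :=
    ((hn.smooth.differentiableOn (by simp)) r ⟨hr.1.le, hr.2.le⟩).differentiableAt hm
  have h0 : n r ≠ 0 := (zero_lt_one.trans (hn.one_lt r ⟨hr.1.le, hr.2.le⟩)).ne'
  rw [derivWithin_of_mem_nhds hm]
  exact (_root_.hasDerivAt_zpow q (n r) (Or.inl h0)).comp r hd.hasDerivAt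

lemma IsOpticalIndex.hasDerivAt_zpow_of_lt (hn : IsOpticalIndex n R) (q : ℤ) {r : ℝ} (hr : R < r) :
    HasDerivAt (fun r => n r ^ q) 0 r := by
  refine (hasDerivAt_const r (1 : ℝ)).congr_of_eventuallyEq ?_
  filter_upwards [lt_mem_nhds hr] with s hs
  simp [hn.eq_one s hs]

lemma IsOpticalIndex.exists_bound (hR : 0 < R) (hn : IsOpticalIndex n R) (q : ℤ) :
    ∃ B, 1 ≤ B ∧ ∀ r ∈ Icc 0 R, |n r ^ q| ≤ B ∧
      |q * n r ^ (q - 1) * derivWithin n (Icc 0 R) r| ≤ B := by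
  have h0 : ∀ r ∈ Icc 0 R, n r ≠ 0 := fun r hr => (zero_lt_one.trans (hn.one_lt r hr)).ne'
  have hc : ∀ q : ℤ, ContinuousOn (fun r => n r ^ q) (Icc 0 R) := fun q =>
    hn.smooth.continuousOn.zpow₀ q fun r hr => Or.inl (h0 r hr)
  have hd : ContinuousOn (derivWithin n (Icc 0 R)) (Icc 0 R) :=
    hn.smooth.continuousOn_derivWithin (uniqueDiffOn_Icc hR) (by simp)
  obtain ⟨B1, hB1⟩ := isCompact_Icc.exists_bound_of_continuousOn (hc q)
  obtain ⟨B2, hB2⟩ := isCompact_Icc.exists_bound_of_continuousOn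
    ((continuousOn_const (c := (q : ℝ)).mul (hc (q - 1))).mul hd)
  refine ⟨max 1 (max B1 B2), le_max_left _ _, fun r hr => ⟨?_, ?_⟩⟩
  · exact (hB1 r hr).trans ((le_max_left _ _).trans (le_max_right _ _))
  · exact (hB2 r hr).trans ((le_max_right _ _).trans (le_max_right _ _))

lemma IsOpticalIndex.continuousOn_disk (hn : IsOpticalIndex n R) (q : ℤ) :
    ContinuousOn (fun x : Plane => n ‖x‖ ^ q) (disk R) := by
  refine ContinuousOn.zpow₀ (hn.smooth.continuousOn.comp continuous_norm.continuousOn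
    fun x hx => ⟨norm_nonneg x, (mem_disk.1 hx).le⟩) q fun x hx => Or.inl ?_
  exact (zero_lt_one.trans (hn.one_lt _ ⟨norm_nonneg x, (mem_disk.1 hx).le⟩)).ne'

lemma IsOpticalIndex.continuousOn_exterior (hn : IsOpticalIndex n R) (q : ℤ) :
    ContinuousOn (fun x : Plane => n ‖x‖ ^ q) (exterior R) :=
  (continuousOn_const (c := (1 : ℝ))).congr fun x hx => by simp [hn.eq_one _ (mem_exterior.1 hx)]

variable {δ : ℝ} {p : ℤ} {χ : Plane → ℝ} {m : ℕ} {fi fo : ℝ → ℝ}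

lemma IsAnnularCutoff.cutMode_eventuallyEq_zero (hχ : IsAnnularCutoff R δ χ) {x : Plane}
    (hx : R / 4 < |‖x‖ - R|) : cutMode R χ m fi fo =ᶠ[𝓝 x] fun _ => 0 := by
  have hcont : Continuous fun y : Plane => |‖y‖ - R| := by fun_prop
  filter_upwards [(isOpen_lt continuous_const hcont).mem_nhds hx] with y hy
  simp [cutMode, hχ.eq_zero y hy]

/-- Smoothness of n on [0, R] does not make n(‖x‖) smooth at the origin; there the flux vanishes
identically because of the cut-off. -/
lemma IsOpticalIndex.contDiffOn_flux_disk (hR : 0 < R) (hn : IsOpticalIndex n R)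
    (hχ : IsAnnularCutoff R δ χ) (hfi : ContDiff ℝ ∞ fi) (q : ℤ) (i : Fin 2) :
    ContDiffOn ℝ 1 (fun x => ((n ‖x‖ ^ q : ℝ) : ℂ) * partialDeriv i (cutMode R χ m fi fo) x)
      (disk R) := by
  intro x hx
  refine ContDiffAt.contDiffWithinAt ?_
  by_cases h0 : x = 0
  · have h1 : R / 4 < |‖x‖ - R| := by
      rw [h0, norm_zero, zero_sub, abs_neg, abs_of_pos hR]; linarith
    have h2 : (fun x => ((n ‖x‖ ^ q : ℝ) : ℂ) * partialDeriv i (cutMode R χ m fi fo) x)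
        =ᶠ[𝓝 x] fun _ => 0 := by
      filter_upwards [eventually_eventually_nhds.2
        (hχ.cutMode_eventuallyEq_zero (m := m) (fi := fi) (fo := fo) h1)] with y hy
      rw [partialDeriv, Filter.EventuallyEq.fderiv_eq (f := fun _ => (0 : ℂ)) hy]
      simp
    exact contDiffAt_const.congr_of_eventuallyEq h2
  · have hr : ‖x‖ ∈ Ioo 0 R := ⟨norm_pos_iff.2 h0, mem_disk.1 hx⟩
    have hnr : ContDiffAt ℝ 1 n ‖x‖ := ((hn.smooth _ ⟨hr.1.le, hr.2.le⟩).contDiffAt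
      (Icc_mem_nhds hr.1 hr.2)).of_le (by exact_mod_cast le_top)
    have hne : n ‖x‖ ≠ 0 := (zero_lt_one.trans (hn.one_lt _ ⟨hr.1.le, hr.2.le⟩)).ne'
    have hz : ContDiffAt ℝ 1 (fun y : Plane => n ‖y‖ ^ q) x := by
      have h3 : ContDiffAt ℝ 1 (fun y : Plane => n ‖y‖) x := hnr.comp x (contDiffAt_norm ℝ h0)
      rcases q with q | q
      · simpa using h3.pow q
      · simp only [zpow_negSucc]
        exact (h3.pow (q + 1)).inv (pow_ne_zero _ hne)
    have hd : ContDiffAt ℝ 1 (partialDeriv i (cutMode R χ m fi fo)) x := by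
      have h4 := ((contDiff_partialDeriv (hχ.contDiff_mul (m := m) hR hfi) i).of_le
        (m := 1) (by exact_mod_cast le_top)).contDiffAt (x := x)
      refine h4.congr_of_eventuallyEq ?_
      exact Filter.eventually_of_mem ((isOpen_disk R).mem_nhds hx)
        (partialDeriv_congr (isOpen_disk R) cutMode_eqOn_disk i)
    exact (Complex.ofRealCLM.contDiff.contDiffAt.comp x hz).mul hd

lemma IsOpticalIndex.contDiffOn_flux_exterior (hR : 0 < R) (hn : IsOpticalIndex n R)
    (hχ : IsAnnularCutoff R δ χ) (hfo : ContDiff ℝ ∞ fo) (q : ℤ) (i : Fin 2) :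
    ContDiffOn ℝ 1 (fun x => ((n ‖x‖ ^ q : ℝ) : ℂ) * partialDeriv i (cutMode R χ m fi fo) x)
      (exterior R) := by
  have h4 := ((contDiff_partialDeriv (hχ.contDiff_mul (m := m) hR hfo) i).of_le
    (m := 1) (by exact_mod_cast le_top)).contDiffOn (s := exterior R)
  refine h4.congr fun x hx => ?_
  rw [partialDeriv_congr (isOpen_exterior R) cutMode_eqOn_exterior i hx,
    hn.eq_one _ (mem_exterior.1 hx)]
  simp

/-- The residual of a cut mode is controlled by the radial residuals, and by the size of the radial
functions and of their derivatives away from the circle. -/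
lemma IsOpticalIndex.exists_residual_cutMode_le (hR : 0 < R) (hn : IsOpticalIndex n R) (p : ℤ)
    (hχ : IsAnnularCutoff R δ χ) :
    ∃ C, 0 ≤ C ∧ ∀ (m : ℕ) (k : ℝ) (fi fo : ℝ → ℝ) (S S' : ℝ), 1 ≤ m → 0 ≤ S → 0 ≤ S' →
      ContDiff ℝ ∞ fi → ContDiff ℝ ∞ fo →
      (∀ r ∈ Ioo 0 R, R - r ≤ R / 4 → |radialOp (n r ^ (p - 1))
        (((p - 1 : ℤ) : ℝ) * n r ^ (p - 1 - 1) * derivWithin n (Icc 0 R) r) (k ^ 2 * n r ^ (p + 1)) m r (fi r)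
        (deriv fi r) (deriv (deriv fi) r)| ≤ S) →
      (∀ r, R < r → |radialOp 1 0 (k ^ 2) m r (fo r) (deriv fo r) (deriv (deriv fo) r)| ≤ S) →
      (∀ r, 0 < r → δ ≤ R - r → R - r ≤ R / 4 → |deriv fi r| + m * |fi r| ≤ S') →
      (∀ r, δ ≤ r - R → |deriv fo r| + m * |fo r| ≤ S') →
      IsResidual n R p k (cutMode R χ m fi fo) (residualFun n p k (cutMode R χ m fi fo)) ∧
      eLpNorm (residualFun n p k (cutMode R χ m fi fo)) 2 volume ≤ ENNReal.ofReal (C * (S + S')) := by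
  obtain ⟨B, hB0, hB, hB'⟩ := exists_bound_partialDeriv hχ.toIsCutoff
  obtain ⟨BN, hBN1, hBN⟩ := hn.exists_bound hR (p - 1)
  set D := BN * B * (8 + 8 / R) with hD
  have hD0 : 0 ≤ D := by positivity
  set V := (volume (Metric.ball (0 : Plane) (2 * R)) ^ (1 / 2 : ℝ)) with hV
  have hVtop : V ≠ ⊤ :=
    (ENNReal.rpow_lt_top_of_nonneg (by norm_num) Metric.isBounded_ball.measure_lt_top.ne).ne
  refine ⟨(1 + D) * V.toReal, by positivity, ?_⟩
  intro m k fi fo S S' hm hS0 hS0' hfi hfo hSi hSo hSi' hSo'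
  have hd : ∀ {f : ℝ → ℝ}, ContDiff ℝ ∞ f → (∀ r, HasDerivAt f (deriv f r) r) ∧
      ∀ r, HasDerivAt (deriv f) (deriv (deriv f) r) r := fun {f} hf =>
    ⟨fun r => (hf.differentiable (by simp) r).hasDerivAt, fun r =>
      ((contDiff_infty_iff_deriv.1 hf).2.differentiable (by simp) r).hasDerivAt⟩
  have hfar : ∀ x : Plane, R / 4 < |‖x‖ - R| →
      residualFun n p k (cutMode R χ m fi fo) x = 0 := by
    intro x hx
    have h0 := hχ.cutMode_eventuallyEq_zero (m := m) (fi := fi) (fo := fo) hx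
    have h1 : ∀ i, (fun y => ((n ‖y‖ ^ (p - 1) : ℝ) : ℂ) * partialDeriv i (cutMode R χ m fi fo) y)
        =ᶠ[𝓝 x] fun _ => 0 := fun i => by
      filter_upwards [eventually_eventually_nhds.2 h0] with y hy
      rw [partialDeriv, Filter.EventuallyEq.fderiv_eq (f := fun _ => (0 : ℂ)) hy]
      simp
    have h2 : ∀ i, partialDeriv i (fun y => ((n ‖y‖ ^ (p - 1) : ℝ) : ℂ) *
        partialDeriv i (cutMode R χ m fi fo) y) x = 0 := fun i => by
      rw [partialDeriv, (h1 i).fderiv_eq]; simp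
    rw [residualFun, Finset.sum_congr rfl fun i _ => h2 i, h0.self_of_nhds]
    simp
  have hbound : ∀ x, x ∈ disk R ∨ x ∈ exterior R →
      ‖residualFun n p k (cutMode R χ m fi fo) x‖ ≤ S + D * S' := by
    intro x hx
    by_cases hxf : R / 4 < |‖x‖ - R|
    · rw [hfar x hxf, norm_zero]; positivity
    push Not at hxf
    have hx0 : x ≠ 0 := by
      rintro rfl
      rw [norm_zero, zero_sub, abs_neg, abs_of_pos hR] at hxf
      linarith
    have hr0 : 0 < ‖x‖ := norm_pos_iff.2 hx0
    rcases hx with hx | hx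
    · have hr : ‖x‖ < R := mem_disk.1 hx
      have habs : |‖x‖ - R| = R - ‖x‖ := by rw [abs_sub_comm, abs_of_pos (by linarith)]
      refine norm_residualFun_le hR hχ hx0 hfi hm (hn.hasDerivAt_zpow (p - 1) ⟨hr0, hr⟩) (hd hfi).1
        (hd hfi).2 (Filter.eventually_of_mem ((isOpen_disk R).mem_nhds hx) cutMode_eqOn_disk) hB0 hS0
        hS0' hB hB' (hBN _ ⟨hr0.le, hr.le⟩).1 (hBN _ ⟨hr0.le, hr.le⟩).2 ?_ ?_
      · rw [habs]; exact hSi _ ⟨hr0, hr⟩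
      · rw [habs]; exact fun h1 h2 => hSi' _ hr0 h2 h1
    · have hr : R < ‖x‖ := mem_exterior.1 hx
      have habs : |‖x‖ - R| = ‖x‖ - R := abs_of_pos (by linarith)
      have h1 : ∀ q : ℤ, n ‖x‖ ^ q = 1 := fun q => by rw [hn.eq_one _ hr, one_zpow]
      refine norm_residualFun_le hR hχ hx0 hfo hm (hn.hasDerivAt_zpow_of_lt (p - 1) hr) (hd hfo).1
        (hd hfo).2 (Filter.eventually_of_mem ((isOpen_exterior R).mem_nhds hx) cutMode_eqOn_exterior)
        hB0 hS0 hS0' hB hB' (by rw [h1]; simpa using hBN1) (by simpa using zero_le_one.trans hBN1) ?_ ?_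
      · rw [h1, h1, mul_one]; exact fun _ => hSo _ hr
      · rw [habs]; exact fun _ h2 => hSo' _ h2
  have hCi : ContDiffOn ℝ 1 (cutMode R χ m fi fo) (disk R) :=
    (((hχ.contDiff_mul hR hfi).of_le (by exact_mod_cast le_top)).contDiffOn).congr cutMode_eqOn_disk
  have hCo : ContDiffOn ℝ 1 (cutMode R χ m fi fo) (exterior R) :=
    (((hχ.contDiff_mul hR hfo).of_le (by exact_mod_cast le_top)).contDiffOn).congr
      cutMode_eqOn_exterior
  obtain ⟨h1, h2⟩ := isResidual_residualFun (k := k) (L := 2 * R) hCi hCo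
    (fun i => hn.contDiffOn_flux_disk hR hχ hfi (p - 1) i)
    (fun i => hn.contDiffOn_flux_exterior hR hχ hfo (p - 1) i)
    (hn.continuousOn_disk (p + 1)) (hn.continuousOn_exterior (p + 1)) hbound
    (fun x hx => hfar x (by rw [abs_of_pos (by linarith)]; linarith))
  refine ⟨h1, h2.trans ?_⟩
  rw [← hV]
  nth_rewrite 1 [← ENNReal.ofReal_toReal hVtop]
  rw [← ENNReal.ofReal_mul (by positivity)]
  refine ENNReal.ofReal_le_ofReal ?_
  have : S + D * S' ≤ (1 + D) * (S + S') := by nlinarith [mul_nonneg hD0 hS0]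
  calc (S + D * S') * V.toReal ≤ (1 + D) * (S + S') * V.toReal :=
        mul_le_mul_of_nonneg_right this ENNReal.toReal_nonneg
    _ = _ := by ring

end Index

/-! ### Scaled modes on the plane -/

/-- The function `s G(α (r/R - 1))` of the radius. -/
noncomputable def scaledFun (s α R : ℝ) (G : ℝ → ℝ) (r : ℝ) : ℝ := s * G (α * (r / R - 1))

section ScaledFun

variable {s α R : ℝ} {G : ℕ → ℝ → ℝ}

lemma hasDerivAt_scaledFun {G G' : ℝ → ℝ} (h : ∀ y, HasDerivAt G (G' y) y) (r : ℝ) :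
    HasDerivAt (scaledFun s α R G) (scaledFun (s * (α / R)) α R G' r) r := by
  have h1 : HasDerivAt (fun r : ℝ => α * (r / R - 1)) (α * (1 / R)) r :=
    (((hasDerivAt_id r).div_const R).sub_const 1).const_mul α
  refine (((h _).comp r h1).const_mul s).congr_deriv ?_
  rw [scaledFun]
  ring

lemma deriv_scaledFun {G G' : ℝ → ℝ} (h : ∀ y, HasDerivAt G (G' y) y) :
    deriv (scaledFun s α R G) = scaledFun (s * (α / R)) α R G' :=
  funext fun r => (hasDerivAt_scaledFun h r).deriv

lemma contDiff_scaledFun {G : ℝ → ℝ} (h : ContDiff ℝ ∞ G) : ContDiff ℝ ∞ (scaledFun s α R G) := by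
  unfold scaledFun
  fun_prop

end ScaledFun

/-! ### The radial operator in the scaled variables -/

section RadialIdentities

variable {n : ℝ → ℝ} {R : ℝ} {p : ℤ} {m : ℕ} {k ε s q : ℝ} {G : ℕ → ℝ → ℝ}

/-- The radial operator in the inner scaled variable. -/
lemma radialOp_inner (hR : 0 < R) (hn : IsOpticalIndex n R) (hk : 0 < k) (hε : 0 < ε)
    (h3 : ε ^ 3 * (k * m) = 1) {r y : ℝ} (hr : r ∈ Ioo 0 R) (hy : k * ε ^ 2 * y = r / R - 1)
    (f0 f1 f2 : ℝ) :
    radialOp (n r ^ (p - 1)) (((p - 1 : ℤ) : ℝ) * n r ^ (p - 1 - 1) * derivWithin n (Icc 0 R) r)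
      ((m * q / (R * n R)) ^ 2 * n r ^ (p + 1)) m r (s * f0) (s * (1 / (k * ε ^ 2) / R) * f1)
      (s * (1 / (k * ε ^ 2) / R) * (1 / (k * ε ^ 2) / R) * f2) =
    n r ^ (p - 1) / r ^ 2 * m ^ 2 * s * (ε ^ 2 * (1 + k * ε ^ 2 * y) ^ 2 * f2
      + ε ^ 4 * k * innerDrift n R p (k * ε ^ 2 * y) * f1
      + (q ^ 2 * innerPotential n R (k * ε ^ 2 * y) - 1) * f0) := by
  have hr0 : r ≠ 0 := hr.1.ne'
  have hnr : n r ≠ 0 := (zero_lt_one.trans (hn.one_lt r ⟨hr.1.le, hr.2.le⟩)).ne'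
  have hnR : n R ≠ 0 := (zero_lt_one.trans (hn.one_lt R ⟨hR.le, le_rfl⟩)).ne'
  have h1 : n r ^ (p - 1 - 1) = n r ^ (p - 1) / n r := zpow_sub_one₀ hnr _
  have h2 : n r ^ (p + 1) = n r ^ (p - 1) * n r ^ 2 := by
    rw [← zpow_natCast, ← zpow_add₀ hnr]; congr 1; push_cast; ring
  have hRr : R * (1 + (r / R - 1)) = r := by field_simp; ring
  -- Expressing m through ε leaves one large parameter, and both sides become rational functions of
  -- the same quantities.
  have hm : (m : ℝ) = 1 / (k * ε ^ 3) := by field_simp; linarith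
  rw [hy, innerDrift, innerPotential, hRr, h1, h2, radialOp, hm]
  push_cast
  generalize n r ^ (p - 1) = N
  generalize derivWithin n (Icc 0 R) r = d
  field_simp
  ring

/-- The radial operator in the outer scaled variable. -/
lemma radialOp_outer {w : ℝ} (hR : 0 < R) (hnR : 1 < n R) (hw : 0 < w)
    (hwn : w ^ 2 * (n R ^ 2 - 1) = n R ^ 2) (hk : 0 < k) (hε : 0 < ε) (h3 : ε ^ 3 * (k * m) = 1)
    {r y : ℝ} (hr : R < r) (hy : y = m / w * (r / R - 1)) (f0 f1 f2 : ℝ) :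
    radialOp 1 0 ((m * q / (R * n R)) ^ 2) m r (s * f0) (s * (m / w / R) * f1)
      (s * (m / w / R) * (m / w / R) * f2) =
    m ^ 2 / (w ^ 2 * r ^ 2) * s * ((1 + ε ^ 3 * (w * k * y)) ^ 2 * f2
        + ε ^ 3 * (w * k) * (1 + ε ^ 3 * (w * k * y)) * f1
        + (q ^ 2 * (w ^ 2 - 1) * (1 + ε ^ 3 * (w * k * y)) ^ 2 - w ^ 2) * f0) := by
  have hr0 : 0 < r := hR.trans hr
  have hn0 : 0 < n R := by linarith
  have hy' : ε ^ 3 * (w * k * y) = r / R - 1 := by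
    rw [hy]
    field_simp
    linear_combination (r - R) * h3
  have hw1 : w ^ 2 - 1 = w ^ 2 / n R ^ 2 := by field_simp; linarith
  have hm : (m : ℝ) = 1 / (k * ε ^ 3) := by field_simp; linarith
  rw [hy', hw1, radialOp, hm]
  field_simp
  ring

end RadialIdentities

/-- The mode on the plane given by scaled profiles. -/
noncomputable def planeMode (R w k : ℝ) (Φ Ψ : ℕ → ℝ → ℝ → ℝ) (χ : Plane → ℝ) (m : ℕ) (ε s : ℝ) :
    Plane → ℂ :=
  cutMode R χ m (scaledFun s (1 / (k * ε ^ 2)) R (Φ 0 ε)) (scaledFun s (m / w) R (Ψ 0 ε))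

section PlaneMode

variable {n : ℝ → ℝ} {R : ℝ} {p : ℤ} {a w k E δ η : ℝ} {r : ℕ → ℝ} {ρ : ℝ → ℝ}
  {Φ Ψ : ℕ → ℝ → ℝ → ℝ} {χ : Plane → ℝ} {m : ℕ} {ε s : ℝ}

lemma IsProfile.contDiff_snd {G : ℕ → ℝ → ℝ → ℝ} (h : IsProfile E G) (i : ℕ) (t : ℝ) :
    ContDiff ℝ ∞ (G i t) :=
  (h.smooth' i).comp (contDiff_const.prodMk contDiff_id)

lemma IsProfile.deriv_scaledFun {G : ℕ → ℝ → ℝ → ℝ} (h : IsProfile E G) (i : ℕ) (t s α : ℝ) :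
    deriv (scaledFun s α R (G i t)) = scaledFun (s * (α / R)) α R (G (i + 1) t) :=
  _root_.deriv_scaledFun (h.hasDerivAt i t)

/-- The chain rule gives slopes n₀^{p-1} Φ'/(kε²) inside and mΨ'/w outside, up to the common factor
s/R. With m = 1/(kε³) their equality is exactly Ψ' = n₀^{p-1} w ε Φ'. -/
lemma inDomain_planeMode (hR : 0 < R) (hw : 0 < w) (hk : 0 < k) (hδ : 0 < δ)
    (hχ : IsAnnularCutoff R δ χ) {φ β : ℝ → ℝ} {δ' : ℝ}
    (S : IsScaledMode a w (n R ^ (p - 1) * w) k E δ' η φ β r ρ Φ Ψ)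
    (hε : 0 < ε) (h3 : ε ^ 3 * (k * m) = 1) : InDomain n R p (planeMode R w k Φ Ψ χ m ε s) := by
  have h0 : R / R - 1 = 0 := by rw [div_self hR.ne', sub_self]
  refine inDomain_cutMode hR hδ hχ (contDiff_scaledFun (S.inner.contDiff_snd 0 ε))
    (contDiff_scaledFun (S.outer.contDiff_snd 0 ε)) ?_ ?_
  · simp only [scaledFun, h0, mul_zero, S.cont ε]
  · rw [S.inner.deriv_scaledFun, S.outer.deriv_scaledFun]
    simp only [scaledFun, h0, mul_zero, zero_add, S.deriv ε]
    have hm : (m : ℝ) = 1 / (k * ε ^ 3) := by field_simp; linarith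
    rw [hm]
    field_simp

/-- Rapid decay of a scaled profile away from the circle. -/
lemma IsProfile.exists_away_le {G : ℕ → ℝ → ℝ → ℝ} (h : IsProfile E G) (i M : ℕ) {b : ℝ}
    (hb : 0 < b) : ∃ C, 0 ≤ C ∧ ∀ ε ∈ Ioc 0 E, ∀ y, b / ε ^ 2 ≤ |y| → |G i ε y| ≤ C * ε ^ M := by
  obtain ⟨C, hC0, hC⟩ := h.rapid i M
  refine ⟨C * (|E| / b) ^ M, by positivity, fun ε hε y hy => ?_⟩
  have hε0 : 0 < ε := hε.1
  have h1 := hC ε ⟨hε.1.le, hε.2⟩ y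
  have h2 : (b / ε ^ 2) ^ M ≤ (1 + |y|) ^ M := by gcongr; linarith
  have h3 : (b / ε ^ 2) ^ M * |G i ε y| ≤ C :=
    (mul_le_mul_of_nonneg_right h2 (abs_nonneg _)).trans h1
  have h4 : |G i ε y| ≤ C * (ε ^ 2 / b) ^ M := by
    have : |G i ε y| = (b / ε ^ 2) ^ M * |G i ε y| * (ε ^ 2 / b) ^ M := by
      rw [mul_right_comm, ← mul_pow, div_mul_div_cancel₀' hb.ne', div_self (by positivity), one_pow,
        one_mul]
    rw [this]
    exact mul_le_mul_of_nonneg_right h3 (by positivity)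
  refine h4.trans ?_
  rw [mul_assoc, ← mul_pow]
  gcongr
  rw [pow_two, div_mul_eq_mul_div]
  gcongr
  exact hε.2.trans (le_abs_self E)

/-- At a fixed distance from the circle both scaled variables are at least of order ε^{-2}, where a
rapidly decreasing profile is O(ε^M) for all M. The single constant b bounds the scale α by b m and
the scaled distance from below, so inner and outer profiles are treated alike. -/
lemma IsProfile.exists_scaledFun_away_le {G : ℕ → ℝ → ℝ → ℝ} (h : IsProfile E G) (hk : 0 < k)
    (hR : 0 < R) (M : ℕ) {b : ℝ} (hb : 0 < b) :
    ∃ C, 0 ≤ C ∧ ∀ ε ∈ Ioc 0 E, ∀ (m : ℕ) (α s r : ℝ), 0 ≤ s → ε ^ 3 * (k * m) = 1 → 0 ≤ α → α ≤ b * m →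
      1 / ε ^ 2 ≤ b * |α * (r / R - 1)| →
      |deriv (scaledFun s α R (G 0 ε)) r| + m * |scaledFun s α R (G 0 ε) r| ≤ C * (s * ε ^ M) := by
  -- The three additional powers of ε pay for the factor m = 1/(kε³).
  obtain ⟨C0, hC0, h0⟩ := h.exists_away_le 0 (M + 3) (inv_pos.2 hb)
  obtain ⟨C1, hC1, h1⟩ := h.exists_away_le 1 (M + 3) (inv_pos.2 hb)
  refine ⟨b / R / k * C1 + 1 / k * C0, by positivity, ?_⟩
  intro ε hε m α s r hs h3 hα hα' hy
  have hε0 : 0 < ε := hε.1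
  have hm : (m : ℝ) = 1 / (k * ε ^ 3) := by field_simp; linarith
  have hy' : b⁻¹ / ε ^ 2 ≤ |α * (r / R - 1)| := by
    rw [div_eq_mul_one_div, inv_mul_le_iff₀ hb]; exact hy
  rw [h.deriv_scaledFun, scaledFun, scaledFun, abs_mul, abs_mul, abs_mul, abs_of_nonneg hs,
    abs_of_nonneg (div_nonneg hα hR.le)]
  have e0 := h0 ε hε _ hy'
  have e1 := h1 ε hε _ hy'
  calc s * (α / R) * |G 1 ε (α * (r / R - 1))| + m * (s * |G 0 ε (α * (r / R - 1))|)
      ≤ s * (b * m / R) * (C1 * ε ^ (M + 3)) + m * (s * (C0 * ε ^ (M + 3))) := by gcongr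
    _ = (b / R / k * C1 + 1 / k * C0) * (s * ε ^ M) := by
      rw [hm]; field_simp; ring

/-- The radial functions of a plane mode are rapidly decreasing away from the circle. -/
lemma exists_scaledMode_away_le (hR : 0 < R) (hw : 0 < w) (hk : 0 < k) (hδ : 0 < δ)
    {γ δ' : ℝ} {φ β : ℝ → ℝ} (S : IsScaledMode a w γ k E δ' η φ β r ρ Φ Ψ) (M : ℕ) :
    ∃ C, 0 ≤ C ∧ ∀ ε ∈ Ioc 0 E, ∀ (m : ℕ) (s : ℝ), 0 ≤ s → ε ^ 3 * (k * m) = 1 →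
      (∀ x, 0 < x → δ ≤ R - x → |deriv (scaledFun s (1 / (k * ε ^ 2)) R (Φ 0 ε)) x|
        + m * |scaledFun s (1 / (k * ε ^ 2)) R (Φ 0 ε) x| ≤ C * (s * ε ^ M)) ∧
      (∀ x, δ ≤ x - R → |deriv (scaledFun s (m / w) R (Ψ 0 ε)) x|
        + m * |scaledFun s (m / w) R (Ψ 0 ε) x| ≤ C * (s * ε ^ M)) := by
  have hE : 0 ≤ |E| := abs_nonneg E
  obtain ⟨Di, hDi0, hDi⟩ := S.inner.exists_scaledFun_away_le hk hR M
    -- The first summand bounds α/m, which is ε in the inner case; the second turns the radial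
    -- distance δ into 1/ε² in the scaled variable. The outer constant below is built in the same
    -- way.
    (b := |E| + k * R / δ) (by positivity)
  obtain ⟨Do, hDo0, hDo⟩ := S.outer.exists_scaledFun_away_le hk hR M
    (b := 1 / w + |E| * k * R * w / δ) (by positivity)
  refine ⟨Di + Do, by positivity, ?_⟩
  intro ε hε m s hs h3
  have hε0 : 0 < ε := hε.1
  have hEε : ε ≤ |E| := hε.2.trans (le_abs_self E)
  have hm : (m : ℝ) = 1 / (k * ε ^ 3) := by field_simp; linarith
  have hmpos : (0 : ℝ) < m := by rw [hm]; positivity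
  constructor
  · intro x hx0 hx
    refine (hDi ε hε m _ s x hs h3 (by positivity) ?_ ?_).trans ?_
    · rw [hm]
      have : 1 / (k * ε ^ 2) = ε * (1 / (k * ε ^ 3)) := by field_simp
      rw [this]
      gcongr
      have : 0 ≤ k * R / δ := by positivity
      linarith
    · have hxR : δ / R ≤ |x / R - 1| := by
        rw [abs_sub_comm, abs_of_nonneg (by rw [sub_nonneg, div_le_one hR]; linarith),
          div_le_iff₀ hR, sub_mul, div_mul_cancel₀ _ hR.ne']
        linarith
      rw [abs_mul, abs_of_pos (show 0 < 1 / (k * ε ^ 2) by positivity)]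
      calc 1 / ε ^ 2 = k * R / δ * (1 / (k * ε ^ 2) * (δ / R)) := by field_simp
        _ ≤ _ := by gcongr; linarith
    · have : 0 ≤ Do * (s * ε ^ M) := by positivity
      linarith
  · intro x hx
    refine (hDo ε hε m _ s x hs h3 (by positivity) ?_ ?_).trans ?_
    · rw [div_eq_mul_one_div, mul_comm]
      gcongr
      have : 0 ≤ |E| * k * R * w / δ := by positivity
      linarith
    · have hxR : δ / R ≤ |x / R - 1| := by
        rw [abs_of_nonneg (by rw [sub_nonneg, one_le_div hR]; linarith),
          div_le_iff₀ hR, sub_mul, div_mul_cancel₀ _ hR.ne']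
        linarith
      rw [abs_mul, abs_of_pos (show 0 < (m : ℝ) / w by positivity)]
      calc 1 / ε ^ 2 = ε * k * R * w / δ * (m / w * (δ / R)) := by rw [hm]; field_simp
        _ ≤ (1 / w + |E| * k * R * w / δ) * (m / w * |x / R - 1|) := by
          gcongr
          have : ε * k * R * w / δ ≤ |E| * k * R * w / δ := by gcongr
          have : 0 ≤ 1 / w := by positivity
          linarith
    · have : 0 ≤ Di * (s * ε ^ M) := by positivity
      linarith

/-- The residual of a plane mode is rapidly decreasing. -/
lemma exists_residual_planeMode_le (hR : 0 < R) (hn : IsOpticalIndex n R) (hw : 0 < w)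
    (hwn : w ^ 2 * (n R ^ 2 - 1) = n R ^ 2) (hk : 0 < k) (hδ : 0 < δ) (hχ : IsAnnularCutoff R δ χ)
    (S : IsScaledMode a w (n R ^ (p - 1) * w) k E (1 / 2) η (innerPotential n R) (innerDrift n R p) r ρ Φ Ψ)
    (M : ℕ) :
    ∃ C, 0 ≤ C ∧ ∀ ε ∈ Ioc 0 E, ∀ (m : ℕ) (s : ℝ), 0 ≤ s → ε ^ 3 * (k * m) = 1 →
      IsResidual n R p (m * (1 + ε ^ 2 * ρ ε) / (R * n R)) (planeMode R w k Φ Ψ χ m ε s)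
        (residualFun n p (m * (1 + ε ^ 2 * ρ ε) / (R * n R)) (planeMode R w k Φ Ψ χ m ε s)) ∧
      eLpNorm (residualFun n p (m * (1 + ε ^ 2 * ρ ε) / (R * n R)) (planeMode R w k Φ Ψ χ m ε s)) 2
        volume ≤ ENNReal.ofReal (C * (s * ε ^ M)) := by
  obtain ⟨C, hC0, hC⟩ := hn.exists_residual_cutMode_le hR p hχ
  obtain ⟨BN, hBN1, hBN⟩ := hn.exists_bound hR (p - 1)
  -- The radial operator is m² times the scaled residual, and m² = ε^{-6}/k².
  obtain ⟨Ci, hCi0, hCi⟩ := S.inner_res (M + 6)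
  obtain ⟨Co, hCo0, hCo⟩ := S.outer_res (M + 6)
  obtain ⟨D, hD0, hD⟩ := exists_scaledMode_away_le hR hw hk hδ S M
  set D1 := BN / (R / 2) ^ 2 / k ^ 2 * Ci with hD1
  set D2 := 1 / (w ^ 2 * R ^ 2) / k ^ 2 * Co with hD2
  refine ⟨C * (D1 + D2 + D), by positivity, ?_⟩
  intro ε hε m s hs h3
  have hε0 : 0 < ε := hε.1
  have hmpos : (0 : ℝ) < m := by
    by_contra h
    have : (m : ℝ) = 0 := le_antisymm (not_lt.1 h) (Nat.cast_nonneg m)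
    rw [this] at h3; simp at h3
  have hm1 : 1 ≤ m := by exact_mod_cast hmpos
  have hm : (m : ℝ) = 1 / (k * ε ^ 3) := by field_simp; linarith
  have hm2 : (m : ℝ) ^ 2 * ε ^ (M + 6) = 1 / k ^ 2 * ε ^ M := by rw [hm]; field_simp; ring
  have key := hC m (m * (1 + ε ^ 2 * ρ ε) / (R * n R)) (scaledFun s (1 / (k * ε ^ 2)) R (Φ 0 ε))
    (scaledFun s (m / w) R (Ψ 0 ε)) ((D1 + D2) * (s * ε ^ M)) (D * (s * ε ^ M)) hm1
    (by positivity) (by positivity) (contDiff_scaledFun (S.inner.contDiff_snd 0 ε))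
    (contDiff_scaledFun (S.outer.contDiff_snd 0 ε)) ?_ ?_
    (fun x h0 h1 _ => (hD ε hε m s hs h3).1 x h0 h1) (hD ε hε m s hs h3).2
  · refine ⟨key.1, key.2.trans (ENNReal.ofReal_le_ofReal (le_of_eq ?_))⟩
    ring
  · intro x hx hx'
    rw [S.inner.deriv_scaledFun, S.inner.deriv_scaledFun]
    simp only [scaledFun]
    have hy : k * ε ^ 2 * (1 / (k * ε ^ 2) * (x / R - 1)) = x / R - 1 := by field_simp
    rw [radialOp_inner hR hn hk hε0 h3 hx hy]
    have hxR : x / R - 1 ∈ Icc (-(1 / 2) : ℝ) 0 := by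
      constructor
      · rw [neg_le_sub_iff_le_add, ← sub_le_iff_le_add, le_div_iff₀ hR]; linarith
      · rw [sub_nonpos, div_le_one hR]; exact hx.2.le
    have e := hCi ε hε (1 / (k * ε ^ 2) * (x / R - 1)) (by rw [hy]; exact hxR)
    have hx2 : (R / 2) ^ 2 ≤ x ^ 2 := by gcongr; linarith
    rw [abs_mul, abs_mul, abs_mul, abs_div, abs_of_nonneg hs, abs_of_nonneg (sq_nonneg (m : ℝ)),
      abs_of_nonneg (sq_nonneg x)]
    calc _ ≤ BN / (R / 2) ^ 2 * m ^ 2 * s * (Ci * ε ^ (M + 6)) := by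
          gcongr
          exact (hBN x ⟨hx.1.le, hx.2.le⟩).1
      _ = D1 * (s * ε ^ M) := by rw [hD1]; linear_combination BN / (R / 2) ^ 2 * s * Ci * hm2
      _ ≤ _ := by
          have : 0 ≤ D2 * (s * ε ^ M) := by positivity
          linarith
  · intro x hx
    rw [S.outer.deriv_scaledFun, S.outer.deriv_scaledFun]
    simp only [scaledFun]
    rw [radialOp_outer hR (hn.one_lt R ⟨hR.le, le_rfl⟩) hw hwn hk hε0 h3 hx rfl]
    have hx0 : 0 ≤ x / R - 1 := by rw [sub_nonneg, one_le_div hR]; exact hx.le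
    have e := hCo ε hε (m / w * (x / R - 1)) (by positivity)
    rw [abs_mul, abs_mul, abs_of_nonneg hs, abs_of_nonneg (by positivity)]
    calc _ ≤ m ^ 2 / (w ^ 2 * R ^ 2) * s * (Co * ε ^ (M + 6)) := by gcongr
      _ = D2 * (s * ε ^ M) := by rw [hD2]; linear_combination 1 / (w ^ 2 * R ^ 2) * s * Co * hm2
      _ ≤ _ := by
          have : 0 ≤ D1 * (s * ε ^ M) := by positivity
          linarith

end PlaneMode

/-! ### Norms and cut-off functions -/

/-- The zero a is simple, so A has no other zero nearby; a compact interval to the left of a then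
has a positive minimum of |A|. It can be placed as close to a as desired, which later keeps the
corresponding radii where the cut-off is 1. -/
lemma exists_interval_le_abs_flippedAiry {a b : ℝ} (ha : flippedAiry a = 0) (hb : 0 < b) :
    ∃ y₁ y₂ η, y₁ < y₂ ∧ y₂ ≤ 0 ∧ -b < y₁ ∧ 0 < η ∧ ∀ y ∈ Icc y₁ y₂, 2 * η ≤ |flippedAiry (a + y)| := by
  have h := (hasDerivAt_flippedAiry a).eventually_ne (c := 0) (flippedAiry'_ne_zero ha)
  rw [eventually_nhdsWithin_iff, Metric.eventually_nhds_iff] at h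
  obtain ⟨e, he, h⟩ := h
  have hd : 0 < min e b := lt_min he hb
  have hd1 := min_le_left e b
  have hd2 := min_le_right e b
  set d := min e b
  have hc : ContinuousOn (fun y => |flippedAiry (a + y)|) (Icc (-(d * (2 / 3))) (-(d / 3))) :=
    (contDiff_flippedAiry.continuous.comp (continuous_const.add continuous_id)).abs.continuousOn
  obtain ⟨y, hy, hmin⟩ := isCompact_Icc.exists_isMinOn (nonempty_Icc.2 (by linarith)) hc
  have hpos : 0 < |flippedAiry (a + y)| := by
    refine abs_pos.2 (h ?_ ?_)
    · rw [Real.dist_eq, add_sub_cancel_left, abs_of_neg (by linarith [hy.2])]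
      linarith [hy.1]
    · simp only [mem_compl_iff, mem_singleton_iff]
      intro h0
      linarith [hy.2]
  refine ⟨-(d * (2 / 3)), -(d / 3), |flippedAiry (a + y)| / 2, by linarith, by linarith, by linarith,
    by positivity, fun z hz => ?_⟩
  have := hmin hz
  simp only [mem_ofPred_eq] at this
  linarith

lemma eLpNorm_le_of_bound_of_support {u : Plane → ℂ} {B L : ℝ} (hB : ∀ x, ‖u x‖ ≤ B)
    (hL : ∀ x : Plane, L ≤ ‖x‖ → u x = 0) :
    eLpNorm u 2 volume ≤ ENNReal.ofReal B * volume (Metric.ball (0 : Plane) L) ^ (1 / 2 : ℝ) := by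
  have hind : (Metric.ball (0 : Plane) L).indicator u = u := by
    rw [indicator_eq_self]
    intro x hx
    by_contra h
    exact hx (hL x (by simpa using h))
  rw [← hind, eLpNorm_indicator_eq_eLpNorm_restrict Metric.isOpen_ball.measurableSet]
  refine (eLpNorm_le_of_ae_bound (C := B) (Filter.Eventually.of_forall hB)).trans (le_of_eq ?_)
  rw [mul_comm]; simp

/-- In dimension two the square root of the area of a ball of radius d is proportional to d. -/
lemma eLpNorm_ge_of_ball {u : Plane → ℂ} {c : Plane} {d η : ℝ} (hd : 0 ≤ d) (hη : 0 ≤ η)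
    (h : ∀ x ∈ Metric.ball c d, η ≤ ‖u x‖) :
    ENNReal.ofReal (η * d) * volume (Metric.ball (0 : Plane) 1) ^ (1 / 2 : ℝ) ≤ eLpNorm u 2 volume := by
  have h1 : eLpNorm ((Metric.ball c d).indicator fun _ => η) 2 volume ≤ eLpNorm u 2 volume := by
    refine eLpNorm_mono fun x => ?_
    by_cases hx : x ∈ Metric.ball c d
    · rw [indicator_of_mem hx, Real.norm_of_nonneg hη]; exact h x hx
    · rw [indicator_of_notMem hx, norm_zero]; exact norm_nonneg _
  refine le_trans (le_of_eq ?_) h1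
  rw [eLpNorm_indicator_const Metric.isOpen_ball.measurableSet (by norm_num) (by norm_num),
    Measure.addHaar_ball _ _ hd, ENNReal.mul_rpow_of_nonneg _ _ (by norm_num), ← mul_assoc,
    Real.enorm_of_nonneg hη, ENNReal.ofReal_mul hη]
  congr 2
  · rw [finrank_euclideanSpace_fin, ENNReal.ofReal_rpow_of_nonneg (by positivity) (by norm_num)]
    congr 1
    rw [ENNReal.toReal_ofNat, ← Real.sqrt_eq_rpow, Real.sqrt_sq hd]

section PlaneModeNorm

variable {n : ℝ → ℝ} {R : ℝ} {p : ℤ} {a w γ k E δ δ' η : ℝ} {r : ℕ → ℝ} {φ β ρ : ℝ → ℝ}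
  {Φ Ψ : ℕ → ℝ → ℝ → ℝ} {χ : Plane → ℝ} {m : ℕ} {ε s : ℝ}

lemma planeMode_eq_smul (ε s : ℝ) : planeMode R w k Φ Ψ χ m ε s = s • planeMode R w k Φ Ψ χ m ε 1 := by
  ext x
  simp only [planeMode, cutMode, angularMode, scaledFun, Pi.smul_apply, Complex.real_smul]
  split_ifs <;> push_cast <;> ring

lemma eLpNorm_planeMode (hs : 0 ≤ s) : eLpNorm (planeMode R w k Φ Ψ χ m ε s) 2 volume =
    ENNReal.ofReal s * eLpNorm (planeMode R w k Φ Ψ χ m ε 1) 2 volume := by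
  rw [planeMode_eq_smul, eLpNorm_const_smul, Real.enorm_of_nonneg hs]

lemma smul_planeMode (θ : Plane → ℝ) : (fun x => θ x • planeMode R w k Φ Ψ χ m ε s x) =
    planeMode R w k Φ Ψ (fun x => θ x * χ x) m ε s := by
  ext x
  simp only [planeMode, cutMode, Complex.real_smul]
  push_cast
  ring

/-- The radii with y ∈ [y₁, y₂] contain a ball of radius proportional to ε². There the cut-off is 1
and the mode has modulus at least 2η - η, since the inner profile stays within η of A(a + ·) for
every ε. The bound therefore holds for all ε ≤ E, not just for small ε. -/
lemma exists_le_eLpNorm_planeMode (hR : 0 < R) (hk : 0 < k) (hE : 0 < E) (hδR : δ ≤ R)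
    (hχ : IsAnnularCutoff R δ χ) {y₁ y₂ : ℝ} (hy : y₁ < y₂) (hy₂ : y₂ ≤ 0)
    (hy₁ : R * (k * E ^ 2 * -y₁) < δ) (hη : 0 < η)
    (hA : ∀ y ∈ Icc y₁ y₂, 2 * η ≤ |flippedAiry (a + y)|)
    (S : IsScaledMode a w γ k E δ' η φ β r ρ Φ Ψ) :
    ∃ c, 0 < c ∧ ∀ ε ∈ Ioc 0 E, ∀ m : ℕ,
      ENNReal.ofReal (c * ε ^ 2) ≤ eLpNorm (planeMode R w k Φ Ψ χ m ε 1) 2 volume := by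
  set v := volume (Metric.ball (0 : Plane) 1) ^ (1 / 2 : ℝ) with hv
  have hvtop : v ≠ ⊤ :=
    (ENNReal.rpow_lt_top_of_nonneg (by norm_num) Metric.isBounded_ball.measure_lt_top.ne).ne
  have hv0 : v ≠ 0 := by
    rw [hv]
    simp only [ne_eq, ENNReal.rpow_eq_zero_iff, not_or, not_and_or]
    exact ⟨Or.inl (Metric.measure_ball_pos _ _ one_pos).ne', Or.inr (by norm_num)⟩
  have hvpos : 0 < v.toReal := ENNReal.toReal_pos hv0 hvtop
  have hyy : 0 < y₂ - y₁ := by linarith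
  refine ⟨η * (R * k * (y₂ - y₁) / 2) * v.toReal, by positivity, fun ε hε m => ?_⟩
  have hε0 : 0 < ε := hε.1
  have hk2 : 0 < k * ε ^ 2 := by positivity
  -- Centre and radius of the ball: the midpoint and half-length of [y₁, y₂], transported to radii.
  set r₀ := R * (1 + k * ε ^ 2 * ((y₁ + y₂) / 2)) with hr₀
  set d := R * (k * ε ^ 2 * (y₂ - y₁) / 2) with hd
  have hsmall : R * (k * ε ^ 2 * -y₁) < δ := by
    refine lt_of_le_of_lt ?_ hy₁
    have hε' : ε ^ 2 ≤ E ^ 2 := by gcongr; exact hε.2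
    have : 0 ≤ -y₁ := by linarith
    gcongr
  have hlow : R * (k * ε ^ 2 * y₁) ≤ R * (k * ε ^ 2 * ((y₁ + y₂) / 2)) := by gcongr; linarith
  have hr₀pos : 0 ≤ r₀ := by rw [hr₀]; linarith
  have key := eLpNorm_ge_of_ball (u := planeMode R w k Φ Ψ χ m ε 1) (c := polarPoint r₀ 0) (d := d)
    (η := η) (by positivity) hη.le ?_
  · refine le_trans (le_of_eq ?_) key
    rw [← hv]
    nth_rewrite 2 [← ENNReal.ofReal_toReal hvtop]
    rw [← ENNReal.ofReal_mul (by positivity)]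
    congr 1
    rw [hd]; ring
  · intro x hx
    rw [Metric.mem_ball, dist_eq_norm] at hx
    have h1 : |‖x‖ - r₀| < d := by
      have := abs_norm_sub_norm_le x (polarPoint r₀ 0)
      rw [norm_polarPoint hr₀pos] at this
      linarith
    rw [abs_lt] at h1
    set y := 1 / (k * ε ^ 2) * (‖x‖ / R - 1) with hydef
    have hxy : ‖x‖ = R * (1 + k * ε ^ 2 * y) := by rw [hydef]; field_simp; ring
    have hRk : 0 < R * (k * ε ^ 2) := by positivity
    have hya : y₁ < y := by
      have : R * (k * ε ^ 2) * y₁ < R * (k * ε ^ 2) * y := by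
        rw [hxy, hr₀, hd] at h1; linarith [h1.1]
      exact lt_of_mul_lt_mul_left this hRk.le
    have hyb : y < y₂ := by
      have : R * (k * ε ^ 2) * y < R * (k * ε ^ 2) * y₂ := by
        rw [hxy, hr₀, hd] at h1; linarith [h1.2]
      exact lt_of_mul_lt_mul_left this hRk.le
    have hy0 : y < 0 := by linarith
    have hxR : ‖x‖ < R := by
      rw [hxy]
      have : R * (k * ε ^ 2) * y < 0 := mul_neg_of_pos_of_neg hRk hy0
      linarith
    have hxδ : |‖x‖ - R| < δ := by
      rw [abs_sub_comm, abs_of_pos (by linarith), hxy]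
      have : R * (k * ε ^ 2) * y₁ < R * (k * ε ^ 2) * y := by gcongr
      linarith
    have hx0 : x ≠ 0 := by
      rintro rfl
      rw [norm_zero, zero_sub, abs_neg, abs_of_pos hR] at hxδ
      linarith
    rw [planeMode, cutMode, hχ.eq_one x hxδ, if_pos hxR, Complex.ofReal_one, one_mul,
      norm_angularMode _ _ hx0, scaledFun, one_mul, ← hydef]
    have h2 := S.near ε y hy0.le
    have h3 := hA y ⟨hya.le, hyb.le⟩
    have h4 := abs_sub_abs_le_abs_sub (flippedAiry (a + y)) (Φ 0 ε y)
    rw [abs_sub_comm] at h4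
    linarith

/-- A cut-off function equal to `1` near the circle captures the mode up to a rapidly decreasing
remainder. -/
lemma exists_eLpNorm_tail_le (hR : 0 < R) (hw : 0 < w) (hk : 0 < k) (hδ : 0 < δ)
    {δχ : ℝ} (hχ : IsAnnularCutoff R δχ χ) {θ : Plane → ℝ} (hθ : IsCutoff θ)
    (hθ1 : ∀ x, |‖x‖ - R| < δ → θ x = 1)
    (S : IsScaledMode a w γ k E δ' η φ β r ρ Φ Ψ) (M : ℕ) :
    ∃ C, 0 ≤ C ∧ ∀ ε ∈ Ioc 0 E, ∀ (m : ℕ) (s : ℝ), 0 ≤ s → ε ^ 3 * (k * m) = 1 →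
      eLpNorm (fun x => planeMode R w k Φ Ψ χ m ε s x - θ x • planeMode R w k Φ Ψ χ m ε s x) 2 volume
        ≤ ENNReal.ofReal (C * (s * ε ^ M)) := by
  obtain ⟨D, hD0, hD⟩ := exists_scaledMode_away_le hR hw hk hδ S M
  set V := (volume (Metric.ball (0 : Plane) (2 * R)) ^ (1 / 2 : ℝ)) with hV
  have hVtop : V ≠ ⊤ :=
    (ENNReal.rpow_lt_top_of_nonneg (by norm_num) Metric.isBounded_ball.measure_lt_top.ne).ne
  refine ⟨D * V.toReal, by positivity, fun ε hε m s hs h3 => ?_⟩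
  have hε0 : 0 < ε := hε.1
  have hmpos : (0 : ℝ) < m := by
    by_contra h
    have : (m : ℝ) = 0 := le_antisymm (not_lt.1 h) (Nat.cast_nonneg m)
    rw [this] at h3; simp at h3
  have hm1 : (1 : ℝ) ≤ m := by exact_mod_cast hmpos
  obtain ⟨hi, ho⟩ := hD ε hε m s hs h3
  have hzero : ∀ x : Plane, R / 4 < |‖x‖ - R| → planeMode R w k Φ Ψ χ m ε s x = 0 := fun x hx => by
    rw [planeMode, cutMode, hχ.eq_zero x hx]; simp
  have hle : ∀ {α β' : ℝ}, |α| + m * |β'| ≤ D * (s * ε ^ M) → |β'| ≤ D * (s * ε ^ M) := by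
    intro α β' h
    have : |β'| ≤ m * |β'| := le_mul_of_one_le_left (abs_nonneg _) hm1
    linarith [abs_nonneg α]
  have h := eLpNorm_le_of_bound_of_support (B := D * (s * ε ^ M)) (L := 2 * R)
    (u := fun x => planeMode R w k Φ Ψ χ m ε s x - θ x • planeMode R w k Φ Ψ χ m ε s x) ?_ ?_
  · refine h.trans (le_of_eq ?_)
    rw [← hV]
    nth_rewrite 1 [← ENNReal.ofReal_toReal hVtop]
    rw [← ENNReal.ofReal_mul (by positivity)]
    congr 1; ring
  · intro x
    have hpos : 0 ≤ D * (s * ε ^ M) := by positivity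
    by_cases h1 : R / 4 < |‖x‖ - R|
    · simpa [hzero x h1] using hpos
    by_cases h2 : |‖x‖ - R| < δ
    · simpa [hθ1 x h2] using hpos
    push Not at h1 h2
    have hx0 : x ≠ 0 := by
      rintro rfl
      rw [norm_zero, zero_sub, abs_neg, abs_of_pos hR] at h1
      linarith
    have hu : ‖planeMode R w k Φ Ψ χ m ε s x‖ ≤ D * (s * ε ^ M) := by
      rw [planeMode, cutMode, norm_mul, Complex.norm_real, Real.norm_of_nonneg (hχ.nonneg x)]
      refine (mul_le_of_le_one_left (norm_nonneg _) (hχ.le_one x)).trans ?_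
      split_ifs with hxR
      · rw [norm_angularMode _ _ hx0]
        rw [abs_sub_comm, abs_of_pos (by linarith)] at h2
        exact hle (hi _ (norm_pos_iff.2 hx0) h2)
      · rw [norm_angularMode _ _ hx0]
        rw [abs_of_nonneg (by linarith)] at h2
        exact hle (ho _ h2)
    have : planeMode R w k Φ Ψ χ m ε s x - θ x • planeMode R w k Φ Ψ χ m ε s x =
        (1 - θ x) • planeMode R w k Φ Ψ χ m ε s x := by rw [sub_smul, one_smul]
    rw [this, norm_smul, Real.norm_of_nonneg (by linarith [hθ.le_one x])]
    exact (mul_le_of_le_one_left (norm_nonneg _) (by linarith [hθ.nonneg x])).trans hu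
  · intro x hx
    rw [hzero x (by rw [abs_of_pos (by linarith)]; linarith)]
    simp

end PlaneModeNorm

/-! ### Cut-off functions -/

lemma IsAnnularCutoff.mul {R δ δ' : ℝ} {χ θ : Plane → ℝ} (hχ : IsAnnularCutoff R δ χ)
    (hθ : IsCutoff θ) (h1 : ∀ x, |‖x‖ - R| < δ' → θ x = 1) :
    IsAnnularCutoff R (min δ δ') fun x => θ x * χ x where
  smooth := hθ.smooth.mul hχ.smooth
  compactSupport := hθ.compactSupport.mul_right
  nonneg x := mul_nonneg (hθ.nonneg x) (hχ.nonneg x)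
  le_one x := mul_le_one₀ (hθ.le_one x) (hχ.nonneg x) (hχ.le_one x)
  eq_zero x hx := by rw [hχ.eq_zero x hx, mul_zero]
  eq_one x hx := by
    rw [h1 x (hx.trans_le (min_le_right _ _)), hχ.eq_one x (hx.trans_le (min_le_left _ _)), mul_one]

/-- By compactness the open set contains a uniform neighbourhood of the circle; radial projection
shows that the distance of x to the circle is |‖x‖ - R|. -/
lemma exists_eq_one_of_isOpen {R : ℝ} (hR : 0 < R) {θ : Plane → ℝ} {V : Set Plane} (hV : IsOpen V)
    (hS : Metric.sphere 0 R ⊆ V) (h1 : ∀ x ∈ V, θ x = 1) :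
    ∃ δ, 0 < δ ∧ δ ≤ R ∧ ∀ x, |‖x‖ - R| < δ → θ x = 1 := by
  obtain ⟨d, hd, hdV⟩ := (isCompact_sphere (0 : Plane) R).exists_thickening_subset_open hV hS
  refine ⟨min d R, lt_min hd hR, min_le_right _ _, fun x hx => h1 x (hdV ?_)⟩
  have hx0 : ‖x‖ ≠ 0 := fun h => by
    rw [h, zero_sub, abs_neg, abs_of_pos hR] at hx
    exact absurd (hx.trans_le (min_le_right _ _)) (lt_irrefl _)
  have hxp : 0 < ‖x‖ := lt_of_le_of_ne (norm_nonneg x) hx0.symm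
  rw [Metric.mem_thickening_iff]
  refine ⟨(R / ‖x‖) • x, ?_, ?_⟩
  · rw [mem_sphere_zero_iff_norm, norm_smul, Real.norm_of_nonneg (by positivity),
      div_mul_cancel₀ _ hx0]
  · have : x - (R / ‖x‖) • x = ((‖x‖ - R) / ‖x‖) • x := by
      rw [sub_div, div_self hx0, sub_smul, one_smul]
    rw [dist_eq_norm, this, norm_smul, Real.norm_eq_abs, abs_div, abs_norm, div_mul_cancel₀ _ hx0]
    exact hx.trans_le (min_le_left _ _)

/-- A radial cut-off function. -/
lemma exists_radial_cutoff {R : ℝ} (hR : 0 < R) : ∃ X : ℝ → ℝ, ContDiff ℝ ∞ X ∧ HasCompactSupport X ∧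
    tsupport X ⊆ Ioi 0 ∧ (∀ᶠ r in 𝓝 R, X r = 1) ∧ (∀ r, 0 ≤ X r ∧ X r ≤ 1) ∧
    IsAnnularCutoff R (R / 8) fun x => X ‖x‖ := by
  let b : ContDiffBump R := ⟨R / 8, R / 4, by positivity, by linarith⟩
  have hzero : ∀ r, R / 4 < |r - R| → b r = 0 := fun r hr =>
    b.zero_of_le_dist (by rw [Real.dist_eq]; exact hr.le)
  have hone : ∀ r, |r - R| < R / 8 → b r = 1 := fun r hr =>
    b.one_of_mem_closedBall (by rw [Metric.mem_closedBall, Real.dist_eq]; exact hr.le)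
  refine ⟨b, b.contDiff, b.hasCompactSupport, ?_, b.eventuallyEq_one, fun r => ⟨b.nonneg, b.le_one⟩,
    ⟨⟨?_, ?_, fun x => b.nonneg, fun x => b.le_one⟩, fun x => hzero _, fun x => hone _⟩⟩
  · rw [b.tsupport_eq]
    intro r hr
    rw [Metric.mem_closedBall, Real.dist_eq, abs_le] at hr
    have : -(R / 4) ≤ r - R := hr.1
    simp only [mem_Ioi]
    linarith
  · refine contDiff_iff_contDiffAt.2 fun x => ?_
    by_cases hx : x = 0
    · have hcont : Continuous fun y : Plane => |‖y‖ - R| := by fun_prop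
      have h0 : R / 4 < |‖x‖ - R| := by
        rw [hx, norm_zero, zero_sub, abs_neg, abs_of_pos hR]; linarith
      have : (fun x : Plane => b ‖x‖) =ᶠ[𝓝 x] fun _ => 0 := by
        filter_upwards [(isOpen_lt continuous_const hcont).mem_nhds h0] with y hy using hzero _ hy
      exact contDiffAt_const.congr_of_eventuallyEq this
    · exact b.contDiff.contDiffAt.comp x (contDiffAt_norm ℝ hx)
  · refine HasCompactSupport.of_support_subset_isCompact (isCompact_closedBall (0 : Plane) (2 * R)) ?_
    intro x hx
    by_contra h
    rw [mem_closedBall_zero_iff, not_le] at h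
    exact hx (hzero _ (by rw [abs_of_pos (by linarith)]; linarith))

lemma exists_plane_cutoff {R : ℝ} (hR : 0 < R) :
    ∃ θ : Plane → ℝ, IsCutoff θ ∧ ∀ x, |‖x‖ - R| ≤ R / 4 → θ x = 1 := by
  let b : ContDiffBump (0 : Plane) := ⟨2 * R, 3 * R, by positivity, by linarith⟩
  refine ⟨b, ⟨b.contDiff, b.hasCompactSupport, fun x => b.nonneg, fun x => b.le_one⟩, fun x hx =>
    b.one_of_mem_closedBall ?_⟩
  rw [mem_closedBall_zero_iff]
  have h := (abs_le.1 hx).2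
  change ‖x‖ ≤ 2 * R
  linarith

/-! ### Uniform estimates in m and normalization -/

/-! ### Families of plane modes -/

section Family

variable {n : ℝ → ℝ} {R : ℝ} {p : ℤ} {a w k E δ η c : ℝ} {r : ℕ → ℝ} {ρ : ℝ → ℝ}
  {Φ Ψ : ℕ → ℝ → ℝ → ℝ} {χ : Plane → ℝ} {ε s k' : ℕ → ℝ}

/-- Normalization costs at most a factor 1/(cε²), and ε³ = 1/(km), so powers of ε are powers of
m^{-1/3}. The estimate depends on the cut-off only through its annular properties, which lets it
serve for localized modes too. -/
lemma residualRapid_planeMode (hR : 0 < R) (hn : IsOpticalIndex n R) (hw : 0 < w)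
    (hwn : w ^ 2 * (n R ^ 2 - 1) = n R ^ 2) (hk : 0 < k) (hδ : 0 < δ) (hχ : IsAnnularCutoff R δ χ)
    (S : IsScaledMode a w (n R ^ (p - 1) * w) k E (1 / 2) η (innerPotential n R) (innerDrift n R p) r ρ Φ Ψ)
    (hε : ∀ m, 1 ≤ m → ε m ∈ Ioc 0 E) (h3 : ∀ m : ℕ, 1 ≤ m → ε m ^ 3 * (k * m) = 1)
    (hk' : ∀ m, k' m = m * (1 + ε m ^ 2 * ρ (ε m)) / (R * n R)) (hc : 0 < c)
    (hs : ∀ m, 1 ≤ m → 0 ≤ s m ∧ c * ε m ^ 2 * s m ≤ 1) {m₀ : ℕ} (hm₀ : 1 ≤ m₀) :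
    ResidualRapid n R p m₀ k' fun m => planeMode R w k Φ Ψ χ m (ε m) (s m) := by
  refine ⟨fun m => residualFun n p (k' m) (planeMode R w k Φ Ψ χ m (ε m) (s m)), fun m hm => ?_,
    fun N => ?_⟩
  · obtain ⟨C, -, hC⟩ := exists_residual_planeMode_le hR hn hw hwn hk hδ hχ S 0
    beta_reduce
    rw [hk']
    exact (hC _ (hε m (hm₀.trans hm)) m (s m) (hs m (hm₀.trans hm)).1 (h3 m (hm₀.trans hm))).1
  -- Two powers of ε compensate the normalization and the remaining 3N give m^{-N}.
  · obtain ⟨C, hC0, hC⟩ := exists_residual_planeMode_le hR hn hw hwn hk hδ hχ S (3 * N + 2)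
    refine ⟨C / c / k ^ N, fun m hm => ?_⟩
    have hm1 := hm₀.trans hm
    have hε0 : 0 < ε m := (hε m hm1).1
    beta_reduce
    rw [hk']
    refine (hC _ (hε m hm1) m (s m) (hs m hm1).1 (h3 m hm1)).2.trans (ENNReal.ofReal_le_ofReal ?_)
    have hm0 : (0 : ℝ) < m := by exact_mod_cast hm1
    have he : ε m ^ (3 * N) = 1 / k ^ N * (m : ℝ) ^ (-(N : ℤ)) := by
      have : ε m ^ 3 = 1 / (k * m) := by field_simp; linarith [h3 m hm1]
      rw [pow_mul, this, zpow_neg, zpow_natCast, div_pow, one_pow, mul_pow]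
      field_simp
    have h1 : s m * ε m ^ 2 ≤ 1 / c := by
      rw [le_div_iff₀ hc]; linarith [(hs m hm1).2]
    calc C * (s m * ε m ^ (3 * N + 2)) = C * ((s m * ε m ^ 2) * ε m ^ (3 * N)) := by ring
      _ ≤ C * (1 / c * ε m ^ (3 * N)) := by gcongr
      _ = _ := by rw [he]; field_simp

/-- Normalized plane modes form a family of quasi-pairs of whispering gallery type. -/
theorem exists_isWhisperingGallery_planeMode (hR : 0 < R) (hn : IsOpticalIndex n R) (hw : 0 < w)
    (hwn : w ^ 2 * (n R ^ 2 - 1) = n R ^ 2) (hk : 0 < k) (hE : 0 < E) (hδ : 0 < δ) (hδR : δ ≤ R)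
    (hχ : IsAnnularCutoff R δ χ)
    {y₁ y₂ : ℝ} (hy : y₁ < y₂) (hy₂ : y₂ ≤ 0) (hy₁ : R * (k * E ^ 2 * -y₁) < δ) (hη : 0 < η)
    (hA : ∀ y ∈ Icc y₁ y₂, 2 * η ≤ |flippedAiry (a + y)|)
    (S : IsScaledMode a w (n R ^ (p - 1) * w) k E (1 / 2) η (innerPotential n R) (innerDrift n R p) r ρ Φ Ψ)
    (hε : ∀ m, 1 ≤ m → ε m ∈ Ioc 0 E) (h3 : ∀ m : ℕ, 1 ≤ m → ε m ^ 3 * (k * m) = 1)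
    (hk' : ∀ m, k' m = m * (1 + ε m ^ 2 * ρ (ε m)) / (R * n R))
    (hreg : ∃ b, 0 < b ∧ RegularInM k' b) :
    ∃ s : ℕ → ℝ, (∀ m, 1 ≤ m → 0 < s m) ∧
      IsWhisperingGallery n R p k' fun m => planeMode R w k Φ Ψ χ m (ε m) (s m) := by
  obtain ⟨c, hc, hlow⟩ := exists_le_eLpNorm_planeMode hR hk hE hδR hχ hy hy₂ hy₁ hη hA S
  have hdom : ∀ {χ' : Plane → ℝ} {d : ℝ}, 0 < d → IsAnnularCutoff R d χ' → ∀ m, 1 ≤ m → ∀ t,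
      InDomain n R p (planeMode R w k Φ Ψ χ' m (ε m) t) := fun hd hχ' m hm t =>
    inDomain_planeMode hR hw hk hd hχ' S (hε m hm).1 (h3 m hm)
  set L : ℕ → ℝ := fun m => (eLpNorm (planeMode R w k Φ Ψ χ m (ε m) 1) 2 volume).toReal with hL
  have htop : ∀ m, 1 ≤ m → eLpNorm (planeMode R w k Φ Ψ χ m (ε m) 1) 2 volume ≠ ⊤ := fun m hm =>
    (hdom hδ hχ m hm 1).memLp.2.ne
  have hLlow : ∀ m, 1 ≤ m → c * ε m ^ 2 ≤ L m := fun m hm =>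
    (ENNReal.ofReal_le_iff_le_toReal (htop m hm)).1 (hlow _ (hε m hm) m)
  have hLpos : ∀ m, 1 ≤ m → 0 < L m := fun m hm =>
    lt_of_lt_of_le (mul_pos hc (pow_pos (hε m hm).1 2)) (hLlow m hm)
  set s : ℕ → ℝ := fun m => (L m)⁻¹ with hs
  have hspos : ∀ m, 1 ≤ m → 0 < s m := fun m hm => inv_pos.2 (hLpos m hm)
  have hsle : ∀ m, 1 ≤ m → 0 ≤ s m ∧ c * ε m ^ 2 * s m ≤ 1 := fun m hm => by
    refine ⟨(hspos m hm).le, ?_⟩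
    rw [hs, ← div_eq_mul_inv, div_le_one (hLpos m hm)]
    exact hLlow m hm
  have hnorm : ∀ m, 1 ≤ m → eLpNorm (planeMode R w k Φ Ψ χ m (ε m) (s m)) 2 volume = 1 := by
    intro m hm
    rw [eLpNorm_planeMode (hspos m hm).le, ← ENNReal.ofReal_toReal (htop m hm),
      ← ENNReal.ofReal_mul (hspos m hm).le, hs]
    change ENNReal.ofReal ((L m)⁻¹ * L m) = 1
    rw [inv_mul_cancel₀ (hLpos m hm).ne', ENNReal.ofReal_one]
  have hres := residualRapid_planeMode hR hn hw hwn hk hδ hχ S hε h3 hk' hc hsle le_rfl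
  refine ⟨s, hspos, ⟨fun m hm => hdom hδ hχ m hm _, hnorm, hres, ?_, hreg⟩, ?_⟩
  -- This θ is 1 wherever χ does not vanish, so θu = u and localization holds for all m ≥ 1 at no
  -- cost.
  · obtain ⟨θ, hθ, hθ1⟩ := exists_plane_cutoff hR
    have hθu : ∀ m, (fun x => θ x • planeMode R w k Φ Ψ χ m (ε m) (s m) x) =
        planeMode R w k Φ Ψ χ m (ε m) (s m) := fun m => by
      have : (fun x => θ x * χ x) = χ := by
        ext x
        by_cases hx : |‖x‖ - R| ≤ R / 4
        · rw [hθ1 x hx, one_mul]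
        · rw [hχ.eq_zero x (not_le.1 hx), mul_zero]
      rw [smul_planeMode, this]
    refine ⟨θ, hθ, ⟨fun m hm => ?_, fun m hm => ?_, ?_⟩⟩
    · rw [hθu]; exact hdom hδ hχ m hm _
    · rw [hθu, hnorm m hm]; exact ENNReal.half_le_self
    · have e : (fun m x => θ x • planeMode R w k Φ Ψ χ m (ε m) (s m) x) =
          fun m => planeMode R w k Φ Ψ χ m (ε m) (s m) := funext hθu
      change ResidualRapid n R p 1 k' fun m x => θ x • planeMode R w k Φ Ψ χ m (ε m) (s m) x
      rwa [e]
  · rintro θ hθ ⟨V, hV, hSV, hV1⟩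
    obtain ⟨d, hd, -, hd1⟩ := exists_eq_one_of_isOpen hR hV hSV hV1
    have hχθ := hχ.mul hθ hd1
    have hd0 : 0 < min δ d := lt_min hδ hd
    -- Exponent 5: two powers for the normalization and three for one factor 1/m, which makes the
    -- tail at most 1/2 for m large. The triangle inequality then leaves at least 1/2 for θu.
    obtain ⟨C, hC0, hC⟩ := exists_eLpNorm_tail_le hR hw hk hd hχ hθ hd1 S 5
    obtain ⟨m₁, hm₁⟩ := exists_nat_ge (2 * (C / c / k))
    have hm₀ : 1 ≤ max 1 m₁ := le_max_left _ _
    refine ⟨max 1 m₁, hm₀, ⟨fun m hm => ?_, fun m hm => ?_, ?_⟩⟩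
    · rw [smul_planeMode]; exact hdom hd0 hχθ m (hm₀.trans hm) _
    · have hm1 := hm₀.trans hm
      have hmpos : (0 : ℝ) < m := by exact_mod_cast hm1
      have hε0 := (hε m hm1).1
      set u := planeMode R w k Φ Ψ χ m (ε m) (s m) with hu
      have htail := hC _ (hε m hm1) m (s m) (hspos m hm1).le (h3 m hm1)
      rw [← hu] at htail
      have hsmall : C * (s m * ε m ^ 5) ≤ 1 / 2 := by
        have he : ε m ^ 3 = 1 / (k * m) := by field_simp; linarith [h3 m hm1]
        have h1 : s m * ε m ^ 2 ≤ 1 / c := by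
          rw [le_div_iff₀ hc]; linarith [(hsle m hm1).2]
        have h2 : (2 * (C / c / k) : ℝ) ≤ m := hm₁.trans (by
          exact_mod_cast (le_max_right 1 m₁).trans hm)
        calc C * (s m * ε m ^ 5) = C * ((s m * ε m ^ 2) * ε m ^ 3) := by ring
          _ ≤ C * (1 / c * ε m ^ 3) := by gcongr
          _ = C / c / k / m := by rw [he]; field_simp
          _ ≤ 1 / 2 := by rw [div_le_iff₀ hmpos]; linarith
      have hu1 : MemLp u 2 volume := (hdom hδ hχ m hm1 _).memLp
      have hu2 : MemLp (fun x => θ x • u x) 2 volume := by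
        rw [hu, smul_planeMode]; exact (hdom hd0 hχθ m hm1 _).memLp
      have htri : eLpNorm u 2 volume ≤ eLpNorm (fun x => u x - θ x • u x) 2 volume +
          eLpNorm (fun x => θ x • u x) 2 volume := by
        have h := eLpNorm_add_le (μ := (volume : Measure Plane)) (p := 2)
          (hu1.sub hu2).aestronglyMeasurable hu2.aestronglyMeasurable (by norm_num)
        have e : (u - fun x => θ x • u x) + (fun x => θ x • u x) = u := sub_add_cancel _ _
        rw [e] at h
        exact h
      rw [hnorm m hm1] at htri
      have htail' : eLpNorm (fun x => u x - θ x • u x) 2 volume ≤ 1 / 2 := by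
        refine htail.trans ((ENNReal.ofReal_le_ofReal hsmall).trans (le_of_eq ?_))
        rw [ENNReal.ofReal_div_of_pos two_pos]; simp
      have h5 : (1 / 2 : ℝ≥0∞) + 1 / 2 ≤ 1 / 2 + eLpNorm (fun x => θ x • u x) 2 volume := by
        rw [ENNReal.add_halves]
        exact htri.trans (add_le_add_left htail' _)
      exact (ENNReal.add_le_add_iff_left (by simp)).1 h5
    · have e : (fun m x => θ x • planeMode R w k Φ Ψ χ m (ε m) (s m) x) =
          fun m => planeMode R w k Φ Ψ (fun x => θ x * χ x) m (ε m) (s m) :=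
        funext fun m => smul_planeMode θ
      change ResidualRapid n R p _ k' fun m x => θ x • planeMode R w k Φ Ψ χ m (ε m) (s m) x
      rw [e]
      exact residualRapid_planeMode hR hn hw hwn hk hd0 hχθ S hε h3 hk' hc hsle hm₀

end Family

/-! ### Boundary layer structure -/

/-- The change of variables (t, x) ↦ (Et, αx) is linear and maps [0, 1] into [0, E], so derivatives
and weights change by constants. Within the product set the iterated derivatives are the full ones,
by unique differentiability. -/
lemma IsProfile.isSchwartzProfile {E : ℝ} {G : ℕ → ℝ → ℝ → ℝ} (h : IsProfile E G) (hE : 0 ≤ E)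
    {α : ℝ} (hα : 0 < α) {S : Set ℝ} (hS : UniqueDiffOn ℝ S) :
    IsSchwartzProfile S fun t x => G 0 (E * t) (α * x) := by
  set L : ℝ × ℝ →L[ℝ] ℝ × ℝ := (E • ContinuousLinearMap.id ℝ ℝ).prodMap
    (α • ContinuousLinearMap.id ℝ ℝ) with hL
  have e : Function.uncurry (fun t x => G 0 (E * t) (α * x)) = Function.uncurry (G 0) ∘ L := rfl
  have hs : ContDiff ℝ ∞ (Function.uncurry (G 0) ∘ L) := h.smooth.comp L.contDiff
  rw [IsSchwartzProfile, e]
  refine ⟨hs.contDiffOn, fun b d => ?_⟩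
  obtain ⟨C, hC⟩ := h.schwartz b d
  have hd : ContDiff ℝ d (Function.uncurry (G 0)) := h.smooth.of_le (by exact_mod_cast le_top)
  refine ⟨(1 / α) ^ b * (C * ‖L‖ ^ d), fun t ht x hx => ?_⟩
  rw [iteratedFDerivWithin_eq_iteratedFDeriv ((uniqueDiffOn_Icc zero_lt_one).prod hS)
    (hs.of_le (by exact_mod_cast le_top)).contDiffAt ⟨ht, hx⟩,
    L.iteratedFDeriv_comp_right hd (t, x) le_rfl]
  have h1 := ContinuousMultilinearMap.norm_compContinuousLinearMap_le
    (iteratedFDeriv ℝ d (Function.uncurry (G 0)) (L (t, x))) fun _ => L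
  rw [Finset.prod_const, Finset.card_univ, Fintype.card_fin] at h1
  have h2 := hC (E * t) ⟨mul_nonneg hE ht.1, mul_le_of_le_one_right hE ht.2⟩ (α * x)
  have h3 : L (t, x) = (E * t, α * x) := rfl
  have h4 : |x| ^ b = (1 / α) ^ b * |α * x| ^ b := by
    rw [abs_mul, abs_of_pos hα, ← mul_pow, ← mul_assoc, one_div_mul_cancel hα.ne', one_mul]
  rw [h3] at h1 ⊢
  calc |x| ^ b * ‖(iteratedFDeriv ℝ d (Function.uncurry (G 0)) (E * t, α * x)).compContinuousLinearMap
        fun _ => L‖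
      ≤ |x| ^ b * (‖iteratedFDeriv ℝ d (Function.uncurry (G 0)) (E * t, α * x)‖ * ‖L‖ ^ d) := by
        gcongr
    _ = (1 / α) ^ b * ((|α * x| ^ b * ‖iteratedFDeriv ℝ d (Function.uncurry (G 0)) (E * t, α * x)‖)
          * ‖L‖ ^ d) := by rw [h4]; ring
    _ ≤ _ := by gcongr

/-! ### Fractional powers of m -/

section SmallParameter

variable {m : ℕ}

lemma rpow_neg_third_pos (hm : 1 ≤ m) : 0 < (m : ℝ) ^ (-(1 / 3) : ℝ) :=
  Real.rpow_pos_of_pos (by exact_mod_cast hm) _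

lemma rpow_neg_third_le_one (hm : 1 ≤ m) : (m : ℝ) ^ (-(1 / 3) : ℝ) ≤ 1 :=
  Real.rpow_le_one_of_one_le_of_nonpos (by exact_mod_cast hm) (by norm_num)

lemma rpow_neg_third_pow (m l : ℕ) :
    ((m : ℝ) ^ (-(1 / 3) : ℝ)) ^ l = (m : ℝ) ^ (-(l : ℝ) / 3) := by
  rw [← Real.rpow_natCast, ← Real.rpow_mul (Nat.cast_nonneg m)]
  congr 1
  ring

lemma rpow_neg_third_cube (hm : 1 ≤ m) : ((m : ℝ) ^ (-(1 / 3) : ℝ)) ^ 3 * m = 1 := by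
  have hm0 : (0 : ℝ) < m := by exact_mod_cast hm
  rw [rpow_neg_third_pow]
  norm_num
  rw [Real.rpow_neg_one, inv_mul_cancel₀ hm0.ne']

lemma rpow_two_thirds (hm : 1 ≤ m) : (m : ℝ) ^ (2 / 3 : ℝ) = 1 / ((m : ℝ) ^ (-(1 / 3) : ℝ)) ^ 2 := by
  have hm0 : (0 : ℝ) < m := by exact_mod_cast hm
  rw [rpow_neg_third_pow, one_div, ← Real.rpow_neg hm0.le]
  congr 1
  norm_num

lemma one_div_rpow_third (m : ℕ) : (1 / (m : ℝ)) ^ (1 / 3 : ℝ) = (m : ℝ) ^ (-(1 / 3) : ℝ) := by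
  rw [one_div, Real.inv_rpow (Nat.cast_nonneg m), Real.rpow_neg (Nat.cast_nonneg m)]

end SmallParameter

lemma cube_root_cube {x : ℝ} (hx : 0 < x) : (x ^ (1 / 3 : ℝ)) ^ 3 = x := by
  rw [← Real.rpow_natCast, ← Real.rpow_mul hx.le]
  norm_num

/-- Plane modes have the boundary layer structure. -/
lemma hasBoundaryLayerForm_planeMode {R κ n₀ η δ : ℝ} {p : ℤ} {j : ℕ} (hR : 0 < R) (hκ : 0 < κ)
    (hn₀ : 1 < n₀) {φ β ρ : ℝ → ℝ} {r : ℕ → ℝ} {Φ Ψ : ℕ → ℝ → ℝ → ℝ}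
    (S : IsScaledMode (airyRoot j) (n₀ / √(n₀ ^ 2 - 1)) (n₀ ^ (p - 1) * (n₀ / √(n₀ ^ 2 - 1)))
      (1 / (2 * κ)) ((2 * κ) ^ (1 / 3 : ℝ)) δ η φ β r ρ Φ Ψ)
    {X : ℝ → ℝ} (hX : ContDiff ℝ ∞ X) (hXc : HasCompactSupport X) (hX0 : tsupport X ⊆ Ioi 0)
    (hX1 : ∀ᶠ r in 𝓝 R, X r = 1) (hX01 : ∀ r, 0 ≤ X r ∧ X r ≤ 1) {s : ℕ → ℝ}
    (hs : ∀ m, 1 ≤ m → 0 < s m) :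
    HasBoundaryLayerForm R κ n₀ p j fun m => planeMode R (n₀ / √(n₀ ^ 2 - 1)) (1 / (2 * κ)) Φ Ψ
      (fun x => X ‖x‖) m ((2 * κ) ^ (1 / 3 : ℝ) * (m : ℝ) ^ (-(1 / 3) : ℝ)) (s m) := by
  have hsq : 0 < √(n₀ ^ 2 - 1) := Real.sqrt_pos.2 (by nlinarith)
  have hn₀0 : 0 < n₀ := by linarith
  set w := n₀ / √(n₀ ^ 2 - 1) with hw
  have hw0 : 0 < w := by positivity
  set c := (2 * κ) ^ (1 / 3 : ℝ) with hc
  have hc0 : 0 < c := Real.rpow_pos_of_pos (by positivity) _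
  have hc3 : c ^ 3 = 2 * κ := cube_root_cube (by positivity)
  have hγ : n₀ ^ (p - 1) * w = n₀ ^ p / √(n₀ ^ 2 - 1) := by
    rw [hw, zpow_sub_one₀ hn₀0.ne']; field_simp
  -- Since c³ = 2κ, the inner variable (2κ/ε²)(r/R - 1) with ε = c m^{-1/3} is cσ, the argument
  -- displayed in the two-term expansion.
  have hin : ∀ m : ℕ, 1 ≤ m → ∀ x : ℝ,
      1 / (1 / (2 * κ) * (c * (m : ℝ) ^ (-(1 / 3) : ℝ)) ^ 2) * (x / R - 1) = c * sigmaVar R m x := by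
    intro m hm x
    have h0 := rpow_neg_third_pos hm
    rw [sigmaVar, rpow_two_thirds hm, ← hc3]
    field_simp
  have hout : ∀ (m : ℕ) (x : ℝ), m / w * (x / R - 1) = 1 / w * rhoVar R m x := fun m x => by
    rw [rhoVar]; ring
  refine ⟨s, fun m x => X x * if x < R then Φ 0 (c * (m : ℝ) ^ (-(1 / 3) : ℝ)) (c * sigmaVar R m x)
      else Ψ 0 (c * (m : ℝ) ^ (-(1 / 3) : ℝ)) (1 / w * rhoVar R m x), X,
    fun t x => Φ 0 (c * t) (c * x), fun t x => Ψ 0 (c * t) (1 / w * x), hs, ?_, hX, hXc, hX0, hX1,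
    S.inner.isSchwartzProfile hc0.le hc0 (uniqueDiffOn_Iic 0),
    S.outer.isSchwartzProfile hc0.le (by positivity) (uniqueDiffOn_Ici 0), ?_,
    fun m _ x _ => rfl, ?_⟩
  · intro m hm x θ hx
    simp only [planeMode, cutMode, norm_polarPoint hx.le, angularMode, angularPhase_polarPoint m hx,
      scaledFun, hin m hm, hout]
    split_ifs <;> push_cast <;> ring
  · intro m _
    simp only [mul_zero, S.cont]
  · obtain ⟨C₁, hC₁, h₁⟩ := S.inner_two
    obtain ⟨C₂, hC₂, h₂⟩ := S.outer_two
    refine ⟨(C₁ + C₂) * c ^ 2, fun m hm x hx => ?_⟩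
    have h0 := rpow_neg_third_pos hm
    have hle := rpow_neg_third_le_one hm
    have hE : (m : ℝ) ^ (-(2 / 3) : ℝ) = ((m : ℝ) ^ (-(1 / 3) : ℝ)) ^ 2 := by
      rw [rpow_neg_third_pow]; norm_num
    rw [hE, one_div_rpow_third]
    set h := (m : ℝ) ^ (-(1 / 3) : ℝ) with hh
    have hmem : c * h ∈ Icc 0 c := ⟨by positivity, mul_le_of_le_one_right hc0.le hle⟩
    rw [← mul_sub, abs_mul, abs_of_nonneg (hX01 x).1]
    refine (mul_le_of_le_one_left (abs_nonneg _) (hX01 x).2).trans ?_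
    have hm0 : (0 : ℝ) ≤ m := Nat.cast_nonneg m
    split_ifs with hxR
    · have hσ : c * sigmaVar R m x ≤ 0 := by
        refine mul_nonpos_of_nonneg_of_nonpos hc0.le
          (mul_nonpos_of_nonneg_of_nonpos (Real.rpow_nonneg hm0 _) ?_)
        rw [sub_nonpos, div_le_one hR]; exact hxR.le
      have key := h₁ (c * h) hmem _ hσ
      have e : modeTerm0 R κ j m x + h * modeTerm1 R κ n₀ p j m x =
          flippedAiry (airyRoot j + c * sigmaVar R m x) - c * h * (n₀ ^ (p - 1) * w *
            flippedAiry' (airyRoot j + c * sigmaVar R m x)) := by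
        rw [modeTerm0, modeTerm1, if_pos hxR, if_pos hxR, deriv_flippedAiry, hγ, ← hc]
        ring
      rw [e]
      refine key.trans ?_
      have : 0 ≤ C₂ * (c * h) ^ 2 := by positivity
      nlinarith
    · have hρ : 0 ≤ 1 / w * rhoVar R m x := by
        refine mul_nonneg (by positivity) (mul_nonneg hm0 ?_)
        rw [sub_nonneg, one_le_div hR]; exact not_lt.1 hxR
      have key := h₂ (c * h) hmem _ hρ
      have e : modeTerm0 R κ j m x + h * modeTerm1 R κ n₀ p j m x =
          -(c * h * (n₀ ^ (p - 1) * w * flippedAiry' (airyRoot j) *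
            Real.exp (-(1 / w * rhoVar R m x)))) := by
        have hexp : -(1 / w * rhoVar R m x) = -(√(n₀ ^ 2 - 1) / n₀) * rhoVar R m x := by
          rw [hw, one_div_div]; ring
        rw [modeTerm0, modeTerm1, if_neg hxR, if_neg hxR, deriv_flippedAiry, hγ, ← hc, hexp]
        ring
      rw [e, sub_neg_eq_add]
      refine key.trans ?_
      have : 0 ≤ C₁ * (c * h) ^ 2 := by positivity
      nlinarith

/-! ### Expansions of the quasi-resonances -/

/-- The coefficients of `1 + ε² ∑ r_l ε^l`. -/
def spectralCoeff (r : ℕ → ℝ) : ℕ → ℝ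
  | 0 => 1
  | 1 => 0
  | l + 2 => r l

lemma sum_spectralCoeff (r : ℕ → ℝ) (ε : ℝ) (N : ℕ) :
    ∑ l ∈ Finset.range (N + 2), ε ^ l * spectralCoeff r l =
      1 + ε ^ 2 * ∑ l ∈ Finset.range N, ε ^ l * r l := by
  rw [Finset.sum_range_succ', Finset.sum_range_succ', Finset.mul_sum]
  simp only [spectralCoeff]
  rw [add_comm]
  simp only [pow_zero, one_mul, mul_zero, add_zero]
  congr 1
  exact Finset.sum_congr rfl fun l _ => by ring

section Expansion

variable {a w γ k E δ η : ℝ} {φ β ρ : ℝ → ℝ} {r : ℕ → ℝ} {Φ Ψ : ℕ → ℝ → ℝ → ℝ}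

/-- The factor ε² shifts the expansion of ρ by two orders and leaves coefficients 1 and 0 in front;
N = 1 lies before the shift and needs boundedness of ρ alone. -/
lemma IsScaledMode.exists_spectral_le (S : IsScaledMode a w γ k E δ η φ β r ρ Φ Ψ) (N : ℕ)
    (hN : 1 ≤ N) : ∃ C, 0 ≤ C ∧ ∀ ε ∈ Icc 0 E,
      |1 + ε ^ 2 * ρ ε - ∑ l ∈ Finset.range N, ε ^ l * spectralCoeff r l| ≤ C * ε ^ N := by
  rcases N with _ | _ | N
  · omega
  · obtain ⟨C, hC0, hC⟩ := S.spec 0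
    refine ⟨C * |E|, by positivity, fun ε hε => ?_⟩
    have h := hC ε hε
    have h0 := hε.1
    simp only [Finset.range_zero, Finset.sum_empty, sub_zero, pow_zero, mul_one] at h
    simp only [zero_add, Finset.sum_range_one, pow_zero, spectralCoeff, mul_one, add_sub_cancel_left,
      pow_one]
    rw [abs_mul, abs_of_nonneg (by positivity)]
    have hE : ε ≤ |E| := hε.2.trans (le_abs_self E)
    calc ε ^ 2 * |ρ ε| ≤ (|E| * ε) * C := by
          rw [pow_two]; gcongr
      _ = _ := by ring
  · obtain ⟨C, hC0, hC⟩ := S.spec N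
    refine ⟨C, hC0, fun ε hε => ?_⟩
    have h := hC ε hε
    have h0 := hε.1
    rw [sum_spectralCoeff, add_sub_add_left_eq_sub, ← mul_sub, abs_mul, abs_of_nonneg (by positivity)]
    calc ε ^ 2 * |ρ ε - ∑ l ∈ Finset.range N, ε ^ l * r l| ≤ ε ^ 2 * (C * ε ^ N) := by gcongr
      _ = _ := by ring

variable {D c : ℝ} {k' : ℕ → ℝ}

lemma regularInM_of_eq (hρ : ContDiff ℝ ∞ ρ) (hk' : ∀ m : ℕ, k' m = m * (1 +
      (c * (m : ℝ) ^ (-(1 / 3) : ℝ)) ^ 2 * ρ (c * (m : ℝ) ^ (-(1 / 3) : ℝ))) / D) :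
    RegularInM k' (1 / 3) := by
  refine ⟨fun h => (1 + (c * h) ^ 2 * ρ (c * h)) / D, ?_, fun m hm => ?_⟩
  · refine ContDiff.contDiffOn ?_
    have : ContDiff ℝ ∞ fun h : ℝ => c * h := contDiff_const.mul contDiff_id
    exact (contDiff_const.add ((this.pow 2).mul (hρ.comp this))).div_const D
  · have hm0 : (m : ℝ) ≠ 0 := by positivity
    rw [hk']
    field_simp

lemma IsScaledMode.hasExpansion (S : IsScaledMode a w γ k c δ η φ β r ρ Φ Ψ) (hc : 0 ≤ c) (hD : 0 < D)
    (hk' : ∀ m : ℕ, k' m = m * (1 +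
      (c * (m : ℝ) ^ (-(1 / 3) : ℝ)) ^ 2 * ρ (c * (m : ℝ) ^ (-(1 / 3) : ℝ))) / D) :
    HasExpansion k' fun l => spectralCoeff r l * c ^ l / D := by
  intro N hN
  obtain ⟨C, hC0, hC⟩ := S.exists_spectral_le N hN
  refine ⟨C * c ^ N / D, fun m hm => ?_⟩
  have hm0 : (m : ℝ) ≠ 0 := by positivity
  have h0 := rpow_neg_third_pos hm
  have h := hC (c * (m : ℝ) ^ (-(1 / 3) : ℝ))
    ⟨by positivity, mul_le_of_le_one_right hc (rpow_neg_third_le_one hm)⟩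
  simp only [← rpow_neg_third_pow]
  set t := (m : ℝ) ^ (-(1 / 3) : ℝ)
  have e : k' m / m - ∑ l ∈ Finset.range N, spectralCoeff r l * c ^ l / D * t ^ l =
      (1 + (c * t) ^ 2 * ρ (c * t) - ∑ l ∈ Finset.range N, (c * t) ^ l * spectralCoeff r l) / D := by
    have h1 : k' m = m * (1 + (c * t) ^ 2 * ρ (c * t)) / D := hk' m
    rw [sub_div, Finset.sum_div, h1]
    congr 1
    · field_simp
    · exact Finset.sum_congr rfl fun l _ => by rw [mul_pow]; ring
  rw [e, abs_div, abs_of_pos hD, div_le_iff₀ hD]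
  refine h.trans (le_of_eq ?_)
  rw [mul_pow]
  field_simp

/-- With s = c³/m = ε³, fractional powers of s are integer powers of ε. A closed form that equals
the partial sum up to ε^{3L+2} has an error O(ε^{3(L+1)}), that is O(m^{-(L+1)}). -/
lemma IsScaledMode.exists_bracket_le (S : IsScaledMode a w γ k c δ η φ β r ρ Φ Ψ) (hc : 0 ≤ c)
    (hD : 0 < D) (hk' : ∀ m : ℕ, k' m = m * (1 +
      (c * (m : ℝ) ^ (-(1 / 3) : ℝ)) ^ 2 * ρ (c * (m : ℝ) ^ (-(1 / 3) : ℝ))) / D) (L : ℕ)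
    {B : ℝ → ℝ} (hB : ∀ ε, 0 ≤ ε → B (ε ^ 3) = 1 + ε ^ 2 * ∑ l ∈ Finset.range (3 * L + 1), ε ^ l * r l) :
    ∃ C : ℝ, ∀ m : ℕ, 1 ≤ m → |k' m - m / D * B (c ^ 3 / m)| ≤
      m / D * (C * (m : ℝ) ^ (-((L + 1 : ℕ) : ℤ))) := by
  obtain ⟨C, hC0, hC⟩ := S.exists_spectral_le (3 * L + 1 + 2) (by omega)
  refine ⟨C * c ^ (3 * (L + 1)), fun m hm => ?_⟩
  have hm0 : (0 : ℝ) < m := by exact_mod_cast hm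
  have h0 := rpow_neg_third_pos hm
  have hcube := rpow_neg_third_cube hm
  have h := hC (c * (m : ℝ) ^ (-(1 / 3) : ℝ))
    ⟨by positivity, mul_le_of_le_one_right hc (rpow_neg_third_le_one hm)⟩
  rw [hk']
  set t := (m : ℝ) ^ (-(1 / 3) : ℝ)
  have ht : t ^ 3 = 1 / m := by field_simp; exact hcube
  have e : c ^ 3 / m = (c * t) ^ 3 := by rw [mul_pow, ht]; ring
  rw [e, hB _ (by positivity), ← sum_spectralCoeff]
  have e2 : m * (1 + (c * t) ^ 2 * ρ (c * t)) / D - m / D *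
      ∑ l ∈ Finset.range (3 * L + 1 + 2), (c * t) ^ l * spectralCoeff r l = m / D *
      (1 + (c * t) ^ 2 * ρ (c * t) - ∑ l ∈ Finset.range (3 * L + 1 + 2), (c * t) ^ l * spectralCoeff r l)
      := by ring
  rw [e2, abs_mul, abs_of_pos (show (0 : ℝ) < m / D by positivity)]
  refine mul_le_mul_of_nonneg_left (h.trans (le_of_eq ?_)) (by positivity)
  rw [mul_pow, show 3 * L + 1 + 2 = 3 * (L + 1) by ring, pow_mul t, ht, zpow_neg, zpow_natCast]
  rw [div_pow, one_pow]
  ring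

end Expansion

/-! ### Identification with the closed-form expansions -/

section Brackets

variable {a n₀ ε : ℝ}

lemma cube_rpow (hε : 0 ≤ ε) (l : ℕ) {x : ℝ} (hx : x = l / 3) : (ε ^ 3) ^ x = ε ^ l := by
  rw [← Real.rpow_natCast, ← Real.rpow_natCast, ← Real.rpow_mul hε, hx]
  congr 1
  push_cast
  ring

/-- With P = n₀^p and t = √(n₀² - 1) one has γ = P/t and w = n₀/t. Treating P and t as independent
letters subject to t² = n₀² - 1 makes the comparison an identity of rational functions. -/
lemma bracket5_cube {κ μ : ℝ} {p : ℤ} (hκ : 0 < κ) (hn₀ : 1 < n₀) (hε : 0 ≤ ε) (b : ℝ) {r : ℕ → ℝ}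
    (hr : ∀ i < 4, r i = (generalInitial a (n₀ / √(n₀ ^ 2 - 1)) (n₀ ^ (p - 1) * (n₀ / √(n₀ ^ 2 - 1)))
      (1 / (2 * κ)) b ((κ ^ 2 + 2 * κ - μ) * (1 / (2 * κ)) ^ 2) i).2.2.2) :
    bracket5 κ μ n₀ p a (ε ^ 3) = 1 + ε ^ 2 * ∑ l ∈ Finset.range (3 * 1 + 1), ε ^ l * r l := by
  have hn0 : 0 < n₀ := by linarith
  have hpos : 0 < n₀ ^ 2 - 1 := by nlinarith
  have hs : 0 < √(n₀ ^ 2 - 1) := Real.sqrt_pos.2 hpos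
  have hs2 : √(n₀ ^ 2 - 1) ^ 2 = n₀ ^ 2 - 1 := Real.sq_sqrt hpos.le
  have hp : n₀ ^ (p - 1) * (n₀ / √(n₀ ^ 2 - 1)) = n₀ ^ p / √(n₀ ^ 2 - 1) := by
    rw [zpow_sub_one₀ hn0.ne']; field_simp
  have h2p : n₀ ^ (2 * p) = (n₀ ^ p) ^ 2 := by rw [mul_comm, zpow_mul]; norm_cast
  simp only [hp] at hr
  simp only [Nat.reduceMul, Nat.reduceAdd, Finset.sum_range_succ, Finset.sum_range_zero,
    hr 0 (by norm_num), hr 1 (by norm_num), hr 2 (by norm_num), hr 3 (by norm_num), generalInitial]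
  rw [bracket5, cube_rpow hε 2 (by norm_num), cube_rpow hε 4 (by norm_num),
    cube_rpow hε 5 (by norm_num), h2p]
  generalize n₀ ^ p = P
  generalize √(n₀ ^ 2 - 1) = t at *
  rw [← hs2]
  field_simp
  ring

lemma rpow_half_odd {x : ℝ} (hx : 0 ≤ x) (l : ℕ) : x ^ ((l : ℝ) / 2) = √x ^ l := by
  rw [Real.sqrt_eq_rpow, ← Real.rpow_natCast, ← Real.rpow_mul hx]
  congr 1
  ring

/-- For p = 1, γ = w = n₀/t, so every coefficient is a polynomial in w, with n₀² = t² + 1 used once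
to remove the factor n₀² - 4. -/
lemma bracket8TM_cube (hn₀ : 1 < n₀) (hε : 0 ≤ ε) {r : ℕ → ℝ}
    (hr : ∀ i < 7, r i = (constantInitial a (n₀ / √(n₀ ^ 2 - 1)) (n₀ / √(n₀ ^ 2 - 1)) i).2.2.2) :
    bracket8TM n₀ a (ε ^ 3) = 1 + ε ^ 2 * ∑ l ∈ Finset.range (3 * 2 + 1), ε ^ l * r l := by
  have hpos : 0 < n₀ ^ 2 - 1 := by nlinarith
  have hs : 0 < √(n₀ ^ 2 - 1) := Real.sqrt_pos.2 hpos
  have hs2 : √(n₀ ^ 2 - 1) ^ 2 = n₀ ^ 2 - 1 := Real.sq_sqrt hpos.le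
  have h1 := rpow_half_odd hpos.le 1
  have h3 := rpow_half_odd hpos.le 3
  have h5 := rpow_half_odd hpos.le 5
  push_cast at h1 h3 h5
  simp only [Nat.reduceMul, Nat.reduceAdd, Finset.sum_range_succ, Finset.sum_range_zero,
    hr 0 (by norm_num), hr 1 (by norm_num), hr 2 (by norm_num), hr 3 (by norm_num),
    hr 4 (by norm_num), hr 5 (by norm_num), hr 6 (by norm_num), constantInitial]
  rw [bracket8TM, cube_rpow hε 2 (by norm_num), cube_rpow hε 4 (by norm_num),
    cube_rpow hε 5 (by norm_num), cube_rpow hε 7 (by norm_num), cube_rpow hε 8 (by norm_num),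
    h1, h3, h5]
  generalize √(n₀ ^ 2 - 1) = t at *
  have hn2 : n₀ ^ 2 = t ^ 2 + 1 := by linarith
  set w := n₀ / t with hw
  have e1 : n₀ / (2 * t ^ 1) = w / 2 := by rw [hw]; field_simp
  have e3 : a * n₀ ^ 3 / (12 * t ^ 3) = a * w ^ 3 / 12 := by rw [hw]; field_simp
  have e5 : a ^ 2 * n₀ ^ 3 * (n₀ ^ 2 - 4) / (80 * t ^ 5) = a ^ 2 * w ^ 3 * (4 - 3 * w ^ 2) / 80 := by
    rw [hw]
    field_simp
    linear_combination 4 * a ^ 2 * hn2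
  have e6 : 2 * n₀ ^ 6 / (n₀ ^ 2 - 1) ^ 3 = 2 * w ^ 6 := by
    rw [hw, ← hs2]; field_simp
  rw [e1, e3, e5, e6]
  ring

/-- For p = -1, γ = (w² - 1)/w and n₀² = w²/(w² - 1). The coefficients of the statement, reduced to
these, match those of the formal solution. -/
lemma bracket8TE_cube (hn₀ : 1 < n₀) (hε : 0 ≤ ε) {r : ℕ → ℝ}
    (hr : ∀ i < 7, r i = (constantInitial a (n₀ / √(n₀ ^ 2 - 1)) (1 / (n₀ * √(n₀ ^ 2 - 1)))
      i).2.2.2) :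
    bracket8TE n₀ a (ε ^ 3) = 1 + ε ^ 2 * ∑ l ∈ Finset.range (3 * 2 + 1), ε ^ l * r l := by
  have hn0 : 0 < n₀ := by linarith
  have hpos : 0 < n₀ ^ 2 - 1 := by nlinarith
  have hs : 0 < √(n₀ ^ 2 - 1) := Real.sqrt_pos.2 hpos
  have hs2 : √(n₀ ^ 2 - 1) ^ 2 = n₀ ^ 2 - 1 := Real.sq_sqrt hpos.le
  have h1 := rpow_half_odd hpos.le 1
  have h3 := rpow_half_odd hpos.le 3
  have h5 := rpow_half_odd hpos.le 5
  push_cast at h1 h3 h5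
  simp only [Nat.reduceMul, Nat.reduceAdd, Finset.sum_range_succ, Finset.sum_range_zero,
    hr 0 (by norm_num), hr 1 (by norm_num), hr 2 (by norm_num), hr 3 (by norm_num),
    hr 4 (by norm_num), hr 5 (by norm_num), hr 6 (by norm_num), constantInitial]
  rw [bracket8TE, cube_rpow hε 2 (by norm_num), cube_rpow hε 4 (by norm_num),
    cube_rpow hε 5 (by norm_num), cube_rpow hε 7 (by norm_num), cube_rpow hε 8 (by norm_num),
    h1, h3, h5]
  generalize √(n₀ ^ 2 - 1) = t at *
  set w := n₀ / t with hw
  set γ := 1 / (n₀ * t) with hγ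
  have hw0 : 0 < w := by positivity
  -- everything is a rational function of `w`
  have hw1 : w ^ 2 - 1 = 1 / t ^ 2 := by rw [hw]; field_simp; linarith
  have hw1' : 0 < w ^ 2 - 1 := by rw [hw1]; positivity
  have hγw : γ = (w ^ 2 - 1) / w := by rw [hw1, hw, hγ]; field_simp
  obtain ⟨N, hN⟩ : ∃ N, N = n₀ ^ 2 := ⟨_, rfl⟩
  have hNw : N = w ^ 2 / (w ^ 2 - 1) := by rw [hw1, hw, hN]; field_simp
  have p4 : n₀ ^ 4 = N ^ 2 := by rw [hN]; ring
  have p6 : n₀ ^ 6 = N ^ 3 := by rw [hN]; ring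
  have p8 : n₀ ^ 8 = N ^ 4 := by rw [hN]; ring
  have hN1 : N - 1 = 1 / (w ^ 2 - 1) := by rw [hNw]; field_simp; ring
  have e1 : 1 / (2 * n₀ * t ^ 1) = γ / 2 := by rw [hγ]; field_simp
  have e3 : a * (3 * n₀ ^ 4 - 2) / (12 * n₀ ^ 3 * t ^ 3) = 1/4*a*w^2*γ - 1/6*a*γ^3 := by
    rw [hw, hγ]
    field_simp
    ring
  have e4 : 1 / (n₀ ^ 4 * (n₀ ^ 2 - 1)) = -w^3*γ + 2*w^2*γ^2 + w*γ - γ^4 - γ^2 := by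
    rw [p4, ← hN, hN1, hNw, hγw]
    field_simp
    ring
  have e5 : a ^ 2 * (3 * n₀ ^ 8 + 12 * n₀ ^ 6 - 12 * n₀ ^ 4 - 8 * n₀ ^ 2 + 8) /
      (80 * n₀ ^ 5 * t ^ 5) = -(-3/16*a^2*w^4*γ + 1/4*a^2*w^2*γ^3 + 3/20*a^2*w^2*γ
        - 1/10*a^2*γ^5 - 1/10*a^2*γ^3) := by
    have : a ^ 2 * (3 * n₀ ^ 8 + 12 * n₀ ^ 6 - 12 * n₀ ^ 4 - 8 * n₀ ^ 2 + 8) /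
      (80 * n₀ ^ 5 * t ^ 5) = a ^ 2 * (3 * N ^ 4 + 12 * N ^ 3 - 12 * N ^ 2 - 8 * N + 8) / 80
        * γ ^ 5 := by
      rw [p8, p6, p4, ← hN, hγ]
      field_simp
    rw [this, hNw, hγw]
    field_simp
    ring
  have e6 : a / 144 * ((18 * n₀ ^ 8 - 45 * n₀ ^ 6 + 12 * n₀ ^ 4 + 45 * n₀ ^ 2 - 28) /
      (n₀ ^ 6 * (n₀ ^ 2 - 1) ^ 3)) = -(-1/4*a*w^5*γ + 1/2*a*w^4*γ^2 + 1/8*a*w^3*γ^3 + 5/16*a*w^3*γ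
      - 7/12*a*w^2*γ^4 - 1/2*a*w^2*γ^2 - 1/8*a*w*γ^3 - 1/16*a*w*γ + 7/36*a*γ^6 + 5/16*a*γ^4
      + 1/16*a*γ^2) := by
    rw [p8, p6, p4, ← hN, hN1, hNw, hγw]
    field_simp
    ring
  rw [e1, e3, e4, e5, mul_add (a / 144), e6]
  ring

end Brackets

/-! ### Main theorem -/

/-- Scaled quasimodes with explicit first coefficients, for a general index and for a constant one. -/
lemma exists_scaledModes {n : ℝ → ℝ} {R : ℝ} (hR : 0 < R) (hn : IsOpticalIndex n R) (p : ℤ)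
    (hκ : 0 < effCurvature n R) (E : ℝ) {a w γ η : ℝ} (hη : 0 < η) (ha : flippedAiry a = 0) :
    ∃ (r : ℕ → ℝ) (ρ : ℝ → ℝ) (Φ Ψ : ℕ → ℝ → ℝ → ℝ),
      (∀ i < 4, r i = (generalInitial a w γ (1 / (2 * effCurvature n R))
        (1 + (p - 1) * (effCurvature n R - 1))
        ((effCurvature n R ^ 2 + 2 * effCurvature n R - adimHessian n R) *
          (1 / (2 * effCurvature n R)) ^ 2) i).2.2.2) ∧
      ((∀ r ∈ Icc 0 R, n r = n R) → ∀ i < 7, r i = (constantInitial a w γ i).2.2.2) ∧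
      IsScaledMode a w γ (1 / (2 * effCurvature n R)) E (1 / 2) η (innerPotential n R)
        (innerDrift n R p) r ρ Φ Ψ := by
  -- One family has to satisfy both expansions. In the constant case κ = 1 and μ = 2, and the first
  -- four coefficients of the general list specialize to those of the constant one.
  by_cases h : ∀ r ∈ Icc 0 R, n r = n R
  · obtain ⟨hκ1, hμ⟩ := constant_index_data hR h
    obtain ⟨r, ρ, Φ, Ψ, hr, S⟩ := exists_scaledModes_constant (w := w) (γ := γ) (δ := 1 / 2) hR hn p h E
      (by norm_num) hη ha
    refine ⟨r, ρ, Φ, Ψ, fun i hi => ?_, fun _ => hr, by rw [hκ1, mul_one]; exact S⟩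
    rw [hr i (by omega), hκ1, hμ]
    interval_cases i <;> simp only [generalInitial, constantInitial] <;> ring
  · obtain ⟨r, ρ, Φ, Ψ, hr, S⟩ := exists_scaledModes_general (w := w) (γ := γ) (δ := 1 / 2) hR hn p hκ E
      (by norm_num) (by norm_num) hη ha
    exact ⟨r, ρ, Φ, Ψ, hr, fun h' => absurd h' h, S⟩

theorem theorem4p1 (n : ℝ → ℝ) (R : ℝ) (hR : 0 < R) (hn : IsOpticalIndex n R)
    (p : ℤ) (hp : p = 1 ∨ p = -1) (hκ : 0 < effCurvature n R) :
    ∃ (k : ℕ → ℕ → ℝ) (u : ℕ → ℕ → Plane → ℂ) (K : ℕ → ℕ → ℝ),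
      (∀ j : ℕ,
        IsWhisperingGallery n R p (k j) (u j) ∧
        -- regularity with respect to `m` and expansion in powers of `m^{-1/3}`
        RegularInM (k j) (1 / 3) ∧ HasExpansion (k j) (K j) ∧
        K j 0 = 1 / (R * indexDeriv n R 0) ∧ K j 1 = 0 ∧
        -- structure of the quasi-modes and their two-term expansion
        HasBoundaryLayerForm R (effCurvature n R) (indexDeriv n R 0) p j (u j) ∧
        -- five-term expansion of the quasi-resonances
        (∃ C : ℝ, ∀ m : ℕ, 1 ≤ m →
          |k j m - m / (R * indexDeriv n R 0) *
            bracket5 (effCurvature n R) (adimHessian n R) (indexDeriv n R 0) p (airyRoot j)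
              (2 * effCurvature n R / m)|
            ≤ m / (R * indexDeriv n R 0) * (C * (m : ℝ) ^ (-2 : ℤ))) ∧
        -- eight-term expansions for a constant index
        ((∀ r ∈ Set.Icc 0 R, n r = n R) → p = 1 →
          ∃ C : ℝ, ∀ m : ℕ, 1 ≤ m →
            |k j m - m / (R * indexDeriv n R 0) *
              bracket8TM (indexDeriv n R 0) (airyRoot j) (2 / m)|
              ≤ m / (R * indexDeriv n R 0) * (C * (m : ℝ) ^ (-3 : ℤ))) ∧
        ((∀ r ∈ Set.Icc 0 R, n r = n R) → p = -1 →
          ∃ C : ℝ, ∀ m : ℕ, 1 ≤ m →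
            |k j m - m / (R * indexDeriv n R 0) *
              bracket8TE (indexDeriv n R 0) (airyRoot j) (2 / m)|
              ≤ m / (R * indexDeriv n R 0) * (C * (m : ℝ) ^ (-3 : ℤ)))) ∧
      -- the coefficients of degree two are distinct
      Function.Injective (fun j => K j 2) := by
  rw [indexDeriv_zero]
  set κ := effCurvature n R with hκdef
  set n₀ := n R with hn₀def
  have hn₀ : 1 < n₀ := hn.one_lt R ⟨hR.le, le_rfl⟩
  have hn₀0 : 0 < n₀ := by linarith
  have hpos : 0 < n₀ ^ 2 - 1 := by nlinarith
  have hsq : 0 < √(n₀ ^ 2 - 1) := Real.sqrt_pos.2 hpos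
  have hsq2 : √(n₀ ^ 2 - 1) ^ 2 = n₀ ^ 2 - 1 := Real.sq_sqrt hpos.le
  have hD : 0 < R * n₀ := by positivity
  set w := n₀ / √(n₀ ^ 2 - 1) with hw
  have hw0 : 0 < w := by positivity
  have hwn : w ^ 2 * (n₀ ^ 2 - 1) = n₀ ^ 2 := by rw [hw, div_pow, hsq2, div_mul_cancel₀ _ hpos.ne']
  -- c is the value of ε at m = 1, hence the right end of the range of ε in all uniform estimates.
  set c := (2 * κ) ^ (1 / 3 : ℝ) with hc
  have hc0 : 0 < c := Real.rpow_pos_of_pos (by positivity) _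
  have hc3 : c ^ 3 = 2 * κ := cube_root_cube (by positivity)
  have hk0 : 0 < 1 / (2 * κ) := by positivity
  obtain ⟨X, hX, hXc, hX0, hX1, hX01, hχ⟩ := exists_radial_cutoff hR
  -- The explicit form of K 2, a positive multiple of the Airy root, is carried along, since
  -- injectivity in j follows from strict monotonicity of the roots.
  suffices H : ∀ j : ℕ, ∃ (k : ℕ → ℝ) (u : ℕ → Plane → ℂ) (K : ℕ → ℝ),
      (IsWhisperingGallery n R p k u ∧ RegularInM k (1 / 3) ∧ HasExpansion k K ∧
        K 0 = 1 / (R * n₀) ∧ K 1 = 0 ∧ HasBoundaryLayerForm R κ n₀ p j u ∧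
        (∃ C : ℝ, ∀ m : ℕ, 1 ≤ m → |k m - m / (R * n₀) *
          bracket5 κ (adimHessian n R) n₀ p (airyRoot j) (2 * κ / m)|
            ≤ m / (R * n₀) * (C * (m : ℝ) ^ (-2 : ℤ))) ∧
        ((∀ r ∈ Set.Icc 0 R, n r = n₀) → p = 1 → ∃ C : ℝ, ∀ m : ℕ, 1 ≤ m →
          |k m - m / (R * n₀) * bracket8TM n₀ (airyRoot j) (2 / m)|
              ≤ m / (R * n₀) * (C * (m : ℝ) ^ (-3 : ℤ))) ∧
        ((∀ r ∈ Set.Icc 0 R, n r = n₀) → p = -1 → ∃ C : ℝ, ∀ m : ℕ, 1 ≤ m →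
          |k m - m / (R * n₀) * bracket8TE n₀ (airyRoot j) (2 / m)|
              ≤ m / (R * n₀) * (C * (m : ℝ) ^ (-3 : ℤ)))) ∧
      K 2 = airyRoot j * (c ^ 2 / (2 * (R * n₀))) by
    choose k u K h hK using H
    refine ⟨k, u, K, h, fun i j hij => ?_⟩
    simp only [hK] at hij
    exact strictMono_airyRoot.injective (mul_right_cancel₀ (by positivity) hij)
  intro j
  -- The size of b ensures that even at the largest ε = c the interval corresponds to radii within
  -- R/8 of R, where the cut-off is 1.
  obtain ⟨y₁, y₂, η, hy, hy₂, hy₁, hη, hA⟩ := exists_interval_le_abs_flippedAiry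
    (flippedAiry_airyRoot j) (b := 1 / (8 * (1 / (2 * κ) * c ^ 2))) (by positivity)
  obtain ⟨r, ρ, Φ, Ψ, hr, hr', S⟩ := exists_scaledModes (w := w) (γ := n₀ ^ (p - 1) * w) hR hn p hκ c hη
    (flippedAiry_airyRoot j)
  set ε : ℕ → ℝ := fun m => c * (m : ℝ) ^ (-(1 / 3) : ℝ) with hεdef
  set k : ℕ → ℝ := fun m => m * (1 + ε m ^ 2 * ρ (ε m)) / (R * n₀) with hkdef
  have hε : ∀ m, 1 ≤ m → ε m ∈ Ioc 0 c := fun m hm =>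
    ⟨mul_pos hc0 (rpow_neg_third_pos hm), mul_le_of_le_one_right hc0.le (rpow_neg_third_le_one hm)⟩
  have h3 : ∀ m : ℕ, 1 ≤ m → ε m ^ 3 * (1 / (2 * κ) * m) = 1 := fun m hm => by
    rw [hεdef, mul_pow, hc3]
    have := rpow_neg_third_cube hm
    field_simp
    linarith
  have hk : ∀ m : ℕ, k m = m * (1 + (c * (m : ℝ) ^ (-(1 / 3) : ℝ)) ^ 2 *
      ρ (c * (m : ℝ) ^ (-(1 / 3) : ℝ))) / (R * n₀) := fun m => rfl
  have hreg : RegularInM k (1 / 3) := regularInM_of_eq S.smooth_spec hk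
  have hsmall : R * (1 / (2 * κ) * c ^ 2 * -y₁) < R / 8 := by
    have : -y₁ < 1 / (8 * (1 / (2 * κ) * c ^ 2)) := by linarith
    rw [lt_div_iff₀ (by positivity)] at this
    nlinarith
  obtain ⟨s, hs, hWG⟩ := exists_isWhisperingGallery_planeMode hR hn hw0 hwn hk0 hc0
    (by positivity) (by linarith) hχ hy hy₂ hsmall hη hA S hε h3 (fun m => rfl)
    ⟨1 / 3, by norm_num, hreg⟩
  refine ⟨k, _, fun l => spectralCoeff r l * c ^ l / (R * n₀), ⟨hWG, hreg,
    S.hasExpansion hc0.le hD hk, ?_, ?_, hasBoundaryLayerForm_planeMode hR hκ hn₀ S hX hXc hX0 hX1 hX01 hs,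
    ?_, ?_, ?_⟩, ?_⟩
  · simp [spectralCoeff]
  · simp [spectralCoeff]
  · have h := S.exists_bracket_le hc0.le hD hk 1 (fun ε hε => bracket5_cube hκ hn₀ hε _ hr)
    rwa [hc3] at h
  · rintro hconst rfl
    have hκ1 : κ = 1 := (constant_index_data hR hconst).1
    have h := S.exists_bracket_le hc0.le hD hk 2 (fun ε hε => bracket8TM_cube hn₀ hε fun i hi => by
      rw [hr' hconst i hi, sub_self, zpow_zero, one_mul])
    rwa [hc3, hκ1, mul_one] at h
  · rintro hconst rfl
    have hκ1 : κ = 1 := (constant_index_data hR hconst).1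
    have hγ : n₀ ^ ((-1 : ℤ) - 1) * w = 1 / (n₀ * √(n₀ ^ 2 - 1)) := by
      rw [hw, show (-1 : ℤ) - 1 = -2 by norm_num, zpow_neg]
      norm_cast
      field_simp
    have h := S.exists_bracket_le hc0.le hD hk 2 (fun ε hε => bracket8TE_cube hn₀ hε fun i hi => by
      rw [hr' hconst i hi, hγ])
    rwa [hc3, hκ1, mul_one] at h
  · change r 0 * c ^ 2 / (R * n₀) = _
    rw [hr 0 (by norm_num)]
    simp only [generalInitial]
    field_simp
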